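/- Let $A=\mathbb F_2\{1,x\}$ with $\deg 1=1$, $\deg x=-1$, and define commutative multiplications and comultiplications on $A$ by $$\overline m(1,1)=1,\ \ \overline m(1,x)=\overline m(x,1)=x,\ \ \overline m(x,x)=0,\qquad \overline\Delta(1)=1\otimes x+x\otimes 1,\ \ \overline\Delta(x)=x\otimes x,$$ $$\tilde m(1,1)=\tilde m(1,x)=\tilde m(x,1)=0,\ \ \tilde m(x,x)=x,\qquad \tilde\Delta(1)=1\otimes 1,\ \ \tilde\Delta(x)=0 .$$ For a diagram $D$ of an oriented link let $C^{*,*}(D)$ be Khovanov's bigraded complex over $\mathbb F_2$: the direct sum of the spaces $A^{\otimes\{\text{circles of } s\}}$ over all complete smoothings $s$, where a pure tensor of basis elements $1,x$ has homological degree $|s|-n_-$ and $q$-degree $\deg+|s|+n_+-2n_-$, $|s|$ being the number of $1$-smoothings and $n_\pm$ the numbers of positive and negative crossings. Its differential $\partial$ is the sum, over all edges of the cube of smoothings, of the maps given by $\overline m$ (if two circles merge) or $\overline\Delta$ (if a circle splits); the map $\beta$ is defined in the same way from $\tilde m$ and $\tilde\Delta$. Write $Kh^{i,j}(D)$ for the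 homology. Then $\partial^2=0$, $\beta\partial=\partial\beta$, $\beta^2=0$, $\beta$ has bidegree $(1,2)$, and so $\beta$ induces maps $\beta_*\colon Kh^{i,j}(D)\to Kh^{i+1,j+2}(D)$. Put $$KK^{i,j}(D)=\frac{\ker(\beta_*\colon Kh^{i,j}(D)\to Kh^{i+1,j+2}(D))}{\operatorname{im}(\beta_*\colon Kh^{i-1,j-2}(D)\to Kh^{i,j}(D))}.$$ **Reidemeister moves.** Below, $C(D(*\epsilon))$ is the part of $C(D)$ where the crossings of the move, in the indicated order, are smoothed according to $\epsilon$; $\partial_\epsilon^{\epsilon'}$ is the component of $\partial$ from $C(D(*\epsilon))$ to $C(D(*\epsilon'))$; and $z\otimes 1$, $z\otimes x$ carry the factor $1$, $x$ on the small extra circle that appears in one of the smoothings. Each of the following maps $\phi$ is well defined, is a map of complexes of bidegree $(0,0)$ inducing isomorphisms in homology, and commutes with $\beta$ up to boundaries: $\beta\phi(z)-\phi\beta(z)$ is a boundary for every cycle $z$. Hence $\phi_*\beta_*=\beta_*\phi_*$. 1. (Reidemeister I, positive twist.) Let $\tilde D$ be $D$ with a positive kink undone, $C(\tilde D)\cong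 C(D(*1))$, $C(D(*0))\cong C(D(*1))\otimes A$. Then $\phi\colon C(D)\to C(\tilde D)$ is the linear map that is $0$ on $X_2=\{a\otimes 1+b\mid a,b\in C(D(*1))\}$ and $\phi(a\otimes 1+b\otimes x)=b$ on $X_1=\ker\partial_0^1\subset C(D(*0))$. 2. (Reidemeister II.) Let $\tilde D$ be $D$ with a bigon, one side of which lies over the other, undone. Order its two crossings such that $C(\tilde D)\cong C(D(*01))$ and $C(D(*10))\cong C(D(*11))\otimes A$. Then $\phi\colon C(\tilde D)\cong C(D(*01))\to C(D)$ is $\phi(a)=a+\partial_{01}^{11}a\otimes 1$. 3. (Reidemeister III.) Let $D$ arise from $\tilde D$ by a Reidemeister III move at a non-alternating triangle exactly two of whose corners are cut off by the $0$-smoothings of their crossings. Let the third crossing $p$ be either of these two, let $y$ be the other one, and let $z$ be the remaining crossing; give a crossing of $D$ the name of the crossing of $\tilde D$ between the same strands, and order the three as $y,z,p$. Then in both diagrams $C(*010)\cong C(*110)\otimes A$; there is an identification $f\colon C(\tilde D(*100))\cong C(D(*100))$; and there is an identification $g\colon C(\tilde D(*1))\cong C(D(*1))$, $1$ being the smoothing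 of $p$, that interchanges the smoothings of $y$ and $z$. The map $\phi\colon C(\tilde D)\to C(D)$ is the linear map that is $0$ on $\{a+\partial b\mid a,b\in C(\tilde D(*000))\}$ and on $\{a\otimes 1+\partial(b\otimes 1)\mid a,b\in C(\tilde D(*110))\}$ and satisfies $$\phi\bigl(a+\partial_{100}^{110}a\otimes 1+b\bigr)=f(a)+\partial_{100}^{110}f(a)\otimes 1+g(b)\qquad(a\in C(\tilde D(*100)),\ b\in C(\tilde D(*1))).$$ **Invariance.** If two diagrams $D,D'$ represent the same oriented link (i.e. are connected by a finite sequence of Reidemeister moves of any kind), then there are isomorphisms $\Phi^{i,j}\colon Kh^{i,j}(D)\cong Kh^{i,j}(D')$ with $\Phi\beta_*=\beta_*\Phi$, and these induce isomorphisms $KK^{i,j}(D)\cong KK^{i,j}(D')$. So $\beta_*\colon Kh^{i,j}(L)\to Kh^{i+1,j+2}(L)$ and $KK^{i,j}(L)$ are well-defined invariants of an oriented link $L$. -/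

import Mathlib

namespace KhBeta

/-! ### Oriented link diagrams -/

/-- Oriented planar-diagram data: finite sets of crossings `X` and arc labels `E`.  Around a crossing
`c` the four arc ends are listed counterclockwise as `arc c 0, …, arc c 3`, starting from the
*incoming* end of the under-strand; so `0, 2` are the ends of the under-strand (directed `0 → 2`)
and `1, 3` those of the over-strand, directed `3 → 1` if the crossing is positive (`pos c = true`)
and `1 → 3` if it is negative.  A label that occurs at no crossing is a crossingless circle. -/
structure PD where
  X : Type
  E : Type
  finX : Fintype X
  finE : Fintype E
  arc : X → Fin 4 → E
  pos : X → Bool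

attribute [instance] PD.finX PD.finE

namespace PD

/-- The end number `h.2` at the crossing `h.1` is directed away from the crossing. -/
def IsOut (D : PD) (h : D.X × Fin 4) : Prop :=
  h.2 = 2 ∨ (h.2 = if D.pos h.1 then 1 else 3)

/-- The label of an arc end. -/
def lab (D : PD) (h : D.X × Fin 4) : D.E := D.arc h.1 h.2

/-- Every label that occurs at all occurs at exactly two arc ends, and the orientations of the two
ends agree: one leaves its crossing, the other enters its crossing. -/
def IsOriented (D : PD) : Prop :=
  (∀ h, ∃! h', h' ≠ h ∧ D.lab h' = D.lab h) ∧
  (∀ h h', h' ≠ h → D.lab h' = D.lab h → (D.IsOut h' ↔ ¬ D.IsOut h))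

/-- The regions of the diagram.  The corner `(c, i)` lies between the ends `i` and `i + 1` of `c`.
The corner to the left of an arc at one of its ends lies in the same region as the
corner to the right of that arc at its other end. -/
def Face (D : PD) : Type :=
  Quot fun p q : D.X × Fin 4 =>
    ∃ h h' : D.X × Fin 4, h ≠ h' ∧ D.lab h = D.lab h' ∧ p = h ∧ q = (h'.1, h'.2 - 1)

/-- The connected components of the underlying 4-valent graph (crossingless circles left out). -/
def Component (D : PD) : Type :=
  Quot fun c c' : D.X => ∃ i j, D.arc c i = D.arc c' j

/-- Planarity by Euler's formula: with `V` vertices, `2 V` edges, `F` faces and `k` components,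
all components lie on spheres iff `V - 2 V + F = 2 k`. -/
def IsPlanar (D : PD) : Prop :=
  Nat.card D.Face = Nat.card D.X + 2 * Nat.card D.Component

/-- Same diagram up to renaming of the crossings and of the arcs. -/
structure Iso (D D' : PD) where
  onX : D.X ≃ D'.X
  onE : D.E ≃ D'.E
  arc_eq : ∀ c i, D'.arc (onX c) i = onE (D.arc c i)
  pos_eq : ∀ c, D'.pos (onX c) = D.pos c

end PD

/-- An oriented link diagram. -/
structure LinkDiagram extends PD where
  oriented : toPD.IsOriented
  planar : toPD.IsPlanar

namespace PD

/-! ### Reidemeister moves -/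

/-- The relation between labels: opposite ends of a strand passing through a crossing in `R`. -/
def Straight (D : PD) (R : Set D.X) (e e' : D.E) : Prop :=
  ∃ c ∈ R, ∃ i : Fin 4, e = D.arc c i ∧ e' = D.arc c (i + 2)

/-- Forget the crossings in `R`, letting both strands go straight through.  The result of
undoing a kink, or of pulling apart the two strands of a bigon, is of this form. -/
noncomputable def erase (D : PD) (R : Set D.X) : PD where
  X := {c : D.X // c ∉ R}
  E := Quot (D.Straight R)
  finX := Fintype.ofFinite _
  finE := Fintype.ofFinite _
  arc c i := Quot.mk _ (D.arc c.1 i)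
  pos c := D.pos c.1

/-- The ends `k` and `k + 1` of the crossing `c` are joined by an arc, forming a kink.  The twist
is positive if `k` is even (then the `0`-smoothing splits off a circle), negative if `k` is odd. -/
def IsKink (D : PD) (c : D.X) (k : Fin 4) : Prop :=
  D.arc c k = D.arc c (k + 1)

/-- The corners `(c₁, k₁)` and `(c₂, k₂)` are those of a bigonal region one of whose sides is over
at both ends and the other under at both ends.  (Exchanging the two crossings, one may take
`k₁` odd and `k₂` even; the side `arc c₁ k₁` is then the upper one.) -/
def IsBigon (D : PD) (c₁ : D.X) (k₁ : Fin 4) (c₂ : D.X) (k₂ : Fin 4) : Prop :=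
  c₁ ≠ c₂ ∧ D.arc c₁ k₁ = D.arc c₂ (k₂ + 1) ∧ D.arc c₂ k₂ = D.arc c₁ (k₁ + 1) ∧
    Odd (k₁ : ℕ) ∧ Even (k₂ : ℕ)

/-- The corners `(t n, k n)`, `n = 0, 1, 2`, are, in counterclockwise order, those of a
triangular region. -/
def IsTriangle (D : PD) (t : Fin 3 → D.X) (k : Fin 3 → Fin 4) : Prop :=
  Function.Injective t ∧ ∀ n, D.arc (t n) (k n) = D.arc (t (n + 1)) (k (n + 1) + 1)

/-- The triangle is not alternating, i.e. its sides belong to a top, a middle and a bottom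
strand. -/
def NonAlternating (k : Fin 3 → Fin 4) : Prop :=
  (∃ n, Even (k n : ℕ)) ∧ (∃ n, Odd (k n : ℕ))

/-- The ends at the corner `n` after the third Reidemeister move, listed counterclockwise from
position `k n`.  Every strand meets its two crossings in the other order: the sides of
the triangle leave at the positions `k n + 2`, `k n + 3`, and the positions `k n`, `k n + 1`
receive the far outer ends of the two strands. -/
def r3Ends (D : PD) (t : Fin 3 → D.X) (k : Fin 3 → Fin 4) (n : Fin 3) : Fin 4 → D.E :=
  ![D.arc (t (n + 1)) (k (n + 1) + 3), D.arc (t (n + 2)) (k (n + 2) + 2),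
    D.arc (t n) (k n), D.arc (t n) (k n + 1)]

open Classical in
/-- The result of the third Reidemeister move at a triangle. -/
noncomputable def r3 (D : PD) (t : Fin 3 → D.X) (k : Fin 3 → Fin 4) : PD where
  X := D.X
  E := D.E
  finX := D.finX
  finE := D.finE
  arc c i :=
    if c = t 0 then D.r3Ends t k 0 (i - k 0)
    else if c = t 1 then D.r3Ends t k 1 (i - k 1)
    else if c = t 2 then D.r3Ends t k 2 (i - k 2)
    else D.arc c i
  pos := D.pos

end PD

/-- Renaming and the Reidemeister moves, with all possible crossings and orientations. -/
inductive Move : LinkDiagram → LinkDiagram → Prop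
  | rename {D D' : LinkDiagram} (e : D.toPD.Iso D'.toPD) : Move D D'
  | r1 {D D' : LinkDiagram} (c : D.X) (k : Fin 4) (h : D.toPD.IsKink c k)
      (e : (D.toPD.erase {c}).Iso D'.toPD) : Move D D'
  | r2 {D D' : LinkDiagram} (c₁ c₂ : D.X) (k₁ k₂ : Fin 4) (h : D.toPD.IsBigon c₁ k₁ c₂ k₂)
      (e : (D.toPD.erase {c₁, c₂}).Iso D'.toPD) : Move D D'
  | r3 {D D' : LinkDiagram} (t : Fin 3 → D.X) (k : Fin 3 → Fin 4) (h : D.toPD.IsTriangle t k)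
      (hk : PD.NonAlternating k) (e : (D.toPD.r3 t k).Iso D'.toPD) : Move D D'

/-- Two diagrams represent the same oriented link: they are connected by a finite sequence of
Reidemeister moves (in either direction). -/
def SameLink : LinkDiagram → LinkDiagram → Prop := Relation.EqvGen Move

/-! ### The Frobenius algebra and the operations `m̃`, `Δ̃`, by structure constants -/

/-- The basis `{1, x}` of `A`. -/
inductive Gen
  | one
  | x

instance : Finite Gen :=
  Finite.of_injective (fun g : Gen => match g with | .one => true | .x => false) (by
    intro a b h
    cases a <;> cases b <;> simp_all)

/-- The degree: `1` has degree `1` and `x` has degree `-1`. -/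
def Gen.deg : Gen → ℤ
  | .one => 1
  | .x => -1

/-- `mulK a b c` is the coefficient of `c` in `m̄(a, b)`. -/
def mulK : Gen → Gen → Gen → ZMod 2
  | .one, .one, .one => 1
  | .one, .x, .x => 1
  | .x, .one, .x => 1
  | _, _, _ => 0

/-- `comulK a b c` is the coefficient of `b ⊗ c` in `Δ̄(a)`. -/
def comulK : Gen → Gen → Gen → ZMod 2
  | .one, .one, .x => 1
  | .one, .x, .one => 1
  | .x, .x, .x => 1
  | _, _, _ => 0

/-- `mulB a b c` is the coefficient of `c` in `m̃(a, b)`. -/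
def mulB : Gen → Gen → Gen → ZMod 2
  | .x, .x, .x => 1
  | _, _, _ => 0

/-- `comulB a b c` is the coefficient of `b ⊗ c` in `Δ̃(a)`. -/
def comulB : Gen → Gen → Gen → ZMod 2
  | .one, .one, .one => 1
  | _, _, _ => 0

namespace PD

/-! ### The cube of smoothings and Khovanov's complex over `𝔽₂` -/

/-- The pairs of ends joined by the smoothing `s` (`false` is the `0`-smoothing, `true` is the
`1`-smoothing) at some crossing. -/
def Joined (D : PD) (s : D.X → Bool) (e e' : D.E) : Prop :=
  ∃ c, (s c = false ∧ ((e = D.arc c 0 ∧ e' = D.arc c 1) ∨ (e = D.arc c 2 ∧ e' = D.arc c 3))) ∨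
    (s c = true ∧ ((e = D.arc c 0 ∧ e' = D.arc c 3) ∨ (e = D.arc c 1 ∧ e' = D.arc c 2)))

/-- The circles of the complete smoothing `s`. -/
def Circ (D : PD) (s : D.X → Bool) : Type := Quot (D.Joined s)

/-- The circle of `s` through a given arc. -/
def circ (D : PD) (s : D.X → Bool) (e : D.E) : D.Circ s := Quot.mk _ e

instance (D : PD) (s : D.X → Bool) : Finite (D.Circ s) :=
  inferInstanceAs (Finite (Quot (D.Joined s)))

noncomputable instance (D : PD) (s : D.X → Bool) : Fintype (D.Circ s) := Fintype.ofFinite _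

/-- The basis of the direct sum, over all complete smoothings, of the tensor powers
`A^{⊗ circles}`: a smoothing and a pure tensor of basis elements, one factor per circle. -/
structure State (D : PD) where
  smoothing : D.X → Bool
  val : D.Circ smoothing → Gen

instance (D : PD) : Finite D.State :=
  Finite.of_injective
    (fun S : D.State => (⟨S.smoothing, S.val⟩ : (s : D.X → Bool) × (D.Circ s → Gen))) (by
      rintro ⟨s, v⟩ ⟨s', v'⟩ h
      simp only [Sigma.mk.injEq] at h
      obtain ⟨rfl, h⟩ := h
      simp_all)

noncomputable instance (D : PD) : Fintype D.State := Fintype.ofFinite _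

/-- The circle, in the smoothing of `S`, through the arc `e`. -/
def State.circ {D : PD} (S : D.State) (e : D.E) : D.Circ S.smoothing := D.circ S.smoothing e

/-- The tensor factor of `S` at the circle through the arc `e`. -/
def State.label {D : PD} (S : D.State) (e : D.E) : Gen := S.val (S.circ e)

/-- The number of `1`-smoothings. -/
def weight (D : PD) (s : D.X → Bool) : ℤ := ∑ c, if s c then 1 else 0

def nPos (D : PD) : ℤ := ∑ c, if D.pos c then 1 else 0

def nNeg (D : PD) : ℤ := ∑ c, if D.pos c then 0 else 1

/-- Homological degree. -/
def State.hdeg {D : PD} (S : D.State) : ℤ := D.weight S.smoothing - D.nNeg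

/-- `q`-degree. -/
noncomputable def State.qdeg {D : PD} (S : D.State) : ℤ :=
  (∑ γ, (S.val γ).deg) + D.weight S.smoothing + D.nPos - 2 * D.nNeg

/-- The underlying vector space of Khovanov's complex: a chain is given by its coordinates. -/
abbrev Chain (D : PD) : Type := D.State → ZMod 2

/-- The bigraded piece of bidegree `(i, j)`. -/
def bideg (D : PD) (i j : ℤ) : Submodule (ZMod 2) D.Chain where
  carrier := {f | ∀ S, f S ≠ 0 → S.hdeg = i ∧ S.qdeg = j}
  add_mem' := by
    intro f g hf hg S h
    by_cases h1 : f S = 0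
    · by_cases h2 : g S = 0
      · simp [h1, h2] at h
      · exact hg S h2
    · exact hf S h1
  zero_mem' := by
    intro S h
    simp at h
  smul_mem' := by
    intro a f hf S h
    refine hf S fun h0 => h ?_
    simp [h0]

open Classical in
/-- The coefficient of `T` in the image of `S` under the map that a multiplication `m` and a
comultiplication `Δ` attach to the edge of the cube which changes the smoothing of `c` from `0`
to `1`: it merges the circles through the ends `0` and `2` of `c` or splits the circle through them,
and is the identity on the other circles. (The last alternative, where one circle becomes one
circle, does not occur in planar diagrams.) -/
noncomputable def edgeCoeff (D : PD) (m Δ : Gen → Gen → Gen → ZMod 2) (c : D.X)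
    (S T : D.State) : ZMod 2 :=
  if S.smoothing c = false ∧ T.smoothing = Function.update S.smoothing c true ∧
      (∀ e, S.circ e ≠ S.circ (D.arc c 0) → S.circ e ≠ S.circ (D.arc c 2) →
        T.label e = S.label e) then
    if S.circ (D.arc c 0) ≠ S.circ (D.arc c 2) then
      m (S.label (D.arc c 0)) (S.label (D.arc c 2)) (T.label (D.arc c 0))
    else if T.circ (D.arc c 0) ≠ T.circ (D.arc c 2) then
      Δ (S.label (D.arc c 0)) (T.label (D.arc c 0)) (T.label (D.arc c 2))
    else 0
  else 0

/-- The sum over all edges of the cube of the maps given by `m` and `Δ`. -/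
noncomputable def cubeMap (D : PD) (m Δ : Gen → Gen → Gen → ZMod 2) :
    D.Chain →ₗ[ZMod 2] D.Chain :=
  Matrix.mulVecLin (Matrix.of fun T S => ∑ c, D.edgeCoeff m Δ c S T)

/-- Khovanov's differential `∂`. -/
noncomputable def d (D : PD) : D.Chain →ₗ[ZMod 2] D.Chain := D.cubeMap mulK comulK

/-- The map `β`. -/
noncomputable def beta (D : PD) : D.Chain →ₗ[ZMod 2] D.Chain := D.cubeMap mulB comulB

/-! ### Homology -/

/-- Cycles of bidegree `(i, j)`. -/
noncomputable def cycles (D : PD) (i j : ℤ) : Submodule (ZMod 2) D.Chain :=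
  D.bideg i j ⊓ LinearMap.ker D.d

/-- Boundaries of bidegree `(i, j)`. -/
noncomputable def boundaries (D : PD) (i j : ℤ) : Submodule (ZMod 2) D.Chain :=
  (D.bideg (i - 1) j).map D.d

/-- Khovanov homology `Kh^{i,j}` of the diagram. -/
abbrev Kh (D : PD) (i j : ℤ) : Type :=
  D.cycles i j ⧸ (D.boundaries i j).submoduleOf (D.cycles i j)

/-- The homology class of a cycle. -/
noncomputable def cls (D : PD) {i j : ℤ} (z : D.cycles i j) : D.Kh i j := Submodule.Quotient.mk z

open Classical in
/-- The map `Kh^{i,j}(D) → Kh^{i',j'}(D')`, `[z] ↦ [φ z]`, induced by a linear map `φ` that takes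
cycles and boundaries of bidegree `(i, j)` to cycles and boundaries of bidegree `(i', j')`.
(It is set to `0` for other `φ`.) -/
noncomputable def induced {D D' : PD} (φ : D.Chain →ₗ[ZMod 2] D'.Chain) (i j i' j' : ℤ) :
    D.Kh i j →ₗ[ZMod 2] D'.Kh i' j' :=
  if h : (∀ z ∈ D.cycles i j, φ z ∈ D'.cycles i' j') ∧
      (∀ z ∈ D.boundaries i j, φ z ∈ D'.boundaries i' j') then
    Submodule.mapQ _ _ (φ.restrict h.1) (fun z hz => h.2 z.1 hz)
  else 0

/-- The map `β_* : Kh^{i,j} → Kh^{i',j'}`; it is meant for `i' = i + 1`, `j' = j + 2`. -/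
noncomputable def betaStar (D : PD) (i j i' j' : ℤ) : D.Kh i j →ₗ[ZMod 2] D.Kh i' j' :=
  induced D.beta i j i' j'

/-- The kernel of `β_*` on `Kh^{i,j}`. -/
noncomputable def kerBeta (D : PD) (i j : ℤ) : Submodule (ZMod 2) (D.Kh i j) :=
  LinearMap.ker (D.betaStar i j (i + 1) (j + 2))

/-- The secondary group `KK^{i,j}`, the kernel of `β_*` on `Kh^{i,j}` modulo the image of `β_*` on
`Kh^{i-1,j-2}`. -/
abbrev KK (D : PD) (i j : ℤ) : Type :=
  D.kerBeta i j ⧸ (LinearMap.range (D.betaStar (i - 1) (j - 2) i j)).submoduleOf (D.kerBeta i j)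

/-- The class in `KK^{i,j}` of an element of the kernel of `β_*`. -/
noncomputable def clsKK (D : PD) {i j : ℤ} (z : D.kerBeta i j) : D.KK i j :=
  Submodule.Quotient.mk z

/-- `φ` is a map of complexes of bidegree `(0, 0)` that induces isomorphisms in homology. -/
structure IsQuasiIso {D D' : PD} (φ : D.Chain →ₗ[ZMod 2] D'.Chain) : Prop where
  graded : ∀ i j, ∀ f ∈ D.bideg i j, φ f ∈ D'.bideg i j
  chain : φ ∘ₗ D.d = D'.d ∘ₗ φ
  bijective : ∀ i j, Function.Bijective (induced φ i j i j)

/-- On cycles, `φ` commutes with `β` up to boundaries. -/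
def CommutesUpToBoundaries {D D' : PD} (φ : D.Chain →ₗ[ZMod 2] D'.Chain) : Prop :=
  ∀ z, D.d z = 0 → D'.beta (φ z) - φ (D.beta z) ∈ LinearMap.range D'.d

/-- The map induced by `φ` in homology commutes with `β_*`. -/
def CommutesWithBetaStar {D D' : PD} (φ : D.Chain →ₗ[ZMod 2] D'.Chain) : Prop :=
  ∀ i j, induced φ (i + 1) (j + 2) (i + 1) (j + 2) ∘ₗ D.betaStar i j (i + 1) (j + 2) =
    D'.betaStar i j (i + 1) (j + 2) ∘ₗ induced φ i j i j

/-! ### Khovanov's quasi-isomorphisms -/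

open Classical in
/-- The linear map whose matrix in the standard bases is the indicator of the relation `R`. -/
noncomputable def ofRel {D D' : PD} (R : D.State → D'.State → Prop) :
    D.Chain →ₗ[ZMod 2] D'.Chain :=
  Matrix.mulVecLin (Matrix.of fun T S => if R S T then 1 else 0)

/-- Chains supported on the smoothings satisfying `P`. -/
def part (D : PD) (P : (D.X → Bool) → Prop) : Submodule (ZMod 2) D.Chain where
  carrier := {f | ∀ S, f S ≠ 0 → P S.smoothing}
  add_mem' := by
    intro f g hf hg S h
    by_cases h1 : f S = 0
    · by_cases h2 : g S = 0
      · simp [h1, h2] at h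
      · exact hg S h2
    · exact hf S h1
  zero_mem' := by
    intro S h
    simp at h
  smul_mem' := by
    intro a f hf S h
    refine hf S fun h0 => h ?_
    simp [h0]

/-- The projection onto the chains supported on the smoothings satisfying `P`. -/
noncomputable def proj (D : PD) (P : (D.X → Bool) → Prop) : D.Chain →ₗ[ZMod 2] D.Chain :=
  ofRel fun S T => S = T ∧ P S.smoothing

/-- The map `z ↦ z ⊗ g` for smoothings where changing `c` from `1` to `0` creates a new circle
that consists of arcs in `I`: the new circle gets the factor `g`, while the circles through arcs
outside `I` keep theirs. -/
noncomputable def tensor (D : PD) (c : D.X) (I : Set D.E) (g : Gen) :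
    D.Chain →ₗ[ZMod 2] D.Chain :=
  ofRel fun S T => S.smoothing c = true ∧
    (∀ c', T.smoothing c' = true ↔ (c' ≠ c ∧ S.smoothing c' = true)) ∧
    (∀ e ∈ I, T.label e = g) ∧ ∀ e ∉ I, T.label e = S.label e

/-- A state of `D` and a state of `D.erase R` that agree at the remaining crossings and along the
arcs outside `I`. -/
def Agree (D : PD) (R : Set D.X) (I : Set D.E) (S : D.State) (T : (D.erase R).State) : Prop :=
  (∀ c : {c : D.X // c ∉ R}, T.smoothing c = S.smoothing c.1) ∧
    ∀ e ∉ I, T.label (Quot.mk (D.Straight R) e) = S.label e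

/-- The identification `C(D(*1)) ≅ C(D̃)` where `D̃` is `D` with the kink at `c` undone. -/
noncomputable def r1Iso (D : PD) (c : D.X) : D.Chain →ₗ[ZMod 2] (D.erase {c}).Chain :=
  ofRel fun S T => S.smoothing c = true ∧ D.Agree {c} ∅ S T

/-- `φ` is Khovanov's map `C(D) → C(D̃)` for a kink with positive twist.  It vanishes on
`X₂ = {a ⊗ 1 + b}` and takes `a ⊗ 1 + b ⊗ x` in `X₁ = Ker (∂ : C(D(*0)) → C(D(*1)))` to `b`, for
`a`, `b` in `C(D(*1))`. -/
def IsR1Map (D : PD) (c : D.X) (k : Fin 4)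
    (φ : D.Chain →ₗ[ZMod 2] (D.erase {c}).Chain) : Prop :=
  (∀ a ∈ D.part (fun s => s c = true), ∀ b ∈ D.part (fun s => s c = true),
    φ (D.tensor c {D.arc c k} .one a + b) = 0) ∧
  (∀ a ∈ D.part (fun s => s c = true), ∀ b ∈ D.part (fun s => s c = true),
    D.proj (fun s => s c = true)
      (D.d (D.tensor c {D.arc c k} .one a + D.tensor c {D.arc c k} .x b)) = 0 →
    φ (D.tensor c {D.arc c k} .one a + D.tensor c {D.arc c k} .x b) = D.r1Iso c b)

/-- The identification `C(D̃) ≅ C(D(*01)) ⊆ C(D)` where `D̃` is `D` with the bigon undone and the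
last two crossings are `c₁`, `c₂`. -/
noncomputable def r2Iso (D : PD) (c₁ : D.X) (k₁ : Fin 4) (c₂ : D.X) (k₂ : Fin 4) :
    (D.erase {c₁, c₂}).Chain →ₗ[ZMod 2] D.Chain :=
  ofRel fun T S => S.smoothing c₁ = false ∧ S.smoothing c₂ = true ∧
    D.Agree {c₁, c₂} {D.arc c₁ k₁, D.arc c₂ k₂} S T

/-- Khovanov's map `ρ : C(D̃) ≅ C(D(*01)) → C(D)`, `ρ(a) = a + ∂₀₁¹¹(a) ⊗ 1`. -/
noncomputable def r2Map (D : PD) (c₁ : D.X) (k₁ : Fin 4) (c₂ : D.X) (k₂ : Fin 4) :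
    (D.erase {c₁, c₂}).Chain →ₗ[ZMod 2] D.Chain :=
  (LinearMap.id + D.tensor c₂ {D.arc c₁ k₁, D.arc c₂ k₂} .one ∘ₗ
    D.proj (fun s => s c₁ = true ∧ s c₂ = true) ∘ₗ D.d) ∘ₗ D.r2Iso c₁ k₁ c₂ k₂

/-- The part `C(D(* u v w))` of the complex where `y`, `z`, `p` are smoothed by `u`, `v`, `w`. -/
def part3 (D : PD) (y z p : D.X) (u v w : Bool) : Submodule (ZMod 2) D.Chain :=
  D.part fun s => s y = u ∧ s z = v ∧ s p = w

/-- The sides of a triangle. -/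
def sides (D : PD) (t : Fin 3 → D.X) (k : Fin 3 → Fin 4) : Set D.E :=
  Set.range fun n => D.arc (t n) (k n)

/-- `a ↦ a + ∂(a) ⊗ 1`, where the component of `∂(a)` in `C(D(*110))` is used, the last three
crossings being `y`, `z`, `p`, and `I` is the set of the sides of their triangle. -/
noncomputable def r3Lift (D : PD) (I : Set D.E) (y z p : D.X) : D.Chain →ₗ[ZMod 2] D.Chain :=
  LinearMap.id + D.tensor y I .one ∘ₗ
    D.proj (fun s => s y = true ∧ s z = true ∧ s p = false) ∘ₗ D.d

/-- The identification `f : C(D̃(*100)) ≅ C(D(*100))` of the third Reidemeister move from `D̃`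
to `D`; the last three crossings are `y`, `z`, `p`, and a crossing of `D` has the name of the
crossing of `D̃` between the same two strands. -/
noncomputable def r3f (D : PD) (t : Fin 3 → D.X) (k : Fin 3 → Fin 4) (y z p : D.X) :
    D.Chain →ₗ[ZMod 2] (D.r3 t k).Chain :=
  ofRel fun S T => (S.smoothing y = true ∧ S.smoothing z = false ∧ S.smoothing p = false) ∧
    (∀ c : D.X, T.smoothing c = S.smoothing c) ∧ ∀ e ∉ D.sides t k, T.label e = S.label e

open Classical in
/-- The identification `g : C(D̃(*1)) ≅ C(D(*1))`, where `p` is smoothed by `1` and the third strand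
is moved across `p`; it crosses the two arcs at `p` in `y` and `z` before, and in `z` and `y`
after the move. -/
noncomputable def r3g (D : PD) (t : Fin 3 → D.X) (k : Fin 3 → Fin 4) (y z p : D.X) :
    D.Chain →ₗ[ZMod 2] (D.r3 t k).Chain :=
  ofRel fun S T => S.smoothing p = true ∧
    (∀ c : D.X, T.smoothing c = S.smoothing (Equiv.swap y z c)) ∧
    ∀ e ∉ D.sides t k, T.label e = S.label e

/-- `φ` is Khovanov's map `C(D̃) → C(D)` for the third Reidemeister move from `D̃` to `D`
(here `D̃` is the first argument, `D` is `r3` of it, and the pivot is `p`): it vanishes on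
`X̃₂ = {a + ∂b | a, b ∈ C(D̃(*000))}` and `X̃₃ = {a ⊗ 1 + ∂(b ⊗ 1) | a, b ∈ C(D̃(*110))}`, and
takes the element `a + ∂(a) ⊗ 1 + b` of `X̃₁`, with `a ∈ C(D̃(*100))` and `b ∈ C(D̃(*1))`, to
`f(a) + ∂(f(a)) ⊗ 1 + g(b)`. -/
def IsR3Map (D : PD) (t : Fin 3 → D.X) (k : Fin 3 → Fin 4) (y z p : D.X)
    (φ : D.Chain →ₗ[ZMod 2] (D.r3 t k).Chain) : Prop :=
  (∀ a ∈ D.part3 y z p true false false, ∀ b ∈ D.part (fun s => s p = true),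
    φ (D.r3Lift (D.sides t k) y z p a + b) =
      (D.r3 t k).r3Lift (D.sides t k) y z p (D.r3f t k y z p a) + D.r3g t k y z p b) ∧
  (∀ a ∈ D.part3 y z p false false false, ∀ b ∈ D.part3 y z p false false false,
    φ (a + D.d b) = 0) ∧
  (∀ a ∈ D.part3 y z p true true false, ∀ b ∈ D.part3 y z p true true false,
    φ (D.tensor y (D.sides t k) .one a + D.d (D.tensor y (D.sides t k) .one b)) = 0)

end PD

end KhBeta

namespace KhBeta

/-! The sum `delta` of ∂ and β is itself a cube differential. It belongs to the Frobenius algebra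
with x² = x, Δ(1) = 1 ⊗ x + x ⊗ 1 + 1 ⊗ 1 and Δ(x) = x ⊗ x (Bar-Natan's deformation). This is the
algebra of functions on two points, so a change of basis trivializes it. Read a chain over a
smoothing s as a multilinear polynomial with one variable per circle, and evaluate it at 0/1-points,
that is, at labelings l of the arcs that are constant on the circles of s; this is `zev`.
Multiplication becomes restriction to the diagonal and comultiplication extension by zero from the
diagonal. Hence (`zev_delta`) the value of δf at (s, l) is the sum of the values of f at (s with c
changed to 0, l), over the crossings c with s c = 1 at whose four ends l is constant. Labels never
change along an edge, and statements about circles become finite checks at single crossings. In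
particular δ² = 0, since the terms for (c, c') and (c', c) cancel.

∂ preserves the q-degree and β raises it by 2, so identities for δ split by q-degree. From δ² = 0
one gets ∂² = 0, ∂β = βδ₀ with δ₀ = ∂, and β² = 0 (`differential_facts`). If φ = φ₀ + φ₂ + …
commutes with δ, then φ₀ is a chain map for ∂, and βφ₀ + φ₀β = ∂φ₂ + φ₂∂: the leading term commutes
with β up to the homotopy φ₂ (`betaEquiv_of_delta`). So it suffices to find filtered homotopy
equivalences for δ whose leading terms are Khovanov's maps.

Planarity enters through `NoSingle`: an edge of the cube merges two circles or splits one. Euler's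
formula yields a checkerboard colouring of the regions, and this marks the arc ends alternately. The
circles of a smoothing are then the cycles of a permutation of the marked ends, and changing one
crossing composes it with a transposition (`Good.noSingle`).

For a kink with a small circle, τ(z) = z ⊗ 1 is a contracting homotopy for everything but the
coefficient of x at that circle. For a bigon or a triangle, two crossings y, z give a square of
smoothings in which one corner carries a small circle. That corner is a copy of one neighbour (by τ)
plus a copy of the other (by ε, the coefficient of x), and Gaussian elimination cancels all three
(`TwoStep`). What remains for the bigon is the complex of the undone diagram. For the triangle it is
the part with pivot smoothed by 1 together with C(*100), and `slide_delta` identifies the remaining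
differentials before and after the move.

The other kinks and triangles are mirror images of these. The complex of the mirror image is the
transpose, with 1 and x exchanged, so transposing the maps settles them (`BetaEquiv.dual`). -/

instance : Fintype Gen where
  elems := ⟨[Gen.one, Gen.x], by simp⟩
  complete := by rintro (_ | _) <;> simp

theorem Gen.sum_eq {M : Type*} [AddCommMonoid M] (F : Gen → M) :
    ∑ g, F g = F .one + F .x := by
  change Multiset.sum (Multiset.map F ↑[Gen.one, Gen.x]) = _
  simp

theorem Gen.ne_x {g : Gen} : g ≠ .x ↔ g = .one := by cases g <;> simp

namespace PD

open scoped Classical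

/-! ### Labelings of the arcs that are constant on circles -/

/-- The labeling `l` of the arcs is constant on the circles of the smoothing `s`. -/
def Compat (D : PD) (s : D.X → Bool) (l : D.E → Gen) : Prop :=
  ∀ c, (s c = false → l (D.arc c 0) = l (D.arc c 1) ∧ l (D.arc c 2) = l (D.arc c 3)) ∧
    (s c = true → l (D.arc c 0) = l (D.arc c 3) ∧ l (D.arc c 1) = l (D.arc c 2))

/-- The labeling `l` takes one value at the four ends of `c`. -/
def Mono (D : PD) (l : D.E → Gen) (c : D.X) : Prop :=
  ∀ i, l (D.arc c i) = l (D.arc c 0)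

theorem mono_iff (D : PD) (l : D.E → Gen) (c : D.X) : D.Mono l c ↔
    l (D.arc c 1) = l (D.arc c 0) ∧ l (D.arc c 2) = l (D.arc c 0) ∧
      l (D.arc c 3) = l (D.arc c 0) := by
  simp [Mono, Fin.forall_fin_succ]

theorem compat_iff_joined (D : PD) (s : D.X → Bool) (l : D.E → Gen) :
    D.Compat s l ↔ ∀ e e', D.Joined s e e' → l e = l e' := by
  constructor
  · rintro h e e' ⟨c, hc⟩
    have := h c
    grind
  · intro h c
    refine ⟨fun hc => ⟨h _ _ ⟨c, ?_⟩, h _ _ ⟨c, ?_⟩⟩, fun hc => ⟨h _ _ ⟨c, ?_⟩, h _ _ ⟨c, ?_⟩⟩⟩ <;>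
    simp [hc]

theorem Compat.eq_of_circ {D : PD} {s : D.X → Bool} {l : D.E → Gen} (h : D.Compat s l)
    {e e' : D.E} (he : D.circ s e = D.circ s e') : l e = l e' :=
  congrArg (Quot.lift l ((D.compat_iff_joined s l).1 h)) he

theorem circ_eq_of_joined {D : PD} {s : D.X → Bool} {e e' : D.E} (h : D.Joined s e e') :
    D.circ s e = D.circ s e' := Quot.sound h

/-- A function on circles gives a compatible labeling. -/
theorem compat_comp_circ (D : PD) (s : D.X → Bool) (v : D.Circ s → Gen) :
    D.Compat s (fun e => v (D.circ s e)) :=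
  (D.compat_iff_joined s _).2 fun _ _ h => congrArg v (circ_eq_of_joined h)

theorem State.compat {D : PD} (S : D.State) : D.Compat S.smoothing S.label :=
  D.compat_comp_circ _ S.val

/-- The indicator of a set of circles. -/
noncomputable def indic (D : PD) (s : D.X → Bool) (A : Set (D.Circ s)) (e : D.E) : Gen :=
  if D.circ s e ∈ A then .x else .one

theorem compat_indic (D : PD) (s : D.X → Bool) (A : Set (D.Circ s)) :
    D.Compat s (D.indic s A) :=
  D.compat_comp_circ s fun γ => if γ ∈ A then .x else .one

/-- The indicator of a circle is a compatible labeling and separates it from all others. Questions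
about circles thus become questions about labelings, which are local at the crossings. -/
theorem circ_eq_iff (D : PD) (s : D.X → Bool) (e e' : D.E) :
    D.circ s e = D.circ s e' ↔ ∀ l, D.Compat s l → l e = l e' := by
  refine ⟨fun h l hl => hl.eq_of_circ h, fun h => ?_⟩
  have := h _ (D.compat_indic s {D.circ s e'})
  by_contra hne
  simp [indic, hne] at this

theorem circ_surj (D : PD) (s : D.X → Bool) (γ : D.Circ s) : ∃ e, D.circ s e = γ :=
  Quot.exists_rep γ

/-- The state with a given smoothing and given labels. -/
def mkState (D : PD) (s : D.X → Bool) (l : D.E → Gen) (h : D.Compat s l) : D.State :=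
  ⟨s, Quot.lift l ((D.compat_iff_joined s l).1 h)⟩

@[simp] theorem mkState_smoothing (D : PD) (s : D.X → Bool) (l : D.E → Gen) (h : D.Compat s l) :
    (D.mkState s l h).smoothing = s := rfl

@[simp] theorem mkState_label (D : PD) (s : D.X → Bool) (l : D.E → Gen) (h : D.Compat s l) :
    (D.mkState s l h).label = l := rfl

theorem State.ext' {D : PD} {S T : D.State} (h : S.smoothing = T.smoothing)
    (h' : ∀ e, S.label e = T.label e) : S = T := by
  obtain ⟨s, v⟩ := S
  obtain ⟨t, w⟩ := T
  obtain rfl : s = t := h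
  congr 1
  funext γ
  obtain ⟨e, rfl⟩ := D.circ_surj s γ
  exact h' e

theorem compat_update_iff (D : PD) (s : D.X → Bool) (c : D.X) (b : Bool) (l : D.E → Gen)
    (h : D.Compat s l) (hm : D.Mono l c) : D.Compat (Function.update s c b) l := by
  intro c'
  by_cases hc : c' = c
  · subst hc
    have := (D.mono_iff l c').1 hm
    grind
  · simpa [hc] using h c'

/-- The two smoothings of a crossing pair its four ends in two ways that together connect all of
them. -/
theorem mono_of_compat (D : PD) {s : D.X → Bool} {c : D.X} {l : D.E → Gen} {b : Bool}
    (hb : s c ≠ b) (h : D.Compat s l) (h' : D.Compat (Function.update s c b) l) :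
    D.Mono l c := by
  rw [mono_iff]
  have h1 := h c
  have h2 := h' c
  simp only [Function.update_self] at h2
  cases hs : s c <;> cases b <;> grind

theorem mono_iff_of_compat (D : PD) {s : D.X → Bool} {c : D.X} {l : D.E → Gen}
    (h : D.Compat s l) : D.Mono l c ↔ l (D.arc c 0) = l (D.arc c 2) := by
  rw [mono_iff]
  have h1 := h c
  cases hs : s c <;> grind

/-! ### Chains -/

theorem cubeMap_apply (D : PD) (m Δ : Gen → Gen → Gen → ZMod 2) (f : D.Chain) (T : D.State) :
    D.cubeMap m Δ f T = ∑ S, (∑ c, D.edgeCoeff m Δ c S T) * f S := rfl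

theorem ofRel_apply {D D' : PD} (R : D.State → D'.State → Prop) (f : D.Chain) (T : D'.State) :
    ofRel R f T = ∑ S, if R S T then f S else 0 := by
  change ∑ S, (if R S T then (1 : ZMod 2) else 0) * f S = _
  simp

theorem proj_apply (D : PD) (P : (D.X → Bool) → Prop) (f : D.Chain) (T : D.State) :
    D.proj P f T = if P T.smoothing then f T else 0 := by
  rw [proj, ofRel_apply, Finset.sum_eq_single T]
  · simp
  · intro S _ h
    simp [h]
  · simp

/-- The sum of the coordinates of a chain over the states with smoothing `s` all of whose
`x`-labeled arcs are `x`-labeled in `l`. -/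
noncomputable def zev (D : PD) (s : D.X → Bool) (l : D.E → Gen) : D.Chain →ₗ[ZMod 2] ZMod 2 :=
  ∑ S : D.State, if S.smoothing = s ∧ ∀ e, S.label e = .x → l e = .x then LinearMap.proj S else 0

theorem zev_apply (D : PD) (s : D.X → Bool) (l : D.E → Gen) (f : D.Chain) :
    D.zev s l f = ∑ S, if S.smoothing = s ∧ ∀ e, S.label e = .x → l e = .x then f S else 0 := by
  rw [zev, LinearMap.sum_apply]
  refine Finset.sum_congr rfl fun S _ => ?_
  split_ifs <;> simp

/-- Evaluation is the zeta transform of the Boolean lattice of sets of `x`-labeled circles, hence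
invertible: a state of the support with the fewest `x`-labeled arcs is the only one that contributes
at its own labeling. -/
theorem eq_zero_of_zev (D : PD) (f : D.Chain)
    (h : ∀ s l, D.Compat s l → D.zev s l f = 0) : f = 0 := by
  by_contra hf
  have hne : (Finset.univ.filter fun S => f S ≠ 0).Nonempty := by
    obtain ⟨S, hS⟩ := Function.ne_iff.1 hf
    exact ⟨S, by simpa using hS⟩
  obtain ⟨S, hS, hmin⟩ := Finset.exists_min_image _
    (fun S : D.State => (Finset.univ.filter fun e => S.label e = .x).card) hne
  have := h S.smoothing S.label S.compat
  rw [zev_apply, Finset.sum_eq_single S] at this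
  · simp only [imp_self, implies_true, and_self, if_true] at this
    simp [this] at hS
  · intro T _ hT
    split_ifs with h1
    · by_contra h2
      have h3 := hmin T (by simpa using h2)
      have h4 : (Finset.univ.filter fun e => T.label e = .x) =
          Finset.univ.filter fun e => S.label e = .x :=
        Finset.eq_of_subset_of_card_le (fun e he => by simpa using h1.2 e (by simpa using he)) h3
      refine hT (State.ext' h1.1 fun e => ?_)
      have h5 := Finset.ext_iff.1 h4 e
      simp only [Finset.mem_filter, Finset.mem_univ, true_and] at h5
      cases h6 : T.label e <;> cases h7 : S.label e <;> simp_all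
    · rfl
  · simp

theorem chain_ext (D : PD) {f g : D.Chain}
    (h : ∀ s l, D.Compat s l → D.zev s l f = D.zev s l g) : f = g :=
  sub_eq_zero.1 (D.eq_zero_of_zev _ fun s l hl => by rw [map_sub, h s l hl, sub_self])

theorem zev_proj (D : PD) (P : (D.X → Bool) → Prop) (s : D.X → Bool) (l : D.E → Gen)
    (f : D.Chain) : D.zev s l (D.proj P f) = if P s then D.zev s l f else 0 := by
  simp only [zev_apply, proj_apply]
  split_ifs with h
  · refine Finset.sum_congr rfl fun S _ => ?_
    split_ifs with h1 h2
    · rfl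
    · exact absurd (h1.1 ▸ h) h2
    · rfl
  · refine Finset.sum_eq_zero fun S _ => ?_
    split_ifs with h1 h2
    · exact absurd (h1.1 ▸ h2) h
    · rfl
    · rfl

/-- Over `s'` the relation is the graph of a function defined on the states over `s`. It need not be
injective, because `zev` adds up the fibres. -/
theorem zev_ofRel {D D' : PD} (R : D.State → D'.State → Prop) (s : D.X → Bool) (l : D.E → Gen)
    (s' : D'.X → Bool) (l' : D'.E → Gen) (f : D.Chain)
    (h1 : ∀ S T, R S T → T.smoothing = s' → S.smoothing = s ∧
      ((∀ e, T.label e = .x → l' e = .x) ↔ ∀ e, S.label e = .x → l e = .x))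
    (h2 : ∀ S, S.smoothing = s → ∃ T, R S T ∧ T.smoothing = s')
    (h3 : ∀ S T T', R S T → R S T' → T.smoothing = s' → T'.smoothing = s' → T = T') :
    D'.zev s' l' (ofRel R f) = D.zev s l f := by
  simp only [zev_apply, ofRel_apply]
  simp only [← Finset.sum_filter]
  rw [Finset.sum_comm' (t' := Finset.univ)
    (s' := fun S => Finset.univ.filter fun T =>
      (T.smoothing = s' ∧ ∀ e, T.label e = .x → l' e = .x) ∧ R S T) (by simp)]
  rw [Finset.sum_filter]
  refine Finset.sum_congr rfl fun S _ => ?_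
  rw [Finset.sum_const]
  split_ifs with h
  · obtain ⟨T, hT, hs⟩ := h2 S h.1
    have : (Finset.univ.filter fun T : D'.State =>
      (T.smoothing = s' ∧ ∀ e, T.label e = .x → l' e = .x) ∧ R S T) = {T} := by
      ext T'
      simp only [Finset.mem_filter, Finset.mem_univ, true_and, Finset.mem_singleton]
      constructor
      · rintro ⟨⟨h4, h5⟩, h6⟩
        exact h3 S T' T h6 hT h4 hs
      · rintro rfl
        exact ⟨⟨hs, (h1 S T' hT hs).2.2 h.2⟩, hT⟩
    rw [this]
    simp
  · rw [Finset.filter_eq_empty_iff.2]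
    · simp
    · rintro T _ ⟨⟨h4, h5⟩, h6⟩
      have := h1 S T h6 h4
      exact h ⟨this.1, this.2.1 h5⟩

theorem zev_ofRel_eq_zero {D D' : PD} (R : D.State → D'.State → Prop)
    (s' : D'.X → Bool) (l' : D'.E → Gen) (f : D.Chain)
    (h : ∀ S T, R S T → T.smoothing = s' → f S = 0) :
    D'.zev s' l' (ofRel R f) = 0 := by
  simp only [zev_apply, ofRel_apply]
  refine Finset.sum_eq_zero fun T _ => ?_
  split_ifs with h1
  · refine Finset.sum_eq_zero fun S _ => ?_
    split_ifs with h2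
    · exact h S T h2 h1.1
    · rfl
  · rfl

theorem proj_eq_self (D : PD) {P : (D.X → Bool) → Prop} {f : D.Chain} (h : f ∈ D.part P) :
    D.proj P f = f := by
  funext S
  rw [proj_apply]
  split_ifs with h1
  · rfl
  · by_contra h2
    exact h1 (h S (Ne.symm h2))

theorem proj_mem (D : PD) (P : (D.X → Bool) → Prop) (f : D.Chain) : D.proj P f ∈ D.part P := by
  intro S h
  rw [proj_apply] at h
  by_contra h1
  simp [h1] at h

theorem proj_eq_zero (D : PD) {P Q : (D.X → Bool) → Prop} {f : D.Chain} (h : f ∈ D.part P)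
    (hPQ : ∀ s, P s → ¬ Q s) : D.proj Q f = 0 := by
  funext S
  rw [proj_apply]
  split_ifs with h1
  · by_contra h2
    exact hPQ _ (h S h2) h1
  · rfl

theorem part_mono (D : PD) {P Q : (D.X → Bool) → Prop} (h : ∀ s, P s → Q s) :
    D.part P ≤ D.part Q := fun _ hf S hS => h _ (hf S hS)

theorem zev_eq_zero_of_mem (D : PD) {P : (D.X → Bool) → Prop} {f : D.Chain} (h : f ∈ D.part P)
    {s : D.X → Bool} (hs : ¬ P s) (l : D.E → Gen) : D.zev s l f = 0 := by
  rw [← D.proj_eq_self h, zev_proj, if_neg hs]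

theorem mem_part_of_zev (D : PD) (P : (D.X → Bool) → Prop) (f : D.Chain)
    (h : ∀ s l, D.Compat s l → ¬ P s → D.zev s l f = 0) : f ∈ D.part P := by
  have : D.proj P f = f := D.chain_ext fun s l hl => by
    rw [zev_proj]
    split_ifs with h1
    · rfl
    · exact (h s l hl h1).symm
  rw [← this]
  exact D.proj_mem P f

theorem proj_add_proj_not (D : PD) (P : (D.X → Bool) → Prop) (f : D.Chain) :
    D.proj P f + D.proj (fun s => ¬ P s) f = f := by
  funext S
  rw [Pi.add_apply, proj_apply, proj_apply]
  by_cases h : P S.smoothing <;> simp [h]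

theorem edgeCoeff_ne_zero (D : PD) {m Δ : Gen → Gen → Gen → ZMod 2} {c : D.X} {S T : D.State}
    (h : D.edgeCoeff m Δ c S T ≠ 0) :
    S.smoothing c = false ∧ T.smoothing = Function.update S.smoothing c true := by
  rw [edgeCoeff] at h
  split_ifs at h with h1
  · exact ⟨h1.1, h1.2.1⟩
  · exact ⟨h1.1, h1.2.1⟩
  all_goals exact absurd rfl h

theorem cubeMap_mem_part (D : PD) (m Δ : Gen → Gen → Gen → ZMod 2)
    {P P' : (D.X → Bool) → Prop}
    (h : ∀ s c, P s → s c = false → P' (Function.update s c true)) {f : D.Chain}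
    (hf : f ∈ D.part P) : D.cubeMap m Δ f ∈ D.part P' := by
  intro T hT
  rw [cubeMap_apply] at hT
  obtain ⟨S, _, hS⟩ := Finset.exists_ne_zero_of_sum_ne_zero hT
  obtain ⟨c, _, hc⟩ := Finset.exists_ne_zero_of_sum_ne_zero (left_ne_zero_of_mul hS)
  have h1 := D.edgeCoeff_ne_zero hc
  rw [h1.2]
  exact h _ c (hf S (right_ne_zero_of_mul hS)) h1.1

/-- Changing a smoothing at one crossing merges two circles or splits one circle. -/
def NoSingle (D : PD) : Prop :=
  ∀ (s : D.X → Bool) (c : D.X) (b : Bool), s c ≠ b →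
    (D.circ s (D.arc c 0) = D.circ s (D.arc c 2) ↔
      D.circ (Function.update s c b) (D.arc c 0) ≠ D.circ (Function.update s c b) (D.arc c 2))

/-- The arc `e` is not on the circles through `c`. -/
def Off (D : PD) (s : D.X → Bool) (c : D.X) (e : D.E) : Prop :=
  D.circ s e ≠ D.circ s (D.arc c 0) ∧ D.circ s e ≠ D.circ s (D.arc c 2)

theorem circ_arc (D : PD) (s : D.X → Bool) (c : D.X) (i : Fin 4) :
    D.circ s (D.arc c i) = D.circ s (D.arc c 0) ∨ D.circ s (D.arc c i) = D.circ s (D.arc c 2) := by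
  have h : ∀ e e', D.Joined s e e' → D.circ s e = D.circ s e' := fun e e' => circ_eq_of_joined
  cases hs : s c
  · have h1 := h (D.arc c 0) (D.arc c 1) ⟨c, by simp [hs]⟩
    have h2 := h (D.arc c 2) (D.arc c 3) ⟨c, by simp [hs]⟩
    fin_cases i <;> simp [h1, h2]
  · have h1 := h (D.arc c 0) (D.arc c 3) ⟨c, by simp [hs]⟩
    have h2 := h (D.arc c 1) (D.arc c 2) ⟨c, by simp [hs]⟩
    fin_cases i <;> simp [h1, h2]

theorem Off.circ_ne {D : PD} {s : D.X → Bool} {c : D.X} {e : D.E} (h : D.Off s c e) (i : Fin 4) :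
    D.circ s e ≠ D.circ s (D.arc c i) := by
  rcases D.circ_arc s c i with h1 | h1 <;> rw [h1]
  exacts [h.1, h.2]

/-- The indicator of a circle that avoids `c` is constant at `c`, hence compatible with both
smoothings of `c`. -/
theorem Off.circ_eq {D : PD} {s : D.X → Bool} {c : D.X} {e e' : D.E} (h : D.Off s c e) (b : Bool)
    (he : D.circ (Function.update s c b) e = D.circ (Function.update s c b) e') :
    D.circ s e = D.circ s e' := by
  have h1 : D.Compat (Function.update s c b) (D.indic s {D.circ s e}) := by
    refine D.compat_update_iff s c b _ (D.compat_indic s _) fun i => ?_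
    simp [indic, (h.circ_ne i).symm, h.1.symm]
  have := h1.eq_of_circ he
  by_contra hne
  simp [indic, Ne.symm hne] at this

theorem Off.update {D : PD} {s : D.X → Bool} {c : D.X} {e : D.E} (h : D.Off s c e) (b : Bool) :
    D.Off (Function.update s c b) c e :=
  ⟨fun h1 => h.1 (h.circ_eq b h1), fun h1 => h.2 (h.circ_eq b h1)⟩

theorem off_update_iff (D : PD) (s : D.X → Bool) (c : D.X) (e : D.E) (b : Bool) :
    D.Off (Function.update s c b) c e ↔ D.Off s c e := by
  refine ⟨fun h => ?_, fun h => h.update b⟩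
  have := h.update (s c)
  simpa using this

theorem Off.circ_eq_iff {D : PD} {s : D.X → Bool} {c : D.X} {e e' : D.E} (h : D.Off s c e)
    (b : Bool) : D.circ (Function.update s c b) e = D.circ (Function.update s c b) e' ↔
      D.circ s e = D.circ s e' := by
  refine ⟨h.circ_eq b, fun h1 => ?_⟩
  refine (h.update b).circ_eq (e' := e') (s c) ?_
  rwa [Function.update_idem, Function.update_eq_self]

/-! ### The deformed differential `∂ + β` -/

/-- The deformed differential `∂ + β` (Bar-Natan's differential, with the parameter set to `1`). -/
noncomputable def delta (D : PD) : D.Chain →ₗ[ZMod 2] D.Chain :=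
  D.cubeMap (mulK + mulB) (comulK + comulB)

theorem edgeCoeff_add (D : PD) (m m' Δ Δ' : Gen → Gen → Gen → ZMod 2) (c : D.X) (S T : D.State) :
    D.edgeCoeff (m + m') (Δ + Δ') c S T = D.edgeCoeff m Δ c S T + D.edgeCoeff m' Δ' c S T := by
  simp only [edgeCoeff]
  split_ifs <;> simp

theorem delta_eq (D : PD) : D.delta = D.d + D.beta := by
  refine LinearMap.ext fun f => ?_
  funext T
  simp only [delta, d, beta, LinearMap.add_apply, Pi.add_apply, cubeMap_apply, edgeCoeff_add,
    Finset.sum_add_distrib, add_mul]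

/-- The labels of `S` off the circles through `c`, and `g`, `h` on the circles through the
ends `0` and `2` of `c`. -/
noncomputable def fillLabel (D : PD) (s : D.X → Bool) (c : D.X) (v : D.E → Gen) (g h : Gen)
    (e : D.E) : Gen :=
  if D.circ s e = D.circ s (D.arc c 0) then g
  else if D.circ s e = D.circ s (D.arc c 2) then h else v e

theorem compat_fillLabel (D : PD) (s : D.X → Bool) (c : D.X) (b : Bool) (v : D.E → Gen)
    (hv : D.Compat s v) (g h : Gen) :
    D.Compat (Function.update s c b) (D.fillLabel (Function.update s c b) c v g h) := by
  rw [compat_iff_joined]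
  intro e e' he
  have h1 := circ_eq_of_joined he
  simp only [fillLabel, h1]
  split_ifs with h2 h3
  · rfl
  · rfl
  · refine hv.eq_of_circ ?_
    have h4 : D.Off s c e := by
      rw [← D.off_update_iff s c e b]
      exact ⟨h1 ▸ h2, h1 ▸ h3⟩
    exact (h4.circ_eq_iff b).1 h1

/-- If one of the two smoothings has a single circle through `c`, then `v` or `l` takes one value on
all circles through `c`, so that the ends `0` and `2` decide the comparison there. -/
theorem le_iff_off (D : PD) (s : D.X → Bool) (c : D.X) (v l : D.E → Gen)
    (hv : ∀ e e', D.circ s e = D.circ s e' → v e = v e')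
    (b : Bool) (hl : D.Compat (Function.update s c b) l)
    (h : D.circ s (D.arc c 0) = D.circ s (D.arc c 2) ∨
      D.circ (Function.update s c b) (D.arc c 0) = D.circ (Function.update s c b) (D.arc c 2)) :
    (∀ e, v e = .x → l e = .x) ↔ (∀ e, D.Off s c e → v e = .x → l e = .x) ∧
      (v (D.arc c 0) = .x → l (D.arc c 0) = .x) ∧ (v (D.arc c 2) = .x → l (D.arc c 2) = .x) := by
  refine ⟨fun h1 => ⟨fun e _ => h1 e, h1 _, h1 _⟩, ?_⟩
  rintro ⟨h1, h2, h3⟩ e he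
  by_cases ho : D.Off s c e
  · exact h1 e ho he
  · have h4 : ¬ D.Off (Function.update s c b) c e := by rwa [off_update_iff]
    have h5 : v e = v (D.arc c 0) ∨ v e = v (D.arc c 2) := by
      unfold Off at ho
      by_contra hne
      push Not at hne
      exact ho ⟨fun h => hne.1 (hv _ _ h), fun h => hne.2 (hv _ _ h)⟩
    have h6 : l e = l (D.arc c 0) ∨ l e = l (D.arc c 2) := by
      unfold Off at h4
      by_contra hne
      push Not at hne
      exact h4 ⟨fun h => hne.1 (hl.eq_of_circ h), fun h => hne.2 (hl.eq_of_circ h)⟩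
    rcases h with h | h
    · have := hv _ _ h
      grind
    · have := hl.eq_of_circ h
      grind

theorem off_le_congr (D : PD) (s : D.X → Bool) (c : D.X) (b : Bool) (v w l : D.E → Gen)
    (h : ∀ e, D.Off s c e → v e = w e) :
    (∀ e, D.Off (Function.update s c b) c e → w e = .x → l e = .x) ↔
      ∀ e, D.Off s c e → v e = .x → l e = .x := by
  simp only [off_update_iff]
  refine forall_congr' fun e => forall_congr' fun he => ?_
  rw [h e he]

theorem le_iff_off_same (D : PD) (s : D.X → Bool) (c : D.X) (v l : D.E → Gen)
    (hv : D.Compat s v) (hl : D.Compat s l) :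
    (∀ e, v e = .x → l e = .x) ↔ (∀ e, D.Off s c e → v e = .x → l e = .x) ∧
      (v (D.arc c 0) = .x → l (D.arc c 0) = .x) ∧ (v (D.arc c 2) = .x → l (D.arc c 2) = .x) := by
  refine ⟨fun h1 => ⟨fun e _ => h1 e, h1 _, h1 _⟩, ?_⟩
  rintro ⟨h1, h2, h3⟩ e he
  by_cases h4 : D.circ s e = D.circ s (D.arc c 0)
  · rw [hl.eq_of_circ h4]
    exact h2 (hv.eq_of_circ h4 ▸ he)
  by_cases h5 : D.circ s e = D.circ s (D.arc c 2)
  · rw [hl.eq_of_circ h5]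
    exact h3 (hv.eq_of_circ h5 ▸ he)
  exact h1 e ⟨h4, h5⟩ he

/-- The states reached from `S` by an edge at `c`. -/
theorem edge_support (D : PD) {S T : D.State} {c : D.X}
    (h2 : T.smoothing = Function.update S.smoothing c true)
    (h3 : ∀ e, S.circ e ≠ S.circ (D.arc c 0) → S.circ e ≠ S.circ (D.arc c 2) →
        T.label e = S.label e) :
    T = D.mkState (Function.update S.smoothing c true) _ (D.compat_fillLabel S.smoothing c true
      S.label S.compat (T.label (D.arc c 0)) (T.label (D.arc c 2))) := by
  refine State.ext' h2 fun e => ?_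
  simp only [mkState_label, fillLabel]
  split_ifs with h4 h5
  · exact T.compat.eq_of_circ (by rw [h2]; exact h4)
  · exact T.compat.eq_of_circ (by rw [h2]; exact h5)
  · have : D.Off S.smoothing c e := (D.off_update_iff S.smoothing c e true).1 ⟨h4, h5⟩
    exact h3 e this.1 this.2

/-- The algebra of ∂ + β consists of the functions on two points. A merge evaluates to the product
of the two values at the common label. A split evaluates to the value at the common label if the
labels of the two new circles agree, and to zero otherwise. So the edge contributes exactly when `l`
is constant at `c`; for a merge this is automatic. -/
theorem edge_sum (D : PD) (hD : D.NoSingle) (c : D.X) (S : D.State) (s' : D.X → Bool)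
    (l : D.E → Gen) (hl : D.Compat s' l) :
    (∑ T : D.State, if T.smoothing = s' ∧ ∀ e, T.label e = .x → l e = .x then
      D.edgeCoeff (mulK + mulB) (comulK + comulB) c S T else 0) =
    if (s' c = true ∧ D.Mono l c) ∧ S.smoothing = Function.update s' c false ∧
      ∀ e, S.label e = .x → l e = .x then 1 else 0 := by
  by_cases h : S.smoothing c = false ∧ s' = Function.update S.smoothing c true
  swap
  · rw [if_neg, Finset.sum_eq_zero]
    · rintro T _
      split_ifs with h1
      · by_contra h2
        have := D.edgeCoeff_ne_zero h2
        exact h ⟨this.1, h1.1 ▸ this.2⟩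
      · rfl
    · rintro ⟨⟨h1, -⟩, h2, -⟩
      refine h ⟨by rw [h2]; simp, ?_⟩
      rw [h2, Function.update_idem, ← h1, Function.update_eq_self]
  obtain ⟨hc, rfl⟩ := h
  have hc' : Function.update (Function.update S.smoothing c true) c false = S.smoothing := by
    rw [Function.update_idem, ← hc, Function.update_eq_self]
  have hsplit := hD S.smoothing c true (by simp [hc])
  have hmono := D.mono_iff_of_compat (c := c) hl
  have hS := D.le_iff_off S.smoothing c S.label l (fun e e' he => S.compat.eq_of_circ he) true hl
    (by by_contra! hh; exact hh.1 (hsplit.2 hh.2))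
  set s' := Function.update S.smoothing c true with hs'
  simp only [hmono, hc', true_and, hS]
  set u := S.label (D.arc c 0) with hu
  set v := S.label (D.arc c 2) with hv
  have hoff : ∀ g h e, D.Off S.smoothing c e → D.fillLabel s' c S.label g h e = S.label e :=
    fun g h e he => by
      have := (D.off_update_iff S.smoothing c e true).2 he
      rw [← hs'] at this
      simp [fillLabel, this.1, this.2]
  have hcomp := D.compat_fillLabel S.smoothing c true S.label S.compat
  rw [← hs'] at hcomp
  have hle : ∀ g h, (∀ e, D.fillLabel s' c S.label g h e = .x → l e = .x) ↔
      (∀ e, D.Off S.smoothing c e → S.label e = .x → l e = .x) ∧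
      (D.fillLabel s' c S.label g h (D.arc c 0) = .x → l (D.arc c 0) = .x) ∧
      (D.fillLabel s' c S.label g h (D.arc c 2) = .x → l (D.arc c 2) = .x) := fun g h => by
    rw [D.le_iff_off_same s' c _ l (hcomp g h) hl, hs',
      D.off_le_congr S.smoothing c true S.label _ l fun e he => (hoff g h e he).symm]
  have hs'c : s' c = true := by simp [hs']
  -- The condition away from `c` is the same on both sides. Abstracting it leaves a finite check of
  -- structure constants.
  obtain ⟨O, hO⟩ : ∃ O : Prop, (∀ e, D.Off S.smoothing c e → S.label e = .x → l e = .x) ↔ O :=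
    ⟨_, Iff.rfl⟩
  simp only [hO] at hle ⊢
  by_cases hm : D.circ S.smoothing (D.arc c 0) = D.circ S.smoothing (D.arc c 2)
  · have hm' := hsplit.1 hm
    have huv : u = v := S.compat.eq_of_circ hm
    have hF0 : ∀ g h, D.fillLabel s' c S.label g h (D.arc c 0) = g := fun g h => by
      simp [fillLabel]
    have hF2 : ∀ g h, D.fillLabel s' c S.label g h (D.arc c 2) = h := fun g h => by
      simp [fillLabel, Ne.symm hm']
    -- A split: the targets agree with `S` off `c` and are parametrized by the labels of the two new
    -- circles. For a merge, below, a single label remains.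
    rw [← Fintype.sum_of_injective (fun p : Gen × Gen => D.mkState s' _ (hcomp p.1 p.2))
      (fun p q hpq => ?_) _ _ ?_ (fun p => rfl)]
    rotate_left
    swap
    · have h := congrArg State.label hpq
      have h0 := congrFun h (D.arc c 0)
      have h2 := congrFun h (D.arc c 2)
      simp only [mkState_label, hF0, hF2] at h0 h2
      exact Prod.ext h0 h2
    · intro T hT
      split_ifs with h1
      · by_contra h2
        rw [edgeCoeff] at h2
        split_ifs at h2 with h3
        · exact hT ⟨(_, _), (D.edge_support h3.2.1 h3.2.2).symm⟩
        · exact hT ⟨(_, _), (D.edge_support h3.2.1 h3.2.2).symm⟩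
        all_goals exact absurd rfl h2
      · rfl
    · have hco : ∀ g h, D.edgeCoeff (mulK + mulB) (comulK + comulB) c S
          (D.mkState s' _ (hcomp g h)) = (comulK + comulB) u g h := fun g h => by
        rw [edgeCoeff, if_pos ⟨hc, rfl, fun e h1 h2 => hoff g h e ⟨h1, h2⟩⟩]
        refine ((if_neg (not_not.2 hm)).trans (if_pos hm')).trans ?_
        simp only [mkState_label, hF0, hF2, hu]
      simp only [mkState_smoothing, mkState_label, hco, hle, hF0, hF2, true_and,
        Fintype.sum_prod_type, Gen.sum_eq, ← huv, hs'c]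
      by_cases ho : O
      · cases u <;> cases l (D.arc c 0) <;> cases l (D.arc c 2) <;>
          simp [ho, comulK, comulB, CharTwo.add_self_eq_zero]
      · simp [ho]
  · have hm' : D.circ s' (D.arc c 0) = D.circ s' (D.arc c 2) := by
      by_contra hne
      exact hm (hsplit.2 hne)
    have hll : l (D.arc c 0) = l (D.arc c 2) := hl.eq_of_circ hm'
    have hF0 : ∀ g h, D.fillLabel s' c S.label g h (D.arc c 0) = g := fun g h => by
      simp [fillLabel]
    have hF2 : ∀ g h, D.fillLabel s' c S.label g h (D.arc c 2) = g := fun g h => by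
      simp [fillLabel, hm']
    rw [← Fintype.sum_of_injective (fun p : Gen => D.mkState s' _ (hcomp p p))
      (fun p q hpq => ?_) _ _ ?_ (fun p => rfl)]
    rotate_left
    swap
    · have h := congrArg State.label hpq
      have h0 := congrFun h (D.arc c 0)
      simp only [mkState_label, hF0] at h0
      exact h0
    · intro T hT
      split_ifs with h1
      · by_contra h2
        rw [edgeCoeff] at h2
        split_ifs at h2 with h3
        · refine hT ⟨T.label (D.arc c 0), ?_⟩
          have h4 : T.label (D.arc c 2) = T.label (D.arc c 0) :=
            T.compat.eq_of_circ (by rw [h1.1]; exact hm'.symm)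
          have h5 := D.edge_support h3.2.1 h3.2.2
          simp only [h4] at h5
          exact h5.symm
        · rename_i h4 h5
          exact absurd hm h4
        all_goals exact absurd rfl h2
      · rfl
    · have hco : ∀ g h, D.edgeCoeff (mulK + mulB) (comulK + comulB) c S
          (D.mkState s' _ (hcomp g h)) = (mulK + mulB) u v g := fun g h => by
        rw [edgeCoeff, if_pos ⟨hc, rfl, fun e h1 h2 => hoff g h e ⟨h1, h2⟩⟩]
        refine (if_pos hm).trans ?_
        simp only [mkState_label, hF0, hu, hv]
      simp only [mkState_smoothing, mkState_label, hco, hle, hF0, hF2, true_and, Gen.sum_eq, hs'c]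
      by_cases ho : O
      · rw [← hll]
        cases u <;> cases v <;> cases l (D.arc c 0) <;>
          simp [ho, mulK, mulB]
      · simp [ho]

/-- The change of basis that makes the differential combinatorial: the labeling stays fixed along
every edge, and the structure constants have disappeared. The later identities for `delta` are read
off from this formula. -/
theorem zev_delta (D : PD) (hD : D.NoSingle) (s : D.X → Bool) (l : D.E → Gen)
    (hl : D.Compat s l) (f : D.Chain) :
    D.zev s l (D.delta f) = ∑ c, if s c = true ∧ D.Mono l c then
      D.zev (Function.update s c false) l f else 0 := by
  simp only [zev_apply, delta, cubeMap_apply]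
  calc _ = ∑ S, (∑ c, ∑ T : D.State, if T.smoothing = s ∧ ∀ e, T.label e = .x → l e = .x then
        D.edgeCoeff (mulK + mulB) (comulK + comulB) c S T else 0) * f S := by
        simp only [Finset.sum_mul, ← Finset.sum_filter]
        rw [Finset.sum_comm]
        refine Finset.sum_congr rfl fun S _ => ?_
        rw [Finset.sum_comm]
    _ = ∑ S, ∑ c, if s c = true ∧ D.Mono l c then
        (if S.smoothing = Function.update s c false ∧ ∀ e, S.label e = .x → l e = .x
          then f S else 0) else 0 := by
        refine Finset.sum_congr rfl fun S _ => ?_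
        rw [Finset.sum_mul]
        refine Finset.sum_congr rfl fun c _ => ?_
        rw [D.edge_sum hD c S s l hl]
        by_cases h1 : s c = true ∧ D.Mono l c <;>
        by_cases h2 : S.smoothing = Function.update s c false ∧
          ∀ e, S.label e = .x → l e = .x <;> simp [h1, h2]
    _ = _ := by
        rw [Finset.sum_comm]
        refine Finset.sum_congr rfl fun c _ => ?_
        split_ifs with h
        · rfl
        · simp

/-- The double sum runs over ordered pairs of distinct crossings smoothed by 1 at which `l` is
constant. Exchanging the two crossings preserves the term, so the terms cancel in pairs. -/
theorem delta_sq (D : PD) (hD : D.NoSingle) : D.delta ∘ₗ D.delta = 0 := by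
  refine LinearMap.ext fun f => D.chain_ext fun s l hl => ?_
  rw [LinearMap.comp_apply, D.zev_delta hD s l hl, LinearMap.zero_apply, map_zero]
  have : ∀ c, (if s c = true ∧ D.Mono l c then
      D.zev (Function.update s c false) l (D.delta f) else 0) =
      ∑ c', if (s c = true ∧ D.Mono l c) ∧ (s c' = true ∧ D.Mono l c') ∧ c ≠ c' then
        D.zev (Function.update (Function.update s c false) c' false) l f else 0 := by
    intro c
    split_ifs with h
    · rw [D.zev_delta hD _ l (D.compat_update_iff s c false l hl h.2)]
      refine Finset.sum_congr rfl fun c' _ => if_congr ?_ rfl rfl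
      by_cases hcc : c' = c
      · simp [hcc]
      · simp [hcc, h, Ne.symm hcc]
    · simp [h]
  simp only [this]
  rw [← Fintype.sum_prod_type']
  refine Finset.sum_involution (fun p _ => (p.2, p.1)) ?_ ?_ (by simp) (by simp)
  · rintro ⟨c, c'⟩ -
    by_cases hcc : c = c'
    · simp [hcc]
    · simp only [Function.update_comm hcc]
      refine (congrArg₂ (· + ·) rfl (if_congr ?_ rfl rfl)).trans (CharTwo.add_self_eq_zero _)
      tauto
  · rintro ⟨c, c'⟩ - h h1
    obtain rfl : c' = c := congrArg Prod.fst h1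
    simp at h

/-! ### Degrees -/

/-- The sum of the degrees of the tensor factors. -/
noncomputable def State.degSum {D : PD} (S : D.State) : ℤ := ∑ γ, (S.val γ).deg

theorem State.qdeg_eq {D : PD} (S : D.State) :
    S.qdeg = S.degSum + D.weight S.smoothing + D.nPos - 2 * D.nNeg := rfl

/-- `ψ` induces a bijection between the circles that meet `A` and those that meet its image. This is
how total degrees are compared across smoothings and diagrams. -/
theorem sum_circ_eq {D D' : PD} {s : D.X → Bool} {s' : D'.X → Bool} (A : D.E → Prop)
    (ψ : D.E → D'.E)
    (h : ∀ e, A e → ∀ e', A e' →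
      (D.circ s e = D.circ s e' ↔ D'.circ s' (ψ e) = D'.circ s' (ψ e')))
    (F : D.Circ s → ℤ) (F' : D'.Circ s' → ℤ)
    (hF : ∀ e, A e → F' (D'.circ s' (ψ e)) = F (D.circ s e)) :
    ∑ γ with ∃ e, A e ∧ D.circ s e = γ, F γ = ∑ γ with ∃ e, A e ∧ D'.circ s' (ψ e) = γ, F' γ := by
  have hch : ∀ γ ∈ Finset.univ.filter (fun γ => ∃ e, A e ∧ D.circ s e = γ),
      ∃ e, A e ∧ D.circ s e = γ := fun γ hγ => by simpa using hγ
  choose g hg hg' using hch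
  refine Finset.sum_bij (fun γ hγ => D'.circ s' (ψ (g γ hγ))) ?_ ?_ ?_ ?_
  · intro γ hγ
    simpa using ⟨g γ hγ, hg γ hγ, rfl⟩
  · intro γ hγ γ' hγ' he
    rw [← hg' γ hγ, ← hg' γ' hγ']
    exact (h _ (hg γ hγ) _ (hg γ' hγ')).2 he
  · intro γ hγ
    obtain ⟨e, he, rfl⟩ : ∃ e, A e ∧ D'.circ s' (ψ e) = γ := by simpa using hγ
    have h1 : D.circ s e ∈ Finset.univ.filter (fun γ => ∃ e, A e ∧ D.circ s e = γ) := by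
      simpa using ⟨e, he, rfl⟩
    exact ⟨_, h1, (h _ (hg _ h1) _ he).1 (hg' _ h1)⟩
  · intro γ hγ
    rw [hF _ (hg γ hγ), hg' γ hγ]

theorem degSum_edge (D : PD) (S : D.State) (c : D.X) :
    S.degSum = (∑ γ with ∃ e, D.Off S.smoothing c e ∧ D.circ S.smoothing e = γ,
      (S.val γ).deg) + (S.label (D.arc c 0)).deg +
      if S.circ (D.arc c 0) ≠ S.circ (D.arc c 2) then (S.label (D.arc c 2)).deg else 0 := by
  rw [State.degSum, ← Finset.sum_filter_add_sum_filter_not Finset.univ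
    (fun γ => ∃ e, D.Off S.smoothing c e ∧ D.circ S.smoothing e = γ), add_assoc]
  congr 1
  have h0 : (Finset.univ.filter fun γ =>
      ¬ ∃ e, D.Off S.smoothing c e ∧ D.circ S.smoothing e = γ) =
      {S.circ (D.arc c 0), S.circ (D.arc c 2)} := by
    ext γ
    obtain ⟨e, rfl⟩ := D.circ_surj _ γ
    simp only [Finset.mem_filter, Finset.mem_univ, true_and, Finset.mem_insert,
      Finset.mem_singleton]
    constructor
    · intro h
      by_contra hne
      push Not at hne
      exact h ⟨e, hne, rfl⟩
    · rintro h ⟨e', he', h'⟩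
      rw [← h'] at h
      exact h.elim he'.1 he'.2
  rw [h0]
  by_cases h : S.circ (D.arc c 0) = S.circ (D.arc c 2)
  · simp [h, State.label]
  · simp only [Finset.sum_pair h, ne_eq, h, not_false_eq_true, if_true]
    rfl

/-- Off `c` the circles and their labels are unchanged, so the structure constants determine the
shift. The `- 1` is made up for by the additional 1-smoothing, which leaves `r` as the `q`-degree of
the cube map. -/
theorem degSum_edge_sub (D : PD) (hD : D.NoSingle) {m Δ : Gen → Gen → Gen → ZMod 2} {r : ℤ}
    (hm : ∀ u v t, m u v t ≠ 0 → t.deg = u.deg + v.deg - 1 + r)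
    (hΔ : ∀ u t t', Δ u t t' ≠ 0 → t.deg + t'.deg = u.deg - 1 + r) {c : D.X} {S T : D.State}
    (h : D.edgeCoeff m Δ c S T ≠ 0) : T.degSum = S.degSum - 1 + r := by
  obtain ⟨h1, h2⟩ := D.edgeCoeff_ne_zero h
  have hs := hD S.smoothing c true (by simp [h1])
  rw [← h2] at hs
  rw [D.degSum_edge S c, D.degSum_edge T c]
  rw [edgeCoeff] at h
  by_cases h3 : S.smoothing c = false ∧ T.smoothing = Function.update S.smoothing c true ∧
      (∀ e, S.circ e ≠ S.circ (D.arc c 0) → S.circ e ≠ S.circ (D.arc c 2) →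
        T.label e = S.label e)
  swap
  · rw [if_neg h3] at h
    exact absurd rfl h
  rw [if_pos h3] at h
  have hoff : D.Off T.smoothing c = D.Off S.smoothing c := by
    funext e
    rw [h2, off_update_iff]
  rw [hoff]
  have key := sum_circ_eq (D := D) (D' := D) (s := S.smoothing) (s' := T.smoothing)
    (D.Off S.smoothing c) id
    (fun e he e' _ => by
      rw [h2]
      exact (Off.circ_eq_iff he true).symm) (fun γ => (S.val γ).deg) (fun γ => (T.val γ).deg)
    (fun e he => by
      have := h3.2.2 e he.1 he.2
      exact congrArg Gen.deg this)
  simp only [id] at key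
  rw [key]
  by_cases h4 : S.circ (D.arc c 0) ≠ S.circ (D.arc c 2)
  · have h5 : ¬ T.circ (D.arc c 0) ≠ T.circ (D.arc c 2) := fun h5 => h4 (hs.2 h5)
    rw [if_pos h4] at h
    rw [if_pos h4, if_neg h5]
    have := hm _ _ _ h
    omega
  · have h5 : T.circ (D.arc c 0) ≠ T.circ (D.arc c 2) := hs.1 (not_not.1 h4)
    rw [if_neg h4, if_pos h5] at h
    rw [if_neg h4, if_pos h5]
    have := hΔ _ _ _ h
    omega

theorem weight_update (D : PD) {s : D.X → Bool} {c : D.X} (h : s c = false) :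
    D.weight (Function.update s c true) = D.weight s + 1 := by
  simp only [weight]
  rw [← Finset.add_sum_erase _ _ (Finset.mem_univ c),
    ← Finset.add_sum_erase Finset.univ (fun c => if s c = true then (1 : ℤ) else 0)
      (Finset.mem_univ c)]
  simp only [Function.update_self, h]
  rw [Finset.sum_congr rfl (g := fun c => if s c = true then (1 : ℤ) else 0)]
  · simp
    ring
  · intro c' hc'
    rw [Function.update_of_ne (Finset.ne_of_mem_erase hc')]

/-- The map `A` is homogeneous of bidegree `(a, b)`. -/
def BiHom {D D' : PD} (a b : ℤ) (A : D.Chain →ₗ[ZMod 2] D'.Chain) : Prop :=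
  ∀ i j, ∀ f ∈ D.bideg i j, A f ∈ D'.bideg (i + a) (j + b)

theorem biHom_cubeMap (D : PD) (hD : D.NoSingle) {m Δ : Gen → Gen → Gen → ZMod 2} {r : ℤ}
    (hm : ∀ u v t, m u v t ≠ 0 → t.deg = u.deg + v.deg - 1 + r)
    (hΔ : ∀ u t t', Δ u t t' ≠ 0 → t.deg + t'.deg = u.deg - 1 + r) :
    BiHom 1 r (D.cubeMap m Δ) := by
  intro i j f hf T hT
  rw [cubeMap_apply] at hT
  obtain ⟨S, _, hS⟩ := Finset.exists_ne_zero_of_sum_ne_zero hT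
  obtain ⟨c, _, hc⟩ := Finset.exists_ne_zero_of_sum_ne_zero (left_ne_zero_of_mul hS)
  have h1 := hf S (right_ne_zero_of_mul hS)
  have h2 := D.edgeCoeff_ne_zero hc
  have h3 := D.degSum_edge_sub hD hm hΔ hc
  have h4 := D.weight_update h2.1
  rw [← h2.2] at h4
  rw [State.qdeg_eq, State.hdeg] at h1 ⊢
  omega

theorem biHom_d (D : PD) (hD : D.NoSingle) : BiHom 1 0 D.d := by
  refine D.biHom_cubeMap hD ?_ ?_ <;> rintro (_ | _) (_ | _) (_ | _) <;>
    simp [mulK, comulK, Gen.deg]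

theorem biHom_beta (D : PD) (hD : D.NoSingle) : BiHom 1 2 D.beta := by
  refine D.biHom_cubeMap hD ?_ ?_ <;> rintro (_ | _) (_ | _) (_ | _) <;>
    simp [mulB, comulB, Gen.deg]

/-! ### Homogeneous maps and their separation by `q`-degree -/

section BiHom

variable {D D' D'' : PD}

theorem BiHom.comp {a b a' b' : ℤ} {A : D'.Chain →ₗ[ZMod 2] D''.Chain}
    {B : D.Chain →ₗ[ZMod 2] D'.Chain} (hA : BiHom a b A) (hB : BiHom a' b' B) :
    BiHom (a' + a) (b' + b) (A ∘ₗ B) := fun _ _ _ hf => by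
  rw [← add_assoc, ← add_assoc]
  exact hA _ _ _ (hB _ _ _ hf)

theorem BiHom.add {a b : ℤ} {A B : D.Chain →ₗ[ZMod 2] D'.Chain}
    (hA : BiHom a b A) (hB : BiHom a b B) : BiHom a b (A + B) := fun _ _ _ hf =>
  Submodule.add_mem _ (hA _ _ _ hf) (hB _ _ _ hf)

theorem BiHom.id : BiHom 0 0 (LinearMap.id : D.Chain →ₗ[ZMod 2] D.Chain) := fun _ _ _ hf => by
  simpa using hf

theorem BiHom.cast {a b a' b' : ℤ} {A : D.Chain →ₗ[ZMod 2] D'.Chain} (h : BiHom a b A)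
    (ha : a = a' := by norm_num) (hb : b = b' := by norm_num) : BiHom a' b' A := by
  subst ha hb
  exact h

theorem biHom_ofRel {a b : ℤ} (R : D.State → D'.State → Prop)
    (h : ∀ S T, R S T → T.hdeg = S.hdeg + a ∧ T.qdeg = S.qdeg + b) : BiHom a b (ofRel R) := by
  intro _ _ f hf T hT
  rw [ofRel_apply] at hT
  obtain ⟨S, _, hS⟩ := Finset.exists_ne_zero_of_sum_ne_zero hT
  split_ifs at hS with hR
  · have h1 := h S T hR
    have h2 := hf S hS
    omega
  · exact absurd rfl hS

theorem biHom_proj (D : PD) (P : (D.X → Bool) → Prop) : BiHom 0 0 (D.proj P) :=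
  biHom_ofRel _ fun S T h => by
    rw [h.1]
    simp

theorem linearMap_ext {A B : D.Chain →ₗ[ZMod 2] D'.Chain}
    (h : ∀ S : D.State, A (Pi.single S 1) = B (Pi.single S 1)) : A = B :=
  LinearMap.pi_ext' fun S => LinearMap.ext_ring (h S)

theorem single_mem_bideg (S : D.State) : (Pi.single S 1 : D.Chain) ∈ D.bideg S.hdeg S.qdeg := by
  intro T hT
  by_cases h : T = S
  · simp [h]
  · rw [Pi.single_eq_of_ne h] at hT
    exact absurd rfl hT

/-- Homogeneous maps of different `q`-degrees are linearly independent. -/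
theorem eq_zero_of_sum_biHom {ι : Type*} [Fintype ι] (a b : ι → ℤ) (hb : Function.Injective b)
    (A : ι → D.Chain →ₗ[ZMod 2] D'.Chain) (hA : ∀ k, BiHom (a k) (b k) (A k))
    (h : ∑ k, A k = 0) (k : ι) : A k = 0 := by
  refine linearMap_ext fun S => ?_
  funext T
  by_contra hne
  have h1 := congrFun (LinearMap.congr_fun h (Pi.single S 1)) T
  rw [LinearMap.sum_apply, Finset.sum_apply, Finset.sum_eq_single k] at h1
  · exact hne h1
  · intro k' _ hk'
    by_contra hne'
    have h2 := (hA k _ _ _ (single_mem_bideg S) T hne).2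
    have h3 := (hA k' _ _ _ (single_mem_bideg S) T hne').2
    exact hk' (hb (by omega))
  · simp

theorem BiHom.eq_zero_three {a b b' b'' : ℤ} {A B C : D.Chain →ₗ[ZMod 2] D'.Chain}
    (hA : BiHom a b A) (hB : BiHom a b' B) (hC : BiHom a b'' C) (hb : b ≠ b') (hb' : b ≠ b'')
    (hb'' : b' ≠ b'') (h : A + B + C = 0) : A = 0 ∧ B = 0 ∧ C = 0 := by
  have h1 : ∀ k : Fin 3, ![A, B, C] k = 0 :=
    eq_zero_of_sum_biHom (fun _ => a) ![b, b', b'']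
      (by intro i j; fin_cases i <;> fin_cases j <;>
            simp [hb, hb.symm, hb', hb'.symm, hb'', hb''.symm]) ![A, B, C]
      (by intro k; fin_cases k <;> assumption)
      (by simpa [Fin.sum_univ_succ, add_assoc] using h)
  exact ⟨h1 0, h1 1, h1 2⟩

end BiHom

/-- Moving a term to the other side in characteristic two. -/
theorem add_eq_zero_iff_eq' {M : Type*} [AddCommGroup M] [Module (ZMod 2) M] {x y : M} :
    x + y = 0 ↔ x = y := by
  rw [add_eq_zero_iff_eq_neg, ZModModule.neg_eq_self]

/-- These are the components of δ² = 0 of `q`-degrees 0, 2 and 4. -/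
theorem differential_facts (D : PD) (hD : D.NoSingle) :
    D.d ∘ₗ D.d = 0 ∧ D.beta ∘ₗ D.d = D.d ∘ₗ D.beta ∧ D.beta ∘ₗ D.beta = 0 := by
  have hd := D.biHom_d hD
  have hb := D.biHom_beta hD
  have h := D.delta_sq hD
  rw [delta_eq, LinearMap.add_comp, LinearMap.comp_add, LinearMap.comp_add] at h
  have := BiHom.eq_zero_three (hd.comp hd) (((hd.comp hb).cast (a' := 1 + 1) (b' := 2)).add
    ((hb.comp hd).cast (b' := 2))) (hb.comp hb) (by norm_num) (by norm_num) (by norm_num)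
    (by rw [← h]; abel)
  refine ⟨this.1, ?_, this.2.2⟩
  rw [← add_eq_zero_iff_eq', add_comm]
  exact this.2.1

end PD
end KhBeta

/-! ### Planarity: every edge of the cube merges two circles or splits one -/

namespace KhBeta

/-- Composing a permutation with a transposition splits or merges the cycles through the two
points. -/
theorem sameCycle_iff_not_of_swap {α : Type*} [Finite α] (f g : Equiv.Perm α) {x y : α}
    (hxy : x ≠ y) (hx : g x = f y) (h : ∀ z, z ≠ x → z ≠ y → g z = f z) :
    f.SameCycle x y ↔ ¬ g.SameCycle x y := by
  -- The least such `n` is the first time the `f`-orbit of `y` meets `x` or `y`. Until then it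
  -- coincides with the `g`-orbit of `x`, since `g x = f y` and the permutations agree off `x` and
  -- `y`.
  have hex : ∃ n, 0 < n ∧ ((f ^ n) y = x ∨ (f ^ n) y = y) :=
    ⟨orderOf f, orderOf_pos f, Or.inr (by simp [pow_orderOf_eq_one])⟩
  classical
  obtain ⟨hm0, hm⟩ := Nat.find_spec hex
  have hmin : ∀ n, 0 < n → n < Nat.find hex → (f ^ n) y ≠ x ∧ (f ^ n) y ≠ y := fun n hn hn' => by
    have := Nat.find_min hex hn'
    tauto
  set m := Nat.find hex
  have hpow : ∀ n, 0 < n → n ≤ m → (g ^ n) x = (f ^ n) y := by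
    intro n hn
    induction n, hn using Nat.le_induction with
    | base => intro _; simpa using hx
    | succ n hn ih =>
      intro hle
      have h1 := hmin n hn (by omega)
      rw [pow_succ', pow_succ', Equiv.Perm.mul_apply, Equiv.Perm.mul_apply, ih (by omega),
        h _ h1.1 h1.2]
  have hmod : ∀ (p : Equiv.Perm α) (z : α), (p ^ m) z = z → ∀ n, (p ^ n) z = (p ^ (n % m)) z := by
    intro p z hz n
    conv_lhs => rw [← Nat.mod_add_div n m, pow_add, Equiv.Perm.mul_apply, pow_mul]
    congr 1
    generalize n / m = q
    induction q with
    | zero => simp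
    | succ q ih => rw [pow_succ, Equiv.Perm.mul_apply, hz, ih]
  -- If the `f`-orbit of `y` reaches `x` first, then the `g`-orbit of `x` closes up without meeting
  -- `y`. If it returns to `y` first, it misses `x`, while the `g`-orbit of `x` has arrived at `y`.
  rcases hm with hm | hm
  · refine iff_of_true (Equiv.Perm.SameCycle.symm ⟨m, by simpa using hm⟩) fun hs => ?_
    obtain ⟨n, hn⟩ := hs.exists_nat_pow_eq
    rw [hmod g x (by rw [hpow m hm0 le_rfl, hm])] at hn
    rcases Nat.eq_zero_or_pos (n % m) with h0 | h0
    · rw [h0] at hn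
      exact hxy hn
    · have hlt := Nat.mod_lt n hm0
      rw [hpow _ h0 hlt.le] at hn
      exact (hmin _ h0 hlt).2 hn
  · refine iff_of_false (fun hs => ?_) (not_not.2 ⟨m, by simpa [hm] using hpow m hm0 le_rfl⟩)
    obtain ⟨n, hn⟩ := hs.symm.exists_nat_pow_eq
    rw [hmod f y hm] at hn
    rcases Nat.eq_zero_or_pos (n % m) with h0 | h0
    · rw [h0] at hn
      exact hxy hn.symm
    · exact (hmin _ h0 (Nat.mod_lt n hm0)).1 hn

namespace PD
open scoped Classical

/-- Every label that occurs at all occurs at exactly two ends, and the ends can be marked such that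
the marks alternate around every crossing and differ at the two ends of every arc. -/
structure Good (D : PD) : Prop where
  pairing : ∀ h, ∃! h', h' ≠ h ∧ D.lab h' = D.lab h
  source : ∃ o : D.X × Fin 4 → Bool, (∀ c i, o (c, i + 1) = !o (c, i)) ∧
    ∀ h h', h' ≠ h → D.lab h' = D.lab h → o h' = !o h

section Pairing

variable {D : PD} (hp : ∀ h, ∃! h', h' ≠ h ∧ D.lab h' = D.lab h)

/-- The other end of an arc. -/
noncomputable def other (h : D.X × Fin 4) : D.X × Fin 4 := (hp h).choose

theorem other_ne (h : D.X × Fin 4) : other hp h ≠ h := (hp h).choose_spec.1.1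

theorem lab_other (h : D.X × Fin 4) : D.lab (other hp h) = D.lab h := (hp h).choose_spec.1.2

theorem eq_other {h h' : D.X × Fin 4} (hne : h' ≠ h) (hl : D.lab h' = D.lab h) :
    h' = other hp h := (hp h).choose_spec.2 h' ⟨hne, hl⟩

theorem other_other (h : D.X × Fin 4) : other hp (other hp h) = h :=
  (eq_other hp (other_ne hp h).symm (lab_other hp h).symm).symm

end Pairing

/-- The position joined to a given one by a smoothing. -/
def turn : Bool → Fin 4 → Fin 4
  | false => ![1, 0, 3, 2]
  | true => ![3, 2, 1, 0]

theorem turn_turn (b : Bool) (i : Fin 4) : turn b (turn b i) = i := by revert b i; decide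

/-- Changing the smoothing of a crossing has the same effect as exchanging opposite ends; this
produces the transposition in `Good.noSingle`. -/
theorem turn_add_two (b : Bool) (i : Fin 4) : turn (!b) (i + 2) = turn b i := by
  revert b i; decide

theorem turn_eq (b : Bool) (i : Fin 4) : turn b i = i + 1 ∨ turn b i + 1 = i := by
  revert b i; decide

theorem compat_iff_turn (D : PD) (s : D.X → Bool) (l : D.E → Gen) :
    D.Compat s l ↔ ∀ c i, l (D.arc c i) = l (D.arc c (turn (s c) i)) := by
  refine forall_congr' fun c => ?_
  cases hs : s c <;> simp [Fin.forall_fin_succ, turn] <;> grind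

theorem joined_turn (D : PD) (s : D.X → Bool) (c : D.X) (i : Fin 4) :
    D.circ s (D.arc c (turn (s c) i)) = D.circ s (D.arc c i) :=
  (D.circ_eq_iff s _ _).2 fun l hl => ((D.compat_iff_turn s l).1 hl c i).symm

/-! ### The circles of a smoothing as cycles of a permutation -/

section Source

variable {D : PD} (hp : ∀ h, ∃! h', h' ≠ h ∧ D.lab h' = D.lab h) {o : D.X × Fin 4 → Bool}
  (ho : ∀ c i, o (c, i + 1) = !o (c, i)) (ho' : ∀ h h', h' ≠ h → D.lab h' = D.lab h → o h' = !o h)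

include ho in
theorem source_turn (b : Bool) (h : D.X × Fin 4) : o (h.1, turn b h.2) = !o h := by
  rcases turn_eq b h.2 with h1 | h1
  · rw [h1, ho]
  · have := ho h.1 (turn b h.2)
    rw [h1] at this
    change o h = _ at this
    rw [this, Bool.not_not]

include ho' in
theorem source_other (h : D.X × Fin 4) : o (other hp h) = !o h :=
  ho' h _ (other_ne hp h) (lab_other hp h)

/-- Following the circles of a smoothing from one marked end to the next. -/
noncomputable def next (s : D.X → Bool) : Equiv.Perm {h : D.X × Fin 4 // o h = true} where
  toFun h := ⟨other hp (h.1.1, turn (s h.1.1) h.1.2), by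
    rw [source_other hp ho', source_turn ho, h.2]; rfl⟩
  invFun h := ⟨((other hp h.1).1, turn (s (other hp h.1).1) (other hp h.1).2), by
    rw [source_turn ho, source_other hp ho', h.2]; rfl⟩
  left_inv h := by
    apply Subtype.ext
    simp [other_other, turn_turn]
  right_inv h := by
    apply Subtype.ext
    simp [other_other, turn_turn]

/-- Smoothings and arcs both join marked ends to unmarked ones, so a circle is traversed
consistently by `next`. For the converse, the indicator of a cycle extends to a compatible labeling
of the arcs, because an arc has only one marked end. -/
theorem sameCycle_next_iff (s : D.X → Bool) (h h' : {h : D.X × Fin 4 // o h = true}) :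
    (next hp ho ho' s).SameCycle h h' ↔ D.circ s (D.lab h.1) = D.circ s (D.lab h'.1) := by
  have hnext : ∀ h : {h : D.X × Fin 4 // o h = true},
      D.lab (next hp ho ho' s h).1 = D.arc h.1.1 (turn (s h.1.1) h.1.2) := fun h =>
    lab_other hp _
  constructor
  · intro hs
    obtain ⟨n, rfl⟩ := hs.exists_nat_pow_eq
    clear hs
    induction n with
    | zero => simp
    | succ n ih =>
      rw [pow_succ', Equiv.Perm.mul_apply, hnext, joined_turn]
      exact ih
  · intro hc
    let l : D.E → Gen := fun e =>
      if ∃ k : {h : D.X × Fin 4 // o h = true}, D.lab k.1 = e ∧ (next hp ho ho' s).SameCycle h k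
      then .x else .one
    have hl1 : ∀ k : {h : D.X × Fin 4 // o h = true},
        l (D.lab k.1) = .x ↔ (next hp ho ho' s).SameCycle h k := by
      intro k
      simp only [l]
      rw [ite_eq_left_iff]
      simp only [reduceCtorEq, imp_false, not_not]
      refine ⟨?_, fun hk => ⟨k, rfl, hk⟩⟩
      rintro ⟨k', hk', hs⟩
      by_cases hkk : k'.1 = k.1
      · rwa [← Subtype.ext hkk]
      · have := ho' _ _ hkk hk'
        rw [k.2, k'.2] at this
        simp at this
    have hl2 : ∀ c i, o (c, i) = true → l (D.arc c i) = l (D.arc c (turn (s c) i)) := by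
      intro c i hi
      have h1 := hl1 ⟨(c, i), hi⟩
      have h2 := hl1 (next hp ho ho' s ⟨(c, i), hi⟩)
      rw [Equiv.Perm.sameCycle_apply_right, ← h1, hnext] at h2
      change l (D.arc c (turn (s c) i)) = .x ↔ l (D.arc c i) = .x at h2
      cases h3 : l (D.arc c (turn (s c) i)) <;> cases h4 : l (D.arc c i) <;> simp_all
    have hl : D.Compat s l := by
      rw [compat_iff_turn]
      intro c i
      cases hi : o (c, i)
      · have := hl2 c (turn (s c) i) (by rw [source_turn ho (s c) (c, i), hi]; rfl)
        rw [turn_turn] at this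
        exact this.symm
      · exact hl2 c i hi
    rw [← hl1, ← hl.eq_of_circ hc, hl1]

end Source

/-- The marked ends at `c` are two opposite ones, and changing the smoothing there composes `next`
with their transposition. This splits or merges the cycles through them. -/
theorem Good.noSingle {D : PD} (hD : D.Good) : D.NoSingle := by
  intro s c b hb
  obtain ⟨hp, o, ho, ho'⟩ := hD
  -- The marked ends may be `1` and `3` instead of `0` and `2`. Every smoothing joins the ones to
  -- the others, so they lie on the same circles.
  obtain ⟨i, hi, hi2⟩ : ∃ i, (∀ s : D.X → Bool,
      D.circ s (D.arc c 0) = D.circ s (D.arc c 2) ↔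
        D.circ s (D.arc c i) = D.circ s (D.arc c (i + 2))) ∧ o (c, i) = true := by
    cases h0 : o (c, 0)
    · refine ⟨1, fun s => ?_, by simpa [h0] using ho c 0⟩
      have h1 := D.joined_turn s c 1
      have h3 := D.joined_turn s c 3
      change _ ↔ _ = D.circ s (D.arc c 3)
      cases hs : s c <;> simp only [hs, turn] at h1 h3 <;>
        simp at h1 h3 <;> rw [← h1, ← h3]
      exact eq_comm
    · exact ⟨0, fun s => Iff.rfl, h0⟩
  have hi3 : o (c, i + 2) = true := by
    have h1 := ho c (i + 1)
    rw [ho c i, hi2, add_assoc] at h1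
    exact h1
  rw [hi s, Ne, hi (Function.update s c b)]
  have h1 := sameCycle_next_iff hp ho ho' s ⟨(c, i), hi2⟩ ⟨(c, i + 2), hi3⟩
  have h2 := sameCycle_next_iff hp ho ho' (Function.update s c b) ⟨(c, i), hi2⟩ ⟨(c, i + 2), hi3⟩
  have hbs : b = !s c := by cases b <;> cases h : s c <;> simp_all
  have key := sameCycle_iff_not_of_swap (next hp ho ho' s) (next hp ho ho' (Function.update s c b))
    (x := ⟨(c, i), hi2⟩) (y := ⟨(c, i + 2), hi3⟩)
    (by
      intro h
      exact absurd (congrArg (fun h => h.1.2) h) ((by decide : ∀ i : Fin 4, i ≠ i + 2) i))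
    (by
      apply Subtype.ext
      simp only [next, Equiv.coe_fn_mk, Function.update_self]
      rw [hbs, ← turn_add_two (!s c) i, Bool.not_not])
    (by
      intro z hz1 hz2
      apply Subtype.ext
      simp only [next, Equiv.coe_fn_mk]
      rw [Function.update_of_ne]
      rintro hz
      have hne : z.1.2 ≠ i ∧ z.1.2 ≠ i + 2 := by
        exact ⟨fun h => hz1 (Subtype.ext (Prod.ext hz h)),
          fun h => hz2 (Subtype.ext (Prod.ext hz h))⟩
      have h4 : z.1.2 = i + 1 ∨ z.1.2 = i + 3 := by
        revert hne
        generalize z.1.2 = j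
        clear * -
        revert i j
        decide
      have h5 := z.2
      have h6 := ho c i
      have h7 := ho c (i + 2)
      rw [hi2] at h6
      rw [hi3, add_assoc] at h7
      obtain ⟨⟨z1, z2⟩, hz3⟩ := z
      simp only at hz h4 h5
      subst hz
      rcases h4 with rfl | rfl
      · rw [h6] at h5; simp at h5
      · rw [show (2 : Fin 4) + 1 = 3 from rfl] at h7
        rw [h7] at h5; simp at h5)
  exact h1.symm.trans (key.trans (not_congr h2))

/-! ### The checkerboard colouring from Euler's formula -/

section Euler

variable {D : PD} (hp : ∀ h, ∃! h', h' ≠ h ∧ D.lab h' = D.lab h)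

instance : Finite D.Face := inferInstanceAs (Finite (Quot _))

instance : Finite D.Component := inferInstanceAs (Finite (Quot _))

/-- The region at a corner. -/
def face (D : PD) (p : D.X × Fin 4) : D.Face := Quot.mk _ p

/-- The connected component of a crossing. -/
def component (D : PD) (c : D.X) : D.Component := Quot.mk _ c

theorem face_other (h : D.X × Fin 4) :
    D.face h = D.face ((other hp h).1, (other hp h).2 - 1) :=
  Quot.sound ⟨h, other hp h, (other_ne hp h).symm, (lab_other hp h).symm, rfl, rfl⟩

/-- The sum of the values of a function on regions at the two sides of an arc. -/
def coboundary (a : D.Face → ZMod 2) (h : D.X × Fin 4) : ZMod 2 :=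
  a (D.face h) + a (D.face (h.1, h.2 - 1))

/-- Seen from its other end, an arc has the same two regions at its sides, in the opposite order. -/
theorem coboundary_other (a : D.Face → ZMod 2) (h : D.X × Fin 4) :
    coboundary a (other hp h) = coboundary a h := by
  have h1 := face_other hp h
  have h2 := face_other hp (other hp h)
  rw [other_other] at h2
  rw [coboundary, coboundary, h2, ← h1, add_comm]

/-- The transfer from functions on components to functions on regions. -/
noncomputable def componentToFace (D : PD) :
    (D.Component → ZMod 2) →ₗ[ZMod 2] (D.Face → ZMod 2) where
  toFun u := Quot.lift (fun p => u (D.component p.1)) (by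
    rintro p q ⟨h, h', -, hl, rfl, rfl⟩
    exact congrArg u (Quot.sound ⟨_, _, hl⟩))
  map_add' u v := by
    funext f
    obtain ⟨p, rfl⟩ := Quot.exists_rep f
    rfl
  map_smul' r u := by
    funext f
    obtain ⟨p, rfl⟩ := Quot.exists_rep f
    rfl

variable (hO : ∀ h h', h' ≠ h → D.lab h' = D.lab h → (D.IsOut h' ↔ ¬ D.IsOut h))

include hO in
theorem isOut_other (h : D.X × Fin 4) : D.IsOut (other hp h) ↔ ¬ D.IsOut h :=
  hO h _ (other_ne hp h) (lab_other hp h)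

/-- The outgoing end of the arc through an end. -/
noncomputable def outEnd (h : D.X × Fin 4) : {h // D.IsOut h} :=
  if hh : D.IsOut h then ⟨h, hh⟩ else ⟨other hp h, (isOut_other hp hO h).2 hh⟩

theorem outEnd_eq_iff (h : D.X × Fin 4) (w : {h // D.IsOut h}) :
    outEnd hp hO h = w ↔ h = w.1 ∨ h = other hp w.1 := by
  rw [outEnd, Subtype.ext_iff]
  split_ifs with hh
  · refine ⟨Or.inl, ?_⟩
    rintro (h1 | h1)
    · exact h1
    · rw [h1, isOut_other hp hO] at hh
      exact absurd w.2 hh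
  · constructor
    · intro h1
      right
      rw [← h1, other_other]
    · rintro (h1 | rfl)
      · exact absurd (h1 ▸ w.2) hh
      · exact other_other hp _

theorem coboundary_outEnd (a : D.Face → ZMod 2) (h : D.X × Fin 4) :
    coboundary a (outEnd hp hO h).1 = coboundary a h := by
  rcases (outEnd_eq_iff hp hO h _).1 rfl with h1 | h1
  · rw [← h1]
  · rw [← coboundary_other hp, ← h1]

include hp hO in
theorem card_isOut : Fintype.card {h // D.IsOut h} = 2 * Fintype.card D.X := by
  have h1 : Fintype.card {h // D.IsOut h} = Fintype.card {h // ¬ D.IsOut h} := by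
    refine Fintype.card_congr ⟨fun h => ⟨other hp h.1, ?_⟩, fun h => ⟨other hp h.1, ?_⟩, ?_, ?_⟩
    · rw [isOut_other hp hO, not_not]; exact h.2
    · rw [isOut_other hp hO]; exact h.2
    · intro h; simp [other_other]
    · intro h; simp [other_other]
  have h2 := Fintype.card_subtype_compl (fun h => D.IsOut h)
  have h3 := Fintype.card_subtype_le (fun h => D.IsOut h)
  rw [Fintype.card_prod, Fintype.card_fin] at h2 h3
  omega

/-- The incidence matrix of crossings and arcs. -/
noncomputable def incidence : Matrix D.X {h // D.IsOut h} (ZMod 2) :=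
  Matrix.of fun c w => ∑ i, if outEnd hp hO (c, i) = w then 1 else 0

theorem incidence_mulVec (w : {h // D.IsOut h} → ZMod 2) (c : D.X) :
    (incidence hp hO).mulVec w c = ∑ i, w (outEnd hp hO (c, i)) := by
  simp only [Matrix.mulVec, dotProduct, incidence, Matrix.of_apply, Finset.sum_mul]
  rw [Finset.sum_comm]
  simp

theorem incidence_transpose_mulVec (u : D.X → ZMod 2) (w : {h // D.IsOut h}) :
    (incidence hp hO).transpose.mulVec u w = u w.1.1 + u (other hp w.1).1 := by
  simp only [Matrix.mulVec, dotProduct, incidence, Matrix.of_apply, Matrix.transpose_apply,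
    Finset.sum_mul]
  rw [← Fintype.sum_prod_type' (f := fun c i =>
    (if outEnd hp hO (c, i) = w then (1 : ZMod 2) else 0) * u c)]
  simp only [outEnd_eq_iff, ite_mul, one_mul, zero_mul, ← Finset.sum_filter]
  rw [Finset.filter_or, Finset.sum_union]
  · simp [Finset.sum_filter]
  · rw [Finset.disjoint_filter]
    rintro h - h1 h2
    exact other_ne hp w.1 (h2.symm.trans h1)

include hO in
-- A function in the kernel takes equal values at the crossings at the two ends of every arc, hence
-- is constant on components.
theorem finrank_ker_incidence_transpose :
    Module.finrank (ZMod 2) (LinearMap.ker (incidence hp hO).transpose.mulVecLin) ≤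
      Nat.card D.Component := by
  have hle : LinearMap.ker (incidence hp hO).transpose.mulVecLin ≤
      LinearMap.range (LinearMap.funLeft (ZMod 2) (ZMod 2) D.component) := by
    intro u hu
    have h1 : ∀ w : {h // D.IsOut h}, u w.1.1 = u (other hp w.1).1 := fun w => by
      have := congrFun (LinearMap.mem_ker.1 hu) w
      rw [Matrix.mulVecLin_apply, incidence_transpose_mulVec] at this
      exact add_eq_zero_iff_eq'.1 this
    refine ⟨Quot.lift u ?_, rfl⟩
    rintro c c' ⟨i, j, hij⟩
    by_cases hne : (c', j) = (c, i)
    · exact (congrArg (fun h => u h.1) hne).symm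
    · have h2 := eq_other hp hne hij.symm
      by_cases ho : D.IsOut (c, i)
      · have := h1 ⟨_, ho⟩
        rwa [← h2] at this
      · have : u (other hp (c, i)).1 = u (other hp (other hp (c, i))).1 :=
          h1 ⟨_, (isOut_other hp hO _).2 ho⟩
        rw [other_other] at this
        rw [← h2] at this
        exact this.symm
  refine (Submodule.finrank_mono hle).trans ((LinearMap.finrank_range_le _).trans ?_)
  have := Fintype.ofFinite D.Component
  rw [Module.finrank_fintype_fun_eq_card, Nat.card_eq_fintype_card]

/-- The coboundary as a function on arcs. -/
noncomputable def coboundaryLin (D : PD) :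
    (D.Face → ZMod 2) →ₗ[ZMod 2] ({h // D.IsOut h} → ZMod 2) where
  toFun a w := coboundary a w.1
  map_add' a b := by
    funext w
    simp only [coboundary, Pi.add_apply]
    ring
  map_smul' r a := by
    funext w
    simp only [coboundary, Pi.smul_apply, smul_eq_mul, RingHom.id_apply]
    ring

include hp hO in
-- A function with zero coboundary takes one value at the four corners of a crossing, and an arc
-- carries this value over to the crossing at its other end; so it comes from a function on
-- components.
theorem finrank_ker_coboundaryLin :
    Module.finrank (ZMod 2) (LinearMap.ker D.coboundaryLin) ≤ Nat.card D.Component := by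
  have hle : LinearMap.ker D.coboundaryLin ≤ LinearMap.range D.componentToFace := by
    intro a ha
    have h1 : ∀ h, a (D.face h) = a (D.face (h.1, h.2 - 1)) := fun h => by
      have := congrFun (LinearMap.mem_ker.1 ha) (outEnd hp hO h)
      change coboundary a (outEnd hp hO h).1 = 0 at this
      rw [coboundary_outEnd] at this
      exact add_eq_zero_iff_eq'.1 this
    have h2 : ∀ c i, a (D.face (c, i)) = a (D.face (c, 0)) := fun c i => by
      have h3 := h1 (c, 1)
      have h4 := h1 (c, 2)
      have h5 := h1 (c, 3)
      change _ = a (D.face (c, 0)) at h3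
      change _ = a (D.face (c, 1)) at h4
      change _ = a (D.face (c, 2)) at h5
      fin_cases i
      · rfl
      · exact h3
      · exact h4.trans h3
      · exact h5.trans (h4.trans h3)
    refine ⟨Quot.lift (fun c => a (D.face (c, 0))) ?_, ?_⟩
    · rintro c c' ⟨i, j, hij⟩
      by_cases hne : (c', j) = (c, i)
      · exact (congrArg (fun h => a (D.face (h.1, 0))) hne).symm
      · have h3 := face_other hp (c, i)
        rw [← eq_other hp hne hij.symm] at h3
        rw [← h2 c i, h3, h2]
    · funext f
      obtain ⟨p, rfl⟩ := Quot.exists_rep f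
      exact (h2 p.1 p.2).symm
  refine (Submodule.finrank_mono hle).trans ((LinearMap.finrank_range_le _).trans ?_)
  have := Fintype.ofFinite D.Component
  rw [Module.finrank_fintype_fun_eq_card, Nat.card_eq_fintype_card]

include hp hO in
-- A dimension count for the mod 2 homology of spheres. With V crossings, 2V arcs, F regions and k
-- components, the coboundaries have dimension at least F - k = V + k. They lie in the kernel of the
-- incidence matrix, whose dimension is at most 2V - (V - k) = V + k. So both spaces agree, and the
-- constant function 1 lies in the kernel because a crossing has four ends.
theorem exists_coboundary_eq_one (hpl : D.IsPlanar) :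
    ∃ a : D.Face → ZMod 2, ∀ h, coboundary a h = 1 := by
  have hr := Matrix.rank_transpose (incidence hp hO)
  have h1 := finrank_ker_incidence_transpose hp hO
  have h2 := LinearMap.finrank_range_add_finrank_ker (incidence hp hO).transpose.mulVecLin
  have h3 := LinearMap.finrank_range_add_finrank_ker (incidence hp hO).mulVecLin
  have h4 := finrank_ker_coboundaryLin hp hO
  have h5 := LinearMap.finrank_range_add_finrank_ker D.coboundaryLin
  have := Fintype.ofFinite D.Face
  rw [Module.finrank_fintype_fun_eq_card] at h2 h3 h5
  rw [card_isOut hp hO] at h3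
  rw [IsPlanar, Nat.card_eq_fintype_card, Nat.card_eq_fintype_card] at hpl
  rw [Matrix.rank, Matrix.rank] at hr
  have hle : LinearMap.range D.coboundaryLin ≤ LinearMap.ker (incidence hp hO).mulVecLin := by
    rintro _ ⟨a, rfl⟩
    rw [LinearMap.mem_ker]
    funext c
    rw [Matrix.mulVecLin_apply, incidence_mulVec]
    change ∑ i, coboundary a (outEnd hp hO (c, i)).1 = 0
    simp only [coboundary_outEnd]
    simp only [coboundary, Finset.sum_add_distrib]
    rw [add_eq_zero_iff_eq']
    exact (Equiv.sum_comp (Equiv.subRight (1 : Fin 4)) fun i => a (D.face (c, i))).symm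
  have heq := Submodule.eq_of_le_of_finrank_le hle (by omega)
  have hone : (fun _ => 1) ∈ LinearMap.ker (incidence hp hO).mulVecLin := by
    rw [LinearMap.mem_ker]
    funext c
    rw [Matrix.mulVecLin_apply, incidence_mulVec]
    simp
    rfl
  rw [← heq] at hone
  obtain ⟨a, ha⟩ := hone
  refine ⟨a, fun h => ?_⟩
  rw [← coboundary_outEnd hp hO]
  exact congrFun ha _

end Euler

/-- The function with coboundary 1 colours the regions so that the colour changes across every arc.
An end is marked by the colour of the corner that follows it counterclockwise; at the other end of
the arc this corner lies across the arc. -/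
theorem good_of_planar {D : PD} (h : D.IsOriented) (hpl : D.IsPlanar) : D.Good := by
  refine ⟨h.1, ?_⟩
  obtain ⟨a, ha⟩ := exists_coboundary_eq_one h.1 h.2 hpl
  have key : ∀ u v : ZMod 2, u + v = 1 → decide (u = 1) = !decide (v = 1) := by decide
  refine ⟨fun h => decide (a (D.face h) = 1), fun c i => key _ _ ?_, fun k k' hne hl => key _ _ ?_⟩
  · have := ha (c, i + 1)
    rwa [coboundary, add_sub_cancel_right] at this
  · have h1 := ha k'
    rw [coboundary] at h1
    have h2 := face_other h.1 k
    rw [← eq_other h.1 hne hl] at h2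
    rwa [h2]

theorem _root_.KhBeta.LinkDiagram.good (D : LinkDiagram) : D.toPD.Good :=
  good_of_planar D.oriented D.planar

/-! ### The third Reidemeister move preserves the marking of the ends -/

section R3Good

variable {D : PD} {t : Fin 3 → D.X} {k : Fin 3 → Fin 4}

theorem r3_arc (ht : Function.Injective t) (n : Fin 3) (j : Fin 4) :
    (D.r3 t k).arc (t n) (k n + j) = D.r3Ends t k n j := by
  have h10 : t 1 ≠ t 0 := ht.ne (by decide)
  have h20 : t 2 ≠ t 0 := ht.ne (by decide)
  have h21 : t 2 ≠ t 1 := ht.ne (by decide)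
  fin_cases n <;> simp [r3, h10, h20, h21]

theorem r3_arc_of_ne (c : D.X) (i : Fin 4) (hc : ∀ n, c ≠ t n) :
    (D.r3 t k).arc c i = D.arc c i := by
  simp [r3, hc]

theorem arc_mem_sides (hp : ∀ h, ∃! h', h' ≠ h ∧ D.lab h' = D.lab h) (h : D.IsTriangle t k)
    {c : D.X} {i : Fin 4} (hc : D.arc c i ∈ D.sides t k) :
    ∃ n, c = t n ∧ (i = k n ∨ i = k n + 1) := by
  obtain ⟨n, hn⟩ := hc
  by_cases hne : (c, i) = (t n, k n)
  · exact ⟨n, congrArg Prod.fst hne, Or.inl (congrArg Prod.snd hne)⟩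
  · have h1 := eq_other hp hne hn.symm
    have h2 : (t (n + 1), k (n + 1) + 1) = other hp (t n, k n) :=
      eq_other hp (fun he => by
        exact (by decide : ∀ m : Fin 3, m + 1 ≠ m) n (h.1 (congrArg Prod.fst he))) (h.2 n).symm
    rw [← h2] at h1
    exact ⟨n + 1, congrArg Prod.fst h1, Or.inr (congrArg Prod.snd h1)⟩

/-- The position before the third Reidemeister move of an arc end after the move. -/
noncomputable def r3Source (t : Fin 3 → D.X) (k : Fin 3 → Fin 4) (h : D.X × Fin 4) :
    D.X × Fin 4 :=
  if hh : ∃ n, h.1 = t n then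
    ![(t (hh.choose + 1), k (hh.choose + 1) + 3), (t (hh.choose + 2), k (hh.choose + 2) + 2),
      (t hh.choose, k hh.choose), (t hh.choose, k hh.choose + 1)] (h.2 - k hh.choose)
  else h

theorem r3Source_apply (ht : Function.Injective t) (n : Fin 3) (j : Fin 4) :
    r3Source t k (t n, k n + j) = ![(t (n + 1), k (n + 1) + 3), (t (n + 2), k (n + 2) + 2),
      (t n, k n), (t n, k n + 1)] j := by
  have hh : ∃ m, (t n, k n + j).1 = t m := ⟨n, rfl⟩
  rw [r3Source, dif_pos hh]
  rw [← ht hh.choose_spec]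
  simp

theorem lab_r3Source (ht : Function.Injective t) (h : D.X × Fin 4) :
    (D.r3 t k).lab h = D.lab (r3Source t k h) := by
  by_cases hh : ∃ n, h.1 = t n
  · obtain ⟨n, hn⟩ := hh
    obtain ⟨c, i⟩ := h
    simp only at hn
    subst hn
    obtain ⟨j, rfl⟩ : ∃ j, i = k n + j := ⟨i - k n, by abel⟩
    rw [r3Source_apply ht]
    refine (r3_arc ht n j).trans ?_
    fin_cases j <;> rfl
  · rw [r3Source, dif_neg hh]
    push Not at hh
    exact r3_arc_of_ne h.1 h.2 hh

theorem r3Source_bijective (ht : Function.Injective t) :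
    Function.Bijective (r3Source t k) := by
  refine Function.Surjective.bijective_of_finite fun h => ?_
  by_cases hh : ∃ n, h.1 = t n
  · obtain ⟨n, hn⟩ := hh
    obtain ⟨c, i⟩ := h
    simp only at hn
    subst hn
    obtain ⟨j, rfl⟩ : ∃ j, i = k n + j := ⟨i - k n, by abel⟩
    have h0 : n + 2 + 1 = n := (by decide : ∀ m : Fin 3, m + 2 + 1 = m) n
    have h1 : n + 1 + 2 = n := (by decide : ∀ m : Fin 3, m + 1 + 2 = m) n
    fin_cases j
    · exact ⟨(t n, k n + 2), by rw [r3Source_apply ht]; simp⟩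
    · exact ⟨(t n, k n + 3), by rw [r3Source_apply ht]; simp⟩
    · exact ⟨(t (n + 1), k (n + 1) + 1), by rw [r3Source_apply ht]; simp [h1]⟩
    · exact ⟨(t (n + 2), k (n + 2) + 0), by rw [r3Source_apply ht]; simp [h0]⟩
  · exact ⟨h, by rw [r3Source, dif_neg hh]⟩

/-- The ends after the move are a permutation of the old ends with the same labels, which preserves
the pairing. The marks are carried along and reversed on the sides of the triangle, which restores
their alternation at the three corners. -/
theorem Good.r3_aux (hD : D.Good) (h : D.IsTriangle t k) (lab' : D.X × Fin 4 → D.E)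
    (hl' : ∀ e, lab' e = D.lab (r3Source t k e)) :
    (∀ e, ∃! e', e' ≠ e ∧ lab' e' = lab' e) ∧
      ∃ o : D.X × Fin 4 → Bool, (∀ c i, o (c, i + 1) = !o (c, i)) ∧
        ∀ e e', e' ≠ e → lab' e' = lab' e → o e' = !o e := by
  have hb := r3Source_bijective (k := k) h.1
  constructor
  · intro e
    obtain ⟨e', he', -⟩ := hD.pairing (r3Source t k e)
    obtain ⟨e', rfl⟩ := hb.2 e'
    refine ⟨e', ⟨fun hh => he'.1 (congrArg _ hh), ?_⟩, ?_⟩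
    · rw [hl', hl']
      exact he'.2
    · rintro e'' ⟨h1, h2⟩
      rw [hl', hl'] at h2
      exact hb.1 ((hD.pairing (r3Source t k e)).unique ⟨fun hh => h1 (hb.1 hh), h2⟩ he')
  · obtain ⟨o, ho, ho'⟩ := hD.source
    let o' : D.X × Fin 4 → Bool := fun e =>
      if D.lab (r3Source t k e) ∈ D.sides t k then !o (r3Source t k e) else o (r3Source t k e)
    refine ⟨o', fun c i => ?_, fun e e' hne hl => ?_⟩
    · by_cases hh : ∃ n, c = t n
      · obtain ⟨n, rfl⟩ := hh
        -- The mark changes along a side and changes back between neighbouring ends, so the ends `k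
        -- m` of the three corners carry the same mark.
        have hstep : ∀ m, o (t (m + 1), k (m + 1)) = o (t m, k m) := fun m => by
          have h1 := ho' (t m, k m) (t (m + 1), k (m + 1) + 1)
            (fun he => by
              exact (by decide : ∀ m : Fin 3, m + 1 ≠ m) m (h.1 (congrArg Prod.fst he)))
            (h.2 m).symm
          rw [ho] at h1
          simpa using h1
        have hconst : ∀ m, o (t m, k m) = o (t 0, k 0) := by
          intro m
          have h0 := hstep 0
          have h1 := hstep 1
          change o (t 1, k 1) = _ at h0
          change o (t 2, k 2) = o (t 1, k 1) at h1
          fin_cases m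
          · rfl
          · exact h0
          · exact h1.trans h0
        have hv1 : ∀ m, o (t m, k m + 1) = !o (t 0, k 0) := fun m => by rw [ho, hconst]
        have hv2 : ∀ m, o (t m, k m + 2) = o (t 0, k 0) := fun m => by
          have := ho (t m) (k m + 1)
          rw [hv1, Bool.not_not, add_assoc] at this
          exact this
        have hv3 : ∀ m, o (t m, k m + 3) = !o (t 0, k 0) := fun m => by
          have := ho (t m) (k m + 2)
          rw [hv2, add_assoc] at this
          exact this
        have hs : ∀ m, D.lab (t m, k m) ∈ D.sides t k := fun m => ⟨m, rfl⟩
        have hs1 : ∀ m, D.lab (t m, k m + 1) ∈ D.sides t k := fun m => by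
          refine ⟨m + 2, ?_⟩
          have := h.2 (m + 2)
          rwa [(by decide : ∀ m : Fin 3, m + 2 + 1 = m) m] at this
        have hns : ∀ m (j : Fin 4), j ≠ 0 → j ≠ 1 → D.lab (t m, k m + j) ∉ D.sides t k := by
          intro m j hj hj' hmem
          obtain ⟨m', hm', hm''⟩ := arc_mem_sides hD.pairing h hmem
          rw [← h.1 hm'] at hm''
          rcases hm'' with h1 | h1
          · exact hj (by simpa using h1)
          · exact hj' (by simpa using h1)
        have hval : ∀ j, o' (t n, k n + j) =
            ![!o (t 0, k 0), o (t 0, k 0), !o (t 0, k 0), o (t 0, k 0)] j := by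
          intro j
          simp only [o', r3Source_apply h.1]
          fin_cases j
          · simpa [hns (n + 1) 3 (by decide) (by decide)] using hv3 (n + 1)
          · simpa [hns (n + 2) 2 (by decide) (by decide)] using hv2 (n + 2)
          · simpa [hs] using hconst n
          · simp [hs1, hv1]
        obtain ⟨j, rfl⟩ : ∃ j, i = k n + j := ⟨i - k n, by abel⟩
        rw [add_assoc, hval, hval]
        fin_cases j <;> simp
      · have hr : ∀ i, r3Source t k (c, i) = (c, i) := fun i => by rw [r3Source, dif_neg hh]
        have hns : ∀ i, D.lab (c, i) ∉ D.sides t k := fun i hmem => by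
          obtain ⟨m', hm', -⟩ := arc_mem_sides hD.pairing h hmem
          exact hh ⟨m', hm'⟩
        simp only [o', hr, hns, if_false]
        exact ho c i
    · rw [hl', hl'] at hl
      have h1 := ho' _ _ (fun hh => hne (hb.1 hh)) hl
      simp only [o', hl]
      split_ifs <;> rw [h1]

/-- Transferring the marking gives `NoSingle` after the move without proving that the new diagram is
planar. -/
theorem Good.r3 (hD : D.Good) (h : D.IsTriangle t k) : (D.r3 t k).Good :=
  have := hD.r3_aux h (D.r3 t k).lab (lab_r3Source h.1)
  ⟨this.1, this.2⟩

end R3Good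

/-! ### Homotopy equivalences compatible with `β` -/

/-- `φ` is a homotopy equivalence of bigraded complexes that commutes with `β` up to homotopy. -/
def BetaEquiv {D D' : PD} (φ : D.Chain →ₗ[ZMod 2] D'.Chain) : Prop :=
  ∃ (ψ : D'.Chain →ₗ[ZMod 2] D.Chain) (H : D.Chain →ₗ[ZMod 2] D.Chain)
    (H' : D'.Chain →ₗ[ZMod 2] D'.Chain) (φ₂ : D.Chain →ₗ[ZMod 2] D'.Chain),
    (BiHom 0 0 φ ∧ BiHom 0 0 ψ ∧ BiHom (-1) 0 H ∧ BiHom (-1) 0 H' ∧ BiHom 0 2 φ₂) ∧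
    φ ∘ₗ D.d = D'.d ∘ₗ φ ∧ ψ ∘ₗ D'.d = D.d ∘ₗ ψ ∧
    ψ ∘ₗ φ + LinearMap.id = D.d ∘ₗ H + H ∘ₗ D.d ∧
    φ ∘ₗ ψ + LinearMap.id = D'.d ∘ₗ H' + H' ∘ₗ D'.d ∧
    D'.beta ∘ₗ φ + φ ∘ₗ D.beta = D'.d ∘ₗ φ₂ + φ₂ ∘ₗ D.d

/-! ### What a homotopy equivalence compatible with β induces in homology -/

section Homology

variable {D D' : PD}

theorem mem_cycles {i j : ℤ} {z : D.Chain} : z ∈ D.cycles i j ↔ z ∈ D.bideg i j ∧ D.d z = 0 :=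
  Iff.rfl

theorem BiHom.mem {a b i j i' j' : ℤ} {A : D.Chain →ₗ[ZMod 2] D'.Chain} (h : BiHom a b A)
    {f : D.Chain} (hf : f ∈ D.bideg i j) (hi : i' = i + a) (hj : j' = j + b) :
    A f ∈ D'.bideg i' j' := by
  subst hi hj
  exact h _ _ _ hf

theorem induced_cond {a b i j i' j' : ℤ} {A : D.Chain →ₗ[ZMod 2] D'.Chain} (h : BiHom a b A)
    (hc : A ∘ₗ D.d = D'.d ∘ₗ A) (hi : i' = i + a) (hj : j' = j + b) :
    (∀ z ∈ D.cycles i j, A z ∈ D'.cycles i' j') ∧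
      (∀ z ∈ D.boundaries i j, A z ∈ D'.boundaries i' j') := by
  have hc' : ∀ z, A (D.d z) = D'.d (A z) := LinearMap.congr_fun hc
  constructor
  · rintro z hz
    rw [mem_cycles] at hz ⊢
    exact ⟨h.mem hz.1 hi hj, by rw [← hc', hz.2, map_zero]⟩
  · rintro _ ⟨w, hw, rfl⟩
    exact ⟨A w, h.mem hw (by omega) hj, (hc' w).symm⟩

theorem induced_cls {i j i' j' : ℤ} {A : D.Chain →ₗ[ZMod 2] D'.Chain}
    (h : (∀ z ∈ D.cycles i j, A z ∈ D'.cycles i' j') ∧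
      (∀ z ∈ D.boundaries i j, A z ∈ D'.boundaries i' j')) (z : D.cycles i j) :
    induced A i j i' j' (D.cls z) = D'.cls ⟨A z, h.1 z z.2⟩ := by
  rw [induced, dif_pos h]
  rfl

theorem cls_surjective {i j : ℤ} (x : D.Kh i j) : ∃ z, D.cls z = x :=
  Submodule.Quotient.mk_surjective _ x

theorem cls_eq_iff {i j : ℤ} (z z' : D.cycles i j) :
    D.cls z = D.cls z' ↔ (z : D.Chain) + z' ∈ D.boundaries i j := by
  rw [cls, cls, Submodule.Quotient.eq, ← ZModModule.sub_eq_add]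
  rfl

theorem beta_cond (hD : D.NoSingle) {i j i' j' : ℤ} (hi : i' = i + 1) (hj : j' = j + 2) :
    (∀ z ∈ D.cycles i j, D.beta z ∈ D.cycles i' j') ∧
      (∀ z ∈ D.boundaries i j, D.beta z ∈ D.boundaries i' j') :=
  induced_cond (D.biHom_beta hD) (D.differential_facts hD).2.1 hi hj

theorem BetaEquiv.isQuasiIso {φ : D.Chain →ₗ[ZMod 2] D'.Chain} (h : BetaEquiv φ) :
    IsQuasiIso φ := by
  obtain ⟨ψ, H, H', φ₂, ⟨hφ, hψ, hH, hH', -⟩, hφd, hψd, h1, h2, -⟩ := h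
  have hcond : ∀ i j, _ := fun i j =>
    induced_cond (i := i) (j := j) (i' := i) (j' := j) hφ hφd (by omega) (by omega)
  have hcond' : ∀ i j, _ := fun i j =>
    induced_cond (i := i) (j := j) (i' := i) (j' := j) hψ hψd (by omega) (by omega)
  refine ⟨fun i j f hf => hφ.mem hf (by omega) (by omega), hφd, fun i j => ⟨?_, ?_⟩⟩
  · rw [injective_iff_map_eq_zero]
    intro x hx
    obtain ⟨z, rfl⟩ := cls_surjective x
    rw [induced_cls (hcond i j), cls, Submodule.Quotient.mk_eq_zero] at hx
    obtain ⟨w, hw, hw'⟩ := hx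
    change D'.d w = φ z at hw'
    rw [cls, Submodule.Quotient.mk_eq_zero]
    refine ⟨ψ w + H z, Submodule.add_mem _ (hψ.mem hw (by omega) (by omega))
      (hH.mem z.2.1 (by omega) (by omega)), ?_⟩
    have h3 := LinearMap.congr_fun h1 z
    have h4 := LinearMap.congr_fun hψd w
    simp only [LinearMap.add_apply, LinearMap.comp_apply, LinearMap.id_apply] at h3 h4
    rw [(mem_cycles.1 z.2).2, map_zero, add_zero] at h3
    rw [map_add, ← h4, hw', ← h3, ← add_assoc, ZModModule.add_self, zero_add]
    rfl
  · intro y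
    obtain ⟨z, rfl⟩ := cls_surjective y
    refine ⟨D.cls ⟨ψ z, (hcond' i j).1 z z.2⟩, ?_⟩
    rw [induced_cls (hcond i j), cls_eq_iff]
    refine ⟨H' z, hH'.mem z.2.1 (by omega) (by omega), ?_⟩
    have h3 := LinearMap.congr_fun h2 z
    simp only [LinearMap.add_apply, LinearMap.comp_apply, LinearMap.id_apply] at h3
    rw [(mem_cycles.1 z.2).2, map_zero, add_zero] at h3
    exact h3.symm

theorem BetaEquiv.commutesUpToBoundaries {φ : D.Chain →ₗ[ZMod 2] D'.Chain} (h : BetaEquiv φ) :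
    CommutesUpToBoundaries φ := by
  obtain ⟨ψ, H, H', φ₂, -, -, -, -, -, h1⟩ := h
  intro z hz
  refine ⟨φ₂ z, ?_⟩
  have h3 := LinearMap.congr_fun h1 z
  simp only [LinearMap.add_apply, LinearMap.comp_apply] at h3
  rw [hz, map_zero, add_zero] at h3
  rw [← h3, ZModModule.sub_eq_add]

theorem BetaEquiv.commutesWithBetaStar {φ : D.Chain →ₗ[ZMod 2] D'.Chain} (h : BetaEquiv φ)
    (hD : D.NoSingle) (hD' : D'.NoSingle) : CommutesWithBetaStar φ := by
  obtain ⟨ψ, H, H', φ₂, ⟨hφ, -, -, -, hφ₂⟩, hφd, -, -, -, h1⟩ := h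
  intro i j
  refine LinearMap.ext fun x => ?_
  obtain ⟨z, rfl⟩ := cls_surjective x
  rw [LinearMap.comp_apply, LinearMap.comp_apply, betaStar, betaStar,
    induced_cls (beta_cond hD rfl rfl), induced_cls (induced_cond hφ hφd (by omega) (by omega)),
    induced_cls (induced_cond hφ hφd (by omega) (by omega)), induced_cls (beta_cond hD' rfl rfl),
    cls_eq_iff]
  refine ⟨φ₂ z, hφ₂.mem z.2.1 (by omega) (by omega), ?_⟩
  have h3 := LinearMap.congr_fun h1 z
  simp only [LinearMap.add_apply, LinearMap.comp_apply] at h3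
  rw [(mem_cycles.1 z.2).2, map_zero, add_zero] at h3
  rw [← h3, add_comm]

end Homology

/-- The Khovanov homologies of the two diagrams are isomorphic, compatibly with `β_*`. -/
def KhIso (D D' : PD) : Prop :=
  ∃ Φ : ∀ i j : ℤ, D.Kh i j ≃ₗ[ZMod 2] D'.Kh i j,
    ∀ i j x, Φ (i + 1) (j + 2) (D.betaStar i j (i + 1) (j + 2) x) =
      D'.betaStar i j (i + 1) (j + 2) (Φ i j x)

theorem KhIso.refl (D : PD) : KhIso D D := ⟨fun _ _ => LinearEquiv.refl _ _, fun _ _ _ => rfl⟩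

theorem KhIso.symm {D D' : PD} (h : KhIso D D') : KhIso D' D := by
  obtain ⟨Φ, hΦ⟩ := h
  refine ⟨fun i j => (Φ i j).symm, fun i j x => ?_⟩
  rw [LinearEquiv.symm_apply_eq, hΦ, LinearEquiv.apply_symm_apply]

theorem KhIso.trans {D D' D'' : PD} (h : KhIso D D') (h' : KhIso D' D'') : KhIso D D'' := by
  obtain ⟨Φ, hΦ⟩ := h
  obtain ⟨Φ', hΦ'⟩ := h'
  exact ⟨fun i j => (Φ i j).trans (Φ' i j), fun i j x => by
    simp only [LinearEquiv.trans_apply, hΦ, hΦ']⟩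

theorem BetaEquiv.khIso {D D' : PD} {φ : D.Chain →ₗ[ZMod 2] D'.Chain} (h : BetaEquiv φ)
    (hD : D.NoSingle) (hD' : D'.NoSingle) : KhIso D D' :=
  ⟨fun i j => LinearEquiv.ofBijective _ (h.isQuasiIso.bijective i j), fun i j x =>
    LinearMap.congr_fun (h.commutesWithBetaStar hD hD' i j) x⟩

/-- Isomorphisms that commute with `β_*` carry kernels onto kernels and images onto images. -/
theorem KhIso.exists_kk {D D' : PD} (h : KhIso D D') :
    ∃ Φ : ∀ i j : ℤ, D.Kh i j ≃ₗ[ZMod 2] D'.Kh i j,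
      (∀ i j x, Φ (i + 1) (j + 2) (D.betaStar i j (i + 1) (j + 2) x) =
        D'.betaStar i j (i + 1) (j + 2) (Φ i j x)) ∧
      ∃ Ψ : ∀ i j : ℤ, D.KK i j ≃ₗ[ZMod 2] D'.KK i j,
        ∀ i j (x : D.kerBeta i j), ∃ h : Φ i j x ∈ D'.kerBeta i j,
          Ψ i j (D.clsKK x) = D'.clsKK ⟨Φ i j x, h⟩ := by
  obtain ⟨Φ, hΦ⟩ := h
  refine ⟨Φ, hΦ, ?_⟩
  -- The image of `β_*` starts in degree `(i - 1, j - 2)`, and `i - 1 + 1` is only provably equal to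
  -- `i`; hence the version with free target degrees.
  have hΦ' : ∀ i j i' j' : ℤ, i' = i + 1 → j' = j + 2 → ∀ x,
      Φ i' j' (D.betaStar i j i' j' x) = D'.betaStar i j i' j' (Φ i j x) := by
    rintro i j _ _ rfl rfl x
    exact hΦ i j x
  have hker : ∀ i j, (D.kerBeta i j).map (Φ i j).toLinearMap = D'.kerBeta i j := by
    intro i j
    ext y
    rw [Submodule.mem_map]
    constructor
    · rintro ⟨x, hx, rfl⟩
      change D'.betaStar _ _ _ _ (Φ i j x) = 0
      rw [← hΦ, LinearMap.mem_ker.1 hx, map_zero]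
    · intro hy
      refine ⟨(Φ i j).symm y, ?_, by simp⟩
      change D.betaStar _ _ _ _ _ = 0
      rw [← (Φ (i + 1) (j + 2)).map_eq_zero_iff, hΦ, LinearEquiv.apply_symm_apply]
      exact hy
  let e : ∀ i j, D.kerBeta i j ≃ₗ[ZMod 2] D'.kerBeta i j := fun i j =>
    (Φ i j).ofSubmodules _ _ (hker i j)
  have he : ∀ i j, ((LinearMap.range (D.betaStar (i - 1) (j - 2) i j)).submoduleOf
      (D.kerBeta i j)).map (e i j).toLinearMap =
      (LinearMap.range (D'.betaStar (i - 1) (j - 2) i j)).submoduleOf (D'.kerBeta i j) := by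
    intro i j
    ext y
    rw [Submodule.mem_map]
    constructor
    · rintro ⟨x, ⟨w, hw⟩, rfl⟩
      refine ⟨Φ _ _ w, ?_⟩
      rw [← hΦ' _ _ _ _ (by omega) (by omega), hw]
      rfl
    · rintro ⟨w, hw⟩
      refine ⟨(e i j).symm y, ⟨(Φ _ _).symm w, ?_⟩, by simp⟩
      apply (Φ i j).injective
      rw [hΦ' _ _ _ _ (by omega) (by omega), LinearEquiv.apply_symm_apply, hw]
      have : (e i j ((e i j).symm y) : D'.Kh i j) = Φ i j ((e i j).symm y) := rfl
      rw [LinearEquiv.apply_symm_apply] at this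
      exact this
  refine ⟨fun i j => Submodule.Quotient.equiv _ _ (e i j) (he i j), fun i j x => ⟨?_, rfl⟩⟩
  rw [← hker]
  exact ⟨x, x.2, rfl⟩

/-! ### Expansion of filtered maps by `q`-degree -/

section Filtered

variable {D D' D'' : PD}

/-- The map `A` changes the homological degree by `a` and the `q`-degree by at least `n`. -/
def Filt (a n : ℤ) (A : D.Chain →ₗ[ZMod 2] D'.Chain) : Prop :=
  ∀ S T, A (Pi.single S 1) T ≠ 0 → T.hdeg = S.hdeg + a ∧ S.qdeg + n ≤ T.qdeg

theorem apply_eq_sum (A : D.Chain →ₗ[ZMod 2] D'.Chain) (f : D.Chain) (T : D'.State) :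
    A f T = ∑ S, f S * A (Pi.single S 1) T := by
  conv_lhs => rw [← Finset.univ_sum_single f, map_sum, Finset.sum_apply]
  refine Finset.sum_congr rfl fun S _ => ?_
  have : (Pi.single S (f S) : D.Chain) = f S • Pi.single S 1 := by
    rw [← Pi.single_smul, smul_eq_mul, mul_one]
  rw [this, map_smul, Pi.smul_apply, smul_eq_mul]

theorem BiHom.filt {a b : ℤ} {A : D.Chain →ₗ[ZMod 2] D'.Chain} (h : BiHom a b A) :
    Filt a b A := fun S T hT => by
  have := h _ _ _ (single_mem_bideg S) T hT
  exact ⟨this.1, this.2.ge⟩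

theorem Filt.mono {a n m : ℤ} {A : D.Chain →ₗ[ZMod 2] D'.Chain} (h : Filt a n A) (hm : m ≤ n) :
    Filt a m A := fun S T hT => ⟨(h S T hT).1, by have := (h S T hT).2; omega⟩

theorem Filt.add {a n : ℤ} {A B : D.Chain →ₗ[ZMod 2] D'.Chain} (hA : Filt a n A)
    (hB : Filt a n B) : Filt a n (A + B) := fun S T hT => by
  by_cases h : A (Pi.single S 1) T = 0
  · refine hB S T fun h' => hT ?_
    rw [LinearMap.add_apply, Pi.add_apply, h, h', add_zero]
  · exact hA S T h

theorem Filt.comp {a n a' n' : ℤ} {A : D'.Chain →ₗ[ZMod 2] D''.Chain}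
    {B : D.Chain →ₗ[ZMod 2] D'.Chain} (hA : Filt a n A) (hB : Filt a' n' B) :
    Filt (a' + a) (n' + n) (A ∘ₗ B) := fun S T hT => by
  rw [LinearMap.comp_apply, apply_eq_sum] at hT
  obtain ⟨U, _, hU⟩ := Finset.exists_ne_zero_of_sum_ne_zero hT
  have h1 := hB S U (left_ne_zero_of_mul hU)
  have h2 := hA U T (right_ne_zero_of_mul hU)
  omega

theorem BiHom.eq_zero_of_filt {a b n : ℤ} {A : D.Chain →ₗ[ZMod 2] D'.Chain} (h : BiHom a b A)
    (h' : Filt a n A) (hn : b < n) : A = 0 := by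
  refine linearMap_ext fun S => ?_
  funext T
  by_contra hT
  have h1 := h _ _ _ (single_mem_bideg S) T hT
  have h2 := h' S T hT
  omega

/-- The expansion `A = A₀ + A₂ + …` of a map by `q`-degree; the terms of degree at least four
are not specified. -/
def Exp (a : ℤ) (A A₀ A₂ : D.Chain →ₗ[ZMod 2] D'.Chain) : Prop :=
  BiHom a 0 A₀ ∧ BiHom a 2 A₂ ∧ ∃ R, Filt a 4 R ∧ A = A₀ + A₂ + R

theorem BiHom.zero {a b : ℤ} : BiHom a b (0 : D.Chain →ₗ[ZMod 2] D'.Chain) := fun _ _ _ _ =>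
  Submodule.zero_mem _

theorem Filt.zero {a b : ℤ} : Filt a b (0 : D.Chain →ₗ[ZMod 2] D'.Chain) :=
  BiHom.zero.filt

theorem BiHom.exp {a : ℤ} {A : D.Chain →ₗ[ZMod 2] D'.Chain} (h : BiHom a 0 A) : Exp a A A 0 :=
  ⟨h, BiHom.zero, 0, Filt.zero, by simp⟩

theorem exp_delta (hD : D.NoSingle) : Exp 1 D.delta D.d D.beta :=
  ⟨D.biHom_d hD, D.biHom_beta hD, 0, Filt.zero, by rw [delta_eq, add_zero]⟩

theorem Exp.add {a : ℤ} {A A₀ A₂ B B₀ B₂ : D.Chain →ₗ[ZMod 2] D'.Chain} (hA : Exp a A A₀ A₂)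
    (hB : Exp a B B₀ B₂) : Exp a (A + B) (A₀ + B₀) (A₂ + B₂) := by
  obtain ⟨h1, h2, R, h3, rfl⟩ := hA
  obtain ⟨h1', h2', R', h3', rfl⟩ := hB
  exact ⟨h1.add h1', h2.add h2', R + R', h3.add h3', by abel⟩

theorem Exp.comp {a a' : ℤ} {A A₀ A₂ : D'.Chain →ₗ[ZMod 2] D''.Chain}
    {B B₀ B₂ : D.Chain →ₗ[ZMod 2] D'.Chain} (hA : Exp a A A₀ A₂)
    (hB : Exp a' B B₀ B₂) : Exp (a' + a) (A ∘ₗ B) (A₀ ∘ₗ B₀) (A₀ ∘ₗ B₂ + A₂ ∘ₗ B₀) := by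
  obtain ⟨h1, h2, R, h3, rfl⟩ := hA
  obtain ⟨h1', h2', R', h3', rfl⟩ := hB
  refine ⟨(h1.comp h1').cast, ((h1.comp h2').cast rfl).add ((h2.comp h1').cast rfl),
    A₂ ∘ₗ B₂ + A₀ ∘ₗ R' + A₂ ∘ₗ R' + R ∘ₗ B₀ + R ∘ₗ B₂ + R ∘ₗ R', ?_, ?_⟩
  · refine Filt.add (Filt.add (Filt.add (Filt.add (Filt.add ?_ ?_) ?_) ?_) ?_) ?_
    exacts [(h2.filt.comp h2'.filt).mono (by norm_num), (h1.filt.comp h3').mono (by norm_num),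
      (h2.filt.comp h3').mono (by norm_num), (h3.comp h1'.filt).mono (by norm_num),
      (h3.comp h2'.filt).mono (by norm_num), (h3.comp h3').mono (by norm_num)]
  · simp only [LinearMap.add_comp, LinearMap.comp_add]
    abel

theorem Exp.cast {a a' : ℤ} {A A₀ A₂ : D.Chain →ₗ[ZMod 2] D'.Chain} (h : Exp a A A₀ A₂)
    (ha : a = a' := by norm_num) : Exp a' A A₀ A₂ := ha ▸ h

/-- A map of `q`-degree 0 that raises the `q`-degree by at least 2 is zero. Once the leading terms
agree, the same argument with 2 and 4 applies to the next ones. -/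
theorem Exp.unique {a : ℤ} {A A₀ A₂ B₀ B₂ : D.Chain →ₗ[ZMod 2] D'.Chain} (hA : Exp a A A₀ A₂)
    (hB : Exp a A B₀ B₂) : A₀ = B₀ ∧ A₂ = B₂ := by
  obtain ⟨h1, h2, R, h3, h4⟩ := hA
  obtain ⟨h1', h2', R', h3', h4'⟩ := hB
  have key : (A₀ + B₀) + ((A₂ + B₂) + (R + R')) = 0 := by
    have : A + A = 0 := ZModModule.add_self A
    nth_rewrite 1 [h4] at this
    rw [h4'] at this
    rw [← this]
    abel
  rw [add_eq_zero_iff_eq'] at key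
  have h5 : A₀ + B₀ = 0 := by
    refine (h1.add h1').eq_zero_of_filt (n := 2) ?_ (by norm_num)
    rw [key]
    exact (h2.add h2').filt.add ((h3.add h3').mono (by norm_num))
  rw [h5, eq_comm, add_eq_zero_iff_eq'] at key
  have h6 : A₂ + B₂ = 0 := by
    refine (h2.add h2').eq_zero_of_filt (n := 4) ?_ (by norm_num)
    rw [key]
    exact h3.add h3'
  exact ⟨add_eq_zero_iff_eq'.1 h5, add_eq_zero_iff_eq'.1 h6⟩

theorem Exp.eq_zero {a : ℤ} {A₀ A₂ : D.Chain →ₗ[ZMod 2] D'.Chain} (h : Exp a 0 A₀ A₂) :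
    A₀ = 0 := (h.unique BiHom.zero.exp).1

/-- A homotopy equivalence for `∂ + β` yields one for `∂` that is compatible with `β`. -/
theorem betaEquiv_of_delta (hD : D.NoSingle) (hD' : D'.NoSingle)
    {φ φ₀ φ₂ : D.Chain →ₗ[ZMod 2] D'.Chain} {ψ ψ₀ ψ₂ : D'.Chain →ₗ[ZMod 2] D.Chain}
    {H : D.Chain →ₗ[ZMod 2] D.Chain} {H' : D'.Chain →ₗ[ZMod 2] D'.Chain}
    (hφ : Exp 0 φ φ₀ φ₂) (hψ : Exp 0 ψ ψ₀ ψ₂) (hH : BiHom (-1) 0 H) (hH' : BiHom (-1) 0 H')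
    (h1 : φ ∘ₗ D.delta = D'.delta ∘ₗ φ) (h2 : ψ ∘ₗ D'.delta = D.delta ∘ₗ ψ)
    (h3 : ψ ∘ₗ φ + LinearMap.id = D.delta ∘ₗ H + H ∘ₗ D.delta)
    (h4 : φ ∘ₗ ψ + LinearMap.id = D'.delta ∘ₗ H' + H' ∘ₗ D'.delta) : BetaEquiv φ₀ := by
  have hd := exp_delta hD
  have hd' := exp_delta hD'
  -- The degree-zero parts of the four identities are those required for ∂. The degree-two part of
  -- the first says that `φ₀` commutes with β up to the homotopy `φ₂`.
  have e1 := (hφ.comp hd).unique (h1 ▸ (hd'.comp hφ).cast)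
  have e2 := (hψ.comp hd').unique (h2 ▸ (hd.comp hψ).cast)
  have e3 := ((hψ.comp hφ).add BiHom.id.exp).unique
    (h3 ▸ ((hd.comp hH.exp).add ((hH.exp.comp hd).cast)).cast)
  have e4 := ((hφ.comp hψ).add BiHom.id.exp).unique
    (h4 ▸ ((hd'.comp hH'.exp).add ((hH'.exp.comp hd').cast)).cast)
  refine ⟨ψ₀, H, H', φ₂, ⟨hφ.1, hψ.1, hH, hH', hφ.2.1⟩, e1.1, e2.1, e3.1, e4.1, ?_⟩
  have h5 := e1.2
  rw [← add_eq_zero_iff_eq'] at h5 ⊢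
  rw [← h5]
  abel

end Filtered

/-! ### Smoothings of two diagrams with corresponding circles -/

section Corr

/-- The circles of `s` and of `s'` correspond to each other in such a way that arcs related by `K`
lie on corresponding circles. -/
structure Corr (D D' : PD) (s : D.X → Bool) (s' : D'.X → Bool) (K : D.E → D'.E → Prop) :
    Prop where
  ext : ∀ m, D.Compat s m → ∃ m', D'.Compat s' m' ∧ ∀ e e', K e e' → m' e' = m e
  ext' : ∀ m', D'.Compat s' m' → ∃ m, D.Compat s m ∧ ∀ e e', K e e' → m' e' = m e
  cov : ∀ e, ∃ e₀ e₀', K e₀ e₀' ∧ D.circ s e = D.circ s e₀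
  cov' : ∀ e', ∃ e₀ e₀', K e₀ e₀' ∧ D'.circ s' e' = D'.circ s' e₀'

variable {D D' : PD} {s : D.X → Bool} {s' : D'.X → Bool} {K : D.E → D'.E → Prop}

theorem Corr.symm (h : Corr D D' s s' K) : Corr D' D s' s (fun e' e => K e e') where
  ext m' hm' := by
    obtain ⟨m, hm, h1⟩ := h.ext' m' hm'
    exact ⟨m, hm, fun e' e he => (h1 e e' he).symm⟩
  ext' m hm := by
    obtain ⟨m', hm', h1⟩ := h.ext m hm
    exact ⟨m', hm', fun e' e he => (h1 e e' he).symm⟩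
  cov e' := by
    obtain ⟨e₀, e₀', h1, h2⟩ := h.cov' e'
    exact ⟨e₀', e₀, h1, h2⟩
  cov' e := by
    obtain ⟨e₀, e₀', h1, h2⟩ := h.cov e
    exact ⟨e₀', e₀, h1, h2⟩

theorem Corr.circ_eq_iff (h : Corr D D' s s' K) {e f : D.E} {e' f' : D'.E} (he : K e e')
    (hf : K f f') : D.circ s e = D.circ s f ↔ D'.circ s' e' = D'.circ s' f' := by
  rw [PD.circ_eq_iff, PD.circ_eq_iff]
  constructor
  · intro h1 m' hm'
    obtain ⟨m, hm, h2⟩ := h.ext' m' hm'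
    rw [h2 _ _ he, h2 _ _ hf, h1 m hm]
  · intro h1 m hm
    obtain ⟨m', hm', h2⟩ := h.ext m hm
    rw [← h2 _ _ he, ← h2 _ _ hf, h1 m' hm']

theorem Corr.degSum_eq {S : D.State} {T : D'.State} (h : Corr D D' S.smoothing T.smoothing K)
    (hl : ∀ e e', K e e' → T.label e' = S.label e) : T.degSum = S.degSum := by
  -- Only the values at arcs with a partner matter; elsewhere any arc of `D'` will do.
  let ψ : D.E → D'.E := fun e => if he : ∃ e', K e e' then he.choose else
    (h.cov e).choose_spec.choose
  have hψ : ∀ e, (∃ e', K e e') → K e (ψ e) := fun e he => by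
    simp only [ψ, dif_pos he]
    exact he.choose_spec
  have key := sum_circ_eq (D := D) (D' := D') (s := S.smoothing) (s' := T.smoothing)
    (fun e => ∃ e', K e e') ψ (fun e he f hf => h.circ_eq_iff (hψ e he) (hψ f hf))
    (fun γ => (S.val γ).deg) (fun γ => (T.val γ).deg)
    (fun e he => congrArg Gen.deg (hl _ _ (hψ e he)))
  have hA : ∀ γ, ∃ e, (∃ e', K e e') ∧ D.circ S.smoothing e = γ := fun γ => by
    obtain ⟨e, rfl⟩ := D.circ_surj _ γ
    obtain ⟨e₀, e₀', h1, h2⟩ := h.cov e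
    exact ⟨e₀, ⟨_, h1⟩, h2.symm⟩
  have hA' : ∀ γ, ∃ e, (∃ e', K e e') ∧ D'.circ T.smoothing (ψ e) = γ := fun γ => by
    obtain ⟨e', rfl⟩ := D'.circ_surj _ γ
    obtain ⟨e₀, e₀', h1, h2⟩ := h.cov' e'
    exact ⟨e₀, ⟨_, h1⟩, h2 ▸ (h.circ_eq_iff (hψ _ ⟨_, h1⟩) h1).1 rfl⟩
  simp only [hA, hA', Finset.filter_true] at key
  exact key.symm

/-- The identification of chains given by a partial bijection `rel` of the smoothings and
by a correspondence `K` of the arcs. -/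
noncomputable def trans (rel : (D.X → Bool) → (D'.X → Bool) → Prop) (K : D.E → D'.E → Prop) :
    D.Chain →ₗ[ZMod 2] D'.Chain :=
  ofRel fun S T => rel S.smoothing T.smoothing ∧ ∀ e e', K e e' → T.label e' = S.label e

/-- `rel` is a partial bijection between smoothings with corresponding circles. -/
structure IsTrans (rel : (D.X → Bool) → (D'.X → Bool) → Prop) (K : D.E → D'.E → Prop) :
    Prop where
  corr : ∀ s s', rel s s' → Corr D D' s s' K
  inj : ∀ s t s', rel s s' → rel t s' → s = t
  inj' : ∀ s s' t', rel s s' → rel s t' → s' = t'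

variable {rel : (D.X → Bool) → (D'.X → Bool) → Prop}

theorem IsTrans.symm (h : IsTrans rel K) :
    IsTrans (D := D') (D' := D) (fun s' s => rel s s') (fun e' e => K e e') :=
  ⟨fun s' s hs => (h.corr s s' hs).symm, fun s' t' s h1 h2 => h.inj' s s' t' h1 h2,
    fun s' s t h1 h2 => h.inj s t s' h1 h2⟩

/-- Every circle on either side contains an arc related by `K`, so the comparisons of `x`-labels on
the two sides can both be made on related arcs. -/
theorem zev_trans (h : IsTrans rel K) (hs : rel s s') {l : D.E → Gen} {l' : D'.E → Gen}
    (hl : D.Compat s l) (hl' : D'.Compat s' l') (hK : ∀ e e', K e e' → l' e' = l e)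
    (f : D.Chain) : D'.zev s' l' (trans rel K f) = D.zev s l f := by
  have hc := h.corr s s' hs
  refine zev_ofRel _ s l s' l' f ?_ ?_ ?_
  · rintro S T ⟨h1, h2⟩ h3
    rw [h3] at h1
    obtain rfl := h.inj _ _ _ h1 hs
    have hT := T.compat
    rw [h3] at hT
    refine ⟨rfl, fun h4 e he => ?_, fun h4 e' he' => ?_⟩
    · obtain ⟨e₀, e₀', h5, h6⟩ := hc.cov e
      rw [S.compat.eq_of_circ h6] at he
      rw [hl.eq_of_circ h6, ← hK _ _ h5]
      exact h4 _ (by rw [h2 _ _ h5, he])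
    · obtain ⟨e₀, e₀', h5, h6⟩ := hc.cov' e'
      rw [hT.eq_of_circ h6] at he'
      rw [hl'.eq_of_circ h6, hK _ _ h5]
      exact h4 _ (by rw [← h2 _ _ h5, he'])
  · rintro S rfl
    obtain ⟨m', hm', h1⟩ := hc.ext _ S.compat
    exact ⟨D'.mkState s' m' hm', ⟨hs, h1⟩, rfl⟩
  · rintro S T T' ⟨h1, h2⟩ ⟨h1', h2'⟩ h3 h3'
    refine State.ext' (h3.trans h3'.symm) fun e' => ?_
    obtain ⟨e₀, e₀', h5, h6⟩ := hc.cov' e'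
    have hT := T.compat
    have hT' := T'.compat
    rw [h3] at hT
    rw [h3'] at hT'
    rw [hT.eq_of_circ h6, hT'.eq_of_circ h6, h2 _ _ h5, h2' _ _ h5]

theorem zev_trans_eq_zero (hs : ∀ s, ¬ rel s s') (l' : D'.E → Gen) (f : D.Chain) :
    D'.zev s' l' (trans rel K f) = 0 :=
  zev_ofRel_eq_zero _ s' l' f fun _ _ h hT => absurd (hT ▸ h.1) (hs _)

/-- Version of `zev_trans` where only the labeling of the target is given. -/
theorem exists_zev_trans (h : IsTrans rel K) (hs : rel s s') {l' : D'.E → Gen}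
    (hl' : D'.Compat s' l') : ∃ l, D.Compat s l ∧ (∀ e e', K e e' → l' e' = l e) ∧
      ∀ f, D'.zev s' l' (trans rel K f) = D.zev s l f := by
  obtain ⟨l, hl, hK⟩ := (h.corr s s' hs).ext' l' hl'
  exact ⟨l, hl, hK, zev_trans h hs hl hl' hK⟩

theorem trans_symm_comp (h : IsTrans rel K) :
    trans (D := D') (D' := D) (fun s' s => rel s s') (fun e' e => K e e') ∘ₗ trans rel K =
      D.proj (fun s => ∃ s', rel s s') := by
  refine LinearMap.ext fun f => D.chain_ext fun s l hl => ?_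
  rw [zev_proj, LinearMap.comp_apply]
  split_ifs with h1
  · obtain ⟨s', hs⟩ := h1
    obtain ⟨l', hl', hK, hz⟩ := exists_zev_trans h.symm hs hl
    rw [hz, zev_trans h hs hl hl' fun e e' he => (hK e' e he).symm]
  · exact zev_trans_eq_zero (fun s' hs => h1 ⟨s', hs⟩) l _

theorem biHom_trans (h : IsTrans rel K) {a b : ℤ}
    (h1 : ∀ s s', rel s s' → D'.weight s' - D'.nNeg = D.weight s - D.nNeg + a)
    (h2 : ∀ s s', rel s s' → D'.weight s' + D'.nPos - 2 * D'.nNeg =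
      D.weight s + D.nPos - 2 * D.nNeg + b) : BiHom a b (trans rel K) :=
  biHom_ofRel _ fun _ _ hST => by
    have h3 := h1 _ _ hST.1
    have h4 := h2 _ _ hST.1
    have h5 := (h.corr _ _ hST.1).degSum_eq hST.2
    rw [State.qdeg_eq, State.qdeg_eq, State.hdeg, State.hdeg]
    omega

theorem trans_mem_part (f : D.Chain) {P : (D'.X → Bool) → Prop}
    (h : ∀ s s', rel s s' → P s') : trans rel K f ∈ D'.part P := by
  intro T hT
  rw [trans, ofRel_apply] at hT
  obtain ⟨S, _, hS⟩ := Finset.exists_ne_zero_of_sum_ne_zero hT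
  split_ifs at hS with hR
  · exact h _ _ hR.1
  · exact absurd rfl hS

end Corr

/-! ### Small circles -/

/-- Change the labels on `I` to `g`. -/
noncomputable def fill {E : Type} (l : E → Gen) (I : Set E) (g : Gen) (e : E) : Gen :=
  if e ∈ I then g else l e

theorem fill_of_mem {E : Type} {l : E → Gen} {I : Set E} {g : Gen} {e : E} (h : e ∈ I) :
    fill l I g e = g := if_pos h

theorem fill_of_not_mem {E : Type} {l : E → Gen} {I : Set E} {g : Gen} {e : E} (h : e ∉ I) :
    fill l I g e = l e := if_neg h

@[simp] theorem fill_fill {E : Type} (l : E → Gen) (I : Set E) (g g' : Gen) :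
    fill (fill l I g) I g' = fill l I g' := by
  funext e
  by_cases h : e ∈ I <;> simp [fill, h]

theorem fill_eq_self {E : Type} {l : E → Gen} {I : Set E} {g : Gen} (h : ∀ e ∈ I, l e = g) :
    fill l I g = l := by
  funext e
  by_cases he : e ∈ I
  · rw [fill_of_mem he, h e he]
  · exact fill_of_not_mem he

theorem mono_fill (D : PD) {l : D.E → Gen} {I : Set D.E} {g : Gen} {c : D.X}
    (h : ∀ i, D.arc c i ∉ I) : D.Mono (fill l I g) c ↔ D.Mono l c := by
  simp [Mono, fill_of_not_mem (h _)]

/-- In the smoothings satisfying `Q`, the crossing `c` is smoothed by `v` and the arcs in `I`, one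
of which is `e₀`, form a circle, which the other smoothing of `c` connects to the circle of `b`. -/
structure Bubble (D : PD) (c : D.X) (v : Bool) (I : Set D.E) (e₀ b : D.E)
    (Q : (D.X → Bool) → Prop) : Prop where
  mem : e₀ ∈ I
  not_mem : b ∉ I
  val : ∀ s, Q s → s c = v
  compat_fill : ∀ s l g, Q s → D.Compat s l → D.Compat s (fill l I g)
  const : ∀ s l, Q s → D.Compat s l → ∀ e ∈ I, l e = l e₀
  opp : ∀ s l, Q s → (D.Compat (Function.update s c (!v)) l ↔
    D.Compat s l ∧ ∀ e ∈ I, l e = l b)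

/-- The smoothings obtained from those satisfying `Q` by changing the smoothing `v` at `c`. -/
def Opp {X : Type} (c : X) (v : Bool) (Q : (X → Bool) → Prop) (t : X → Bool) : Prop :=
  t c = !v ∧ Q (Function.update t c v)

/-- The map `z ↦ z ⊗ 1` on the chains with smoothings opposite to those satisfying `Q`. -/
noncomputable def tau (D : PD) (c : D.X) (I : Set D.E) (Q : (D.X → Bool) → Prop) :
    D.Chain →ₗ[ZMod 2] D.Chain :=
  D.tensor c I .one ∘ₗ D.proj (Opp c false Q)

/-- The projection to the states with factor `g` at the circle through `e₀`. -/
noncomputable def labProj (D : PD) (e₀ : D.E) (g : Gen) : D.Chain →ₗ[ZMod 2] D.Chain :=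
  ofRel fun S T => S = T ∧ S.label e₀ = g

/-- Forget the circle with arcs in `I`. -/
noncomputable def drop (D : PD) (c : D.X) (v : Bool) (I : Set D.E) (Q : (D.X → Bool) → Prop) :
    D.Chain →ₗ[ZMod 2] D.Chain :=
  ofRel fun S T => Q S.smoothing ∧ T.smoothing = Function.update S.smoothing c (!v) ∧
    ∀ e ∉ I, T.label e = S.label e

/-- The coefficient of `g` at the circle with arcs in `I`. -/
noncomputable def coef (D : PD) (c : D.X) (v : Bool) (I : Set D.E) (e₀ : D.E)
    (Q : (D.X → Bool) → Prop) (g : Gen) : D.Chain →ₗ[ZMod 2] D.Chain :=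
  D.drop c v I Q ∘ₗ D.labProj e₀ g

section Bubble

variable {D : PD} {c : D.X} {v : Bool} {I : Set D.E} {e₀ b : D.E} {Q : (D.X → Bool) → Prop}

theorem labProj_apply (e₀ : D.E) (g : Gen) (f : D.Chain) (T : D.State) :
    D.labProj e₀ g f T = if T.label e₀ = g then f T else 0 := by
  rw [labProj, ofRel_apply, Finset.sum_eq_single T]
  · simp
  · intro S _ h
    simp [h]
  · simp

theorem Bubble.fill_eq (h : Bubble D c v I e₀ b Q) {s : D.X → Bool} (hs : Q s) {l : D.E → Gen}
    (hl : D.Compat (Function.update s c (!v)) l) : fill l I (l b) = l :=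
  fill_eq_self ((h.opp s l hs).1 hl).2

theorem Bubble.compat_opp (h : Bubble D c v I e₀ b Q) {s : D.X → Bool} (hs : Q s)
    {l : D.E → Gen} (hl : D.Compat s l) :
    D.Compat (Function.update s c (!v)) (fill l I (l b)) :=
  (h.opp s _ hs).2 ⟨h.compat_fill s l _ hs hl, fun e he => by
    rw [fill_of_mem he, fill_of_not_mem h.not_mem]⟩

/-- The hypothesis on `g` says that this factor evaluates to 1 at the label of the small circle. The
rest is evaluated in the other smoothing of `c`, where the arcs in `I` lie on the circle of `b` and
must take its label. -/
theorem zev_tensor (h : Bubble D c false I e₀ b Q) {s : D.X → Bool} (hs : Q s)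
    {l : D.E → Gen} (hl : D.Compat s l) {g : Gen} (hg : g = .x → l e₀ = .x) (f : D.Chain) :
    D.zev s l (D.tensor c I g f) =
      D.zev (Function.update s c true) (fill l I (l b)) f := by
  have hsc := h.val s hs
  have hop := fun m => h.opp s m hs
  simp only [Bool.not_false] at hop
  refine zev_ofRel _ _ _ s l f ?_ ?_ ?_
  · rintro S T ⟨h1, h2, h3, h4⟩ rfl
    have h5 : S.smoothing = Function.update T.smoothing c true := by
      funext c'
      by_cases hc : c' = c
      · subst hc
        simp [h1]
      · have := h2 c'
        rw [Function.update_of_ne hc]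
        cases h6 : T.smoothing c' <;> simp_all
    have h6 := ((hop S.label).1 (h5 ▸ S.compat)).2
    refine ⟨h5, fun h7 e he => ?_, fun h7 e he => ?_⟩
    · by_cases heI : e ∈ I
      · rw [fill_of_mem heI]
        rw [h6 e heI, ← h4 b h.not_mem] at he
        exact h7 b he
      · rw [fill_of_not_mem heI]
        exact h7 e (by rw [h4 e heI, he])
    · by_cases heI : e ∈ I
      · rw [h3 e heI] at he
        rw [h.const _ l hs hl e heI, hg he]
      · have := h7 e (by rw [← h4 e heI, he])
        rwa [fill_of_not_mem heI] at this
  · rintro S hS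
    have hc := (hop S.label).1 (hS ▸ S.compat)
    refine ⟨D.mkState s _ (h.compat_fill s _ g hs hc.1), ⟨?_, ?_, ?_, ?_⟩, rfl⟩
    · simp [hS]
    · intro c'
      by_cases hc' : c' = c
      · simp [hc', hsc]
      · simp [hS, hc']
    · intro e he
      exact fill_of_mem he
    · intro e he
      exact fill_of_not_mem he
  · rintro S T T' ⟨h1, h2, h3, h4⟩ ⟨-, -, h3', h4'⟩ h5 h5'
    refine State.ext' (h5.trans h5'.symm) fun e => ?_
    by_cases he : e ∈ I
    · rw [h3 e he, h3' e he]
    · rw [h4 e he, h4' e he]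

theorem zev_tensor_one (h : Bubble D c false I e₀ b Q) {s : D.X → Bool} (hs : Q s)
    {l : D.E → Gen} (hl : D.Compat s l) (f : D.Chain) :
    D.zev s l (D.tensor c I .one f) =
      D.zev (Function.update s c true) (fill l I (l b)) f :=
  zev_tensor h hs hl (by simp) f

theorem zev_tensor_x (h : Bubble D c false I e₀ b Q) {s : D.X → Bool} (hs : Q s)
    {l : D.E → Gen} (hl : D.Compat s l) (f : D.Chain) :
    D.zev s l (D.tensor c I .x f) =
      if l e₀ = .x then D.zev (Function.update s c true) (fill l I (l b)) f else 0 := by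
  split_ifs with h1
  · exact zev_tensor h hs hl (fun _ => h1) f
  · rw [zev_apply]
    refine Finset.sum_eq_zero fun T _ => ?_
    split_ifs with h2
    · rw [tensor, ofRel_apply]
      refine Finset.sum_eq_zero fun S _ => ?_
      rw [if_neg]
      exact fun h3 => h1 (h2.2 _ (h3.2.2.1 _ h.mem))
    · rfl

theorem tensor_smoothing {g : Gen} {s : D.X → Bool} (l : D.E → Gen) {f : D.Chain}
    {P : (D.X → Bool) → Prop} (hf : f ∈ D.part P)
    (h : s c = false → ¬ P (Function.update s c true)) : D.zev s l (D.tensor c I g f) = 0 := by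
  refine zev_ofRel_eq_zero _ _ _ _ ?_
  rintro S T ⟨h1, h2, -, -⟩ rfl
  by_contra h3
  have h4 : T.smoothing c = false := by
    have := h2 c
    cases h6 : T.smoothing c <;> simp_all
  have h5 : S.smoothing = Function.update T.smoothing c true := by
    funext c'
    by_cases hc : c' = c
    · subst hc
      simp [h1]
    · have := h2 c'
      rw [Function.update_of_ne hc]
      cases h6 : T.smoothing c' <;> simp_all
  exact h h4 (h5 ▸ hf S h3)

theorem opp_update {X : Type} {c : X} {v : Bool} {Q : (X → Bool) → Prop} {s : X → Bool}
    (hs : s c = v) : Opp c v Q (Function.update s c (!v)) ↔ Q s := by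
  have : Function.update (Function.update s c (!v)) c v = s := by
    rw [Function.update_idem, ← hs, Function.update_eq_self]
  rw [Opp, this]
  simp

theorem zev_tau (h : Bubble D c false I e₀ b Q) {s : D.X → Bool} {l : D.E → Gen}
    (hl : D.Compat s l) (f : D.Chain) :
    D.zev s l (D.tau c I Q f) =
      if Q s then D.zev (Function.update s c true) (fill l I (l b)) f else 0 := by
  rw [tau, LinearMap.comp_apply]
  split_ifs with hs
  · rw [zev_tensor_one h hs hl, zev_proj, if_pos]
    exact (opp_update (h.val s hs)).2 hs
  · exact tensor_smoothing l (D.proj_mem _ f) fun h1 h2 => hs ((opp_update h1).1 h2)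

/-- Setting the variable of the small circle to 0 in p + q x leaves p. -/
theorem zev_labProj_one (h : Bubble D c v I e₀ b Q) {s : D.X → Bool} (hs : Q s)
    (l : D.E → Gen) (f : D.Chain) :
    D.zev s l (D.labProj e₀ .one f) = D.zev s (fill l I .one) f := by
  simp only [zev_apply, labProj_apply]
  refine Finset.sum_congr rfl fun S _ => ?_
  by_cases hS : S.smoothing = s
  · have hc := h.const s S.label hs (hS ▸ S.compat)
    have : (∀ e, S.label e = .x → fill l I .one e = .x) ↔
        (∀ e, S.label e = .x → l e = .x) ∧ S.label e₀ = .one := by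
      constructor
      · intro h1
        have h0 : S.label e₀ = .one := by
          rw [← Gen.ne_x]
          intro h2
          have := h1 e₀ h2
          rw [fill_of_mem h.mem] at this
          exact absurd this (by simp)
        refine ⟨fun e he => ?_, h0⟩
        by_cases heI : e ∈ I
        · rw [hc e heI, h0] at he
          exact absurd he (by simp)
        · have := h1 e he
          rwa [fill_of_not_mem heI] at this
      · rintro ⟨h1, h0⟩ e he
        by_cases heI : e ∈ I
        · rw [hc e heI, h0] at he
          exact absurd he (by simp)
        · rw [fill_of_not_mem heI]
          exact h1 e he
    simp only [this]
    by_cases h3 : S.label e₀ = .one <;> simp [h3]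
  · simp [hS]

theorem labProj_add (e₀ : D.E) (f : D.Chain) :
    D.labProj e₀ .one f + D.labProj e₀ .x f = f := by
  funext S
  rw [Pi.add_apply, labProj_apply, labProj_apply]
  cases S.label e₀ <;> simp

theorem zev_labProj_x (h : Bubble D c v I e₀ b Q) {s : D.X → Bool} (hs : Q s)
    (l : D.E → Gen) (f : D.Chain) :
    D.zev s l (D.labProj e₀ .x f) = D.zev s l f + D.zev s (fill l I .one) f := by
  have h1 := congrArg (D.zev s l) (labProj_add e₀ f)
  rw [map_add, zev_labProj_one h hs] at h1
  rw [← h1, add_right_comm, CharTwo.add_self_eq_zero, zero_add]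

/-- Both basis elements evaluate to 1 at the label `x`, so forgetting the small factor is evaluation
at that label. -/
theorem zev_drop (h : Bubble D c v I e₀ b Q) {s : D.X → Bool} (hs : Q s)
    {l : D.E → Gen} (hl : D.Compat (Function.update s c (!v)) l) (f : D.Chain) :
    D.zev (Function.update s c (!v)) l (D.drop c v I Q f) = D.zev s (fill l I .x) f := by
  have hsc := h.val s hs
  have hop := fun m => h.opp s m hs
  have hinv : ∀ s', Q s' → Function.update s' c (!v) = Function.update s c (!v) → s' = s := by
    intro s' hs' h1
    have h2 := congrArg (fun t => Function.update t c v) h1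
    simp only [Function.update_idem] at h2
    rwa [← hsc, Function.update_eq_self, hsc, ← h.val s' hs', Function.update_eq_self] at h2
  refine zev_ofRel _ _ _ _ l f ?_ ?_ ?_
  · rintro S T ⟨h1, h2, h3⟩ h4
    have h5 := hinv _ h1 (h2 ▸ h4)
    have h6 := ((hop T.label).1 (h4 ▸ T.compat)).2
    have h6' := ((hop l).1 hl).2
    refine ⟨h5, fun h7 e he => ?_, fun h7 e he => ?_⟩
    · by_cases heI : e ∈ I
      · exact fill_of_mem heI
      · rw [fill_of_not_mem heI]
        exact h7 e (by rw [h3 e heI, he])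
    · have h8 : ∀ e ∉ I, T.label e = .x → l e = .x := fun e he h9 => by
        have := h7 e (by rw [← h3 e he, h9])
        rwa [fill_of_not_mem he] at this
      by_cases heI : e ∈ I
      · rw [h6 e heI] at he
        rw [h6' e heI]
        exact h8 b h.not_mem he
      · exact h8 e heI he
  · rintro S rfl
    refine ⟨D.mkState _ _ (h.compat_opp hs S.compat), ⟨hs, rfl, fun e he => ?_⟩, rfl⟩
    exact fill_of_not_mem he
  · rintro S T T' ⟨-, -, h3⟩ ⟨-, -, h3'⟩ h5 h5'
    have h6 := ((hop T.label).1 (h5 ▸ T.compat)).2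
    have h6' := ((hop T'.label).1 (h5' ▸ T'.compat)).2
    refine State.ext' (h5.trans h5'.symm) fun e => ?_
    by_cases he : e ∈ I
    · rw [h6 e he, h6' e he, h3 b h.not_mem, h3' b h.not_mem]
    · rw [h3 e he, h3' e he]

theorem drop_eq_zero {t : D.X → Bool} (hQ : ∀ s, Q s → s c = v) (ht : ¬ Opp c v Q t)
    (l : D.E → Gen) (f : D.Chain) : D.zev t l (D.drop c v I Q f) = 0 := by
  refine zev_ofRel_eq_zero _ _ _ _ ?_
  rintro S T ⟨h1, h2, -⟩ rfl
  refine absurd ?_ ht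
  rw [h2]
  exact (opp_update (hQ _ h1)).2 h1

theorem drop_mem (hQ : ∀ s, Q s → s c = v) (f : D.Chain) :
    D.drop c v I Q f ∈ D.part (Opp c v Q) :=
  D.mem_part_of_zev _ _ fun _ l _ ht => drop_eq_zero hQ ht l f

theorem zev_coef_one (h : Bubble D c v I e₀ b Q) {s : D.X → Bool} (hs : Q s)
    {l : D.E → Gen} (hl : D.Compat (Function.update s c (!v)) l) (f : D.Chain) :
    D.zev (Function.update s c (!v)) l (D.coef c v I e₀ Q .one f) =
      D.zev s (fill l I .one) f := by
  rw [coef, LinearMap.comp_apply, zev_drop h hs hl, zev_labProj_one h hs, fill_fill]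

/-- The coefficient q in p + q x is the sum of the values at the two labels of the small circle. -/
theorem zev_coef_x (h : Bubble D c v I e₀ b Q) {s : D.X → Bool} (hs : Q s)
    {l : D.E → Gen} (hl : D.Compat (Function.update s c (!v)) l) (f : D.Chain) :
    D.zev (Function.update s c (!v)) l (D.coef c v I e₀ Q .x f) =
      D.zev s (fill l I .x) f + D.zev s (fill l I .one) f := by
  rw [coef, LinearMap.comp_apply, zev_drop h hs hl, zev_labProj_x h hs, fill_fill]

theorem coef_mem (hQ : ∀ s, Q s → s c = v) (g : Gen) (f : D.Chain) :
    D.coef c v I e₀ Q g f ∈ D.part (Opp c v Q) := drop_mem hQ _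

theorem coef_eq_zero {P : (D.X → Bool) → Prop} {f : D.Chain} (hf : f ∈ D.part P)
    (hP : ∀ s, P s → ¬ Q s) (g : Gen) : D.coef c v I e₀ Q g f = 0 := by
  funext T
  rw [coef, LinearMap.comp_apply, drop, ofRel_apply]
  refine Finset.sum_eq_zero fun S _ => ?_
  split_ifs with h1
  · rw [labProj_apply]
    split_ifs
    · by_contra h2
      exact hP _ (hf S h2) h1.1
    · rfl
  · rfl

theorem tau_mem (f : D.Chain) : D.tau c I Q f ∈ D.part Q := by
  refine D.mem_part_of_zev _ _ fun s l _ hs => ?_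
  rw [tau, LinearMap.comp_apply]
  exact tensor_smoothing l (D.proj_mem _ f) fun h1 h2 => hs ((opp_update h1).1 h2)

theorem tau_eq_zero {P : (D.X → Bool) → Prop} {f : D.Chain} (hf : f ∈ D.part P)
    (hP : ∀ s, P s → ¬ Opp c false Q s) : D.tau c I Q f = 0 := by
  rw [tau, LinearMap.comp_apply, D.proj_eq_zero hf hP, map_zero]

theorem tau_eq_tensor {f : D.Chain} (hf : f ∈ D.part (Opp c false Q)) :
    D.tau c I Q f = D.tensor c I .one f := by
  rw [tau, LinearMap.comp_apply, D.proj_eq_self hf]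

/-- The values of `z ⊗ 1` do not depend on the label of the small circle, so they cancel in the
coefficient of `x`. The crossings `c` and `c'` may differ: in a square one takes the circle off at
one crossing and puts it on at the other. -/
theorem coef_tau {c' : D.X} {b' : D.E} (h : Bubble D c v I e₀ b Q)
    (h' : Bubble D c' false I e₀ b' Q) (w : D.Chain) :
    D.coef c v I e₀ Q .x (D.tau c' I Q w) = 0 := by
  refine D.chain_ext fun t l hl => ?_
  rw [map_zero]
  by_cases ht : Opp c v Q t
  · obtain ⟨h1, h2⟩ := ht
    have h3 : t = Function.update (Function.update t c v) c (!v) := by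
      rw [Function.update_idem, ← h1, Function.update_eq_self]
    rw [h3] at hl ⊢
    have h4 := ((h.opp _ l h2).1 hl).1
    rw [zev_coef_x h h2 hl, zev_tau h' (h.compat_fill _ _ _ h2 h4),
      zev_tau h' (h.compat_fill _ _ _ h2 h4), if_pos h2, if_pos h2, fill_fill, fill_fill,
      fill_of_not_mem h'.not_mem, fill_of_not_mem h'.not_mem, CharTwo.add_self_eq_zero]
  · exact D.zev_eq_zero_of_mem (coef_mem h.val _ _) ht l

/-- Removing a small circle changes the degree by the degree of its factor. -/
theorem Bubble.degSum_eq (h : Bubble D c v I e₀ b Q) {S T : D.State} (hS : Q S.smoothing)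
    (hT : T.smoothing = Function.update S.smoothing c (!v))
    (hl : ∀ e ∉ I, T.label e = S.label e) : S.degSum = T.degSum + (S.label e₀).deg := by
  have hop := fun m => h.opp S.smoothing m hS
  rw [← hT] at hop
  have hcI : ∀ e ∈ I, D.circ T.smoothing e = D.circ T.smoothing b := fun e he => by
    rw [PD.circ_eq_iff]
    intro l hl
    exact ((hop l).1 hl).2 e he
  have key := sum_circ_eq (D := D) (D' := D) (s := S.smoothing) (s' := T.smoothing)
    (fun e => e ∉ I) id (fun e he f hf => by
      rw [PD.circ_eq_iff, PD.circ_eq_iff]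
      constructor
      · intro h1 l hl
        exact h1 l ((hop l).1 hl).1
      · intro h1 l hl
        have h2 := h1 _ (hT ▸ h.compat_opp hS hl)
        rwa [id, id, fill_of_not_mem he, fill_of_not_mem hf] at h2)
    (fun γ => (S.val γ).deg) (fun γ => (T.val γ).deg)
    (fun e he => congrArg Gen.deg (hl e he))
  have hA : ∀ γ, ∃ e, e ∉ I ∧ D.circ T.smoothing (id e) = γ := fun γ => by
    obtain ⟨e, rfl⟩ := D.circ_surj _ γ
    by_cases he : e ∈ I
    · exact ⟨b, h.not_mem, (hcI e he).symm⟩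
    · exact ⟨e, he, rfl⟩
  simp only [hA, Finset.filter_true] at key
  rw [State.degSum, State.degSum, ← key, ← Finset.sum_filter_add_sum_filter_not Finset.univ
    (fun γ => ∃ e, e ∉ I ∧ D.circ S.smoothing e = γ)]
  congr 1
  · convert rfl
  have : (Finset.univ.filter fun γ => ¬ ∃ e, e ∉ I ∧ D.circ S.smoothing e = γ) =
      {S.circ e₀} := by
    ext γ
    obtain ⟨e, rfl⟩ := D.circ_surj _ γ
    simp only [Finset.mem_filter, Finset.mem_univ, true_and, Finset.mem_singleton]
    constructor
    · intro h1
      have he : e ∈ I := by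
        by_contra he
        exact h1 ⟨e, he, rfl⟩
      exact (PD.circ_eq_iff _ _ _ _).2 fun l hl => h.const _ l hS hl e he
    · rintro h1 ⟨e', he', h2⟩
      rw [h1] at h2
      have h3 := ((PD.circ_eq_iff _ _ _ _).1 h2) _ (h.compat_fill _ _ .x hS
        (h.compat_fill _ (fun _ => .one) .one hS (by intro c; simp)))
      rw [fill_fill, fill_of_not_mem he', fill_of_mem h.mem] at h3
      exact absurd h3 (by simp)
  rw [this, Finset.sum_singleton]
  rfl

theorem weight_update_not (D : PD) {s : D.X → Bool} {c : D.X} {v : Bool} (h : s c = v) :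
    D.weight (Function.update s c (!v)) = D.weight s + if v then -1 else 1 := by
  cases v
  · exact D.weight_update h
  · have h1 := D.weight_update (s := Function.update s c false) (c := c) (by simp)
    have h2 : Function.update s c true = s := by rw [← h, Function.update_eq_self]
    rw [Function.update_idem, h2] at h1
    simp only [Bool.not_true, if_true]
    omega

theorem biHom_coef (h : Bubble D c v I e₀ b Q) (g : Gen) :
    BiHom (if v then -1 else 1) ((if v then -1 else 1) - g.deg) (D.coef c v I e₀ Q g) := by
  have : D.coef c v I e₀ Q g = ofRel fun S T => (Q S.smoothing ∧
      T.smoothing = Function.update S.smoothing c (!v) ∧ ∀ e ∉ I, T.label e = S.label e) ∧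
      S.label e₀ = g := by
    refine LinearMap.ext fun f => ?_
    funext T
    rw [coef, LinearMap.comp_apply, drop, ofRel_apply, ofRel_apply]
    refine Finset.sum_congr rfl fun S _ => ?_
    rw [labProj_apply]
    by_cases h1 : S.label e₀ = g <;> simp [h1]
  rw [this]
  refine biHom_ofRel _ fun S T hST => ?_
  obtain ⟨⟨h1, h2, h3⟩, h4⟩ := hST
  have h5 := h.degSum_eq h1 h2 h3
  have h6 := D.weight_update_not (h.val _ h1)
  rw [← h2] at h6
  rw [h4] at h5
  rw [State.qdeg_eq, State.qdeg_eq, State.hdeg, State.hdeg]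
  constructor <;> omega

theorem biHom_tensor_proj (h : Bubble D c false I e₀ b Q) (g : Gen) :
    BiHom (-1) (g.deg - 1) (D.tensor c I g ∘ₗ D.proj (Opp c false Q)) := by
  have : D.tensor c I g ∘ₗ D.proj (Opp c false Q) = ofRel fun S T => (S.smoothing c = true ∧
      (∀ c', T.smoothing c' = true ↔ (c' ≠ c ∧ S.smoothing c' = true)) ∧
      (∀ e ∈ I, T.label e = g) ∧ ∀ e ∉ I, T.label e = S.label e) ∧
      Opp c false Q S.smoothing := by
    refine LinearMap.ext fun f => ?_
    funext T
    rw [LinearMap.comp_apply, tensor, ofRel_apply, ofRel_apply]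
    refine Finset.sum_congr rfl fun S _ => ?_
    rw [proj_apply]
    by_cases h1 : Opp c false Q S.smoothing <;> simp [h1]
  rw [this]
  refine biHom_ofRel _ fun S T hST => ?_
  obtain ⟨⟨h1, h2, h3, h4⟩, h5, h6⟩ := hST
  have h7 : Function.update S.smoothing c false = T.smoothing := by
    funext c'
    have := h2 c'
    by_cases hc : c' = c
    · subst hc
      simp only [Function.update_self]
      cases h6 : T.smoothing c' <;> simp_all
    · rw [Function.update_of_ne hc]
      cases h6 : T.smoothing c' <;> cases h7 : S.smoothing c' <;> simp_all
  rw [h7] at h6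
  have h8 : S.smoothing = Function.update T.smoothing c (!false) := by
    rw [← h7, Function.update_idem, ← h5, Function.update_eq_self]
  have h9 := h.degSum_eq h6 h8 (fun e he => (h4 e he).symm)
  have h10 := D.weight_update_not (h.val _ h6)
  rw [← h8] at h10
  rw [h3 _ h.mem] at h9
  rw [State.qdeg_eq, State.qdeg_eq, State.hdeg, State.hdeg]
  simp only [Bool.false_eq_true, if_false] at h10
  constructor <;> omega

theorem biHom_tau (h : Bubble D c false I e₀ b Q) : BiHom (-1) 0 (D.tau c I Q) :=
  (biHom_tensor_proj h .one).cast rfl (by simp [Gen.deg])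

/-- Up to smoothings outside the region of the small circle, `z ↦ z ⊗ 1` is a homotopy from the
identity to zero. -/
theorem delta_tau (hD : D.NoSingle) (h : Bubble D c false I e₀ b Q)
    (hI : ∀ s, Q s → ∀ c', s c' = true → Q (Function.update s c' false) → ∀ i, D.arc c' i ∉ I)
    {w : D.Chain} (hw : w ∈ D.part (Opp c false Q)) :
    D.delta (D.tau c I Q w) + w + D.tau c I Q (D.delta w) ∈
      D.part fun s => ¬ Q s ∧ ¬ Opp c false Q s := by
  refine D.mem_part_of_zev _ _ fun s l hl hs => ?_
  rw [map_add, map_add, D.zev_delta hD s l hl, zev_tau h hl]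
  have hcompat : ∀ c', D.Mono l c' → D.Compat (Function.update s c' false) l := fun c' hm =>
    D.compat_update_iff s c' false l hl hm
  by_cases hQ : Q s
  · rw [if_pos hQ, D.zev_eq_zero_of_mem hw, add_zero]
    swap
    · intro h1
      simpa [h.val s hQ] using h1.1
    have hop := h.compat_opp hQ hl
    simp only [Bool.not_false] at hop
    rw [D.zev_delta hD _ _ hop, ← Finset.sum_add_distrib]
    -- Compare term by term. The term of `c` vanishes by its support. Another edge starting in `Q`
    -- does not touch the small circle and commutes with `tau`; if it starts outside `Q`, both terms
    -- are zero.
    refine Finset.sum_eq_zero fun c' _ => ?_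
    rw [add_eq_zero_iff_eq']
    by_cases hc : c' = c
    · subst hc
      rw [if_neg (by simp [h.val s hQ]), D.zev_eq_zero_of_mem hw]
      · simp
      · intro h1
        simpa using h1.1
    · rw [Function.update_of_ne hc, Function.update_comm (Ne.symm hc)]
      by_cases hc' : s c' = true
      · by_cases hQ' : Q (Function.update s c' false)
        · rw [mono_fill D (hI s hQ c' hc' hQ')]
          refine if_ctx_congr Iff.rfl (fun h1 => ?_) fun _ => rfl
          rw [zev_tau h (hcompat c' h1.2), if_pos hQ']
        · rw [D.zev_eq_zero_of_mem hw]
          · simp only [ite_self]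
            split_ifs with h1
            · rw [zev_tau h (hcompat c' h1.2), if_neg hQ']
            · rfl
          · intro h1
            apply hQ'
            have h2 := h1.2
            have h3 : Function.update (Function.update (Function.update s c' false) c true) c
                false = Function.update s c' false := by
              rw [Function.update_idem, Function.update_eq_self_iff, Function.update_of_ne
                (Ne.symm hc), h.val s hQ]
            rwa [h3] at h2
      · simp [hc']
  · rw [if_neg hQ, add_zero]
    have hO : Opp c false Q s := by
      by_contra h1
      exact hs ⟨hQ, h1⟩
    have hupd : Function.update (Function.update s c false) c true = s := by
      rw [Function.update_idem, show true = s c from hO.1.symm, Function.update_eq_self]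
    have hcs : D.Compat (Function.update s c false) l := by
      refine ((h.opp _ l hO.2).1 ?_).1
      rw [Bool.not_false, hupd]
      exact hl
    -- Over the opposite smoothings only the edge at `c` starts in `Q`. It merges the new factor 1
    -- into its neighbour and so returns `w`.
    rw [Finset.sum_eq_single c]
    · rw [if_pos ⟨hO.1, D.mono_of_compat (by simp [hO.1]) hl hcs⟩, zev_tau h hcs, if_pos hO.2,
        hupd, fill_eq_self, CharTwo.add_self_eq_zero]
      refine ((h.opp _ l hO.2).1 ?_).2
      rw [Bool.not_false, hupd]
      exact hl
    · intro c' _ hc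
      split_ifs with h1
      · rw [zev_tau h (hcompat c' h1.2), if_neg]
        intro h2
        have := h.val _ h2
        rw [Function.update_of_ne (Ne.symm hc), hO.1] at this
        exact absurd this (by simp)
      · rfl
    · simp

end Bubble

/-! ### Local conditions at a corner -/

/-- The smoothing that cuts off the corners `k` and `k + 2`. -/
def cut (k : Fin 4) : Bool := decide (Odd (k : ℕ))

theorem cut_of_even {k : Fin 4} (h : Even (k : ℕ)) : cut k = false := by
  simpa [cut] using h

theorem cut_of_odd {k : Fin 4} (h : Odd (k : ℕ)) : cut k = true := by
  simpa [cut] using h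

/-- The labeling `l` is compatible with the smoothing `v` at `c`. -/
def Loc (D : PD) (v : Bool) (l : D.E → Gen) (c : D.X) : Prop :=
  (v = false → l (D.arc c 0) = l (D.arc c 1) ∧ l (D.arc c 2) = l (D.arc c 3)) ∧
    (v = true → l (D.arc c 0) = l (D.arc c 3) ∧ l (D.arc c 1) = l (D.arc c 2))

theorem compat_iff_loc (D : PD) (s : D.X → Bool) (l : D.E → Gen) :
    D.Compat s l ↔ ∀ c, D.Loc (s c) l c := Iff.rfl

/-- Written relative to the position `k`, the condition depends on `k` only through its parity,
which is why the moves below distinguish even and odd corners. -/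
theorem loc_cut (D : PD) (k : Fin 4) (l : D.E → Gen) (c : D.X) : D.Loc (cut k) l c ↔
    l (D.arc c k) = l (D.arc c (k + 1)) ∧ l (D.arc c (k + 2)) = l (D.arc c (k + 3)) := by
  have h3 : (2 + 1 : Fin 4) = 3 := rfl
  have h2 : (2 + 2 : Fin 4) = 0 := rfl
  have h1 : (2 + 3 : Fin 4) = 1 := rfl
  have h0 : (3 + 1 : Fin 4) = 0 := rfl
  have h4 : (3 + 2 : Fin 4) = 1 := rfl
  have h5 : (3 + 3 : Fin 4) = 2 := rfl
  have h6 : (1 + 1 : Fin 4) = 2 := rfl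
  have h7 : (1 + 2 : Fin 4) = 3 := rfl
  have h8 : (1 + 3 : Fin 4) = 0 := rfl
  fin_cases k <;> simp [Loc, cut, Nat.odd_iff, h0, h1, h2, h3, h4, h5, h6, h7, h8] <;> grind

theorem loc_not_cut (D : PD) (k : Fin 4) (l : D.E → Gen) (c : D.X) : D.Loc (!cut k) l c ↔
    l (D.arc c k) = l (D.arc c (k + 3)) ∧ l (D.arc c (k + 1)) = l (D.arc c (k + 2)) := by
  have h3 : (2 + 1 : Fin 4) = 3 := rfl
  have h2 : (2 + 2 : Fin 4) = 0 := rfl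
  have h1 : (2 + 3 : Fin 4) = 1 := rfl
  have h0 : (3 + 1 : Fin 4) = 0 := rfl
  have h4 : (3 + 2 : Fin 4) = 1 := rfl
  have h5 : (3 + 3 : Fin 4) = 2 := rfl
  have h6 : (1 + 1 : Fin 4) = 2 := rfl
  have h7 : (1 + 2 : Fin 4) = 3 := rfl
  have h8 : (1 + 3 : Fin 4) = 0 := rfl
  fin_cases k <;> simp [Loc, cut, Nat.odd_iff, h0, h1, h2, h3, h4, h5, h6, h7, h8] <;> grind

theorem loc_congr (D : PD) {v : Bool} {l l' : D.E → Gen} {c : D.X}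
    (h : ∀ i, l (D.arc c i) = l' (D.arc c i)) : D.Loc v l c ↔ D.Loc v l' c := by
  simp only [Loc, h]

theorem Mono.loc {D : PD} {v : Bool} {l : D.E → Gen} {c : D.X} (h : D.Mono l c) :
    D.Loc v l c := by
  simp [Loc, h 1, h 2, h 3]

theorem mono_corner (D : PD) (k : Fin 4) (l : D.E → Gen) (c : D.X) : D.Mono l c ↔
    l (D.arc c (k + 1)) = l (D.arc c k) ∧ l (D.arc c (k + 2)) = l (D.arc c k) ∧
      l (D.arc c (k + 3)) = l (D.arc c k) := by
  constructor
  · intro h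
    simp only [h _, and_self]
  · rintro ⟨h1, h2, h3⟩
    have : ∀ i, l (D.arc c (k + i)) = l (D.arc c k) := by
      intro i
      fin_cases i
      · simp
      · exact h1
      · exact h2
      · exact h3
    intro i
    have h4 := this (i - k)
    have h5 := this (0 - k)
    rw [add_sub_cancel] at h4 h5
    rw [h4, h5]

/-! ### Chains of a diagram and of the diagram with some crossings erased -/

section Erase

variable {D : PD} {R : Set D.X}

theorem sum_erase {M : Type*} [AddCommMonoid M] (F : D.X → M) :
    ∑ c, F c = ∑ c : (D.erase R).X, F c.1 + ∑ c with c ∈ R, F c := by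
  rw [← Finset.sum_filter_add_sum_filter_not Finset.univ (fun c => c ∈ R), add_comm]
  congr 1
  exact Finset.sum_subtype _ (p := fun c => c ∉ R) (by simp) F

theorem sum_erase_singleton {M : Type*} [AddCommMonoid M] (c : D.X) (F : D.X → M) :
    ∑ c, F c = ∑ c' : (D.erase {c}).X, F c'.1 + F c := by
  rw [sum_erase (R := {c}), Finset.sum_filter]
  congr 1
  rw [Finset.sum_eq_single c] <;> simp +contextual

theorem sum_erase_pair {M : Type*} [AddCommMonoid M] {c₁ c₂ : D.X} (h : c₁ ≠ c₂) (F : D.X → M) :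
    ∑ c, F c = ∑ c' : (D.erase {c₁, c₂}).X, F c'.1 + (F c₁ + F c₂) := by
  rw [sum_erase (R := {c₁, c₂}), Finset.sum_filter]
  congr 1
  rw [Finset.sum_eq_add c₁ c₂ h] <;> simp +contextual

/-- The smoothings of `D` given by `v` at the crossings in `R`, and by a smoothing of
`D.erase R` at the others. -/
def EraseRel (D : PD) (R : Set D.X) (v : D.X → Bool) (s : D.X → Bool)
    (s' : (D.erase R).X → Bool) : Prop :=
  (∀ c ∈ R, s c = v c) ∧ ∀ c : (D.erase R).X, s' c = s c.1

/-- The correspondence between the arcs outside `I` and the arcs of `D.erase R`. -/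
def EraseArc (D : PD) (R : Set D.X) (I : Set D.E) (e : D.E) (e' : (D.erase R).E) : Prop :=
  e ∉ I ∧ e' = Quot.mk _ e

variable {v : D.X → Bool} {I : Set D.E}

/-- Extend a smoothing by `v` at the erased crossings. -/
noncomputable def unerase (D : PD) (R : Set D.X) (v : D.X → Bool) (s' : (D.erase R).X → Bool)
    (c : D.X) : Bool :=
  if h : c ∈ R then v c else s' ⟨c, h⟩

theorem eraseRel_unerase (s' : (D.erase R).X → Bool) : D.EraseRel R v (D.unerase R v s') s' := by
  refine ⟨fun c hc => dif_pos hc, fun c => ?_⟩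
  rw [unerase, dif_neg c.2]
  rfl

theorem EraseRel.update {s : D.X → Bool} {s' : (D.erase R).X → Bool} (h : D.EraseRel R v s s')
    (c : (D.erase R).X) (b : Bool) :
    D.EraseRel R v (Function.update s c.1 b) (Function.update s' c b) := by
  refine ⟨fun c' hc' => ?_, fun c' => ?_⟩
  · rw [Function.update_of_ne, h.1 c' hc']
    rintro rfl
    exact c.2 hc'
  · by_cases hc : c' = c
    · subst hc
      simp
    · rw [Function.update_of_ne hc, Function.update_of_ne, h.2 c']
      exact fun h1 => hc (Subtype.ext h1)

theorem eraseRel_inj {s t : D.X → Bool} {s' : (D.erase R).X → Bool} (h : D.EraseRel R v s s')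
    (h' : D.EraseRel R v t s') : s = t := by
  funext c
  by_cases hc : c ∈ R
  · rw [h.1 c hc, h'.1 c hc]
  · exact (h.2 ⟨c, hc⟩).symm.trans (h'.2 ⟨c, hc⟩)

theorem eraseRel_inj' {s : D.X → Bool} {s' t' : (D.erase R).X → Bool} (h : D.EraseRel R v s s')
    (h' : D.EraseRel R v s t') : s' = t' := by
  funext c
  rw [h.2, h'.2]

/-- Outside `I` the two diagrams carry the same labels. On `I` these labels are completed in one way
that fits the smoothing `v`, and in another that is constant along the strands running straight
through `R`. -/
theorem corr_erase {s : D.X → Bool} {s' : (D.erase R).X → Bool} (h : D.EraseRel R v s s')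
    (hI : ∀ c ∉ R, ∀ i, D.arc c i ∉ I)
    (h1 : ∀ m, D.Compat s m → ∃ m₁ : D.E → Gen, (∀ e ∉ I, m₁ e = m e) ∧
      ∀ c ∈ R, ∀ i, m₁ (D.arc c i) = m₁ (D.arc c (i + 2)))
    (h2 : ∀ m₁ : D.E → Gen, (∀ c ∈ R, ∀ i, m₁ (D.arc c i) = m₁ (D.arc c (i + 2))) →
      ∃ m, (∀ e ∉ I, m₁ e = m e) ∧ ∀ c ∈ R, D.Loc (v c) m c)
    (h3 : ∀ e ∈ I, ∃ e₀ ∉ I, D.circ s e = D.circ s e₀)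
    (h4 : ∀ e ∈ I, ∃ e₀ ∉ I, D.Straight R e e₀ ∨ D.Straight R e₀ e) :
    Corr D (D.erase R) s s' (D.EraseArc R I) where
  ext m hm := by
    obtain ⟨m₁, h5, h6⟩ := h1 m hm
    refine ⟨Quot.lift m₁ ?_, fun c => ?_, ?_⟩
    · rintro _ _ ⟨c, hc, i, rfl, rfl⟩
      exact h6 c hc i
    · have h7 : D.Loc (s' c) m₁ c.1 := by
        rw [h.2 c, loc_congr D (l' := m) fun i => h5 _ (hI c.1 c.2 i)]
        exact hm c.1
      exact h7
    · rintro e _ ⟨he, rfl⟩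
      exact h5 e he
  ext' m' hm' := by
    obtain ⟨m, h5, h6⟩ := h2 (fun e => m' (Quot.mk _ e)) (by
      intro c hc i
      exact congrArg m' (Quot.sound ⟨c, hc, i, rfl, rfl⟩))
    refine ⟨m, fun c => ?_, ?_⟩
    · by_cases hc : c ∈ R
      · rw [h.1 c hc]
        exact h6 c hc
      · have h7 : ∀ b, s' ⟨c, hc⟩ = b → D.Loc b (fun e => m' (Quot.mk _ e)) c := by
          rintro _ rfl
          exact hm' ⟨c, hc⟩
        exact (loc_congr D fun i => h5 _ (hI c hc i)).1 (h7 _ (h.2 ⟨c, hc⟩))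
    · rintro e _ ⟨he, rfl⟩
      exact h5 e he
  cov e := by
    by_cases he : e ∈ I
    · obtain ⟨e₀, h5, h6⟩ := h3 e he
      exact ⟨e₀, _, ⟨h5, rfl⟩, h6⟩
    · exact ⟨e, _, ⟨he, rfl⟩, rfl⟩
  cov' e' := by
    obtain ⟨e, rfl⟩ := Quot.exists_rep e'
    by_cases he : e ∈ I
    · obtain ⟨e₀, h5, h6⟩ := h4 e he
      refine ⟨e₀, _, ⟨h5, rfl⟩, congrArg _ ?_⟩
      rcases h6 with h6 | h6
      exacts [Quot.sound h6, (Quot.sound h6).symm]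
    · exact ⟨e, _, ⟨he, rfl⟩, rfl⟩

/-- The property passes along the correspondence of circles, so the planarity of the erased diagram
is not needed. -/
theorem NoSingle.erase (hD : D.NoSingle) (hI : ∀ c ∉ R, ∀ i, D.arc c i ∉ I)
    (h : ∀ s s', D.EraseRel R v s s' → Corr D (D.erase R) s s' (D.EraseArc R I)) :
    (D.erase R).NoSingle := by
  intro s' c b hc
  have hr := D.eraseRel_unerase (v := v) s'
  have h0 : ∀ i, D.EraseArc R I (D.arc c.1 i) ((D.erase R).arc c i) := fun i =>
    ⟨hI c.1 c.2 i, rfl⟩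
  exact ((h _ _ hr).circ_eq_iff (h0 0) (h0 2)).symm.trans
    ((hD _ c.1 b (by rwa [← hr.2])).trans
      (not_congr ((h _ _ (hr.update c b)).circ_eq_iff (h0 0) (h0 2))))

/-- The differential of `D.erase R` on the chains of `D`. -/
theorem zev_delta_erase (hN : (D.erase R).NoSingle) {K : D.E → (D.erase R).E → Prop}
    (hT : IsTrans (D.EraseRel R v) K) (hK : ∀ c : (D.erase R).X, ∀ i,
      K (D.arc c.1 i) ((D.erase R).arc c i)) {s : D.X → Bool} {s' : (D.erase R).X → Bool}
    (hs : D.EraseRel R v s s') {l : D.E → Gen} {l' : (D.erase R).E → Gen} (hl : D.Compat s l)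
    (hl' : (D.erase R).Compat s' l') (hll : ∀ e e', K e e' → l' e' = l e) (f : D.Chain) :
    (D.erase R).zev s' l' ((D.erase R).delta (trans (D.EraseRel R v) K f)) =
      ∑ c, if c ∉ R ∧ s c = true ∧ D.Mono l c then D.zev (Function.update s c false) l f
        else 0 := by
  rw [zev_delta _ hN _ _ hl', sum_erase (R := R), Finset.sum_eq_zero (s := Finset.filter _ _),
    add_zero]
  · refine Finset.sum_congr rfl fun c _ => ?_
    have h1 : (D.erase R).Mono l' c ↔ D.Mono l c.1 := by
      simp only [Mono, hll _ _ (hK c _)]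
    have h2 := hs.2 c
    have h3 : c.1 ∉ R := c.2
    rw [h1, h2]
    simp only [h3, not_false_eq_true, true_and]
    refine if_ctx_congr Iff.rfl (fun h4 => ?_) fun _ => rfl
    exact zev_trans hT (hs.update c false) (compat_update_iff D _ _ _ _ hl h4.2)
      (compat_update_iff _ _ _ _ _ hl' (h1.2 h4.2)) hll f
  · intro c hc
    rw [if_neg]
    simp at hc
    simp [hc]

end Erase

/-! ### The first Reidemeister move -/

section Kink

variable {D : PD} {c : D.X} {k : Fin 4}

theorem kink_arc (hp : ∀ h, ∃! h', h' ≠ h ∧ D.lab h' = D.lab h) (h : D.IsKink c k) {c' : D.X}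
    {i : Fin 4} (he : D.arc c' i = D.arc c k) : c' = c ∧ (i = k ∨ i = k + 1) := by
  by_cases hne : (c', i) = (c, k)
  · exact ⟨congrArg Prod.fst hne, Or.inl (congrArg Prod.snd hne)⟩
  · have h1 := eq_other hp hne he
    have h2 : (c, k + 1) = other hp (c, k) := eq_other hp (fun h2 => by
      exact (by decide : ∀ j : Fin 4, j + 1 ≠ j) k (congrArg Prod.snd h2)) h.symm
    rw [← h2] at h1
    exact ⟨congrArg Prod.fst h1, Or.inr (congrArg Prod.snd h1)⟩

/-- For even `k` the 0-smoothing cuts off the corner of the kink, so that the arc of the kink closes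
up by itself. -/
theorem kink_bubble (hp : ∀ h, ∃! h', h' ≠ h ∧ D.lab h' = D.lab h) (h : D.IsKink c k)
    (hk : Even (k : ℕ)) : Bubble D c false {D.arc c k} (D.arc c k) (D.arc c (k + 2))
      (fun s => s c = false) := by
  have h2 : D.arc c (k + 2) ∉ ({D.arc c k} : Set D.E) := fun he => by
    have := (kink_arc hp h he).2
    revert this
    clear h he hk
    revert k
    decide
  have h3 : D.arc c (k + 3) ∉ ({D.arc c k} : Set D.E) := fun he => by
    have := (kink_arc hp h he).2
    revert this
    clear h he hk h2
    revert k
    decide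
  have hoff : ∀ c' ≠ c, ∀ i, D.arc c' i ∉ ({D.arc c k} : Set D.E) := fun c' hc' i he =>
    hc' (kink_arc hp h he).1
  have hcut := cut_of_even hk
  have h0 : ∀ l, D.Loc false l c ↔ l (D.arc c (k + 2)) = l (D.arc c (k + 3)) := fun l => by
    rw [← hcut, loc_cut, ← show D.arc c k = D.arc c (k + 1) from h]
    simp
  have h1 : ∀ l, D.Loc true l c ↔ l (D.arc c k) = l (D.arc c (k + 3)) ∧
      l (D.arc c k) = l (D.arc c (k + 2)) := fun l => by
    rw [← Bool.not_false, ← hcut, loc_not_cut, ← show D.arc c k = D.arc c (k + 1) from h]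
  refine ⟨rfl, h2, fun s hs => hs, fun s l g hs hl c' => ?_, fun s l _ _ e he => ?_,
    fun s l hs => ?_⟩
  · by_cases hc : c' = c
    · subst hc
      have := hl c'
      change D.Loc _ _ _
      change D.Loc _ _ _ at this
      rw [hs, h0] at this ⊢
      rwa [fill_of_not_mem h2, fill_of_not_mem h3]
    · exact (loc_congr D fun i => fill_of_not_mem (hoff c' hc i)).2 (hl c')
  · rw [Set.mem_singleton_iff.1 he]
  · simp only [Set.mem_singleton_iff, forall_eq]
    constructor
    · intro hl
      have h4 := hl c
      change D.Loc _ _ _ at h4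
      rw [Function.update_self, Bool.not_false, h1] at h4
      refine ⟨fun c' => ?_, h4.2⟩
      by_cases hc : c' = c
      · subst hc
        change D.Loc _ _ _
        rw [hs, h0, ← h4.1, h4.2]
      · have := hl c'
        rwa [Function.update_of_ne hc] at this
    · rintro ⟨hl, h4⟩ c'
      by_cases hc : c' = c
      · subst hc
        have := hl c'
        change D.Loc _ _ _ at this
        change D.Loc _ _ _
        rw [hs, h0] at this
        rw [Function.update_self, Bool.not_false, h1]
        exact ⟨h4.trans this, h4⟩
      · rw [Function.update_of_ne hc]
        exact hl c'

/-- The arc of the kink already joins the ends `k` and `k + 1`, so the smoothing that does not cut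
off the kink connects all four ends. -/
theorem kink_mono (h : D.IsKink c k) (l : D.E → Gen) : D.Mono l c ↔
    l (D.arc c k) = l (D.arc c (k + 3)) ∧ l (D.arc c (k + 1)) = l (D.arc c (k + 2)) := by
  rw [mono_corner D k, ← show D.arc c k = D.arc c (k + 1) from h]
  grind

theorem kink_trans (h : D.IsKink c k) (hk : Even (k : ℕ)) :
    IsTrans (D.EraseRel {c} fun _ => true) (D.EraseArc {c} ∅) := by
  refine ⟨fun s s' hs => corr_erase hs (by simp) ?_ ?_ (by simp) (by simp),
    fun _ _ _ h1 h2 => eraseRel_inj h1 h2, fun _ _ _ h1 h2 => eraseRel_inj' h1 h2⟩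
  · intro m hm
    have h1 : D.Loc _ _ _ := hm c
    rw [hs.1 c rfl, ← Bool.not_false, ← cut_of_even hk, loc_not_cut, ← kink_mono h] at h1
    refine ⟨m, fun _ _ => rfl, fun c' hc' i => ?_⟩
    rw [Set.mem_singleton_iff.1 hc', h1 i, h1 (i + 2)]
  · intro m hm
    refine ⟨m, fun _ _ => rfl, fun c' hc' => ?_⟩
    have h1 := hm c' hc'
    rw [Set.mem_singleton_iff.1 hc'] at h1 ⊢
    refine Mono.loc ?_
    rw [kink_mono h]
    have h2 := h1 k
    have h3 := h1 (k + 1)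
    rw [add_assoc, show (1 + 2 : Fin 4) = 3 from rfl] at h3
    rw [← show D.arc c k = D.arc c (k + 1) from h] at h3 ⊢
    exact ⟨h3, h2⟩

theorem r1Iso_eq (D : PD) (c : D.X) :
    D.r1Iso c = trans (D.EraseRel {c} fun _ => true) (D.EraseArc {c} ∅) := by
  rw [r1Iso, trans]
  congr 1
  funext S T
  simp only [Agree, EraseRel, EraseArc, Set.mem_singleton_iff, forall_eq, Set.mem_empty_iff_false,
    not_false_eq_true, true_and, forall_true_left, eq_iff_iff]
  constructor
  · rintro ⟨h1, h2, h3⟩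
    exact ⟨⟨h1, h2⟩, by rintro e _ rfl; exact h3 e⟩
  · rintro ⟨⟨h1, h2⟩, h3⟩
    exact ⟨h1, h2, fun e => h3 e _ rfl⟩

theorem NoSingle.erase_kink (hD : D.NoSingle) (h : D.IsKink c k) (hk : Even (k : ℕ)) :
    (D.erase {c}).NoSingle :=
  hD.erase (v := fun _ => true) (I := ∅) (by simp) (kink_trans h hk).corr

/-- Khovanov's map for the first Reidemeister move: the coefficient of `x` at the kink. -/
noncomputable def r1Map (D : PD) (c : D.X) (k : Fin 4) : D.Chain →ₗ[ZMod 2] (D.erase {c}).Chain :=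
  D.r1Iso c ∘ₗ D.coef c false {D.arc c k} (D.arc c k) (fun s => s c = false) .x

theorem zev_r1Iso (h : D.IsKink c k) (hk : Even (k : ℕ)) {s : D.X → Bool}
    {s' : (D.erase {c}).X → Bool} (hs : D.EraseRel {c} (fun _ => true) s s')
    {l : D.E → Gen} {l' : (D.erase {c}).E → Gen} (hl : D.Compat s l)
    (hl' : (D.erase {c}).Compat s' l') (hK : ∀ e e', D.EraseArc {c} ∅ e e' → l' e' = l e)
    (f : D.Chain) : (D.erase {c}).zev s' l' (D.r1Iso c f) = D.zev s l f := by
  rw [r1Iso_eq]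
  exact zev_trans (kink_trans h hk) hs hl hl' hK f

/-- The opposite smoothing of the kink. -/
theorem update_kink {s : D.X → Bool} (hs : s c = true) :
    Function.update (Function.update s c false) c (!false) = s := by
  rw [Function.update_idem, Bool.not_false, ← hs, Function.update_eq_self]

/-- In evaluated form the map adds the values for the two labels of the small circle. An edge at
another crossing does not see this label, and no edge at `c` ends in a 0-smoothing of `c`. -/
theorem r1Map_delta (hG : D.Good) (h : D.IsKink c k) (hk : Even (k : ℕ)) :
    D.r1Map c k ∘ₗ D.delta = (D.erase {c}).delta ∘ₗ D.r1Map c k := by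
  have hD := hG.noSingle
  have hT := kink_trans h hk
  have hB := kink_bubble hG.pairing h hk
  refine LinearMap.ext fun f => PD.chain_ext _ fun s' l' hl' => ?_
  have hr := D.eraseRel_unerase (R := {c}) (v := fun _ => true) s'
  set s := D.unerase {c} (fun _ => true) s'
  obtain ⟨l, hl, hK⟩ := (hT.corr s s' hr).ext' l' hl'
  have hsc : s c = true := hr.1 c rfl
  have hupd := update_kink hsc
  have hs0 : Function.update s c false c = false := Function.update_self ..
  have hl2 : D.Compat (Function.update (Function.update s c false) c (!false)) l := by rwa [hupd]
  have hl3 := ((hB.opp _ l hs0).1 hl2).1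
  simp only [LinearMap.comp_apply, r1Map]
  rw [zev_r1Iso h hk hr hl hl' hK, ← hupd, zev_coef_x hB hs0 hl2,
    zev_delta _ hD _ _ (hB.compat_fill _ _ _ hs0 hl3),
    zev_delta _ hD _ _ (hB.compat_fill _ _ _ hs0 hl3), r1Iso_eq,
    zev_delta_erase (hD.erase_kink h hk) hT (fun c' i => ⟨id, rfl⟩) hr hl hl' hK,
    ← Finset.sum_add_distrib]
  refine Finset.sum_congr rfl fun c' _ => ?_
  by_cases hc : c' = c
  · subst hc
    simp
  · have hoff : ∀ i, D.arc c' i ∉ ({D.arc c k} : Set D.E) := fun i he =>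
      hc (kink_arc hG.pairing h he).1
    rw [mono_fill D hoff, mono_fill D hoff, Function.update_of_ne hc]
    by_cases hm : s c' = true ∧ D.Mono l c'
    · rw [if_pos hm, if_pos hm, if_pos ⟨hc, hm⟩]
      have h4 : (Function.update (Function.update s c' false) c false) c = false :=
        Function.update_self ..
      have h5 : Function.update (Function.update (Function.update s c' false) c false) c (!false) =
          Function.update s c' false := update_kink (by rwa [Function.update_of_ne (Ne.symm hc)])
      have h6 := D.compat_update_iff s c' false l hl hm.2
      have h7 := zev_coef_x hB h4 (l := l) (by rwa [h5]) f
      rw [h5] at h7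
      rw [h7, Function.update_comm hc]
    · rw [if_neg hm, if_neg hm, if_neg fun h1 => hm h1.2, add_zero]

theorem opp_kink : Opp c false (fun s => s c = false) = fun s => s c = true := by
  funext s
  simp [Opp]

section KinkChains

variable (D c k)

/-- The circle that is split off by the `0`-smoothing of a kink. -/
noncomputable abbrev kinkTau : D.Chain →ₗ[ZMod 2] D.Chain :=
  D.tau c {D.arc c k} fun s => s c = false

/-- The coefficient of a basis element at the small circle of a kink. -/
noncomputable abbrev kinkCoef (g : Gen) : D.Chain →ₗ[ZMod 2] D.Chain :=
  D.coef c false {D.arc c k} (D.arc c k) (fun s => s c = false) g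

end KinkChains

theorem kinkCoef_mem (g : Gen) (z : D.Chain) :
    D.kinkCoef c k g z ∈ D.part fun s => s c = true := by
  have := coef_mem (D := D) (c := c) (v := false) (I := {D.arc c k}) (e₀ := D.arc c k)
    (Q := fun s => s c = false) (fun _ h => h) g z
  rwa [opp_kink] at this

theorem kinkTau_eq {z : D.Chain} (hz : z ∈ D.part fun s => s c = true) :
    D.kinkTau c k z = D.tensor c {D.arc c k} .one z :=
  tau_eq_tensor (by rwa [opp_kink])

theorem tensor_mem_part {I : Set D.E} (g : Gen) (z : D.Chain) :
    D.tensor c I g z ∈ D.part fun s => s c = false := by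
  intro T hT
  rw [tensor, ofRel_apply] at hT
  obtain ⟨S, _, hS⟩ := Finset.exists_ne_zero_of_sum_ne_zero hT
  split_ifs at hS with hR
  · have := hR.2.1 c
    cases h6 : T.smoothing c <;> simp_all
  · exact absurd rfl hS

/-- The decomposition of the chains in which the kink is smoothed to a circle. -/
theorem kink_decomp (hG : D.Good) (h : D.IsKink c k) (hk : Even (k : ℕ)) {z : D.Chain}
    (hz : z ∈ D.part fun s => s c = false) :
    z = D.kinkTau c k (D.kinkCoef c k .one z) +
      D.tensor c {D.arc c k} .x (D.kinkCoef c k .x z) := by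
  have hB := kink_bubble hG.pairing h hk
  rw [kinkTau_eq (kinkCoef_mem _ _)]
  refine D.chain_ext fun s l hl => ?_
  rw [map_add]
  by_cases hs : s c = false
  · have hop := hB.compat_opp (s := s) hs hl
    have hcf := fun g => hB.compat_fill s l g hs hl
    rw [zev_tensor_one hB hs hl, zev_tensor_x hB hs hl]
    have h1 := zev_coef_one hB (s := s) hs hop z
    have h2 := zev_coef_x hB (s := s) hs hop z
    rw [Bool.not_false] at h1 h2
    rw [h1, h2, fill_fill, fill_fill]
    have hI : ∀ g, l (D.arc c k) = g → fill l {D.arc c k} g = l := fun g hg =>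
      fill_eq_self (by simpa using hg)
    cases h3 : l (D.arc c k)
    · rw [hI _ h3]
      simp
    · rw [hI _ h3, if_pos rfl, add_left_comm, CharTwo.add_self_eq_zero, add_zero]
  · rw [D.zev_eq_zero_of_mem hz hs, D.zev_eq_zero_of_mem (tensor_mem_part _ _) hs,
      D.zev_eq_zero_of_mem (tensor_mem_part _ _) hs, add_zero]

theorem kinkCoef_tensor_x (hG : D.Good) (h : D.IsKink c k) (hk : Even (k : ℕ)) {w : D.Chain}
    (hw : w ∈ D.part fun s => s c = true) :
    D.kinkCoef c k .x (D.tensor c {D.arc c k} .x w) = w := by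
  have hB := kink_bubble hG.pairing h hk
  refine D.chain_ext fun t l hl => ?_
  by_cases ht : t c = true
  · have hupd := update_kink ht
    have hs0 : Function.update t c false c = false := Function.update_self ..
    have hl2 : D.Compat (Function.update (Function.update t c false) c (!false)) l := by rwa [hupd]
    have hl3 := (hB.opp _ l hs0).1 hl2
    rw [← hupd, zev_coef_x hB hs0 hl2, zev_tensor_x hB hs0 (hB.compat_fill _ _ _ hs0 hl3.1),
      zev_tensor_x hB hs0 (hB.compat_fill _ _ _ hs0 hl3.1), fill_of_mem hB.mem, if_pos rfl,
      fill_of_mem hB.mem, if_neg (by simp), add_zero, fill_fill, fill_of_not_mem hB.not_mem,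
      hB.fill_eq hs0 hl2, Bool.not_false]
  · rw [D.zev_eq_zero_of_mem hw ht, D.zev_eq_zero_of_mem (kinkCoef_mem _ _) ht]

theorem kinkCoef_tau (hG : D.Good) (h : D.IsKink c k) (hk : Even (k : ℕ)) (w : D.Chain) :
    D.kinkCoef c k .x (D.kinkTau c k w) = 0 :=
  coef_tau (kink_bubble hG.pairing h hk) (kink_bubble hG.pairing h hk) w

theorem kinkCoef_eq_zero {z : D.Chain} (hz : z ∈ D.part fun s => s c = true) (g : Gen) :
    D.kinkCoef c k g z = 0 :=
  coef_eq_zero hz (by simp +contextual) g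

theorem kinkTau_eq_zero {z : D.Chain} (hz : z ∈ D.part fun s => s c = false) :
    D.kinkTau c k z = 0 :=
  tau_eq_zero hz (by simp +contextual [Opp])

/-- The error term of `delta_tau` would be supported where `c` has neither of its two smoothings. -/
theorem kink_homotopy (hG : D.Good) (h : D.IsKink c k) (hk : Even (k : ℕ)) {w : D.Chain}
    (hw : w ∈ D.part fun s => s c = true) :
    D.delta (D.kinkTau c k w) + w + D.kinkTau c k (D.delta w) = 0 := by
  have hB := kink_bubble hG.pairing h hk
  have h1 := delta_tau hG.noSingle hB (fun s hs c' hc' _ i he => by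
    have := (kink_arc hG.pairing h he).1
    rw [this, hs] at hc'
    exact absurd hc' (by simp)) (w := w) (by rwa [opp_kink])
  rw [opp_kink] at h1
  funext S
  by_contra hS
  have := h1 S hS
  cases h2 : S.smoothing c <;> simp [h2] at this

theorem kink_proj_add (z : D.Chain) :
    z = D.proj (fun s => s c = true) z + D.proj (fun s => s c = false) z := by
  have := D.proj_add_proj_not (fun s => s c = true) z
  simpa using this.symm

theorem weight_kink {s : D.X → Bool} {s' : (D.erase {c}).X → Bool}
    (hs : D.EraseRel {c} (fun _ => true) s s') : D.weight s = (D.erase {c}).weight s' + 1 := by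
  have h1 := hs.1 c rfl
  rw [weight, sum_erase_singleton c, weight, h1]
  congr 1
  refine Finset.sum_congr rfl fun c' _ => ?_
  rw [hs.2]

theorem nPos_kink (hpos : D.pos c = true) : D.nPos = (D.erase {c}).nPos + 1 := by
  rw [nPos, sum_erase_singleton c, nPos, hpos]
  rfl

theorem nNeg_kink (hpos : D.pos c = true) : D.nNeg = (D.erase {c}).nNeg := by
  rw [nNeg, sum_erase_singleton c, nNeg, hpos]
  simp only [if_true, add_zero]
  rfl

theorem biHom_r1Iso (h : D.IsKink c k) (hk : Even (k : ℕ)) (hpos : D.pos c = true) :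
    BiHom (-1) (-2) (D.r1Iso c) := by
  have h1 := nPos_kink hpos
  have h2 := nNeg_kink hpos
  rw [r1Iso_eq]
  refine biHom_trans (kink_trans h hk) (fun s s' hs => ?_) fun s s' hs => ?_ <;>
  · have := weight_kink hs
    omega

/-- A section of `r1Map`. -/
noncomputable def r1Section (D : PD) (c : D.X) (k : Fin 4) :
    (D.erase {c}).Chain →ₗ[ZMod 2] D.Chain :=
  (D.tensor c {D.arc c k} .x ∘ₗ D.proj (Opp c false fun s => s c = false)) ∘ₗ
    trans (fun s' s => D.EraseRel {c} (fun _ => true) s s') (fun e' e => D.EraseArc {c} ∅ e e')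

theorem biHom_r1Map (hG : D.Good) (h : D.IsKink c k) (hk : Even (k : ℕ))
    (hpos : D.pos c = true) : BiHom 0 0 (D.r1Map c k) := by
  refine ((biHom_r1Iso h hk hpos).comp (biHom_coef (kink_bubble hG.pairing h hk) .x)).cast ?_ ?_
  · norm_num
  · norm_num [Gen.deg]

theorem biHom_r1Section (hG : D.Good) (h : D.IsKink c k) (hk : Even (k : ℕ))
    (hpos : D.pos c = true) : BiHom 0 0 (D.r1Section c k) := by
  have h1 := nPos_kink hpos
  have h2 := nNeg_kink hpos
  have h3 : BiHom 1 2 (trans (D := D.erase {c}) (D' := D)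
      (fun s' s => D.EraseRel {c} (fun _ => true) s s') (fun e' e => D.EraseArc {c} ∅ e e')) := by
    refine biHom_trans (kink_trans h hk).symm (fun s s' hs => ?_) fun s s' hs => ?_ <;>
    · have := weight_kink hs
      omega
  exact ((biHom_tensor_proj (kink_bubble hG.pairing h hk) .x).comp h3).cast
    (by norm_num) (by norm_num [Gen.deg])

theorem r1Section_r1Map (h : D.IsKink c k) (hk : Even (k : ℕ)) (z : D.Chain) :
    D.r1Section c k (D.r1Map c k z) = D.tensor c {D.arc c k} .x (D.kinkCoef c k .x z) := by
  have h1 := LinearMap.congr_fun (trans_symm_comp (kink_trans h hk)) (D.kinkCoef c k .x z)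
  rw [D.proj_eq_self (P := fun s => ∃ s', D.EraseRel {c} (fun _ => true) s s')] at h1
  · simp only [r1Section, r1Map, LinearMap.comp_apply] at h1 ⊢
    rw [r1Iso_eq, h1, D.proj_eq_self]
    rw [opp_kink]
    exact kinkCoef_mem _ _
  · refine D.part_mono (fun s hs => ?_) (kinkCoef_mem _ _)
    exact ⟨fun c' => s c'.1, fun c' hc' => by rw [Set.mem_singleton_iff.1 hc', hs], fun _ => rfl⟩

theorem r1Map_r1Section (hG : D.Good) (h : D.IsKink c k) (hk : Even (k : ℕ))
    (z : (D.erase {c}).Chain) : D.r1Map c k (D.r1Section c k z) = z := by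
  have h1 := LinearMap.congr_fun (trans_symm_comp (kink_trans h hk).symm) z
  rw [PD.proj_eq_self] at h1
  · simp only [r1Section, r1Map, LinearMap.comp_apply] at h1 ⊢
    have h2 := trans_mem_part (D := D.erase {c}) (D' := D)
      (rel := fun s' s => D.EraseRel {c} (fun _ => true) s s')
      (K := fun e' e => D.EraseArc {c} ∅ e e') z (P := fun s => s c = true)
      (fun s' s hs => hs.1 c rfl)
    rw [opp_kink, D.proj_eq_self h2, kinkCoef_tensor_x hG h hk h2, r1Iso_eq]
    exact h1
  · intro S _
    exact ⟨_, D.eraseRel_unerase S.smoothing⟩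

/-- The section `z ↦ z ⊗ x` is corrected to a chain map by `P = 1 + δτ + τδ`. This operator commutes
with δ, is homotopic to the identity by `τ`, and kills both C(*1) and C(*1) ⊗ 1. The inverse up to
homotopy is the section followed by `P`. -/
theorem r1_betaEquiv (hG : D.Good) (h : D.IsKink c k) (hk : Even (k : ℕ))
    (hpos : D.pos c = true) : BetaEquiv (D.r1Map c k) := by
  have hD := hG.noSingle
  have hD' := hD.erase_kink h hk
  have hτ : BiHom (-1) 0 (D.kinkTau c k) := biHom_tau (kink_bubble hG.pairing h hk)
  have hsq : ∀ z, D.delta (D.delta z) = 0 := LinearMap.congr_fun (D.delta_sq hD)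
  have hφδ : ∀ z, D.r1Map c k (D.delta z) = (D.erase {c}).delta (D.r1Map c k z) :=
    LinearMap.congr_fun (r1Map_delta hG h hk)
  have hφτ : ∀ z, D.r1Map c k (D.kinkTau c k z) = 0 := fun z => by
    rw [r1Map, LinearMap.comp_apply, kinkCoef_tau hG h hk, map_zero]
  set P : D.Chain →ₗ[ZMod 2] D.Chain :=
    LinearMap.id + (D.delta ∘ₗ D.kinkTau c k + D.kinkTau c k ∘ₗ D.delta) with hP
  have hPz : ∀ z, P z = z + (D.delta (D.kinkTau c k z) + D.kinkTau c k (D.delta z)) :=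
    fun _ => rfl
  have hPδ : ∀ z, P (D.delta z) = D.delta (P z) := fun z => by
    rw [hPz, hPz, hsq, map_zero, add_zero, map_add, map_add, hsq, zero_add]
  have hP1 : ∀ w ∈ D.part (fun s => s c = true), P w = 0 := fun w hw => by
    rw [← kink_homotopy hG h hk hw, hPz]
    abel
  have hPτ : ∀ w ∈ D.part (fun s => s c = true), P (D.kinkTau c k w) = 0 := fun w hw => by
    have h1 := congrArg (D.kinkTau c k) (kink_homotopy hG h hk hw)
    have h2 : ∀ z, D.kinkTau c k (D.kinkTau c k z) = 0 := fun z => by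
      refine kinkTau_eq_zero (tau_mem _)
    rw [map_add, map_add, h2, add_zero, map_zero] at h1
    rw [hPz, h2, map_zero, zero_add, add_comm, h1]
  -- Modulo the two summands killed by `P`, a chain equals its part with factor `x` at the small
  -- circle.
  have hPs : ∀ z, P (D.r1Section c k (D.r1Map c k z)) = P z := fun z => by
    rw [r1Section_r1Map h hk]
    conv_rhs => rw [kink_proj_add (c := c) z, map_add, hP1 _ (D.proj_mem _ _), zero_add,
      kink_decomp hG h hk (D.proj_mem _ _), map_add, hPτ _ (kinkCoef_mem _ _), zero_add]
    congr 2
    conv_lhs => rw [kink_proj_add (c := c) z, map_add, kinkCoef_eq_zero (D.proj_mem _ _), zero_add]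
  have hPexp : Exp 0 P (LinearMap.id + (D.d ∘ₗ D.kinkTau c k + D.kinkTau c k ∘ₗ D.d)) _ :=
    BiHom.id.exp.add ((((exp_delta hD).comp hτ.exp).cast).add
      ((hτ.exp.comp (exp_delta hD)).cast))
  have hs := (biHom_r1Section hG h hk hpos).exp
  refine betaEquiv_of_delta hD hD' (biHom_r1Map hG h hk hpos).exp (hPexp.comp hs).cast hτ
    (H' := 0) BiHom.zero (r1Map_delta hG h hk) ?_ ?_ ?_
  · refine LinearMap.ext fun z => ?_
    simp only [LinearMap.comp_apply]
    rw [← hPδ, ← hPs (D.delta _), hφδ, r1Map_r1Section hG h hk]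
  · refine LinearMap.ext fun z => ?_
    simp only [LinearMap.comp_apply, LinearMap.add_apply, LinearMap.id_apply]
    rw [hPs, hPz, add_right_comm, ZModModule.add_self, zero_add]
  · refine LinearMap.ext fun z => ?_
    simp only [LinearMap.comp_apply, LinearMap.add_apply, LinearMap.id_apply,
      LinearMap.zero_apply, map_zero, add_zero]
    rw [hPz, map_add, map_add, r1Map_r1Section hG h hk, hφδ, hφτ, hφτ, map_zero, add_zero, add_zero,
      ZModModule.add_self]

theorem isR1Map_r1Map (hG : D.Good) (h : D.IsKink c k) (hk : Even (k : ℕ)) :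
    D.IsR1Map c k (D.r1Map c k) := by
  have h1 : ∀ a ∈ D.part (fun s => s c = true),
      D.r1Map c k (D.tensor c {D.arc c k} .one a) = 0 := fun a ha => by
    rw [← kinkTau_eq ha, r1Map, LinearMap.comp_apply, kinkCoef_tau hG h hk, map_zero]
  refine ⟨fun a ha b hb => ?_, fun a ha b hb _ => ?_⟩
  · rw [map_add, h1 a ha, zero_add, r1Map, LinearMap.comp_apply, kinkCoef_eq_zero hb, map_zero]
  · rw [map_add, h1 a ha, zero_add, r1Map, LinearMap.comp_apply, kinkCoef_tensor_x hG h hk hb]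

/-- This is the part of `q`-degree 0 of the homotopy for δ; composing with a projection makes it an
identity of maps, so that it can be split by degree. -/
theorem kink_homotopy_d (hG : D.Good) (h : D.IsKink c k) (hk : Even (k : ℕ)) {w : D.Chain}
    (hw : w ∈ D.part fun s => s c = true) :
    D.d (D.kinkTau c k w) + w + D.kinkTau c k (D.d w) = 0 := by
  have hD := hG.noSingle
  have hτ : BiHom (-1) 0 (D.kinkTau c k) := biHom_tau (kink_bubble hG.pairing h hk)
  have hp := D.biHom_proj (fun s => s c = true)
  have h1 : (D.delta ∘ₗ D.kinkTau c k + LinearMap.id + D.kinkTau c k ∘ₗ D.delta) ∘ₗ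
      D.proj (fun s => s c = true) = 0 :=
    LinearMap.ext fun z => kink_homotopy hG h hk (D.proj_mem _ z)
  have h2 := (((((exp_delta hD).comp hτ.exp).cast (a' := 0)).add BiHom.id.exp).add
    ((hτ.exp.comp (exp_delta hD)).cast)).comp hp.exp
  rw [h1] at h2
  have h4 := LinearMap.congr_fun h2.eq_zero w
  simpa only [LinearMap.comp_apply, LinearMap.add_apply, LinearMap.id_apply,
    LinearMap.zero_apply, D.proj_eq_self hw] using h4

/-- X₁ and X₂ span C(D). Given a coefficient `w` of `x`, let `a` be the component of ∂(w ⊗ x) in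
C(*1). The component of ∂(a ⊗ 1) there is `a` again, so `a ⊗ 1 + w ⊗ x` lies in X₁, and the rest of
the chain lies in X₂. -/
theorem IsR1Map.unique (hG : D.Good) (h : D.IsKink c k) (hk : Even (k : ℕ))
    {φ : D.Chain →ₗ[ZMod 2] (D.erase {c}).Chain} (hφ : D.IsR1Map c k φ) :
    φ = D.r1Map c k := by
  have hr := isR1Map_r1Map hG h hk
  refine LinearMap.ext fun z => ?_
  have h0 : (0 : D.Chain) ∈ D.part fun s => s c = true := Submodule.zero_mem _
  have key : ∀ χ : D.Chain →ₗ[ZMod 2] (D.erase {c}).Chain, D.IsR1Map c k χ →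
      χ z = D.r1Iso c (D.kinkCoef c k .x (D.proj (fun s => s c = false) z)) := by
    intro χ hχ
    set z₀ := D.proj (fun s => s c = false) z with hz₀
    set w := D.kinkCoef c k .x z₀
    have hw : w ∈ D.part fun s => s c = true := kinkCoef_mem _ _
    set v := D.kinkCoef c k .one z₀
    have hv : v ∈ D.part fun s => s c = true := kinkCoef_mem _ _
    set a := D.proj (fun s => s c = true) (D.d (D.tensor c {D.arc c k} .x w)) with ha'
    have ha : a ∈ D.part fun s => s c = true := D.proj_mem _ _
    have hz : z = (D.tensor c {D.arc c k} .one (v + a) + D.proj (fun s => s c = true) z) +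
        (D.tensor c {D.arc c k} .one a + D.tensor c {D.arc c k} .x w) := by
      have h1 := kink_decomp hG h hk (D.proj_mem _ z)
      rw [← hz₀, kinkTau_eq hv] at h1
      have h2 : ∀ p q r s : D.Chain, (p + q) + r + (q + s) = r + (p + s) + (q + q) := by
        intros
        abel
      conv_lhs => rw [kink_proj_add (c := c) z, ← hz₀, h1]
      rw [map_add, h2, ZModModule.add_self, add_zero]
    rw [hz, map_add, hχ.1 _ (Submodule.add_mem _ hv ha) _ (D.proj_mem _ _), zero_add]
    refine hχ.2 _ ha _ hw ?_
    have h3 := kink_homotopy_d hG h hk ha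
    rw [kinkTau_eq ha] at h3
    have h4 := congrArg (D.proj (fun s => s c = true)) h3
    have h5 : D.proj (fun s => s c = true) (D.kinkTau c k (D.d a)) = 0 :=
      D.proj_eq_zero (tau_mem (Q := fun s => s c = false) _) (by simp +contextual)
    rw [map_add, map_add, h5, D.proj_eq_self ha, add_zero, map_zero] at h4
    rw [map_add, map_add, ← ha', h4]
  rw [key φ hφ, key _ hr]

end Kink

/-! ### Cancelling two pairs of summands of a complex -/

section TwoStep

variable {M : Type*} [AddCommGroup M] [Module (ZMod 2) M]

/-- A complex with four summands `p₀₀`, `p₀₁`, `p₁₀`, `p₁₁` and a subcomplex `n`, where the maps `τ`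
and `ε` express that `p₀₁` is the sum of a copy of `p₁₁` and of a copy of `p₀₀`; `q` is the
projection to `p₁₀` and `n`. -/
structure TwoStep (p₀₀ p₀₁ p₁₀ p₁₁ n : Submodule (ZMod 2) M) (q δ τ ε : M →ₗ[ZMod 2] M) :
    Prop where
  dec : ∀ x, ∃ a ∈ p₀₀, ∃ b ∈ p₀₁, ∃ c ∈ p₁₀, ∃ d ∈ p₁₁, ∃ e ∈ n, x = a + b + c + d + e
  δ₀₀ : ∀ x ∈ p₀₀, ∃ a ∈ p₀₀, ∃ b ∈ p₀₁, ∃ c ∈ p₁₀, ∃ e ∈ n, δ x = a + b + c + e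
  δ₁₀ : ∀ x ∈ p₁₀, ∃ c ∈ p₁₀, ∃ d ∈ p₁₁, ∃ e ∈ n, δ x = c + d + e
  δ₁₁ : ∀ x ∈ p₁₁, ∃ d ∈ p₁₁, ∃ e ∈ n, δ x = d + e
  δn : ∀ x ∈ n, δ x ∈ n
  τ_mem : ∀ x, τ x ∈ p₀₁
  τ₀₀ : ∀ x ∈ p₀₀, τ x = 0
  τ₀₁ : ∀ x ∈ p₀₁, τ x = 0
  τ₁₀ : ∀ x ∈ p₁₀, τ x = 0
  τn : ∀ x ∈ n, τ x = 0
  ε_mem : ∀ x, ε x ∈ p₀₀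
  ε₀₀ : ∀ x ∈ p₀₀, ε x = 0
  ε₁₀ : ∀ x ∈ p₁₀, ε x = 0
  ε₁₁ : ∀ x ∈ p₁₁, ε x = 0
  εn : ∀ x ∈ n, ε x = 0
  q₀₀ : ∀ x ∈ p₀₀, q x = 0
  q₀₁ : ∀ x ∈ p₀₁, q x = 0
  q₁₁ : ∀ x ∈ p₁₁, q x = 0
  q₁₀ : ∀ x ∈ p₁₀, q x = x
  qn : ∀ x ∈ n, q x = x
  sq : ∀ x, δ (δ x) = 0
  homotopy : ∀ w ∈ p₁₁, δ (τ w) + w + τ (δ w) ∈ n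
  ε_δ : ∀ v ∈ p₀₀, ε (δ v) = v
  ε_τ : ∀ w, ε (τ w) = 0
  split : ∀ z ∈ p₀₁, ε z = 0 → ∃ w ∈ p₁₁, z = τ w

/-- The map `1 + δ H + H δ` where `H = τ + ε`. -/
def stepP (δ τ ε : M →ₗ[ZMod 2] M) : M →ₗ[ZMod 2] M :=
  LinearMap.id + (δ ∘ₗ (τ + ε) + (τ + ε) ∘ₗ δ)

/-- The map `a ↦ a + τ δ a` on the image of `q`. -/
def stepJ (q δ τ : M →ₗ[ZMod 2] M) : M →ₗ[ZMod 2] M := q + τ ∘ₗ δ ∘ₗ q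

theorem stepP_apply (δ τ ε : M →ₗ[ZMod 2] M) (x : M) :
    stepP δ τ ε x = x + (δ (τ x + ε x) + (τ (δ x) + ε (δ x))) := rfl

theorem stepJ_apply (q δ τ : M →ₗ[ZMod 2] M) (x : M) : stepJ q δ τ x = q x + τ (δ (q x)) := rfl

namespace TwoStep

variable {p₀₀ p₀₁ p₁₀ p₁₁ n : Submodule (ZMod 2) M} {q δ τ ε : M →ₗ[ZMod 2] M}
  (h : TwoStep p₀₀ p₀₁ p₁₀ p₁₁ n q δ τ ε)
include h

theorem stepP_δ (x : M) : stepP δ τ ε (δ x) = δ (stepP δ τ ε x) := by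
  simp only [stepP_apply, map_add, h.sq, map_zero, add_zero, zero_add]

theorem stepP₀₀ {x : M} (hx : x ∈ p₀₀) : stepP δ τ ε x = 0 := by
  obtain ⟨a, ha, b, hb, c, hc, e, he, h1⟩ := h.δ₀₀ x hx
  have h2 : τ (δ x) = 0 := by
    rw [h1, map_add, map_add, map_add, h.τ₀₀ a ha, h.τ₀₁ b hb, h.τ₁₀ c hc, h.τn e he]
    simp
  rw [stepP_apply, h.τ₀₀ x hx, h.ε₀₀ x hx, h2, h.ε_δ x hx, add_zero, map_zero, zero_add, zero_add,
    ZModModule.add_self]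

theorem stepP₁₀ {x : M} (hx : x ∈ p₁₀) : stepP δ τ ε x = stepJ q δ τ x := by
  obtain ⟨c, hc, d, hd, e, he, h1⟩ := h.δ₁₀ x hx
  have h2 : ε (δ x) = 0 := by
    rw [h1, map_add, map_add, h.ε₁₀ c hc, h.ε₁₁ d hd, h.εn e he]
    simp
  rw [stepP_apply, stepJ_apply, h.q₁₀ x hx, h.τ₁₀ x hx, h.ε₁₀ x hx, h2]
  simp

theorem stepJn {x : M} (hx : x ∈ n) : stepJ q δ τ x = x := by
  rw [stepJ_apply, h.qn x hx, h.τn _ (h.δn x hx), add_zero]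

theorem stepPn {x : M} (hx : x ∈ n) : stepP δ τ ε x = x := by
  rw [stepP_apply, h.τn x hx, h.εn x hx, h.τn _ (h.δn x hx), h.εn _ (h.δn x hx)]
  simp

theorem stepP₁₁ {x : M} (hx : x ∈ p₁₁) : stepP δ τ ε x ∈ n := by
  obtain ⟨d, hd, e, he, h1⟩ := h.δ₁₁ x hx
  have h2 : ε (δ x) = 0 := by
    rw [h1, map_add, h.ε₁₁ d hd, h.εn e he, add_zero]
  have h3 := h.homotopy x hx
  rw [stepP_apply, h.ε₁₁ x hx, h2, add_zero, add_zero]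
  rwa [show x + (δ (τ x) + τ (δ x)) = δ (τ x) + x + τ (δ x) by abel]

/-- For `d` in `p₁₁`, δτd equals d + τδd up to a term in `n`. Both τδd and that term are killed by
τ, so τδτd = τd, and the two summands of `P (τ d)` cancel. -/
theorem stepPτ (w : M) : stepP δ τ ε (τ w) = 0 := by
  obtain ⟨a, ha, b, hb, c, hc, d, hd, e, he, rfl⟩ := h.dec w
  simp only [map_add, h.τ₀₀ a ha, h.τ₀₁ b hb, h.τ₁₀ c hc, h.τn e he, zero_add, add_zero]
  obtain ⟨r, hr, h1⟩ : ∃ r ∈ n, δ (τ d) = d + τ (δ d) + r := by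
    refine ⟨_, h.homotopy d hd, ?_⟩
    have h2 : ∀ u v w : M, v + w + (u + v + w) = u + (v + v) + (w + w) := by
      intros
      abel
    rw [h2, ZModModule.add_self, ZModModule.add_self, add_zero, add_zero]
  have h2 : τ (δ (τ d)) = τ d := by
    rw [h1, map_add, map_add, h.τ₀₁ _ (h.τ_mem (δ d)), h.τn r hr, add_zero, add_zero]
  have h3 : ε (δ (τ d)) = 0 := by
    rw [h1, map_add, map_add, h.ε₁₁ d hd, h.ε_τ, h.εn r hr, add_zero, add_zero]
  rw [stepP_apply, h.τ₀₁ _ (h.τ_mem d), h.ε_τ, h2, h3, add_zero, map_zero, zero_add, add_zero,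
    ZModModule.add_self]

/-- The image of `stepP` is contained in that of `stepJ`. -/
theorem exists_stepJ (x : M) : ∃ u, stepP δ τ ε x = stepJ q δ τ u := by
  obtain ⟨a, ha, z, hz, c, hc, d, hd, e, he, rfl⟩ := h.dec x
  have hv := h.ε_mem z
  obtain ⟨a', ha', b', hb', c', hc', e', he', h1⟩ := h.δ₀₀ _ hv
  -- Adding the `p₀₁`-component `b'` of δεz moves `z` into the kernel of ε, that is, into the image
  -- of τ, which `P` kills. As `P` also kills δεz, it takes `z` to the image of the components `c'`
  -- and `e'`.
  have h2 : ε (z + b') = 0 := by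
    have h3 := h.ε_δ _ hv
    rw [h1, map_add, map_add, map_add, h.ε₀₀ a' ha', h.ε₁₀ c' hc', h.εn e' he', zero_add, add_zero,
      add_zero] at h3
    rw [map_add, h3, ZModModule.add_self]
  obtain ⟨w, -, h4⟩ := h.split _ (Submodule.add_mem _ hz hb') h2
  have h5 : stepP δ τ ε z = stepJ q δ τ (c' + e') := by
    have h6 := h.stepPτ w
    have h7 := h.stepP_δ (ε z)
    rw [← h4, map_add, add_eq_zero_iff_eq'] at h6
    rw [h.stepP₀₀ hv, map_zero, h1, map_add, map_add, map_add, h.stepP₀₀ ha', zero_add,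
      h.stepP₁₀ hc', h.stepPn he', ← h.stepJn he', add_assoc, ← map_add,
      add_eq_zero_iff_eq'] at h7
    rw [h6, h7]
  refine ⟨(c' + e') + c + stepP δ τ ε d + e, ?_⟩
  simp only [map_add] at h5 ⊢
  rw [h.stepP₀₀ ha, h5, h.stepP₁₀ hc, h.stepPn he, h.stepJn (h.stepP₁₁ hd), h.stepJn he, zero_add]

theorem q_q (x : M) : q (q x) = q x := by
  obtain ⟨a, ha, b, hb, c, hc, d, hd, e, he, rfl⟩ := h.dec x
  simp only [map_add, h.q₀₀ a ha, h.q₀₁ b hb, h.q₁₀ c hc, h.q₁₁ d hd, h.qn e he, map_zero]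

theorem stepJ_q (x : M) : stepJ q δ τ (q x) = stepJ q δ τ x := by
  rw [stepJ_apply, stepJ_apply, h.q_q]

theorem q_stepJ (x : M) : q (stepJ q δ τ x) = q x := by
  rw [stepJ_apply, map_add, h.q_q, h.q₀₁ _ (h.τ_mem _), add_zero]

theorem stepP_stepJ (x : M) : stepP δ τ ε (stepJ q δ τ x) = stepJ q δ τ x := by
  have h0 : ∀ x, stepP δ τ ε (q x) = stepJ q δ τ (q x) := fun x => by
    obtain ⟨a, ha, b, hb, c, hc, d, hd, e, he, rfl⟩ := h.dec x
    simp only [map_add, h.q₀₀ a ha, h.q₀₁ b hb, h.q₁₀ c hc, h.q₁₁ d hd, h.qn e he]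
    rw [h.stepP₁₀ hc, h.stepPn he, h.stepJn he]
    simp
  conv_lhs => rw [stepJ_apply]
  rw [map_add, h.stepPτ, add_zero, h0, h.stepJ_q]

theorem stepJ_q_stepP (x : M) : stepJ q δ τ (q (stepP δ τ ε x)) = stepP δ τ ε x := by
  obtain ⟨u, hu⟩ := h.exists_stepJ x
  rw [hu, h.q_stepJ, h.stepJ_q]

end TwoStep

/-- The image of the idempotent `q` carries a complex which is homotopy equivalent to
the given one. -/
structure Red (δ q J P H : M →ₗ[ZMod 2] M) : Prop where
  sq : ∀ x, δ (δ x) = 0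
  P_eq : ∀ x, P x = x + (δ (H x) + H (δ x))
  P_J : ∀ x, P (J x) = J x
  q_J : ∀ x, q (J x) = q x
  J_q : ∀ x, J (q x) = J x
  J_q_P : ∀ x, J (q (P x)) = P x

theorem Red.refl {δ : M →ₗ[ZMod 2] M} (h : ∀ x, δ (δ x) = 0) :
    Red δ LinearMap.id LinearMap.id LinearMap.id 0 := by
  refine ⟨h, ?_, ?_, ?_, ?_, ?_⟩ <;> simp

theorem TwoStep.red {p₀₀ p₀₁ p₁₀ p₁₁ n : Submodule (ZMod 2) M} {q δ τ ε : M →ₗ[ZMod 2] M}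
    (h : TwoStep p₀₀ p₀₁ p₁₀ p₁₁ n q δ τ ε) :
    Red δ q (stepJ q δ τ) (stepP δ τ ε) (τ + ε) :=
  ⟨h.sq, fun _ => rfl, h.stepP_stepJ, h.q_stepJ, h.stepJ_q, h.stepJ_q_stepP⟩

theorem Red.P_δ {δ q J P H : M →ₗ[ZMod 2] M} (h : Red δ q J P H) (x : M) :
    P (δ x) = δ (P x) := by
  simp only [h.P_eq, map_add, h.sq, map_zero, add_zero, zero_add]

theorem Red.q_q {δ q J P H : M →ₗ[ZMod 2] M} (h : Red δ q J P H) (x : M) : q (q x) = q x := by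
  rw [← h.q_J (q x), h.J_q, h.q_J]

theorem Red.J_q_δ_J {δ q J P H : M →ₗ[ZMod 2] M} (h : Red δ q J P H) (x : M) :
    J (q (δ (J x))) = δ (J x) := by
  have := h.J_q_P (δ (J x))
  rwa [h.P_δ, h.P_J] at this

end TwoStep

section Assembly

variable {D D' : PD}

theorem chain_of_red {δ q J P H : D.Chain →ₗ[ZMod 2] D.Chain} (h : Red δ q J P H)
    {δ' q' J' P' H' : D'.Chain →ₗ[ZMod 2] D'.Chain} (h' : Red δ' q' J' P' H')
    {θ : D.Chain →ₗ[ZMod 2] D'.Chain} (h3 : ∀ x, θ (q (δ (J x))) = q' (δ' (J' (θ x))))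
    (x : D.Chain) : J' (θ (q (P (δ x)))) = δ' (J' (θ (q (P x)))) := by
  rw [h.P_δ, ← h.J_q_P, h3, h'.J_q_δ_J, h.J_q_P]

theorem inverse_of_red {δ q J P H : D.Chain →ₗ[ZMod 2] D.Chain} (h : Red δ q J P H)
    {δ' q' J' P' H' : D'.Chain →ₗ[ZMod 2] D'.Chain} (h' : Red δ' q' J' P' H')
    {θ : D.Chain →ₗ[ZMod 2] D'.Chain} {θ' : D'.Chain →ₗ[ZMod 2] D.Chain}
    (h1 : ∀ x, θ' (θ x) = q x) (h2 : ∀ x, q' (θ x) = θ x) (x : D.Chain) :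
    J (θ' (q' (P' (J' (θ (q (P x))))))) + x = δ (H x) + H (δ x) := by
  rw [h'.P_J, h'.q_J, h2, h1, h.q_q, h.J_q_P, h.P_eq, add_right_comm, ZModModule.add_self, zero_add]

/-- Two complexes with isomorphic reductions are homotopy equivalent. -/
theorem betaEquiv_of_red (hD : D.NoSingle) (hD' : D'.NoSingle)
    {q J J₀ J₂ P P₀ P₂ H : D.Chain →ₗ[ZMod 2] D.Chain} (h : Red D.delta q J P H)
    {q' J' J₀' J₂' P' P₀' P₂' H' : D'.Chain →ₗ[ZMod 2] D'.Chain} (h' : Red D'.delta q' J' P' H')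
    {θ : D.Chain →ₗ[ZMod 2] D'.Chain} {θ' : D'.Chain →ₗ[ZMod 2] D.Chain}
    (hq : BiHom 0 0 q) (hq' : BiHom 0 0 q') (hJ : Exp 0 J J₀ J₂) (hJ' : Exp 0 J' J₀' J₂')
    (hP : Exp 0 P P₀ P₂) (hP' : Exp 0 P' P₀' P₂') (hH : BiHom (-1) 0 H) (hH' : BiHom (-1) 0 H')
    (hθ : BiHom 0 0 θ) (hθ' : BiHom 0 0 θ') (h1 : ∀ x, θ' (θ x) = q x) (h1' : ∀ x, θ (θ' x) = q' x)
    (h2 : ∀ x, q' (θ x) = θ x) (h2' : ∀ x, q (θ' x) = θ' x)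
    (h3 : ∀ x, θ (q (D.delta (J x))) = q' (D'.delta (J' (θ x)))) :
    BetaEquiv (J₀' ∘ₗ θ ∘ₗ q ∘ₗ P₀) := by
  have h3' : ∀ x, θ' (q' (D'.delta (J' x))) = q (D.delta (J (θ' x))) := fun x => by
    rw [← h'.J_q x, ← h1' x, ← h3, h1, h.q_q]
  refine betaEquiv_of_delta hD hD' (φ := J' ∘ₗ θ ∘ₗ q ∘ₗ P) (ψ := J ∘ₗ θ' ∘ₗ q' ∘ₗ P')
    (hJ'.comp (hθ.exp.comp (hq.exp.comp hP))).cast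
    (hJ.comp (hθ'.exp.comp (hq'.exp.comp hP'))).cast hH hH'
    (LinearMap.ext (chain_of_red h h' h3)) (LinearMap.ext (chain_of_red h' h h3'))
    (LinearMap.ext (inverse_of_red h h' h1 h2)) (LinearMap.ext (inverse_of_red h' h h1' h2'))

theorem exp_stepP (hD : D.NoSingle) {τ ε : D.Chain →ₗ[ZMod 2] D.Chain} (hτ : BiHom (-1) 0 τ)
    (hε : BiHom (-1) 0 ε) : Exp 0 (stepP D.delta τ ε) (stepP D.d τ ε)
      (0 + (D.d ∘ₗ 0 + D.beta ∘ₗ (τ + ε) + ((τ + ε) ∘ₗ D.beta + 0 ∘ₗ D.d))) :=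
  BiHom.id.exp.add ((((exp_delta hD).comp (hτ.add hε).exp).cast).add
    (((hτ.add hε).exp.comp (exp_delta hD)).cast))

theorem exp_stepJ (hD : D.NoSingle) {τ q : D.Chain →ₗ[ZMod 2] D.Chain} (hτ : BiHom (-1) 0 τ)
    (hq : BiHom 0 0 q) : ∃ J₂, Exp 0 (stepJ q D.delta τ) (stepJ q D.d τ) J₂ :=
  ⟨_, hq.exp.add ((hτ.exp.comp ((exp_delta hD).comp hq.exp)).cast)⟩

end Assembly

/-! ### Squares of smoothings with a small circle -/

section Square

variable {D : PD}

/-- Smoothings by `0` at the crossings in `W`, by `u` at `y` and by `v` at `z`. -/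
def Reg {X : Type} (W : Set X) (y z : X) (u v : Bool) (s : X → Bool) : Prop :=
  (∀ c ∈ W, s c = false) ∧ s y = u ∧ s z = v

/-- Smoothings that are not by `0` at all crossings in `W`. -/
def Out {X : Type} (W : Set X) (s : X → Bool) : Prop := ¬ ∀ c ∈ W, s c = false

/-- If the crossings in `W`, `y` and `z` are smoothed by `0`, `0`, `1`, then the arcs in `I` form a
small circle; each of the other smoothings of `y` and of `z` connects it to another circle. -/
structure Square (D : PD) (W : Set D.X) (y z : D.X) (I : Set D.E) (e₀ b b' : D.E) : Prop where
  ne : y ≠ z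
  y_not_mem : y ∉ W
  z_not_mem : z ∉ W
  bubble : Bubble D y false I e₀ b (Reg W y z false true)
  bubble' : Bubble D z true I e₀ b' (Reg W y z false true)
  arc_not_mem : ∀ c, c ∉ W → c ≠ y → c ≠ z → ∀ i, D.arc c i ∉ I

variable {W : Set D.X} {y z : D.X} {I : Set D.E} {e₀ b b' : D.E}

theorem Reg.update_y {X : Type} {W : Set X} {y z : X} {u v : Bool} {s : X → Bool} (hy : y ∉ W)
    (hz : y ≠ z) (u' : Bool) (h : Reg W y z u v s) : Reg W y z u' v (Function.update s y u') := by
  refine ⟨fun c hc => ?_, Function.update_self .., ?_⟩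
  · rw [Function.update_of_ne, h.1 c hc]
    rintro rfl
    exact hy hc
  · rw [Function.update_of_ne hz.symm, h.2.2]

theorem Reg.update_z {X : Type} {W : Set X} {y z : X} {u v : Bool} {s : X → Bool} (hz : z ∉ W)
    (hy : y ≠ z) (v' : Bool) (h : Reg W y z u v s) : Reg W y z u v' (Function.update s z v') := by
  refine ⟨fun c hc => ?_, ?_, Function.update_self ..⟩
  · rw [Function.update_of_ne, h.1 c hc]
    rintro rfl
    exact hz hc
  · rw [Function.update_of_ne hy, h.2.1]

theorem Square.opp_y (h : D.Square W y z I e₀ b b') :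
    Opp y false (Reg W y z false true) = Reg W y z true true := by
  funext s
  rw [eq_iff_iff]
  constructor
  · rintro ⟨h1, h2⟩
    have := h2.update_y h.y_not_mem h.ne true
    rwa [Function.update_idem, Function.update_eq_self_iff.2 h1.symm] at this
  · intro h1
    exact ⟨h1.2.1, h1.update_y h.y_not_mem h.ne false⟩

theorem Square.opp_z (h : D.Square W y z I e₀ b b') :
    Opp z true (Reg W y z false true) = Reg W y z false false := by
  funext s
  rw [eq_iff_iff]
  constructor
  · rintro ⟨h1, h2⟩
    have := h2.update_z h.z_not_mem h.ne false
    rwa [Function.update_idem, Function.update_eq_self_iff.2 h1.symm] at this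
  · intro h1
    exact ⟨h1.2.2, h1.update_z h.z_not_mem h.ne true⟩

section Maps

variable (D W y z I e₀)

noncomputable abbrev sqTau : D.Chain →ₗ[ZMod 2] D.Chain := D.tau y I (Reg W y z false true)

noncomputable abbrev sqEps : D.Chain →ₗ[ZMod 2] D.Chain :=
  D.coef z true I e₀ (Reg W y z false true) .x

noncomputable abbrev sqProj : D.Chain →ₗ[ZMod 2] D.Chain :=
  D.proj fun s => Reg W y z true false s ∨ Out W s

end Maps

theorem reg_dec_eq (W : Set D.X) (y z : D.X) (x : D.Chain) :
    x = D.proj (Reg W y z false false) x + D.proj (Reg W y z false true) x +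
      D.proj (Reg W y z true false) x + D.proj (Reg W y z true true) x + D.proj (Out W) x := by
  funext S
  simp only [Pi.add_apply, proj_apply, Reg, Out]
  obtain ⟨O, hO⟩ : ∃ O : Prop, (∀ c ∈ W, S.smoothing c = false) ↔ O := ⟨_, Iff.rfl⟩
  simp only [hO]
  by_cases h : O <;>
    rcases Bool.eq_false_or_eq_true (S.smoothing y) with hy | hy <;>
    rcases Bool.eq_false_or_eq_true (S.smoothing z) with hz | hz <;> simp [h, hy, hz]

theorem mem_part_reg_dec (W : Set D.X) (y z : D.X) (x : D.Chain) :
    ∃ a ∈ D.part (Reg W y z false false), ∃ b ∈ D.part (Reg W y z false true),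
    ∃ c ∈ D.part (Reg W y z true false), ∃ d ∈ D.part (Reg W y z true true),
    ∃ e ∈ D.part (Out W), x = a + b + c + d + e := by
  refine ⟨_, D.proj_mem _ x, _, D.proj_mem _ x, _, D.proj_mem _ x, _, D.proj_mem _ x, _,
    D.proj_mem _ x, reg_dec_eq W y z x⟩

theorem Reg.not_of_ne {X : Type} {W : Set X} {y z : X} {u v u' v' : Bool}
    (hne : (u, v) ≠ (u', v')) (s : X → Bool) (h : Reg W y z u v s) : ¬ Reg W y z u' v' s :=
  fun h' => hne (by rw [← h.2.1, ← h.2.2, ← h'.2.1, ← h'.2.2])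

theorem Out.not_reg {X : Type} {W : Set X} {y z : X} {u v : Bool} (s : X → Bool) (h : Out W s) :
    ¬ Reg W y z u v s := fun h' => h h'.1

theorem out_update {X : Type} {W : Set X} (s : X → Bool) (c : X) (h : Out W s) :
    Out W (Function.update s c true) := fun h' => h fun c' hc' => by
  have := h' c' hc'
  by_cases hc : c' = c
  · subst hc
    simp at this
  · rwa [Function.update_of_ne hc] at this

section Supports

variable (m Δ : Gen → Gen → Gen → ZMod 2)

theorem cubeMap_mem_out {x : D.Chain} (hx : x ∈ D.part (Out W)) :
    D.cubeMap m Δ x ∈ D.part (Out W) :=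
  D.cubeMap_mem_part m Δ (fun s c h _ => out_update s c h) hx

variable (h : D.Square W y z I e₀ b b')
include h

/-- A single change of a smoothing does not affect both `y` and `z`. -/
theorem Square.cubeMap_mem {u v : Bool} {x : D.Chain} (hx : x ∈ D.part (Reg W y z u v)) :
    D.cubeMap m Δ x ∈ D.part fun s => Out W s ∨ Reg W y z u v s ∨ (u = false ∧ Reg W y z true v s) ∨
      (v = false ∧ Reg W y z u true s) := by
  refine D.cubeMap_mem_part m Δ (fun s c hs hc => ?_) hx
  by_cases hW : Out W (Function.update s c true)
  · exact Or.inl hW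
  · have hW' := not_not.1 hW
    obtain ⟨-, rfl, rfl⟩ := hs
    by_cases hy : c = y
    · subst hy
      exact Or.inr (Or.inr (Or.inl ⟨hc, hW', by simp, by
        rw [Function.update_of_ne h.ne.symm]⟩))
    · by_cases hz : c = z
      · subst hz
        exact Or.inr (Or.inr (Or.inr ⟨hc, hW', by rw [Function.update_of_ne h.ne], by simp⟩))
      · exact Or.inr (Or.inl ⟨hW', by rw [Function.update_of_ne (Ne.symm hy)], by
          rw [Function.update_of_ne (Ne.symm hz)]⟩)

end Supports

theorem sqTau_mem (x : D.Chain) : D.sqTau W y z I x ∈ D.part (Reg W y z false true) := tau_mem x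

theorem Square.tau_zero (h : D.Square W y z I e₀ b b') {P : (D.X → Bool) → Prop} {x : D.Chain}
    (hx : x ∈ D.part P) (hP : ∀ s, P s → ¬ Reg W y z true true s) : D.sqTau W y z I x = 0 :=
  tau_eq_zero hx (by rwa [h.opp_y])

theorem eps_zero {P : (D.X → Bool) → Prop} {x : D.Chain} (hx : x ∈ D.part P)
    (hP : ∀ s, P s → ¬ Reg W y z false true s) : D.sqEps W y z I e₀ x = 0 :=
  coef_eq_zero hx hP .x

theorem Square.eps_mem (h : D.Square W y z I e₀ b b') (x : D.Chain) :
    D.sqEps W y z I e₀ x ∈ D.part (Reg W y z false false) := by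
  have := coef_mem (D := D) (I := I) (e₀ := e₀) h.bubble'.val .x x
  rwa [h.opp_z] at this

theorem biHom_sqTau (h : D.Square W y z I e₀ b b') : BiHom (-1) 0 (D.sqTau W y z I) :=
  biHom_tau h.bubble

theorem biHom_sqEps (h : D.Square W y z I e₀ b b') : BiHom (-1) 0 (D.sqEps W y z I e₀) :=
  (biHom_coef h.bubble' .x).cast (by simp) (by simp [Gen.deg])

/-- By `delta_tau` the error avoids the two regions with `z` smoothed by 1. All terms involved live
over such smoothings or outside the square, so the error lies outside. -/
theorem Square.homotopy (hD : D.NoSingle) (h : D.Square W y z I e₀ b b') {w : D.Chain}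
    (hw : w ∈ D.part (Reg W y z true true)) :
    D.delta (D.sqTau W y z I w) + w + D.sqTau W y z I (D.delta w) ∈ D.part (Out W) := by
  have h1 := delta_tau hD h.bubble (fun s hs c hc hQ i => by
    refine h.arc_not_mem c (fun hW => ?_) ?_ ?_ i
    · rw [hs.1 c hW] at hc
      exact absurd hc (by simp)
    · rintro rfl
      rw [hs.2.1] at hc
      exact absurd hc (by simp)
    · rintro rfl
      have := hQ.2.2
      simp at this) (w := w) (by rwa [h.opp_y])
  rw [h.opp_y] at h1
  have h2 : D.delta (D.sqTau W y z I w) + w + D.sqTau W y z I (D.delta w) ∈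
      D.part fun s => Out W s ∨ s z = true := by
    refine Submodule.add_mem _ (Submodule.add_mem _ ?_ ?_) ?_
    · refine D.part_mono ?_ (h.cubeMap_mem _ _ (sqTau_mem w))
      rintro s (hs | hs | hs | hs)
      exacts [Or.inl hs, Or.inr hs.2.2, Or.inr hs.2.2.2, Or.inr hs.2.2.2]
    · exact D.part_mono (fun s hs => Or.inr hs.2.2) hw
    · exact D.part_mono (fun s hs => Or.inr hs.2.2) (sqTau_mem _)
  intro S hS hout
  have h3 := h1 S hS
  have h4 := (h2 S hS).resolve_left (not_not.2 hout)
  rcases Bool.eq_false_or_eq_true (S.smoothing y) with hy | hy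
  · exact h3.2 ⟨hout, hy, h4⟩
  · exact h3.1 ⟨hout, hy, h4⟩

/-- The counit axiom: the edge at `z` splits off the small circle, and the coefficient of `x` there
undoes the comultiplication. In evaluated form the split is supported where the small circle has the
label of `b'`, and the sum over both labels returns `v`. -/
theorem Square.eps_delta (hD : D.NoSingle) (h : D.Square W y z I e₀ b b') {v : D.Chain}
    (hv : v ∈ D.part (Reg W y z false false)) : D.sqEps W y z I e₀ (D.delta v) = v := by
  have hB := h.bubble'
  refine D.chain_ext fun t l hl => ?_
  by_cases ht : Reg W y z false false t
  · have hs := ht.update_z h.z_not_mem h.ne true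
    have hupd : Function.update (Function.update t z true) z (!true) = t := by
      rw [Function.update_idem, Bool.not_true, ← ht.2.2, Function.update_eq_self]
    set s := Function.update t z true
    have hl2 : D.Compat (Function.update s z (!true)) l := by rwa [hupd]
    have hl3 := (hB.opp s l hs).1 hl2
    have hcomp : ∀ g, D.zev s (fill l I g) (D.delta v) =
        if g = l b' then D.zev t l v else 0 := fun g => by
      rw [D.zev_delta hD _ _ (hB.compat_fill s l g hs hl3.1), Finset.sum_eq_single z]
      · have h1 : Function.update s z false = t := hupd
        rw [h1]
        by_cases hg : g = l b'
        · have h2 : fill l I g = l := by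
            rw [hg]
            exact hB.fill_eq hs hl2
          have h3 : D.Mono l z :=
            D.mono_of_compat (s := s) (b := false) (by simp [hs.2.2]) hl3.1 (by rwa [h1])
          rw [h2, if_pos hg, if_pos ⟨hs.2.2, h3⟩]
        · rw [if_neg hg, if_neg]
          rintro ⟨-, hm⟩
          have h2 := D.compat_update_iff s z false _ (hB.compat_fill s l g hs hl3.1) hm
          have h3 := ((hB.opp s _ hs).1 h2).2 e₀ hB.mem
          rw [fill_of_mem hB.mem, fill_of_not_mem hB.not_mem] at h3
          exact hg h3
      · intro c _ hc
        rw [D.zev_eq_zero_of_mem hv, ite_self]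
        intro h1
        have := h1.2.2
        rw [Function.update_of_ne (Ne.symm hc), hs.2.2] at this
        exact absurd this (by simp)
      · simp
    have h4 := zev_coef_x hB hs hl2 (D.delta v)
    rw [hupd] at h4
    rw [h4, hcomp, hcomp]
    cases l b' <;> simp
  · rw [D.zev_eq_zero_of_mem hv ht, D.zev_eq_zero_of_mem (h.eps_mem _) ht]

/-- If the coefficient of `x` vanishes, the values do not depend on the label of the small circle,
so the chain is its own 1-coefficient tensored with 1. The coefficient of `x` is taken at `z`, that
of 1 at `y`. -/
theorem Square.split (h : D.Square W y z I e₀ b b') {x : D.Chain}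
    (hx : x ∈ D.part (Reg W y z false true)) (hε : D.sqEps W y z I e₀ x = 0) :
    ∃ w ∈ D.part (Reg W y z true true), x = D.sqTau W y z I w := by
  have hB := h.bubble
  have hB' := h.bubble'
  refine ⟨D.coef y false I e₀ (Reg W y z false true) .one x, ?_, D.chain_ext fun s l hl => ?_⟩
  · have := coef_mem (D := D) (I := I) (e₀ := e₀) hB.val .one x
    rwa [h.opp_y] at this
  · rw [zev_tau hB hl]
    split_ifs with hs
    · have hop := hB.compat_opp hs hl
      have h1 := zev_coef_one hB hs hop x
      rw [Bool.not_false] at h1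
      rw [h1, fill_fill]
      have hfl : ∀ g, l e₀ = g → fill l I g = l := fun g hg =>
        fill_eq_self fun e he => (hB.const s l hs hl e he).trans hg
      cases h2 : l e₀
      · rw [hfl _ h2]
      · have hop' := hB'.compat_opp hs hl
        have h3 := zev_coef_x hB' hs hop' x
        rw [hε, map_zero, fill_fill, fill_fill, hfl _ h2, eq_comm, add_eq_zero_iff_eq'] at h3
        exact h3
    · exact D.zev_eq_zero_of_mem hx hs l

/-- Apart from the three hypotheses only supports are used. The structure is needed for δ, where the
homotopy equivalence is built, and for ∂, where Khovanov's maps are described. -/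
theorem Square.twoStep (h : D.Square W y z I e₀ b b') (m Δ : Gen → Gen → Gen → ZMod 2)
    (hsq : ∀ x, D.cubeMap m Δ (D.cubeMap m Δ x) = 0)
    (hh : ∀ w ∈ D.part (Reg W y z true true), D.cubeMap m Δ (D.sqTau W y z I w) + w +
      D.sqTau W y z I (D.cubeMap m Δ w) ∈ D.part (Out W))
    (hε : ∀ v ∈ D.part (Reg W y z false false), D.sqEps W y z I e₀ (D.cubeMap m Δ v) = v) :
    TwoStep (D.part (Reg W y z false false)) (D.part (Reg W y z false true))
      (D.part (Reg W y z true false)) (D.part (Reg W y z true true)) (D.part (Out W))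
      (D.sqProj W y z) (D.cubeMap m Δ) (D.sqTau W y z I) (D.sqEps W y z I e₀) where
  dec := mem_part_reg_dec W y z
  δ₀₀ x hx := by
    refine ⟨_, D.proj_mem _ (D.cubeMap m Δ x), _, D.proj_mem _ (D.cubeMap m Δ x), _,
      D.proj_mem _ (D.cubeMap m Δ x), _, D.proj_mem _ (D.cubeMap m Δ x), ?_⟩
    conv_lhs => rw [reg_dec_eq W y z (D.cubeMap m Δ x)]
    rw [D.proj_eq_zero (h.cubeMap_mem m Δ hx) (Q := Reg W y z true true), add_zero]
    rintro s (hs | hs | hs | hs)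
    exacts [hs.not_reg, Reg.not_of_ne (by simp) s hs, Reg.not_of_ne (by simp) s hs.2,
      Reg.not_of_ne (by simp) s hs.2]
  δ₁₀ x hx := by
    refine ⟨_, D.proj_mem _ (D.cubeMap m Δ x), _, D.proj_mem _ (D.cubeMap m Δ x), _,
      D.proj_mem _ (D.cubeMap m Δ x), ?_⟩
    conv_lhs => rw [reg_dec_eq W y z (D.cubeMap m Δ x)]
    rw [D.proj_eq_zero (h.cubeMap_mem m Δ hx) (Q := Reg W y z false false),
      D.proj_eq_zero (h.cubeMap_mem m Δ hx) (Q := Reg W y z false true), zero_add, zero_add]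
    all_goals
      rintro s (hs | hs | hs | hs)
      exacts [hs.not_reg, Reg.not_of_ne (by simp) s hs, absurd hs.1 (by simp),
        Reg.not_of_ne (by simp) s hs.2]
  δ₁₁ x hx := by
    refine ⟨_, D.proj_mem _ (D.cubeMap m Δ x), _, D.proj_mem _ (D.cubeMap m Δ x), ?_⟩
    conv_lhs => rw [reg_dec_eq W y z (D.cubeMap m Δ x)]
    rw [D.proj_eq_zero (h.cubeMap_mem m Δ hx) (Q := Reg W y z false false),
      D.proj_eq_zero (h.cubeMap_mem m Δ hx) (Q := Reg W y z false true),
      D.proj_eq_zero (h.cubeMap_mem m Δ hx) (Q := Reg W y z true false), zero_add, zero_add,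
      zero_add]
    all_goals
      rintro s (hs | hs | hs | hs)
      exacts [hs.not_reg, Reg.not_of_ne (by simp) s hs, absurd hs.1 (by simp),
        absurd hs.1 (by simp)]
  δn _ hx := cubeMap_mem_out m Δ hx
  τ_mem := sqTau_mem
  τ₀₀ _ hx := h.tau_zero hx (Reg.not_of_ne (by simp))
  τ₀₁ _ hx := h.tau_zero hx (Reg.not_of_ne (by simp))
  τ₁₀ _ hx := h.tau_zero hx (Reg.not_of_ne (by simp))
  τn _ hx := h.tau_zero hx Out.not_reg
  ε_mem := h.eps_mem
  ε₀₀ _ hx := eps_zero hx (Reg.not_of_ne (by simp))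
  ε₁₀ _ hx := eps_zero hx (Reg.not_of_ne (by simp))
  ε₁₁ _ hx := eps_zero hx (Reg.not_of_ne (by simp))
  εn _ hx := eps_zero hx Out.not_reg
  q₀₀ _ hx := D.proj_eq_zero hx fun s hs =>
    not_or.2 ⟨Reg.not_of_ne (by simp) s hs, fun ho => ho hs.1⟩
  q₀₁ _ hx := D.proj_eq_zero hx fun s hs =>
    not_or.2 ⟨Reg.not_of_ne (by simp) s hs, fun ho => ho hs.1⟩
  q₁₁ _ hx := D.proj_eq_zero hx fun s hs =>
    not_or.2 ⟨Reg.not_of_ne (by simp) s hs, fun ho => ho hs.1⟩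
  q₁₀ _ hx := D.proj_eq_self (D.part_mono (fun _ => Or.inl) hx)
  qn _ hx := D.proj_eq_self (D.part_mono (fun _ => Or.inr) hx)
  sq := hsq
  homotopy := hh
  ε_δ := hε
  ε_τ := coef_tau h.bubble' h.bubble
  split _ hx := h.split hx

theorem Square.twoStep_delta (hD : D.NoSingle) (h : D.Square W y z I e₀ b b') :
    TwoStep (D.part (Reg W y z false false)) (D.part (Reg W y z false true))
      (D.part (Reg W y z true false)) (D.part (Reg W y z true true)) (D.part (Out W))
      (D.sqProj W y z) D.delta (D.sqTau W y z I) (D.sqEps W y z I e₀) :=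
  h.twoStep _ _ (LinearMap.congr_fun (D.delta_sq hD)) (fun _ => h.homotopy hD)
    fun _ => h.eps_delta hD

/-- The identities for ∂ are the parts of `q`-degree 0 of those for δ. Projections turn the
conditions on supports into equations between maps, which can be split by degree. -/
theorem Square.twoStep_d (hD : D.NoSingle) (h : D.Square W y z I e₀ b b') :
    TwoStep (D.part (Reg W y z false false)) (D.part (Reg W y z false true))
      (D.part (Reg W y z true false)) (D.part (Reg W y z true true)) (D.part (Out W))
      (D.sqProj W y z) D.d (D.sqTau W y z I) (D.sqEps W y z I e₀) := by
  have hτ := biHom_sqTau h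
  have hε := biHom_sqEps h
  have hδ := exp_delta hD
  refine h.twoStep _ _ (LinearMap.congr_fun (D.differential_facts hD).1) (fun w hw => ?_)
    fun v hv => ?_
  · have h1 : D.proj (fun s => ¬ Out W s) ∘ₗ (D.delta ∘ₗ D.sqTau W y z I + LinearMap.id +
        D.sqTau W y z I ∘ₗ D.delta) ∘ₗ D.proj (Reg W y z true true) = 0 :=
      LinearMap.ext fun x => D.proj_eq_zero (h.homotopy hD (D.proj_mem _ x)) fun s => not_not.2
    have h2 := ((D.biHom_proj fun s => ¬ Out W s).exp).comp
      ((((hδ.comp hτ.exp).cast (a' := 0)).add BiHom.id.exp).add (hτ.exp.comp hδ).cast |>.comp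
        (D.biHom_proj (Reg W y z true true)).exp)
    rw [h1] at h2
    have h3 := LinearMap.congr_fun h2.eq_zero w
    simp only [LinearMap.comp_apply, LinearMap.add_apply, LinearMap.id_apply,
      LinearMap.zero_apply, D.proj_eq_self hw] at h3
    have h4 := D.proj_add_proj_not (Out W) (D.d (D.sqTau W y z I w) + w +
      D.sqTau W y z I (D.d w))
    rw [h3, add_zero] at h4
    rw [← d, ← h4]
    exact D.proj_mem _ _
  · have h1 : (D.sqEps W y z I e₀ ∘ₗ D.delta + LinearMap.id) ∘ₗ
        D.proj (Reg W y z false false) = 0 := LinearMap.ext fun x => by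
      simp only [LinearMap.comp_apply, LinearMap.add_apply, LinearMap.id_apply]
      rw [h.eps_delta hD (D.proj_mem _ x), ZModModule.add_self, LinearMap.zero_apply]
    have h2 := (((hε.exp.comp hδ).cast (a' := 0)).add BiHom.id.exp).comp
      (D.biHom_proj (Reg W y z false false)).exp
    rw [h1] at h2
    have h3 := LinearMap.congr_fun h2.eq_zero v
    simp only [LinearMap.comp_apply, LinearMap.add_apply, LinearMap.id_apply,
      LinearMap.zero_apply, D.proj_eq_self hv] at h3
    exact add_eq_zero_iff_eq'.1 h3

end Square

/-! ### The second Reidemeister move -/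

theorem straight_corner (k : Fin 4) (f : Fin 4 → Gen) :
    (∀ i, f i = f (i + 2)) ↔ f k = f (k + 2) ∧ f (k + 1) = f (k + 3) := by
  have h13 : ∀ k : Fin 4, k + 1 + 2 = k + 3 := by decide
  constructor
  · intro h
    exact ⟨h k, by rw [h (k + 1), h13]⟩
  · rintro ⟨h0, h1⟩ i
    obtain ⟨j, rfl⟩ : ∃ j, i = k + j := ⟨i - k, by abel⟩
    have h22 : ∀ k : Fin 4, k + 2 + 2 = k := by decide
    have h32 : ∀ k : Fin 4, k + 3 + 2 = k + 1 := by decide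
    fin_cases j
    · simpa using h0
    · simpa [h13] using h1
    · simpa [h22] using h0.symm
    · simpa [h32] using h1.symm

section Bigon

variable {D : PD} {c₁ c₂ : D.X} {k₁ k₂ : Fin 4}

theorem bigon_arc (hp : ∀ h, ∃! h', h' ≠ h ∧ D.lab h' = D.lab h) (h : D.IsBigon c₁ k₁ c₂ k₂)
    {c : D.X} {i : Fin 4} (he : D.arc c i ∈ ({D.arc c₁ k₁, D.arc c₂ k₂} : Set D.E)) :
    (c = c₁ ∧ (i = k₁ ∨ i = k₁ + 1)) ∨ (c = c₂ ∧ (i = k₂ ∨ i = k₂ + 1)) := by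
  obtain ⟨hne, h1, h2, -⟩ := h
  rcases he with he | he
  · by_cases hx : (c, i) = (c₁, k₁)
    · exact Or.inl ⟨congrArg Prod.fst hx, Or.inl (congrArg Prod.snd hx)⟩
    · have h3 := eq_other hp hx he
      have h4 : (c₂, k₂ + 1) = other hp (c₁, k₁) :=
        eq_other hp (fun h4 => hne (congrArg Prod.fst h4).symm) h1.symm
      rw [← h4] at h3
      exact Or.inr ⟨congrArg Prod.fst h3, Or.inr (congrArg Prod.snd h3)⟩
  · by_cases hx : (c, i) = (c₂, k₂)
    · exact Or.inr ⟨congrArg Prod.fst hx, Or.inl (congrArg Prod.snd hx)⟩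
    · have h3 := eq_other hp hx he
      have h4 : (c₁, k₁ + 1) = other hp (c₂, k₂) :=
        eq_other hp (fun h4 => hne (congrArg Prod.fst h4)) h2.symm
      rw [← h4] at h3
      exact Or.inl ⟨congrArg Prod.fst h3, Or.inr (congrArg Prod.snd h3)⟩

/-- Compatibility away from two crossings and at them. -/
theorem compat_pair (D : PD) (c₁ c₂ : D.X) (s : D.X → Bool) (l : D.E → Gen) : D.Compat s l ↔
    (∀ c, c ≠ c₁ → c ≠ c₂ → D.Loc (s c) l c) ∧ D.Loc (s c₁) l c₁ ∧ D.Loc (s c₂) l c₂ := by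
  rw [compat_iff_loc]
  constructor
  · intro h
    exact ⟨fun c _ _ => h c, h _, h _⟩
  · rintro ⟨h1, h2, h3⟩ c
    by_cases hc : c = c₁
    · exact hc ▸ h2
    · by_cases hc' : c = c₂
      · exact hc' ▸ h3
      · exact h1 c hc hc'

theorem bigon_outer (hp : ∀ h, ∃! h', h' ≠ h ∧ D.lab h' = D.lab h)
    (h : D.IsBigon c₁ k₁ c₂ k₂) :
    (∀ c, c ≠ c₁ → c ≠ c₂ → ∀ i, D.arc c i ∉ ({D.arc c₁ k₁, D.arc c₂ k₂} : Set D.E)) ∧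
    D.arc c₁ (k₁ + 2) ∉ ({D.arc c₁ k₁, D.arc c₂ k₂} : Set D.E) ∧
    D.arc c₁ (k₁ + 3) ∉ ({D.arc c₁ k₁, D.arc c₂ k₂} : Set D.E) ∧
    D.arc c₂ (k₂ + 2) ∉ ({D.arc c₁ k₁, D.arc c₂ k₂} : Set D.E) ∧
    D.arc c₂ (k₂ + 3) ∉ ({D.arc c₁ k₁, D.arc c₂ k₂} : Set D.E) := by
  have h2 : ∀ k : Fin 4, ¬ (k + 2 = k ∨ k + 2 = k + 1) := by decide
  have h3 : ∀ k : Fin 4, ¬ (k + 3 = k ∨ k + 3 = k + 1) := by decide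
  refine ⟨fun c hc hc' i he => ?_, fun he => ?_, fun he => ?_, fun he => ?_, fun he => ?_⟩
  · rcases bigon_arc hp h he with h1 | h1
    exacts [hc h1.1, hc' h1.1]
  · rcases bigon_arc hp h he with h1 | h1
    exacts [h2 _ h1.2, h.1 h1.1]
  · rcases bigon_arc hp h he with h1 | h1
    exacts [h3 _ h1.2, h.1 h1.1]
  · rcases bigon_arc hp h he with h1 | h1
    exacts [h.1 h1.1.symm, h2 _ h1.2]
  · rcases bigon_arc hp h he with h1 | h1
    exacts [h.1 h1.1.symm, h3 _ h1.2]

theorem bigon_sides_ne (hp : ∀ h, ∃! h', h' ≠ h ∧ D.lab h' = D.lab h)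
    (h : D.IsBigon c₁ k₁ c₂ k₂) : D.arc c₁ k₁ ≠ D.arc c₂ k₂ := fun he => by
  have h1 : (c₂, k₂ + 1) = other hp (c₁, k₁) :=
    eq_other hp (fun h4 => h.1 (congrArg Prod.fst h4).symm) h.2.1.symm
  have h2 : (c₂, k₂) = other hp (c₁, k₁) :=
    eq_other hp (fun h4 => h.1 (congrArg Prod.fst h4).symm) he.symm
  exact (by decide : ∀ k : Fin 4, k + 1 ≠ k) k₂ (congrArg Prod.snd (h1.trans h2.symm))

/-- The local conditions at the corners of a bigon. -/
theorem bigon_loc (h : D.IsBigon c₁ k₁ c₂ k₂) (l : D.E → Gen) :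
    (D.Loc true l c₁ ↔ l (D.arc c₁ k₁) = l (D.arc c₂ k₂) ∧
      l (D.arc c₁ (k₁ + 2)) = l (D.arc c₁ (k₁ + 3))) ∧
    (D.Loc false l c₁ ↔ l (D.arc c₁ k₁) = l (D.arc c₁ (k₁ + 3)) ∧
      l (D.arc c₂ k₂) = l (D.arc c₁ (k₁ + 2))) ∧
    (D.Loc false l c₂ ↔ l (D.arc c₂ k₂) = l (D.arc c₁ k₁) ∧
      l (D.arc c₂ (k₂ + 2)) = l (D.arc c₂ (k₂ + 3))) ∧
    (D.Loc true l c₂ ↔ l (D.arc c₂ k₂) = l (D.arc c₂ (k₂ + 3)) ∧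
      l (D.arc c₁ k₁) = l (D.arc c₂ (k₂ + 2))) := by
  obtain ⟨-, h1, h2, h3, h4⟩ := h
  refine ⟨?_, ?_, ?_, ?_⟩
  · rw [← cut_of_odd h3, loc_cut, h2]
  · rw [← Bool.not_true, ← cut_of_odd h3, loc_not_cut, h2]
  · rw [← cut_of_even h4, loc_cut, h1]
  · rw [← Bool.not_false, ← cut_of_even h4, loc_not_cut, h1]

/-- Since `k₁` is odd and `k₂` even, the 1-smoothing of `c₁` and the 0-smoothing of `c₂` cut off the
bigon. So `c₂` plays the part of `y` and `c₁` that of `z`, with no further crossings to be fixed. -/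
theorem bigon_square (hp : ∀ h, ∃! h', h' ≠ h ∧ D.lab h' = D.lab h)
    (h : D.IsBigon c₁ k₁ c₂ k₂) : D.Square ∅ c₂ c₁ {D.arc c₁ k₁, D.arc c₂ k₂} (D.arc c₁ k₁)
      (D.arc c₂ (k₂ + 2)) (D.arc c₁ (k₁ + 2)) := by
  obtain ⟨ho, h12, h13, h22, h23⟩ := bigon_outer hp h
  have hl := bigon_loc h
  have hI : ∀ (l : D.E → Gen) g, fill l {D.arc c₁ k₁, D.arc c₂ k₂} g (D.arc c₁ k₁) = g :=
    fun l g => fill_of_mem (by simp)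
  have hI' : ∀ (l : D.E → Gen) g, fill l {D.arc c₁ k₁, D.arc c₂ k₂} g (D.arc c₂ k₂) = g :=
    fun l g => fill_of_mem (by simp)
  have hfill : ∀ s l g, Reg ∅ c₂ c₁ false true s → D.Compat s l →
      D.Compat s (fill l {D.arc c₁ k₁, D.arc c₂ k₂} g) := by
    intro s l g hs hc
    rw [compat_pair D c₁ c₂, hs.2.1, hs.2.2, (hl _).1, (hl _).2.2.1] at hc ⊢
    refine ⟨fun c h1 h2 => (loc_congr D fun i => fill_of_not_mem (ho c h1 h2 i)).2 (hc.1 c h1 h2),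
      ⟨?_, ?_⟩, ?_, ?_⟩
    · rw [hI, hI']
    · rw [fill_of_not_mem h12, fill_of_not_mem h13]
      exact hc.2.1.2
    · rw [hI, hI']
    · rw [fill_of_not_mem h22, fill_of_not_mem h23]
      exact hc.2.2.2
  have hconst : ∀ s l, Reg ∅ c₂ c₁ false true s → D.Compat s l →
      ∀ e ∈ ({D.arc c₁ k₁, D.arc c₂ k₂} : Set D.E), l e = l (D.arc c₁ k₁) := by
    intro s l hs hc e he
    rw [compat_pair D c₁ c₂, hs.2.1, hs.2.2, (hl _).1, (hl _).2.2.1] at hc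
    rcases he with rfl | rfl
    · rfl
    · exact hc.2.2.1
  refine ⟨h.1.symm, by simp, by simp, ⟨by simp, h22, fun s hs => hs.2.1, hfill, hconst, ?_⟩,
    ⟨by simp, h12, fun s hs => hs.2.2, hfill, hconst, ?_⟩, fun c _ h1 h2 => ho c h2 h1⟩
  · intro s l hs
    have hu : ∀ c, c ≠ c₁ → c ≠ c₂ → Function.update s c₂ (!false) c = s c :=
      fun c _ hc => Function.update_of_ne hc _ _
    rw [compat_pair D c₁ c₂, compat_pair D c₁ c₂, Function.update_self,
      Function.update_of_ne h.1, hs.2.1, hs.2.2, (hl _).1, (hl _).2.2.1, Bool.not_false,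
      (hl _).2.2.2]
    simp only [Set.mem_insert_iff, Set.mem_singleton_iff, forall_eq_or_imp, forall_eq]
    constructor
    · rintro ⟨h1, h2, h3⟩
      refine ⟨⟨fun c hc hc' => by rw [← hu c hc hc']; exact h1 c hc hc', ?_⟩, ?_⟩ <;> grind
    · rintro ⟨⟨h1, h2⟩, h3⟩
      refine ⟨fun c hc hc' => by rw [← Bool.not_false, hu c hc hc']; exact h1 c hc hc', ?_⟩
      grind
  · intro s l hs
    have hu : ∀ c, c ≠ c₁ → c ≠ c₂ → Function.update s c₁ (!true) c = s c :=
      fun c hc _ => Function.update_of_ne hc _ _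
    rw [compat_pair D c₁ c₂, compat_pair D c₁ c₂, Function.update_self,
      Function.update_of_ne h.1.symm, hs.2.1, hs.2.2, (hl _).1, (hl _).2.2.1, Bool.not_true,
      (hl _).2.1]
    simp only [Set.mem_insert_iff, Set.mem_singleton_iff, forall_eq_or_imp, forall_eq]
    constructor
    · rintro ⟨h1, h2, h3⟩
      refine ⟨⟨fun c hc hc' => by rw [← hu c hc hc']; exact h1 c hc hc', ?_⟩, ?_⟩ <;> grind
    · rintro ⟨⟨h1, h2⟩, h3⟩
      refine ⟨fun c hc hc' => by rw [← Bool.not_true, hu c hc hc']; exact h1 c hc hc', ?_⟩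
      grind

/-- The relation between smoothings of a diagram with a bigon and of the diagram where it is
undone. -/
def BigonRel (D : PD) (c₁ c₂ : D.X) : (D.X → Bool) → ((D.erase {c₁, c₂}).X → Bool) → Prop :=
  D.EraseRel {c₁, c₂} fun c => decide (c = c₂)

theorem BigonRel.values (hne : c₁ ≠ c₂) {s : D.X → Bool} {s' : (D.erase {c₁, c₂}).X → Bool}
    (hs : D.BigonRel c₁ c₂ s s') : s c₁ = false ∧ s c₂ = true :=
  ⟨(hs.1 c₁ (by simp)).trans (by simp [hne]), (hs.1 c₂ (by simp)).trans (by simp)⟩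

/-- In the smoothing 01 each side of the bigon belongs to the strand that contains the other side
once the bigon is undone. The labels of the two sides therefore have to be exchanged. -/
theorem bigon_trans (hp : ∀ h, ∃! h', h' ≠ h ∧ D.lab h' = D.lab h)
    (h : D.IsBigon c₁ k₁ c₂ k₂) : IsTrans (D.BigonRel c₁ c₂)
      (D.EraseArc {c₁, c₂} {D.arc c₁ k₁, D.arc c₂ k₂}) := by
  obtain ⟨ho, h12, h13, h22, h23⟩ := bigon_outer hp h
  have hl := bigon_loc h
  have hne := bigon_sides_ne hp h
  refine ⟨fun s s' hs => corr_erase hs ?_ ?_ ?_ ?_ ?_,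
    fun _ _ _ h1 h2 => eraseRel_inj h1 h2, fun _ _ _ h1 h2 => eraseRel_inj' h1 h2⟩
  · intro c hc
    simp only [Set.mem_insert_iff, Set.mem_singleton_iff, not_or] at hc
    exact ho c hc.1 hc.2
  · intro m hm
    rw [compat_pair D c₁ c₂, (hs.values h.1).1, (hs.values h.1).2, (hl _).2.1, (hl _).2.2.2] at hm
    refine ⟨fun e => if e = D.arc c₁ k₁ then m (D.arc c₂ k₂) else
      if e = D.arc c₂ k₂ then m (D.arc c₁ k₁) else m e, fun e he => ?_, fun c hc => ?_⟩
    · simp only [Set.mem_insert_iff, Set.mem_singleton_iff, not_or] at he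
      simp [he]
    · simp only [Set.mem_insert_iff, Set.mem_singleton_iff, not_or] at h12 h13 h22 h23
      rcases hc with rfl | rfl
      · refine (straight_corner k₁ _).2 ?_
        rw [← h.2.2.1]
        simp [h12, h13, hne.symm, hm.2.1.1, hm.2.1.2]
      · refine (straight_corner k₂ _).2 ?_
        rw [← h.2.1]
        simp [h22, h23, hne.symm, hm.2.2.1, hm.2.2.2]
  · intro m hm
    have hm1 := (straight_corner k₁ _).1 (hm c₁ (by simp))
    have hm2 := (straight_corner k₂ _).1 (hm c₂ (by simp))
    rw [← h.2.2.1] at hm1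
    rw [← h.2.1] at hm2
    simp only [Set.mem_insert_iff, Set.mem_singleton_iff, not_or] at h12 h13 h22 h23
    refine ⟨fun e => if e = D.arc c₁ k₁ then m (D.arc c₂ k₂) else
      if e = D.arc c₂ k₂ then m (D.arc c₁ k₁) else m e, fun e he => ?_, fun c hc => ?_⟩
    · simp only [Set.mem_insert_iff, Set.mem_singleton_iff, not_or] at he
      simp [he]
    · rcases hc with rfl | rfl
      · rw [show decide (c = c₂) = false by simp [h.1], (hl _).2.1]
        simp [h12, h13, hne.symm, hm1.1, hm1.2]
      · rw [show decide (c = c) = true by simp, (hl _).2.2.2]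
        simp [h22, h23, hne.symm, hm2.1, hm2.2]
  · intro e he
    have hc : ∀ l, D.Compat s l → l (D.arc c₁ k₁) = l (D.arc c₁ (k₁ + 3)) ∧
        l (D.arc c₂ k₂) = l (D.arc c₁ (k₁ + 2)) := fun l hm => by
      rw [compat_pair D c₁ c₂, (hs.values h.1).1, (hs.values h.1).2, (hl _).2.1,
        (hl _).2.2.2] at hm
      exact hm.2.1
    rcases he with rfl | rfl
    · exact ⟨_, h13, (PD.circ_eq_iff _ _ _ _).2 fun l hm => (hc l hm).1⟩
    · exact ⟨_, h12, (PD.circ_eq_iff _ _ _ _).2 fun l hm => (hc l hm).2⟩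
  · rintro e (rfl | rfl)
    · exact ⟨_, h12, Or.inl ⟨c₁, by simp, k₁, rfl, rfl⟩⟩
    · exact ⟨_, h22, Or.inl ⟨c₂, by simp, k₂, rfl, rfl⟩⟩

theorem NoSingle.erase_bigon (hp : ∀ h, ∃! h', h' ≠ h ∧ D.lab h' = D.lab h) (hD : D.NoSingle)
    (h : D.IsBigon c₁ k₁ c₂ k₂) : (D.erase {c₁, c₂}).NoSingle := by
  refine hD.erase (v := fun c => decide (c = c₂)) (I := {D.arc c₁ k₁, D.arc c₂ k₂}) ?_
    (bigon_trans hp h).corr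
  intro c hc
  simp only [Set.mem_insert_iff, Set.mem_singleton_iff, not_or] at hc
  exact (bigon_outer hp h).1 c hc.1 hc.2

theorem r2Iso_eq (hne : c₁ ≠ c₂) : D.r2Iso c₁ k₁ c₂ k₂ = trans
    (fun s' s => D.BigonRel c₁ c₂ s s')
    (fun e' e => D.EraseArc {c₁, c₂} {D.arc c₁ k₁, D.arc c₂ k₂} e e') := by
  rw [r2Iso, trans]
  congr 1
  funext T S
  rw [eq_iff_iff]
  constructor
  · rintro ⟨h1, h2, h3, h4⟩
    refine ⟨⟨?_, h3⟩, ?_⟩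
    · rintro c (rfl | rfl)
      · simp [h1, hne]
      · simp [h2]
    · rintro _ e ⟨he, rfl⟩
      exact (h4 e he).symm
  · rintro ⟨h1, h2⟩
    have h3 := BigonRel.values hne h1
    exact ⟨h3.1, h3.2, h1.2, fun e he => (h2 _ e ⟨he, rfl⟩).symm⟩

/-- The two crossings have opposite signs, so `nPos` and `nNeg` both drop by one when they are
removed; this balances the one additional 1-smoothing. -/
theorem biHom_r2 (hp : ∀ h, ∃! h', h' ≠ h ∧ D.lab h' = D.lab h) (h : D.IsBigon c₁ k₁ c₂ k₂)
    (hpos : D.pos c₁ = !D.pos c₂) :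
    BiHom 0 0 (D.r2Iso c₁ k₁ c₂ k₂) ∧ BiHom 0 0 (trans (D.BigonRel c₁ c₂)
      (D.EraseArc {c₁, c₂} {D.arc c₁ k₁, D.arc c₂ k₂})) := by
  have h1 : D.nPos = (D.erase {c₁, c₂}).nPos + 1 := by
    rw [nPos, sum_erase_pair h.1, nPos, hpos]
    congr 1
    cases D.pos c₂ <;> simp
  have h2 : D.nNeg = (D.erase {c₁, c₂}).nNeg + 1 := by
    rw [nNeg, sum_erase_pair h.1, nNeg, hpos]
    congr 1
    cases D.pos c₂ <;> simp
  have h3 : ∀ s s', D.BigonRel c₁ c₂ s s' → D.weight s = (D.erase {c₁, c₂}).weight s' + 1 := by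
    intro s s' hs
    rw [weight, sum_erase_pair h.1, weight, (hs.values h.1).1, (hs.values h.1).2]
    congr 1
    exact Finset.sum_congr rfl fun c _ => by rw [hs.2]
  have hT := bigon_trans hp h
  rw [r2Iso_eq h.1]
  constructor
  · refine biHom_trans hT.symm (fun s' s hs => ?_) fun s' s hs => ?_ <;>
    · have := h3 s s' hs
      omega
  · refine biHom_trans hT (fun s s' hs => ?_) fun s s' hs => ?_ <;>
    · have := h3 s s' hs
      omega

/-- Over a smoothing with `c₁` by 0 and `c₂` by 1, an edge at `c₁` cannot end and an edge at `c₂`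
starts outside the image of the identification. The other edges correspond. -/
theorem r2Iso_delta (hG : D.Good) (h : D.IsBigon c₁ k₁ c₂ k₂)
    (x : (D.erase {c₁, c₂}).Chain) :
    D.r2Iso c₁ k₁ c₂ k₂ ((D.erase {c₁, c₂}).delta x) =
      D.sqProj ∅ c₂ c₁ (D.delta (D.r2Iso c₁ k₁ c₂ k₂ x)) := by
  have hT := bigon_trans hG.pairing h
  have hD := hG.noSingle
  have hD' := hD.erase_bigon hG.pairing h
  rw [r2Iso_eq h.1]
  refine D.chain_ext fun s l hl => ?_
  rw [zev_proj]
  split_ifs with hs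
  · have hs' := hs.resolve_right (fun ho => ho (by simp))
    have hr : D.BigonRel c₁ c₂ s fun c => s c.1 := by
      refine ⟨?_, fun _ => rfl⟩
      rintro c (rfl | rfl)
      · simp [hs'.2.2, h.1]
      · simp [hs'.2.1]
    obtain ⟨l', hl', hK⟩ := (hT.corr _ _ hr).ext l hl
    rw [zev_trans hT.symm hr hl' hl (fun e' e he => (hK e e' he).symm), zev_delta _ hD' _ _ hl',
      zev_delta _ hD _ _ hl, sum_erase_pair h.1, if_neg (by simp [hs'.2.2]), zero_add]
    have h0 : D.zev (Function.update s c₂ false) l (trans (fun s' s => D.BigonRel c₁ c₂ s s')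
        (fun e' e => D.EraseArc {c₁, c₂} {D.arc c₁ k₁, D.arc c₂ k₂} e e') x) = 0 := by
      refine zev_trans_eq_zero (fun s' hs => ?_) _ _
      have := (hs.values h.1).2
      simp at this
    rw [h0, ite_self, add_zero]
    refine Finset.sum_congr rfl fun c _ => ?_
    have hc := c.2
    simp only [Set.mem_insert_iff, Set.mem_singleton_iff, not_or] at hc
    have h1 : (D.erase {c₁, c₂}).Mono l' c ↔ D.Mono l c.1 := by
      have h2 : ∀ i, l' ((D.erase {c₁, c₂}).arc c i) = l (D.arc c.1 i) := fun i =>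
        hK _ _ ⟨(bigon_outer hG.pairing h).1 c.1 hc.1 hc.2 i, rfl⟩
      simp only [Mono, h2]
    rw [h1]
    refine if_ctx_congr Iff.rfl (fun h4 => ?_) fun _ => rfl
    refine (zev_trans hT.symm (EraseRel.update hr c false)
      (compat_update_iff _ _ _ _ _ hl' (h1.2 h4.2))
      (compat_update_iff D _ _ _ _ hl h4.2) (fun e' e he => (hK e e' he).symm) x).symm
  · refine zev_trans_eq_zero (fun s' hr => hs (Or.inl ⟨by simp, ?_⟩)) _ _
    exact (BigonRel.values h.1 hr).symm

/-- With `W = ∅` there are no smoothings outside the square, so elimination leaves just C(*01),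
which is the complex of the undone diagram. The latter needs no reduction, and `J` is the map a ↦ a
+ ∂a ⊗ 1. -/
theorem r2_betaEquiv (hG : D.Good) (h : D.IsBigon c₁ k₁ c₂ k₂)
    (hpos : D.pos c₁ = !D.pos c₂) : BetaEquiv (D.r2Map c₁ k₁ c₂ k₂) := by
  have hD := hG.noSingle
  have hD' := hD.erase_bigon hG.pairing h
  have hT := bigon_trans hG.pairing h
  have hS := bigon_square hG.pairing h
  have hτ := biHom_sqTau hS
  have hε := biHom_sqEps hS
  have hq : BiHom 0 0 (D.sqProj ∅ c₂ c₁) := D.biHom_proj _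
  obtain ⟨hθ, hθ'⟩ := biHom_r2 hG.pairing h hpos
  obtain ⟨J₂, hJ⟩ := exp_stepJ hD hτ hq
  have hts := hS.twoStep_delta hD
  have hmem : ∀ x, D.r2Iso c₁ k₁ c₂ k₂ x ∈ D.part (Reg ∅ c₂ c₁ true false) := fun x => by
    rw [r2Iso_eq h.1]
    exact trans_mem_part x fun s' s hs => ⟨by simp, (BigonRel.values h.1 hs).symm⟩
  have hqθ : ∀ x, D.sqProj ∅ c₂ c₁ (D.r2Iso c₁ k₁ c₂ k₂ x) = D.r2Iso c₁ k₁ c₂ k₂ x := fun x =>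
    D.proj_eq_self (D.part_mono (fun _ => Or.inl) (hmem x))
  have key := betaEquiv_of_red hD' hD
    (Red.refl (LinearMap.congr_fun ((D.erase {c₁, c₂}).delta_sq hD'))) hts.red BiHom.id hq
    BiHom.id.exp hJ BiHom.id.exp (exp_stepP hD hτ hε) BiHom.zero (hτ.add hε) hθ hθ' ?_ ?_ hqθ
    (fun _ => rfl) ?_
  · convert key using 1
    rw [r2Map]
    refine LinearMap.ext fun x => ?_
    simp only [LinearMap.comp_apply, LinearMap.add_apply, LinearMap.id_apply, stepJ, hqθ]
    congr 1
    simp only [sqTau, tau, LinearMap.comp_apply, hS.opp_y]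
    congr 3
    funext s
    simp [Reg, and_comm]
  · intro x
    rw [r2Iso_eq h.1]
    have h1 := LinearMap.congr_fun (trans_symm_comp hT.symm) x
    rw [PD.proj_eq_self] at h1
    · exact h1
    · intro S _
      exact ⟨_, D.eraseRel_unerase S.smoothing⟩
  · intro x
    rw [r2Iso_eq h.1]
    refine (LinearMap.congr_fun (trans_symm_comp hT) x).trans ?_
    rw [sqProj]
    congr 2
    funext s
    rw [eq_iff_iff]
    constructor
    · rintro ⟨s', hs⟩
      exact Or.inl ⟨by simp, (BigonRel.values h.1 hs).symm⟩
    · rintro (hs | hs)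
      · refine ⟨fun c => s c.1, ?_, fun _ => rfl⟩
        rintro c (rfl | rfl)
        · simp [hs.2.2, h.1]
        · simp [hs.2.1]
      · exact absurd (by simp) hs
  · intro x
    -- The correction term does not alter the reduced differential: one edge cannot change the
    -- smoothings of both `c₁` and `c₂`.
    have h1 : D.sqProj ∅ c₂ c₁ (D.delta (D.sqTau ∅ c₂ c₁ {D.arc c₁ k₁, D.arc c₂ k₂}
        (D.delta (D.r2Iso c₁ k₁ c₂ k₂ x)))) = 0 := by
      refine D.proj_eq_zero (hS.cubeMap_mem _ _ (sqTau_mem _)) fun s hs => not_or.2 ⟨?_, ?_⟩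
      · rcases hs with hs | hs | hs | hs
        exacts [absurd (by simp) hs, Reg.not_of_ne (by simp) s hs, Reg.not_of_ne (by simp) s hs.2,
          Reg.not_of_ne (by simp) s hs.2]
      · exact fun ho => ho (by simp)
    simp only [LinearMap.id_apply]
    rw [stepJ_apply, hqθ, map_add, map_add, h1, add_zero]
    exact r2Iso_delta hG h x

end Bigon

/-! ### Triangles -/

theorem mono_iff_loc (D : PD) (l : D.E → Gen) (c : D.X) :
    D.Mono l c ↔ D.Loc false l c ∧ D.Loc true l c := by
  rw [mono_iff]
  simp only [Loc, true_implies, reduceCtorEq, false_implies, and_true, true_and]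
  grind

theorem sum_three {X M : Type*} [Fintype X] [AddCommMonoid M] {y z p : X} (hyz : y ≠ z)
    (hyp : y ≠ p) (hzp : z ≠ p) (F : X → M) : ∑ c, F c =
      F y + F z + F p + ∑ c with c ≠ y ∧ c ≠ z ∧ c ≠ p, F c := by
  rw [← Finset.sum_filter_add_sum_filter_not Finset.univ (fun c => c ≠ y ∧ c ≠ z ∧ c ≠ p), add_comm]
  congr 1
  have : (Finset.univ.filter fun c => ¬ (c ≠ y ∧ c ≠ z ∧ c ≠ p)) = {y, z, p} := by
    ext c
    simp only [Finset.mem_filter, Finset.mem_univ, true_and, Finset.mem_insert,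
      Finset.mem_singleton]
    tauto
  rw [this, Finset.sum_insert (by simp [hyz, hyp]), Finset.sum_pair hzp, add_assoc]

/-- Compatibility away from three crossings and at them. -/
theorem compat_triple (D : PD) (y z p : D.X) (s : D.X → Bool) (l : D.E → Gen) : D.Compat s l ↔
    (∀ c, c ≠ y → c ≠ z → c ≠ p → D.Loc (s c) l c) ∧ D.Loc (s y) l y ∧ D.Loc (s z) l z ∧
      D.Loc (s p) l p := by
  rw [compat_iff_loc]
  constructor
  · intro h1
    exact ⟨fun c _ _ _ => h1 c, h1 _, h1 _, h1 _⟩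
  · rintro ⟨h1, h2, h3, h4⟩ c
    by_cases hc : c = y
    · exact hc ▸ h2
    by_cases hc' : c = z
    · exact hc' ▸ h3
    by_cases hc'' : c = p
    · exact hc'' ▸ h4
    exact h1 c hc hc' hc''

/-- The crossings `y`, `z`, `p` are the corners of a triangle with sides `A` (from `y` to `z`),
`B` (from `z` to `p`) and `C` (from `p` to `y`), which are cut off by the smoothings
`0`, `1`, `0`.  The other smoothing connects, for instance, `A` to `yA` and `C` to `yC` at `y`. -/
structure Tri (D : PD) (y z p : D.X) (A B C yA yC zA zB pB pC : D.E) : Prop where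
  yz : y ≠ z
  yp : y ≠ p
  zp : z ≠ p
  AB : A ≠ B
  AC : A ≠ C
  BC : B ≠ C
  y₀ : ∀ l, D.Loc false l y ↔ l A = l C ∧ l yA = l yC
  y₁ : ∀ l, D.Loc true l y ↔ l A = l yA ∧ l C = l yC
  z₁ : ∀ l, D.Loc true l z ↔ l A = l B ∧ l zA = l zB
  z₀ : ∀ l, D.Loc false l z ↔ l A = l zA ∧ l B = l zB
  p₀ : ∀ l, D.Loc false l p ↔ l B = l C ∧ l pB = l pC
  p₁ : ∀ l, D.Loc true l p ↔ l B = l pB ∧ l C = l pC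
  off : ∀ c, c ≠ y → c ≠ z → c ≠ p → ∀ i, D.arc c i ∉ ({A, B, C} : Set D.E)
  out : ∀ e ∈ ({yA, yC, zA, zB, pB, pC} : Set D.E), e ∉ ({A, B, C} : Set D.E)

namespace Tri

variable {D : PD} {y z p : D.X} {A B C yA yC zA zB pB pC : D.E}
  (h : D.Tri y z p A B C yA yC zA zB pB pC)
include h

theorem out' : yA ∉ ({A, B, C} : Set D.E) ∧ yC ∉ ({A, B, C} : Set D.E) ∧
    zA ∉ ({A, B, C} : Set D.E) ∧ zB ∉ ({A, B, C} : Set D.E) ∧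
    pB ∉ ({A, B, C} : Set D.E) ∧ pC ∉ ({A, B, C} : Set D.E) := by
  refine ⟨h.out _ ?_, h.out _ ?_, h.out _ ?_, h.out _ ?_, h.out _ ?_, h.out _ ?_⟩ <;> simp

/-- The sides form a small circle only while the pivot is smoothed by 0, whence `W = {p}`. -/
theorem square : D.Square {p} y z {A, B, C} A yA zA := by
  obtain ⟨o1, o2, o3, o4, o5, o6⟩ := h.out'
  have hfA : ∀ (l : D.E → Gen) g, fill l {A, B, C} g A = g := fun l g => fill_of_mem (by simp)
  have hfB : ∀ (l : D.E → Gen) g, fill l {A, B, C} g B = g := fun l g => fill_of_mem (by simp)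
  have hfC : ∀ (l : D.E → Gen) g, fill l {A, B, C} g C = g := fun l g => fill_of_mem (by simp)
  have hfill : ∀ s l g, Reg {p} y z false true s → D.Compat s l →
      D.Compat s (fill l {A, B, C} g) := by
    intro s l g hs hc
    rw [D.compat_triple y z p, hs.1 p rfl, hs.2.1, hs.2.2, h.y₀, h.z₁, h.p₀] at hc ⊢
    refine ⟨fun c h1 h2 h3 => (loc_congr D fun i => fill_of_not_mem (h.off c h1 h2 h3 i)).2
      (hc.1 c h1 h2 h3), ?_⟩
    rw [hfA, hfB, hfC, fill_of_not_mem o1, fill_of_not_mem o2, fill_of_not_mem o3,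
      fill_of_not_mem o4, fill_of_not_mem o5, fill_of_not_mem o6]
    tauto
  have hconst : ∀ s l, Reg {p} y z false true s → D.Compat s l →
      ∀ e ∈ ({A, B, C} : Set D.E), l e = l A := by
    intro s l hs hc e he
    rw [D.compat_triple y z p, hs.1 p rfl, hs.2.1, hs.2.2, h.y₀, h.z₁, h.p₀] at hc
    rcases he with rfl | rfl | rfl
    exacts [rfl, hc.2.2.1.1.symm, hc.2.1.1.symm]
  refine ⟨h.yz, h.yp, h.zp, ⟨by simp, o1, fun s hs => hs.2.1, hfill, hconst, ?_⟩,
    ⟨by simp, o3, fun s hs => hs.2.2, hfill, hconst, ?_⟩, fun c h1 h2 h3 => h.off c h2 h3 h1⟩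
  · intro s l hs
    have hu : ∀ c, c ≠ y → Function.update s y (!false) c = s c :=
      fun c hc => Function.update_of_ne hc _ _
    rw [D.compat_triple y z p, D.compat_triple y z p, Function.update_self, hu z h.yz.symm,
      hu p h.yp.symm, hs.1 p rfl, hs.2.1, hs.2.2, Bool.not_false, h.y₀, h.y₁, h.z₁, h.p₀]
    simp only [Set.mem_insert_iff, Set.mem_singleton_iff, forall_eq_or_imp, forall_eq]
    constructor
    · rintro ⟨h1, h2⟩
      refine ⟨⟨fun c hc hc' hc'' => by rw [← hu c hc]; exact h1 c hc hc' hc'', ?_⟩, ?_⟩ <;> grind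
    · rintro ⟨⟨h1, h2⟩, h3⟩
      refine ⟨fun c hc hc' hc'' => by
        rw [← Bool.not_false, hu c hc]; exact h1 c hc hc' hc'', ?_⟩
      grind
  · intro s l hs
    have hu : ∀ c, c ≠ z → Function.update s z (!true) c = s c :=
      fun c hc => Function.update_of_ne hc _ _
    rw [D.compat_triple y z p, D.compat_triple y z p, Function.update_self, hu y h.yz,
      hu p h.zp.symm, hs.1 p rfl, hs.2.1, hs.2.2, Bool.not_true, h.y₀, h.z₀, h.z₁, h.p₀]
    simp only [Set.mem_insert_iff, Set.mem_singleton_iff, forall_eq_or_imp, forall_eq]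
    constructor
    · rintro ⟨h1, h2⟩
      refine ⟨⟨fun c hc hc' hc'' => by rw [← hu c hc']; exact h1 c hc hc' hc'', ?_⟩, ?_⟩ <;> grind
    · rintro ⟨⟨h1, h2⟩, h3⟩
      refine ⟨fun c hc hc' hc'' => by
        rw [← Bool.not_true, hu c hc']; exact h1 c hc hc' hc'', ?_⟩
      grind

end Tri

/-! ### Evaluation of `a + ∂(a) ⊗ 1` -/

section StepJ

variable {D : PD} {W : Set D.X} {y z : D.X} {I : Set D.E} {e₀ b b' : D.E}

theorem zev_stepJ_of_q {s : D.X → Bool}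
    (hs : Reg W y z true false s ∨ Out W s) (l : D.E → Gen) (x : D.Chain) :
    D.zev s l (stepJ (D.sqProj W y z) D.delta (D.sqTau W y z I) x) = D.zev s l x := by
  rw [stepJ_apply, map_add, zev_proj, if_pos hs, D.zev_eq_zero_of_mem (sqTau_mem _), add_zero]
  rcases hs with hs | hs
  exacts [Reg.not_of_ne (by simp) s hs, Out.not_reg s hs]

theorem zev_stepJ_eq_zero {s : D.X → Bool} {u : Bool}
    (hs : Reg W y z u u s) (l : D.E → Gen) (x : D.Chain) :
    D.zev s l (stepJ (D.sqProj W y z) D.delta (D.sqTau W y z I) x) = 0 := by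
  rw [stepJ_apply, map_add, zev_proj, if_neg, D.zev_eq_zero_of_mem (sqTau_mem _), add_zero]
  · exact Reg.not_of_ne (by cases u <;> simp) s hs
  · rintro (h1 | h1)
    exacts [Reg.not_of_ne (by cases u <;> simp) s hs h1, h1 hs.1]

/-- Over the smoothings with the small circle, `J x` is the correction ∂x ⊗ 1. Of the edges that end
over `11`, only the one at `z` starts in the image of `q`. -/
theorem Square.zev_stepJ (hD : D.NoSingle) (h : D.Square W y z I e₀ b b') {s : D.X → Bool}
    (hs : Reg W y z false true s) {l : D.E → Gen} (hl : D.Compat s l) (x : D.Chain) :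
    D.zev s l (stepJ (D.sqProj W y z) D.delta (D.sqTau W y z I) x) =
      if D.Mono (fill l I (l b)) z then
        D.zev (Function.update (Function.update s y true) z false) (fill l I (l b)) x else 0 := by
  have hr := hs.update_y h.y_not_mem h.ne true
  have hop := h.bubble.compat_opp hs hl
  rw [Bool.not_false] at hop
  rw [stepJ_apply, map_add, zev_proj, if_neg, zero_add, zev_tau h.bubble hl, if_pos hs,
    D.zev_delta hD _ _ hop, Finset.sum_eq_single z]
  · rw [zev_proj, if_pos (Or.inl (hr.update_z h.z_not_mem h.ne false))]
    simp only [hr.2.2, true_and]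
  · intro c _ hc
    split_ifs with h1
    · rw [zev_proj, if_neg]
      have hcW : c ∉ W := fun hcW => by
        rw [hr.1 c hcW] at h1
        exact absurd h1.1 (by simp)
      rintro (h2 | h2)
      · have := h2.2.2
        rw [Function.update_of_ne hc.symm, hr.2.2] at this
        exact absurd this (by simp)
      · refine h2 fun c' hc' => ?_
        rw [Function.update_of_ne, hr.1 c' hc']
        rintro rfl
        exact hcW hc'
    · rfl
  · simp
  · rintro (h1 | h1)
    exacts [Reg.not_of_ne (by simp) s hs h1, h1 hs.1]

end StepJ

/-! ### Moving a strand across a crossing -/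

/-- Reconnect the crossings. -/
abbrev rewire (D : PD) (arc' : D.X → Fin 4 → D.E) : PD := { D with arc := arc' }

/-- Corresponding smoothings before and after the third Reidemeister move. -/
def SlideRel {X : Type} (y z p : X) (s s' : X → Bool) : Prop :=
  (Reg {p} y z true false s ∧ s' = s) ∨ (s p = true ∧ s' = fun c => s (Equiv.swap y z c))

/-- Arcs outside `I` correspond to themselves. -/
def OffRel {E : Type} (I : Set E) (e e' : E) : Prop := e ∉ I ∧ e' = e

theorem SlideRel.symm {X : Type} {y z p : X} (hy : y ≠ p) (hz : z ≠ p) {s s' : X → Bool}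
    (h : SlideRel y z p s s') : SlideRel y z p s' s := by
  rcases h with ⟨h1, rfl⟩ | ⟨h1, rfl⟩
  · exact Or.inl ⟨h1, rfl⟩
  · refine Or.inr ⟨?_, ?_⟩
    · change s _ = true
      rwa [Equiv.swap_apply_of_ne_of_ne hy.symm hz.symm]
    · funext c
      simp

section Slide

variable {D : PD} {y z p : D.X} {A B C yA yC zA zB pB pC : D.E} {arc' : D.X → Fin 4 → D.E}

theorem fill_three {E : Type} {A B C : E} (AB : A ≠ B) (AC : A ≠ C) (BC : B ≠ C) (m : E → Gen)
    (a b c : Gen) : ∃ m' : E → Gen, m' A = a ∧ m' B = b ∧ m' C = c ∧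
      ∀ e ∉ ({A, B, C} : Set E), m' e = m e := by
  refine ⟨fun e => if e = A then a else if e = B then b else if e = C then c else m e, by simp,
    by simp [AB.symm], by simp [AC.symm, BC.symm], fun e he => ?_⟩
  simp only [Set.mem_insert_iff, Set.mem_singleton_iff, not_or] at he
  simp [he]

theorem slide_values (hyp : y ≠ p) (hzp : z ≠ p) {s s' : D.X → Bool}
    (hs : SlideRel y z p s s') : (∀ c, c ≠ y → c ≠ z → c ≠ p → s' c = s c) ∧ s' p = s p ∧
      ((s y = true ∧ s z = false ∧ s p = false ∧ s' y = true ∧ s' z = false) ∨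
        (s p = true ∧ s' y = s z ∧ s' z = s y)) := by
  rcases hs with ⟨h1, rfl⟩ | ⟨h1, rfl⟩
  · exact ⟨fun _ _ _ _ => rfl, rfl, Or.inl ⟨h1.2.1, h1.2.2, h1.1 p rfl, h1.2.1, h1.2.2⟩⟩
  · refine ⟨fun c h2 h3 _ => ?_, ?_, Or.inr ⟨h1, ?_, ?_⟩⟩
    · exact congrArg s (Equiv.swap_apply_of_ne_of_ne h2 h3)
    · exact congrArg s (Equiv.swap_apply_of_ne_of_ne hyp.symm hzp.symm)
    · simp
    · simp

/-- Away from the triangle nothing changes. It remains to find labels for the three sides that fit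
the new smoothings, which is a finite check. -/
theorem slide_ext (h : D.Tri y z p A B C yA yC zA zB pB pC)
    (h' : (D.rewire arc').Tri y z p A B C pB zB pC yC yA zA)
    (harc : ∀ c, c ≠ y → c ≠ z → c ≠ p → ∀ i, arc' c i = D.arc c i) {s s' : D.X → Bool}
    (hs : SlideRel y z p s s') (m : D.E → Gen) (hm : D.Compat s m) :
    ∃ m' : D.E → Gen, (D.rewire arc').Compat s' m' ∧
      ∀ e e', OffRel {A, B, C} e e' → m' e' = m e := by
  obtain ⟨h1, h2, h3⟩ := slide_values h.yp h.zp hs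
  have key : ∀ m' : D.E → Gen, (∀ e ∉ ({A, B, C} : Set D.E), m' e = m e) →
      ((D.rewire arc').Loc (s' y) m' y ∧ (D.rewire arc').Loc (s' z) m' z ∧
        (D.rewire arc').Loc (s' p) m' p) →
      ∃ m' : D.E → Gen, (D.rewire arc').Compat s' m' ∧
        ∀ e e', OffRel {A, B, C} e e' → m' e' = m e := by
    intro m' h4 h5
    refine ⟨m', ((D.rewire arc').compat_triple y z p s' m').2 ⟨fun c hy hz hp => ?_, h5⟩, ?_⟩
    · have h6 := ((D.compat_triple y z p s m).1 hm).1 c hy hz hp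
      rw [h1 c hy hz hp]
      rw [← loc_congr D (l := m') (l' := m) (c := c)
        fun i => h4 (D.arc c i) (h.off c hy hz hp i)] at h6
      simpa only [Loc, harc c hy hz hp] using h6
    · rintro _ e ⟨he, rfl⟩
      exact h4 e he
  obtain ⟨o1, o2, o3, o4, o5, o6⟩ := h.out'
  have hl := ((D.compat_triple y z p s m).1 hm).2
  rcases h3 with ⟨h3, h4, h5, h6, h7⟩ | ⟨h3, h4, h5⟩
  -- The side labels are those of the outer arcs to which the new smoothings of `y` and `z` join the
  -- sides.
  · obtain ⟨m', hA, hB, hC, ho⟩ := fill_three h.AB h.AC h.BC m (m pB) (m yC) (m zB)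
    refine key m' ho ?_
    rw [h3, h4, h5, h.y₁, h.z₀, h.p₀] at hl
    rw [h6, h7, h2, h5, h'.y₁, h'.z₀, h'.p₀, hA, hB, hC, ho _ o1, ho _ o2, ho _ o3, ho _ o4,
      ho _ o5, ho _ o6]
    grind
  · rw [h3, h.p₁] at hl
    -- The 1-smoothing of `p` prescribes the labels of `B` and `C`. The label of `A` depends on the
    -- new smoothings of `y` and `z`, which are the old ones of `z` and `y`.
    obtain ⟨m', hA, hB, hC, ho⟩ := fill_three h.AB h.AC h.BC m
      (if s z = true then m pB else if s y = true then m zA else m pC) (m yA) (m zA)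
    refine key m' ho ?_
    rw [h4, h5, h2, h3, h'.p₁]
    rcases Bool.eq_false_or_eq_true (s y) with hy | hy <;>
      rcases Bool.eq_false_or_eq_true (s z) with hz | hz
    · rw [hy, hz, h.y₁, h.z₁] at hl
      rw [hy, hz, h'.y₁, h'.z₁, hA, hB, hC, ho _ o1, ho _ o2, ho _ o3, ho _ o4, ho _ o5, ho _ o6]
      grind
    · rw [hy, hz, h.y₁, h.z₀] at hl
      rw [hy, hz, h'.y₀, h'.z₁, hA, hB, hC, ho _ o1, ho _ o2, ho _ o3, ho _ o4, ho _ o5, ho _ o6]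
      grind
    · rw [hy, hz, h.y₀, h.z₁] at hl
      rw [hy, hz, h'.y₁, h'.z₀, hA, hB, hC, ho _ o1, ho _ o2, ho _ o3, ho _ o4, ho _ o5, ho _ o6]
      grind
    · rw [hy, hz, h.y₀, h.z₀] at hl
      rw [hy, hz, h'.y₀, h'.z₀, hA, hB, hC, ho _ o1, ho _ o2, ho _ o3, ho _ o4, ho _ o5, ho _ o6]
      grind

theorem slide_cov (h : D.Tri y z p A B C yA yC zA zB pB pC) {s : D.X → Bool}
    (hs : Reg {p} y z true false s ∨ s p = true) (e : D.E) :
    ∃ e₀ e₀', OffRel {A, B, C} e₀ e₀' ∧ D.circ s e = D.circ s e₀ := by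
  by_cases he : e ∈ ({A, B, C} : Set D.E)
  · obtain ⟨o1, o2, o3, o4, o5, o6⟩ := h.out'
    suffices hk : ∃ e₀ ∉ ({A, B, C} : Set D.E), ∀ l, D.Compat s l → l e = l e₀ by
      obtain ⟨e₀, h1, h2⟩ := hk
      exact ⟨e₀, e₀, ⟨h1, rfl⟩, (D.circ_eq_iff _ _ _).2 h2⟩
    have hl := fun l hm => ((D.compat_triple y z p s l).1 hm).2
    rcases hs with hs | hs
    · rw [hs.2.1, hs.2.2, hs.1 p rfl] at hl
      simp only [h.y₁, h.z₀, h.p₀] at hl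
      rcases he with rfl | rfl | rfl
      · exact ⟨_, o1, fun l hm => (hl l hm).1.1⟩
      · exact ⟨_, o4, fun l hm => (hl l hm).2.1.2⟩
      · exact ⟨_, o2, fun l hm => (hl l hm).1.2⟩
    · rw [hs] at hl
      simp only [h.p₁] at hl
      rcases he with rfl | rfl | rfl
      · rcases Bool.eq_false_or_eq_true (s y) with hy | hy
        · rw [hy] at hl
          simp only [h.y₁] at hl
          exact ⟨_, o1, fun l hm => (hl l hm).1.1⟩
        · rw [hy] at hl
          simp only [h.y₀] at hl
          exact ⟨_, o6, fun l hm => (hl l hm).1.1.trans (hl l hm).2.2.2⟩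
      · exact ⟨_, o5, fun l hm => (hl l hm).2.2.1⟩
      · exact ⟨_, o6, fun l hm => (hl l hm).2.2.2⟩
  · exact ⟨e, e, ⟨he, rfl⟩, rfl⟩

theorem SlideRel.dom {X : Type} {y z p : X} {s s' : X → Bool} (h : SlideRel y z p s s') :
    Reg {p} y z true false s ∨ s p = true := by
  rcases h with h | h
  exacts [Or.inl h.1, Or.inr h.1]

/-- The renaming of the outer arcs from `h` to `h'` is an involution and `SlideRel` is symmetric, so
the conditions on the new diagram are those on the old one with the roles exchanged. -/
theorem slide_trans (h : D.Tri y z p A B C yA yC zA zB pB pC)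
    (h' : (D.rewire arc').Tri y z p A B C pB zB pC yC yA zA)
    (harc : ∀ c, c ≠ y → c ≠ z → c ≠ p → ∀ i, arc' c i = D.arc c i) :
    IsTrans (D := D) (D' := D.rewire arc') (SlideRel y z p) (OffRel {A, B, C}) := by
  have hinj : ∀ s t t' : D.X → Bool, SlideRel y z p s t → SlideRel y z p s t' → t = t' := by
    rintro s t t' (⟨h1, rfl⟩ | ⟨h1, rfl⟩) (⟨h2, rfl⟩ | ⟨h2, rfl⟩)
    · rfl
    · rw [h1.1 p rfl] at h2
      exact absurd h2 (by simp)
    · rw [h2.1 p rfl] at h1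
      exact absurd h1 (by simp)
    · rfl
  refine ⟨fun s s' hs => ⟨slide_ext h h' harc hs, ?_, slide_cov h hs.dom, ?_⟩, ?_, hinj⟩
  · intro m' hm'
    obtain ⟨m, hm, hK⟩ := slide_ext (D := D.rewire arc') (arc' := D.arc) h' h
      (fun c hy hz hp i => (harc c hy hz hp i).symm) (hs.symm h.yp h.zp) m' hm'
    exact ⟨m, hm, fun e e' he => (hK e' e ⟨he.2 ▸ he.1, he.2.symm⟩).symm⟩
  · intro e'
    obtain ⟨e₀, e₀', hK, he⟩ := slide_cov (D := D.rewire arc') h' (hs.symm h.yp h.zp).dom e'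
    exact ⟨e₀, e₀, ⟨hK.1, rfl⟩, he⟩
  · exact fun s t s' h1 h2 => hinj s' s t (h1.symm h.yp h.zp) (h2.symm h.yp h.zp)

end Slide

/-! ### The reduced differentials before and after the third move -/

section Slide

variable {D : PD} {y z p : D.X} {A B C yA yC zA zB pB pC : D.E} {arc' : D.X → Fin 4 → D.E}

theorem Tri.mono_z (h : D.Tri y z p A B C yA yC zA zB pB pC) (l : D.E → Gen) :
    D.Mono l z ↔ (l A = l zA ∧ l B = l zB) ∧ l A = l B ∧ l zA = l zB := by
  rw [mono_iff_loc, h.z₀, h.z₁]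

theorem Tri.mono_y (h : D.Tri y z p A B C yA yC zA zB pB pC) (l : D.E → Gen) :
    D.Mono l y ↔ (l A = l C ∧ l yA = l yC) ∧ l A = l yA ∧ l C = l yC := by
  rw [mono_iff_loc, h.y₀, h.y₁]

theorem Tri.mono_p (h : D.Tri y z p A B C yA yC zA zB pB pC) (l : D.E → Gen) :
    D.Mono l p ↔ (l B = l C ∧ l pB = l pC) ∧ l B = l pB ∧ l C = l pC := by
  rw [mono_iff_loc, h.p₀, h.p₁]

theorem slideRel_update {X : Type} {y z p c : X} (hy : c ≠ y) (hz : c ≠ z) (hp : c ≠ p)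
    {s s' : X → Bool} (h : SlideRel y z p s s') (v : Bool) :
    SlideRel y z p (Function.update s c v) (Function.update s' c v) := by
  rcases h with ⟨h1, rfl⟩ | ⟨h1, rfl⟩
  · refine Or.inl ⟨⟨?_, ?_, ?_⟩, rfl⟩
    · rintro _ rfl
      rw [Function.update_of_ne hp.symm, h1.1 _ rfl]
    · rw [Function.update_of_ne hy.symm, h1.2.1]
    · rw [Function.update_of_ne hz.symm, h1.2.2]
  · refine Or.inr ⟨?_, ?_⟩
    · rwa [Function.update_of_ne hp.symm]
    · funext c'
      by_cases hc : c' = c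
      · subst hc
        rw [Function.update_self, Equiv.swap_apply_of_ne_of_ne hy hz, Function.update_self]
      · rw [Function.update_of_ne hc, Function.update_of_ne]
        intro h2
        rw [Equiv.swap_apply_eq_iff, Equiv.swap_apply_of_ne_of_ne hy hz] at h2
        exact hc h2

theorem slideRel_update_y {X : Type} {y z p : X} (hy : y ≠ p)
    {s s' : X → Bool} (h : SlideRel y z p s s') (hs : s p = true) (v : Bool) :
    SlideRel y z p (Function.update s y v) (Function.update s' z v) := by
  rcases h with ⟨h1, rfl⟩ | ⟨h1, rfl⟩
  · rw [h1.1 p rfl] at hs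
    exact absurd hs (by simp)
  · refine Or.inr ⟨?_, ?_⟩
    · rwa [Function.update_of_ne hy.symm]
    · funext c
      by_cases hc : c = z
      · subst hc
        simp
      · rw [Function.update_of_ne hc, Function.update_of_ne]
        intro h2
        rw [Equiv.swap_apply_eq_iff, Equiv.swap_apply_left] at h2
        exact hc h2

theorem slideRel_update_z {X : Type} {y z p : X} (hy : y ≠ p) (hz : z ≠ p)
    {s s' : X → Bool} (h : SlideRel y z p s s') (hs : s p = true) (v : Bool) :
    SlideRel y z p (Function.update s z v) (Function.update s' y v) := by
  refine (slideRel_update_y hy (h.symm hy hz) ?_ v).symm hy hz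
  rcases h with ⟨h1, rfl⟩ | ⟨h1, rfl⟩
  · exact hs
  · exact (congrArg s (Equiv.swap_apply_of_ne_of_ne hy.symm hz.symm)).trans h1

/-- The move turns the smoothing 101 into 011. Changing the pivot to 0 gives 100 before the move,
but 010, the one with the small circle, after it; changing `y` and `z` as well leads back to 100. -/
theorem slideRel_pivot {X : Type} {y z p : X} (hyp : y ≠ p) (hzp : z ≠ p) (hyz : y ≠ z)
    {s s' : X → Bool} (h : SlideRel y z p s s') (hs : s p = true) (hy : s y = true)
    (hz : s z = false) : SlideRel y z p (Function.update s p false)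
      (Function.update (Function.update (Function.update s' p false) y true) z false) := by
  rcases h with ⟨h1, rfl⟩ | ⟨h1, rfl⟩
  · rw [h1.1 p rfl] at hs
    exact absurd hs (by simp)
  · refine Or.inl ⟨⟨?_, ?_, ?_⟩, ?_⟩
    · rintro _ rfl
      simp
    · rwa [Function.update_of_ne hyp]
    · rwa [Function.update_of_ne hzp]
    · funext c
      by_cases hcz : c = z
      · subst hcz
        rw [Function.update_self, Function.update_of_ne hzp, hz]
      rw [Function.update_of_ne hcz]
      by_cases hcy : c = y
      · subst hcy
        rw [Function.update_self, Function.update_of_ne hyp, hy]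
      rw [Function.update_of_ne hcy]
      by_cases hcp : c = p
      · subst hcp
        rw [Function.update_self, Function.update_self]
      · rw [Function.update_of_ne hcp, Function.update_of_ne hcp,
          Equiv.swap_apply_of_ne_of_ne hcy hcz]

/-- The identification of the reduced complexes before and after the third Reidemeister move. -/
noncomputable abbrev slide (D : PD) (arc' : D.X → Fin 4 → D.E) (y z p : D.X) (I : Set D.E) :
    D.Chain →ₗ[ZMod 2] (D.rewire arc').Chain :=
  trans (D := D) (D' := D.rewire arc') (SlideRel y z p) (OffRel I)

theorem zev_slide (h : D.Tri y z p A B C yA yC zA zB pB pC)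
    (h' : (D.rewire arc').Tri y z p A B C pB zB pC yC yA zA)
    (harc : ∀ c, c ≠ y → c ≠ z → c ≠ p → ∀ i, arc' c i = D.arc c i) {s s' : D.X → Bool}
    (hs : SlideRel y z p s s') {l l' : D.E → Gen} (hl : D.Compat s l)
    (hl' : (D.rewire arc').Compat s' l') (hK : ∀ e ∉ ({A, B, C} : Set D.E), l' e = l e)
    (x : D.Chain) : (D.rewire arc').zev s' l' (D.slide arc' y z p {A, B, C} x) = D.zev s l x :=
  zev_trans (slide_trans h h' harc) hs hl hl' (fun _ e' he => by
    rw [he.2]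
    exact hK _ he.1) x

/-- The pivot term of the differential where the other two crossings are smoothed by `1`, `0` before
the move. -/
theorem slide_pivot (hD' : (D.rewire arc').NoSingle) (h : D.Tri y z p A B C yA yC zA zB pB pC)
    (h' : (D.rewire arc').Tri y z p A B C pB zB pC yC yA zA)
    (harc : ∀ c, c ≠ y → c ≠ z → c ≠ p → ∀ i, arc' c i = D.arc c i) {s s' : D.X → Bool}
    (hs : SlideRel y z p s s') {l l' : D.E → Gen} (hl : D.Compat s l)
    (hl' : (D.rewire arc').Compat s' l') (hK : ∀ e ∉ ({A, B, C} : Set D.E), l' e = l e)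
    (hp : s p = true) (hy : s y = true) (hz : s z = false) (x : D.Chain) :
    (if D.Mono l p then D.zev (Function.update s p false) l (stepJ (D.sqProj {p} y z) D.delta
        (D.sqTau {p} y z {A, B, C}) x) else 0) =
      if (D.rewire arc').Mono l' p then (D.rewire arc').zev (Function.update s' p false) l'
        (stepJ ((D.rewire arc').sqProj {p} y z) (D.rewire arc').delta
          ((D.rewire arc').sqTau {p} y z {A, B, C}) (D.slide arc' y z p {A, B, C} x)) else 0 := by
  obtain ⟨-, hp', h3⟩ := slide_values h.yp h.zp hs
  obtain ⟨hy', hz'⟩ : s' y = false ∧ s' z = true := by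
    rcases h3 with ⟨-, -, h3, -⟩ | ⟨-, h3, h4⟩
    · rw [hp] at h3
      exact absurd h3 (by simp)
    · rw [h3, h4]
      exact ⟨hz, hy⟩
  rw [hp] at hp'
  obtain ⟨o1, o2, o3, o4, o5, o6⟩ := h.out'
  have hm := ((D.compat_triple y z p s l).1 hl).2
  have hm' := (((D.rewire arc').compat_triple y z p s' l').1 hl').2
  rw [hy, hz, hp, h.y₁, h.z₀, h.p₁] at hm
  rw [hy', hz', hp', h'.y₀, h'.z₁, h'.p₁, hK _ o1, hK _ o2, hK _ o3, hK _ o4, hK _ o5, hK _ o6]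
    at hm'
  have h1 : (D.rewire arc').Mono l' p := by
    rw [h'.mono_p, hK _ o1, hK _ o3]
    grind
  have hc := compat_update_iff (D.rewire arc') s' p false l' hl' h1
  have hr : Reg {p} y z false true (Function.update s' p false) :=
    ⟨by rintro _ rfl; simp, by rwa [Function.update_of_ne h.yp],
      by rwa [Function.update_of_ne h.zp]⟩
  have hr₀ : Reg {p} y z true false (Function.update s p false) :=
    ⟨by rintro _ rfl; simp, by rwa [Function.update_of_ne h.yp],
      by rwa [Function.update_of_ne h.zp]⟩
  -- Before the move the edge at `p` starts in the region 100. After it, the edge starts at the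
  -- small circle, where the value of `J` comes from 100 by way of 110. The condition at `p` before
  -- the move turns into one at `z` after it.
  rw [if_pos h1, h'.square.zev_stepJ hD' hr hc, zev_stepJ_of_q (Or.inl hr₀)]
  have h2 : D.Mono l p ↔ (D.rewire arc').Mono (fill l' {A, B, C} (l' pB)) z := by
    rw [h.mono_p, h'.mono_z, fill_of_mem (e := A) (by simp), fill_of_mem (e := B) (by simp),
      fill_of_not_mem o6, fill_of_not_mem o2, hK _ o5, hK _ o6, hK _ o2]
    grind
  refine if_ctx_congr h2 (fun h3 => ?_) fun _ => rfl
  have h4 := h'.square.bubble.compat_opp hr hc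
  rw [Bool.not_false] at h4
  refine (zev_slide h h' harc (slideRel_pivot h.yp h.zp h.yz hs hp hy hz)
    (compat_update_iff D s p false l hl (h2.2 h3))
    (compat_update_iff (D.rewire arc') _ z false _ h4 h3) (fun e he => ?_) x).symm
  rw [fill_of_not_mem he, hK e he]

/-- The same term where the other two crossings are smoothed by `0`, `1` before the move. -/
theorem slide_pivot' (hD : D.NoSingle) (h : D.Tri y z p A B C yA yC zA zB pB pC)
    (h' : (D.rewire arc').Tri y z p A B C pB zB pC yC yA zA)
    (harc : ∀ c, c ≠ y → c ≠ z → c ≠ p → ∀ i, arc' c i = D.arc c i) {s s' : D.X → Bool}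
    (hs : SlideRel y z p s s') {l l' : D.E → Gen} (hl : D.Compat s l)
    (hl' : (D.rewire arc').Compat s' l') (hK : ∀ e ∉ ({A, B, C} : Set D.E), l' e = l e)
    (hp : s p = true) (hy : s y = false) (hz : s z = true) (x : D.Chain) :
    (if D.Mono l p then D.zev (Function.update s p false) l (stepJ (D.sqProj {p} y z) D.delta
        (D.sqTau {p} y z {A, B, C}) x) else 0) =
      if (D.rewire arc').Mono l' p then (D.rewire arc').zev (Function.update s' p false) l'
        (stepJ ((D.rewire arc').sqProj {p} y z) (D.rewire arc').delta
          ((D.rewire arc').sqTau {p} y z {A, B, C}) (D.slide arc' y z p {A, B, C} x)) else 0 := by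
  obtain ⟨-, hp', h3⟩ := slide_values h.yp h.zp hs
  obtain ⟨hy', hz'⟩ : s' y = true ∧ s' z = false := by
    rcases h3 with ⟨-, -, h3, -⟩ | ⟨-, h3, h4⟩
    · rw [hp] at h3
      exact absurd h3 (by simp)
    · rw [h3, h4]
      exact ⟨hz, hy⟩
  rw [hp] at hp'
  obtain ⟨o1, o2, o3, o4, o5, o6⟩ := h.out'
  have hm := ((D.compat_triple y z p s l).1 hl).2
  have hm' := (((D.rewire arc').compat_triple y z p s' l').1 hl').2
  rw [hy, hz, hp, h.y₀, h.z₁, h.p₁] at hm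
  rw [hy', hz', hp', h'.y₁, h'.z₀, h'.p₁, hK _ o1, hK _ o2, hK _ o3, hK _ o4, hK _ o5, hK _ o6]
    at hm'
  have h1 : D.Mono l p := by
    rw [h.mono_p]
    grind
  have hc := compat_update_iff D s p false l hl h1
  have hr : Reg {p} y z false true (Function.update s p false) :=
    ⟨by rintro _ rfl; simp, by rwa [Function.update_of_ne h.yp],
      by rwa [Function.update_of_ne h.zp]⟩
  have hr₀ : Reg {p} y z true false (Function.update s' p false) :=
    ⟨by rintro _ rfl; simp, by rwa [Function.update_of_ne h.yp],
      by rwa [Function.update_of_ne h.zp]⟩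
  have hJ := zev_stepJ_of_q (D := D.rewire arc') (I := {A, B, C}) (Or.inl hr₀) l'
    (D.slide arc' y z p {A, B, C} x)
  -- Now the small circle occurs before the move, and the detour through 110 is made on that side.
  rw [if_pos h1, h.square.zev_stepJ hD hr hc, hJ]
  have h2 : (D.rewire arc').Mono l' p ↔ D.Mono (fill l {A, B, C} (l yA)) z := by
    rw [h'.mono_p, h.mono_z, fill_of_mem (e := A) (by simp), fill_of_mem (e := B) (by simp),
      fill_of_not_mem o3, fill_of_not_mem o4, hK _ o1, hK _ o3]
    grind
  refine if_ctx_congr h2.symm (fun h3 => ?_) fun _ => rfl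
  have h4 := h.square.bubble.compat_opp hr hc
  rw [Bool.not_false] at h4
  refine (zev_slide h h' harc (SlideRel.symm h.yp h.zp
      (slideRel_pivot h.yp h.zp h.yz (hs.symm h.yp h.zp) hp' hy' hz'))
    (compat_update_iff D _ z false _ h4 (h2.1 h3))
    (compat_update_iff (D.rewire arc') s' p false l' hl' h3) (fun e he => ?_) x).symm
  rw [fill_of_not_mem he, hK e he]


theorem SlideRel.dom' {X : Type} {y z p : X} {s s' : X → Bool} (h : SlideRel y z p s s') :
    Reg {p} y z true false s ∨ Out {p} s := by
  rcases h with h | h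
  · exact Or.inl h.1
  · refine Or.inr fun h1 => ?_
    rw [h1 p rfl] at h
    exact absurd h.1 (by simp)

theorem exists_slideRel {X : Type} {y z p : X} (hy : y ≠ p) (hz : z ≠ p) {s' : X → Bool}
    (hs : Reg {p} y z true false s' ∨ Out {p} s') : ∃ s, SlideRel y z p s s' := by
  rcases hs with hs | hs
  · exact ⟨s', Or.inl ⟨hs, rfl⟩⟩
  · refine ⟨fun c => s' (Equiv.swap y z c), SlideRel.symm hy hz (Or.inr ⟨?_, rfl⟩)⟩
    by_contra h
    refine hs ?_
    rintro _ rfl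
    simpa using h

/-- The differentials of the reduced complexes before and after the move. -/
theorem slide_delta (hD : D.NoSingle) (hD' : (D.rewire arc').NoSingle)
    (h : D.Tri y z p A B C yA yC zA zB pB pC)
    (h' : (D.rewire arc').Tri y z p A B C pB zB pC yC yA zA)
    (harc : ∀ c, c ≠ y → c ≠ z → c ≠ p → ∀ i, arc' c i = D.arc c i) {s s' : D.X → Bool}
    (hs : SlideRel y z p s s') {l l' : D.E → Gen} (hl : D.Compat s l)
    (hl' : (D.rewire arc').Compat s' l') (hK : ∀ e ∉ ({A, B, C} : Set D.E), l' e = l e)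
    (x : D.Chain) :
    D.zev s l (D.delta (stepJ (D.sqProj {p} y z) D.delta (D.sqTau {p} y z {A, B, C}) x)) =
      (D.rewire arc').zev s' l' ((D.rewire arc').delta
        (stepJ ((D.rewire arc').sqProj {p} y z) (D.rewire arc').delta
          ((D.rewire arc').sqTau {p} y z {A, B, C}) (D.slide arc' y z p {A, B, C} x))) := by
  obtain ⟨hoff, hp', h3⟩ := slide_values h.yp h.zp hs
  have hval : ∀ c c' : D.X, D.Mono l c → (D.rewire arc').Mono l' c' →
      SlideRel y z p (Function.update s c false) (Function.update s' c' false) →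
      D.zev (Function.update s c false) l
        (stepJ (D.sqProj {p} y z) D.delta (D.sqTau {p} y z {A, B, C}) x) =
      (D.rewire arc').zev (Function.update s' c' false) l'
        (stepJ ((D.rewire arc').sqProj {p} y z) (D.rewire arc').delta
          ((D.rewire arc').sqTau {p} y z {A, B, C}) (D.slide arc' y z p {A, B, C} x)) := by
    intro c c' hc hc' hr
    have h1 := zev_stepJ_of_q (D := D.rewire arc') (I := {A, B, C}) (hr.symm h.yp h.zp).dom' l'
      (D.slide arc' y z p {A, B, C} x)
    rw [zev_stepJ_of_q hr.dom', h1]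
    exact (zev_slide h h' harc hr (compat_update_iff D s c false l hl hc)
      (compat_update_iff (D.rewire arc') s' c' false l' hl' hc') hK x).symm
  have e1 := D.zev_delta hD s l hl
    (stepJ (D.sqProj {p} y z) D.delta (D.sqTau {p} y z {A, B, C}) x)
  have e2 := (D.rewire arc').zev_delta hD' s' l' hl'
    (stepJ ((D.rewire arc').sqProj {p} y z) (D.rewire arc').delta
          ((D.rewire arc').sqTau {p} y z {A, B, C}) (D.slide arc' y z p {A, B, C} x))
  rw [sum_three h.yz h.yp h.zp] at e1 e2
  rw [e1, e2]
  refine congrArg₂ (· + ·) ?_ (Finset.sum_congr rfl fun c hc => ?_)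
  · rcases h3 with ⟨h3, h4, h5, h6, h7⟩ | ⟨h3, h4, h5⟩
    · have hr : Reg {p} y z true false s := ⟨by rintro _ rfl; exact h5, h3, h4⟩
      have hr' : Reg {p} y z true false s' := ⟨by rintro _ rfl; rw [hp']; exact h5, h6, h7⟩
      -- Over 100 the only edge at a corner is the one at `y`. It starts at 000, where `J` vanishes.
      have h8 := zev_stepJ_eq_zero (I := {A, B, C})
        (hr.update_y h.square.y_not_mem h.yz false) l x
      have h9 := zev_stepJ_eq_zero (D := D.rewire arc') (I := {A, B, C})
        (hr'.update_y h.square.y_not_mem h.yz false) l' (D.slide arc' y z p {A, B, C} x)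
      rw [h8, h9, h4, h5, h7, hp', h5]
      simp
    · obtain ⟨o1, o2, o3, o4, o5, o6⟩ := h.out'
      have hm := ((D.compat_triple y z p s l).1 hl).2
      have hm' := (((D.rewire arc').compat_triple y z p s' l').1 hl').2
      rw [h3, h.p₁] at hm
      rw [hp', h3, h'.p₁] at hm'
      -- With `p` smoothed by 1 the move interchanges the edges at `y` and at `z`.
      have hyz : s y = true ∧ D.Mono l y ↔ s' z = true ∧ (D.rewire arc').Mono l' z := by
        rw [h5]
        refine and_congr_right fun h6 => ?_
        rw [h6, h.y₁] at hm
        rw [h5, h6, h'.z₁] at hm'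
        rw [h.mono_y, h'.mono_z]
        rw [hK _ o1, hK _ o2, hK _ o3, hK _ o6] at *
        grind
      have hzy : s z = true ∧ D.Mono l z ↔ s' y = true ∧ (D.rewire arc').Mono l' y := by
        rw [h4]
        refine and_congr_right fun h6 => ?_
        rw [h6, h.z₁] at hm
        rw [h4, h6, h'.y₁] at hm'
        rw [h.mono_z, h'.mono_y]
        rw [hK _ o1, hK _ o3, hK _ o4, hK _ o5] at *
        grind
      refine congrArg₂ (· + ·) ((congrArg₂ (· + ·)
        (if_ctx_congr hyz (fun h6 => hval y z (hyz.2 h6).2 h6.2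
          (slideRel_update_y h.yp hs h3 false)) fun _ => rfl)
        (if_ctx_congr hzy (fun h6 => hval z y (hzy.2 h6).2 h6.2
          (slideRel_update_z h.yp h.zp hs h3 false)) fun _ => rfl)).trans (add_comm _ _)) ?_
      rw [hp']
      simp only [h3, true_and]
      -- If `y` and `z` have the same smoothing, the edge at `p` starts at 000 or 110, where `J`
      -- vanishes on both sides.
      have hzero : ∀ u, s y = u → s z = u → Reg {p} y z u u (Function.update s p false) ∧
          Reg {p} y z u u (Function.update s' p false) := by
        intro u h6 h7
        refine ⟨⟨by rintro _ rfl; simp, ?_, ?_⟩, ⟨by rintro _ rfl; simp, ?_, ?_⟩⟩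
        · rwa [Function.update_of_ne h.yp]
        · rwa [Function.update_of_ne h.zp]
        · rwa [Function.update_of_ne h.yp, h4]
        · rwa [Function.update_of_ne h.zp, h5]
      rcases Bool.eq_false_or_eq_true (s y) with hy | hy <;>
        rcases Bool.eq_false_or_eq_true (s z) with hz | hz
      · rw [zev_stepJ_eq_zero (hzero _ hy hz).1]
        have := zev_stepJ_eq_zero (D := D.rewire arc') (I := {A, B, C}) (hzero _ hy hz).2 l'
            (D.slide arc' y z p {A, B, C} x)
        rw [this, ite_self, ite_self]
      · exact slide_pivot hD' h h' harc hs hl hl' hK h3 hy hz x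
      · exact slide_pivot' hD h h' harc hs hl hl' hK h3 hy hz x
      · rw [zev_stepJ_eq_zero (hzero _ hy hz).1]
        have := zev_stepJ_eq_zero (D := D.rewire arc') (I := {A, B, C}) (hzero _ hy hz).2 l'
            (D.slide arc' y z p {A, B, C} x)
        rw [this, ite_self, ite_self]
  · simp only [Finset.mem_filter, Finset.mem_univ, true_and] at hc
    have h4 : s c = true ∧ D.Mono l c ↔ s' c = true ∧ (D.rewire arc').Mono l' c := by
      rw [hoff c hc.1 hc.2.1 hc.2.2]
      have h5 : ∀ i, l' (arc' c i) = l (D.arc c i) := fun i => by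
        rw [harc c hc.1 hc.2.1 hc.2.2]
        exact hK _ (h.off c hc.1 hc.2.1 hc.2.2 i)
      simp only [Mono, h5]
    exact if_ctx_congr h4 (fun h5 => hval c c (h4.2 h5).2 h5.2
      (slideRel_update hc.1 hc.2.1 hc.2.2 hs false)) fun _ => rfl

theorem biHom_slide (h : D.Tri y z p A B C yA yC zA zB pB pC)
    (h' : (D.rewire arc').Tri y z p A B C pB zB pC yC yA zA)
    (harc : ∀ c, c ≠ y → c ≠ z → c ≠ p → ∀ i, arc' c i = D.arc c i) :
    BiHom 0 0 (D.slide arc' y z p {A, B, C}) := by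
  have hw : ∀ s s' : D.X → Bool, SlideRel y z p s s' →
      (D.rewire arc').weight s' = D.weight s := by
    rintro s s' (⟨-, rfl⟩ | ⟨-, rfl⟩)
    · rfl
    · exact Equiv.sum_comp (Equiv.swap y z) fun c => if s c = true then (1 : ℤ) else 0
  refine biHom_trans (slide_trans h h' harc) (fun s s' hs => ?_) fun s s' hs => ?_
  · rw [hw s s' hs, add_zero]
    rfl
  · rw [hw s s' hs, add_zero]
    rfl

theorem slide_comp (h : D.Tri y z p A B C yA yC zA zB pB pC)
    (h' : (D.rewire arc').Tri y z p A B C pB zB pC yC yA zA)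
    (harc : ∀ c, c ≠ y → c ≠ z → c ≠ p → ∀ i, arc' c i = D.arc c i) (x : D.Chain) :
    slide (D.rewire arc') D.arc y z p {A, B, C} (D.slide arc' y z p {A, B, C} x) =
      D.sqProj {p} y z x := by
  have h1 := LinearMap.congr_fun (trans_symm_comp (slide_trans h h' harc)) x
  have h2 : (fun s => ∃ s', SlideRel y z p s s') =
      fun s => Reg {p} y z true false s ∨ Out {p} s := by
    funext s
    rw [eq_iff_iff]
    constructor
    · rintro ⟨s', hs⟩
      exact hs.dom'
    · intro hs
      obtain ⟨s', hs'⟩ := exists_slideRel h.yp h.zp hs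
      exact ⟨s', hs'.symm h.yp h.zp⟩
  rw [h2] at h1
  refine Eq.trans ?_ h1
  have h3 : slide (D.rewire arc') D.arc y z p {A, B, C} = trans (D := D.rewire arc') (D' := D)
      (fun s' s => SlideRel y z p s s') (fun e' e => OffRel {A, B, C} e e') := by
    have h4 : SlideRel y z p = fun s' s : D.X → Bool => SlideRel y z p s s' := by
      funext s s'
      rw [eq_iff_iff]
      exact ⟨fun hs => hs.symm h.yp h.zp, fun hs => hs.symm h.yp h.zp⟩
    have h5 : OffRel {A, B, C} = fun e' e : D.E => OffRel {A, B, C} e e' := by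
      funext e e'
      rw [eq_iff_iff]
      exact ⟨fun he => ⟨he.2 ▸ he.1, he.2.symm⟩, fun he => ⟨he.2 ▸ he.1, he.2.symm⟩⟩
    exact congrArg₂ (fun r k => trans (D := D.rewire arc') (D' := D) r k) h4 h5
  exact LinearMap.congr_fun h3 _

theorem slide_mem (hyp : y ≠ p) (hzp : z ≠ p) (I : Set D.E) (x : D.Chain) :
    D.slide arc' y z p I x ∈
      (D.rewire arc').part fun s => Reg {p} y z true false s ∨ Out {p} s :=
  trans_mem_part (D := D) (D' := D.rewire arc') x fun _ _ hs => (hs.symm hyp hzp).dom'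

/-- Khovanov's map for the third Reidemeister move. -/
noncomputable def slideMap (D : PD) (arc' : D.X → Fin 4 → D.E) (y z p : D.X) (I : Set D.E)
    (e₀ : D.E) : D.Chain →ₗ[ZMod 2] (D.rewire arc').Chain :=
  stepJ ((D.rewire arc').sqProj {p} y z) (D.rewire arc').d ((D.rewire arc').sqTau {p} y z I) ∘ₗ
    D.slide arc' y z p I ∘ₗ D.sqProj {p} y z ∘ₗ
      stepP D.d (D.sqTau {p} y z I) (D.sqEps {p} y z I e₀)

theorem slideMap_betaEquiv (hD : D.NoSingle) (hD' : (D.rewire arc').NoSingle)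
    (h : D.Tri y z p A B C yA yC zA zB pB pC)
    (h' : (D.rewire arc').Tri y z p A B C pB zB pC yC yA zA)
    (harc : ∀ c, c ≠ y → c ≠ z → c ≠ p → ∀ i, arc' c i = D.arc c i) :
    BetaEquiv (D.slideMap arc' y z p {A, B, C} A) := by
  have hS := h.square
  have hS' := h'.square
  have hτ := biHom_sqTau hS
  have hε := biHom_sqEps hS
  have hτ' := biHom_sqTau hS'
  have hε' := biHom_sqEps hS'
  have hq : BiHom 0 0 (D.sqProj {p} y z) := D.biHom_proj _
  have hq' : BiHom 0 0 ((D.rewire arc').sqProj {p} y z) := (D.rewire arc').biHom_proj _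
  obtain ⟨J₂, hJ⟩ := exp_stepJ hD hτ hq
  obtain ⟨J₂', hJ'⟩ := exp_stepJ hD' hτ' hq'
  have harc' : ∀ c, c ≠ y → c ≠ z → c ≠ p → ∀ i, D.arc c i = arc' c i :=
    fun c hy hz hp i => (harc c hy hz hp i).symm
  have hqθ : ∀ x, (D.rewire arc').sqProj {p} y z (D.slide arc' y z p {A, B, C} x) =
      D.slide arc' y z p {A, B, C} x := fun x =>
    (D.rewire arc').proj_eq_self (slide_mem h.yp h.zp _ x)
  have hqθ' : ∀ x, D.sqProj {p} y z (slide (D.rewire arc') D.arc y z p {A, B, C} x) =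
      slide (D.rewire arc') D.arc y z p {A, B, C} x := fun x =>
    D.proj_eq_self (slide_mem (D := D.rewire arc') h.yp h.zp _ x)
  refine betaEquiv_of_red hD hD' (hS.twoStep_delta hD).red (hS'.twoStep_delta hD').red hq hq'
    hJ hJ' (exp_stepP hD hτ hε) (exp_stepP hD' hτ' hε') (hτ.add hε) (hτ'.add hε')
    (biHom_slide h h' harc) (biHom_slide (D := D.rewire arc') h' h harc') (slide_comp h h' harc)
    (slide_comp (D := D.rewire arc') h' h harc') hqθ hqθ' fun x => ?_
  -- Over the smoothings that survive the elimination the identity is `slide_delta`; over the others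
  -- both sides vanish.
  refine (D.rewire arc').chain_ext fun s' l' hl' => ?_
  by_cases hs : Reg {p} y z true false s' ∨ Out {p} s'
  · obtain ⟨s, hr⟩ := exists_slideRel h.yp h.zp hs
    obtain ⟨l, hl, hK, hz⟩ := exists_zev_trans (slide_trans h h' harc) hr hl'
    have hKl : ∀ e ∉ ({A, B, C} : Set D.E), l' e = l e := fun e he => hK e e ⟨he, rfl⟩
    have h1 := slide_delta hD hD' h h' harc hr hl hl' hKl x
    have h2 := (D.rewire arc').zev_proj (fun s => Reg {p} y z true false s ∨ Out {p} s) s' l'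
      ((D.rewire arc').delta (stepJ ((D.rewire arc').sqProj {p} y z) (D.rewire arc').delta
          ((D.rewire arc').sqTau {p} y z {A, B, C}) (D.slide arc' y z p {A, B, C} x)))
    rw [if_pos hs] at h2
    refine Eq.trans ?_ (h1.trans h2.symm)
    rw [hz, zev_proj, if_pos hr.dom']
  · have h2 := (D.rewire arc').zev_proj (fun s => Reg {p} y z true false s ∨ Out {p} s) s' l'
      ((D.rewire arc').delta (stepJ ((D.rewire arc').sqProj {p} y z) (D.rewire arc').delta
          ((D.rewire arc').sqTau {p} y z {A, B, C}) (D.slide arc' y z p {A, B, C} x)))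
    rw [if_neg hs] at h2
    refine Eq.trans ?_ h2.symm
    exact zev_trans_eq_zero (D' := D.rewire arc') (fun s hr => hs (hr.symm h.yp h.zp).dom') l' _

end Slide

/-! ### Characterization of the map -/

section TwoStep

variable {M N : Type*} [AddCommGroup M] [Module (ZMod 2) M] [AddCommGroup N] [Module (ZMod 2) N]
  {p₀₀ p₀₁ p₁₀ p₁₁ n : Submodule (ZMod 2) M} {q δ τ ε : M →ₗ[ZMod 2] M}

/-- The subspaces on which Khovanov's map is prescribed span the complex: X₁ is `J p₁₀ + n`, X₂ is
`p₀₀ + δ p₀₀`, and X₃ is `τ p₁₁ + δ τ p₁₁`. The homotopy formula recovers `p₁₁`, and splitting with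
ε recovers `p₀₁`. -/
theorem TwoStep.eq_zero (h : TwoStep p₀₀ p₀₁ p₁₀ p₁₁ n q δ τ ε) (χ : M →ₗ[ZMod 2] N)
    (h₁₀ : ∀ a ∈ p₁₀, χ (stepJ q δ τ a) = 0) (hn : ∀ e ∈ n, χ e = 0) (h₀₀ : ∀ a ∈ p₀₀, χ a = 0)
    (hδ : ∀ a ∈ p₀₀, χ (δ a) = 0) (hτ : ∀ d ∈ p₁₁, χ (τ d) = 0)
    (hδτ : ∀ d ∈ p₁₁, χ (δ (τ d)) = 0) : χ = 0 := by
  have hτ' : ∀ x, χ (τ x) = 0 := fun x => by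
    obtain ⟨a, ha, b, hb, c, hc, d, hd, e, he, rfl⟩ := h.dec x
    simp only [map_add, h.τ₀₀ a ha, h.τ₀₁ b hb, h.τ₁₀ c hc, h.τn e he, map_zero, hτ d hd, add_zero]
  have hc' : ∀ c ∈ p₁₀, χ c = 0 := fun c hc => by
    have h1 := h₁₀ c hc
    rwa [stepJ_apply, map_add, hτ', add_zero, h.q₁₀ c hc] at h1
  have hd' : ∀ d ∈ p₁₁, χ d = 0 := fun d hd => by
    have h1 := hn _ (h.homotopy d hd)
    rwa [map_add, map_add, hδτ d hd, hτ', add_zero, zero_add] at h1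
  have hb' : ∀ b ∈ p₀₁, χ b = 0 := fun b hb => by
    have hv := h.ε_mem b
    obtain ⟨a', ha', b', hb', c', hc, e', he', h1⟩ := h.δ₀₀ _ hv
    have h2 : ε (b + b') = 0 := by
      have h3 := h.ε_δ _ hv
      rw [h1, map_add, map_add, map_add, h.ε₀₀ a' ha', h.ε₁₀ c' hc, h.εn e' he', zero_add,
        add_zero, add_zero] at h3
      rw [map_add, h3, ZModModule.add_self]
    obtain ⟨w, -, h4⟩ := h.split _ (Submodule.add_mem _ hb hb') h2
    have h5 := hδ _ hv
    rw [h1, map_add, map_add, map_add, h₀₀ a' ha', hc' c' hc, hn e' he', zero_add, add_zero,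
      add_zero] at h5
    have h6 := hτ' w
    rwa [← h4, map_add, h5, add_zero] at h6
  refine LinearMap.ext fun x => ?_
  obtain ⟨a, ha, b, hb, c, hc, d, hd, e, he, rfl⟩ := h.dec x
  simp only [map_add, h₀₀ a ha, hb' b hb, hc' c hc, hd' d hd, hn e he, LinearMap.zero_apply,
    add_zero]

end TwoStep

section R3

variable {D : PD} {y z p : D.X} {A B C yA yC zA zB pB pC : D.E} {arc' : D.X → Fin 4 → D.E}

theorem trans_mem_part_of {D D' : PD} {rel : (D.X → Bool) → (D'.X → Bool) → Prop}
    {K : D.E → D'.E → Prop} {P : (D.X → Bool) → Prop} {P' : (D'.X → Bool) → Prop} {f : D.Chain}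
    (hf : f ∈ D.part P) (h : ∀ s s', P s → rel s s' → P' s') : trans rel K f ∈ D'.part P' := by
  intro T hT
  rw [trans, ofRel_apply] at hT
  obtain ⟨S, _, hS⟩ := Finset.exists_ne_zero_of_sum_ne_zero hT
  split_ifs at hS with hR
  · exact h _ _ (hf S hS) hR.1
  · exact absurd rfl hS

theorem ofRel_congr_of_mem {D D' : PD} {R R' : D.State → D'.State → Prop}
    {P : (D.X → Bool) → Prop} {f : D.Chain} (hf : f ∈ D.part P)
    (h : ∀ S T, P S.smoothing → (R S T ↔ R' S T)) : ofRel R f = ofRel R' f := by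
  funext T
  rw [ofRel_apply, ofRel_apply]
  refine Finset.sum_congr rfl fun S _ => ?_
  by_cases hS : f S = 0
  · simp [hS]
  · simp only [h S T (hf S hS)]

theorem part3_eq (D : PD) (y z p : D.X) (u v : Bool) :
    D.part3 y z p u v false = D.part (Reg {p} y z u v) := by
  rw [part3]
  congr 1
  funext s
  simp only [Reg, Set.mem_singleton_iff, forall_eq, eq_iff_iff]
  tauto

theorem part_eq_out (D : PD) (p : D.X) : D.part (fun s => s p = true) = D.part (Out {p}) := by
  congr 1
  funext s
  simp [Out]

theorem Tri.r3Lift_eq (h : D.Tri y z p A B C yA yC zA zB pB pC) {a : D.Chain}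
    (ha : a ∈ D.part (Reg {p} y z true false)) : D.r3Lift {A, B, C} y z p a =
      stepJ (D.sqProj {p} y z) D.d (D.sqTau {p} y z {A, B, C}) a := by
  rw [stepJ_apply, sqProj, D.proj_eq_self (D.part_mono (fun _ => Or.inl) ha), r3Lift]
  simp only [LinearMap.add_apply, LinearMap.id_apply, LinearMap.comp_apply, tau, h.square.opp_y]
  congr 3
  refine congrArg D.proj ?_
  funext s
  simp only [Reg, Set.mem_singleton_iff, forall_eq, eq_iff_iff]
  tauto

theorem Tri.tensor_eq (h : D.Tri y z p A B C yA yC zA zB pB pC) {a : D.Chain}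
    (ha : a ∈ D.part (Reg {p} y z true true)) :
    D.tensor y {A, B, C} .one a = D.sqTau {p} y z {A, B, C} a :=
  (tau_eq_tensor (by rwa [h.square.opp_y])).symm

/-- `P` fixes the lift `J a`, and `q` takes it back to `a`. So the map slides `a` and lifts it
again, while on `n` neither `P` nor `J` has any effect. -/
theorem slideMap_lift (hD : D.NoSingle) (h : D.Tri y z p A B C yA yC zA zB pB pC)
    (hD' : (D.rewire arc').NoSingle)
    (h' : (D.rewire arc').Tri y z p A B C pB zB pC yC yA zA) {a b : D.Chain}
    (ha : a ∈ D.part (Reg {p} y z true false)) (hb : b ∈ D.part (Out {p})) :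
    D.slideMap arc' y z p {A, B, C} A (D.r3Lift {A, B, C} y z p a + b) =
      (D.rewire arc').r3Lift {A, B, C} y z p (D.slide arc' y z p {A, B, C} a) +
        D.slide arc' y z p {A, B, C} b := by
  have hts := h.square.twoStep_d hD
  have hts' := h'.square.twoStep_d hD'
  have ha' : D.slide arc' y z p {A, B, C} a ∈ (D.rewire arc').part (Reg {p} y z true false) := by
    refine trans_mem_part_of (D := D) (D' := D.rewire arc') ha fun s s' hs hr => ?_
    rcases hr with ⟨h1, rfl⟩ | ⟨h1, rfl⟩
    · exact hs
    · rw [hs.1 p rfl] at h1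
      exact absurd h1 (by simp)
  have hb' : D.slide arc' y z p {A, B, C} b ∈ (D.rewire arc').part (Out {p}) := by
    refine trans_mem_part_of (D := D) (D' := D.rewire arc') hb fun s s' hs hr => ?_
    exact (hr.symm h.yp h.zp).dom'.resolve_left fun h1 => hs fun c hc => by
      rw [Set.mem_singleton_iff.1 hc, ← (slide_values h.yp h.zp hr).2.1, h1.1 p rfl]
  rw [h.r3Lift_eq ha, h'.r3Lift_eq ha', slideMap]
  simp only [LinearMap.comp_apply, map_add]
  rw [hts.stepP_stepJ, hts.q_stepJ, hts.stepPn hb, hts.qn b hb, hts.q₁₀ a ha, hts'.stepJn hb']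

theorem slideMap_eq_zero (hD : D.NoSingle) (h : D.Tri y z p A B C yA yC zA zB pB pC)
    {x x' : D.Chain}
    (hx : stepP D.d (D.sqTau {p} y z {A, B, C}) (D.sqEps {p} y z {A, B, C} A) x = 0)
    (hx' : stepP D.d (D.sqTau {p} y z {A, B, C}) (D.sqEps {p} y z {A, B, C} A) x' = 0) :
    D.slideMap arc' y z p {A, B, C} A (x + D.d x') = 0 := by
  have h2 := (h.square.twoStep_d hD).stepP_δ x'
  rw [hx', map_zero] at h2
  simp only [slideMap, LinearMap.comp_apply, map_add]
  rw [hx]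
  erw [h2]
  simp

variable {t : Fin 3 → D.X} {k : Fin 3 → Fin 4}

theorem r3f_eq_slide {a : D.Chain} (ha : a ∈ D.part (Reg {p} y z true false)) :
    D.r3f t k y z p a = D.slide (D.r3 t k).arc y z p (D.sides t k) a := by
  refine ofRel_congr_of_mem (D' := D.r3 t k) ha fun S T hS => ?_
  constructor
  · rintro ⟨-, h2, h3⟩
    refine ⟨Or.inl ⟨hS, funext h2⟩, ?_⟩
    rintro e e' ⟨he, rfl⟩
    exact h3 _ he
  · rintro ⟨⟨-, h1⟩ | ⟨h1, -⟩, h3⟩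
    · exact ⟨⟨hS.2.1, hS.2.2, hS.1 p rfl⟩, congrFun h1, fun e he => h3 e e ⟨he, rfl⟩⟩
    · rw [hS.1 p rfl] at h1
      exact absurd h1 (by simp)

theorem r3g_eq_slide {b : D.Chain} (hb : b ∈ D.part (Out {p})) :
    D.r3g t k y z p b = D.slide (D.r3 t k).arc y z p (D.sides t k) b := by
  refine ofRel_congr_of_mem (D' := D.r3 t k) hb fun S T hS => ?_
  constructor
  · rintro ⟨h1, h2, h3⟩
    refine ⟨Or.inr ⟨h1, funext h2⟩, ?_⟩
    rintro e e' ⟨he, rfl⟩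
    exact h3 _ he
  · rintro ⟨⟨h1, -⟩ | ⟨h1, h2⟩, h3⟩
    · exact absurd h1.1 hS
    · exact ⟨h1, congrFun h2, fun e he => h3 e e ⟨he, rfl⟩⟩

theorem isR3Map_slideMap (hD : D.NoSingle) (hD' : (D.r3 t k).NoSingle)
    (h : D.Tri y z p A B C yA yC zA zB pB pC)
    (h' : (D.rewire (D.r3 t k).arc).Tri y z p A B C pB zB pC yC yA zA)
    (hI : D.sides t k = {A, B, C}) :
    D.IsR3Map t k y z p (D.slideMap (D.r3 t k).arc y z p (D.sides t k) A) := by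
  refine ⟨fun a ha b hb => ?_, fun a ha b hb => ?_, fun a ha b hb => ?_⟩
  · rw [part3_eq] at ha
    rw [part_eq_out] at hb
    rw [r3f_eq_slide ha, r3g_eq_slide hb, hI]
    exact slideMap_lift hD h hD' h' ha hb
  · rw [part3_eq] at ha hb
    rw [hI]
    have hts := h.square.twoStep_d hD
    exact slideMap_eq_zero (D := D) (arc' := (D.r3 t k).arc) hD h (hts.stepP₀₀ ha) (hts.stepP₀₀ hb)
  · rw [part3_eq] at ha hb
    rw [hI, h.tensor_eq ha, h.tensor_eq hb]
    have hts := h.square.twoStep_d hD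
    exact slideMap_eq_zero (D := D) (arc' := (D.r3 t k).arc) hD h (hts.stepPτ a) (hts.stepPτ b)

theorem IsR3Map.unique (hD : D.NoSingle) (h : D.Tri y z p A B C yA yC zA zB pB pC)
    (hI : D.sides t k = {A, B, C}) {φ ψ : D.Chain →ₗ[ZMod 2] (D.r3 t k).Chain}
    (hφ : D.IsR3Map t k y z p φ) (hψ : D.IsR3Map t k y z p ψ) : ψ = φ := by
  refine sub_eq_zero.1 ((h.square.twoStep_d hD).eq_zero (ψ - φ) ?_ ?_ ?_ ?_ ?_ ?_)
  · intro a ha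
    have h1 := hφ.1 a (by rwa [part3_eq]) 0 (Submodule.zero_mem _)
    have h2 := hψ.1 a (by rwa [part3_eq]) 0 (Submodule.zero_mem _)
    rw [hI, h.r3Lift_eq ha, add_zero] at h1 h2
    exact sub_eq_zero.2 (h2.trans h1.symm)
  · intro b hb
    have h1 := hφ.1 0 (Submodule.zero_mem _) b (by rwa [part_eq_out])
    have h2 := hψ.1 0 (Submodule.zero_mem _) b (by rwa [part_eq_out])
    rw [map_zero, zero_add] at h1 h2
    exact sub_eq_zero.2 (h2.trans h1.symm)
  · intro a ha
    rw [← part3_eq] at ha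
    have h1 := hφ.2.1 a ha 0 (Submodule.zero_mem _)
    have h2 := hψ.2.1 a ha 0 (Submodule.zero_mem _)
    rw [map_zero, add_zero] at h1 h2
    exact sub_eq_zero.2 (h2.trans h1.symm)
  · intro a ha
    rw [← part3_eq] at ha
    have h1 := hφ.2.1 0 (Submodule.zero_mem _) a ha
    have h2 := hψ.2.1 0 (Submodule.zero_mem _) a ha
    rw [zero_add] at h1 h2
    exact sub_eq_zero.2 (h2.trans h1.symm)
  · intro a ha
    have h1 := hφ.2.2 a (by rwa [part3_eq]) 0 (Submodule.zero_mem _)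
    have h2 := hψ.2.2 a (by rwa [part3_eq]) 0 (Submodule.zero_mem _)
    rw [hI, map_zero, map_zero, add_zero, h.tensor_eq ha] at h1 h2
    exact sub_eq_zero.2 (h2.trans h1.symm)
  · intro a ha
    have h1 := hφ.2.2 0 (Submodule.zero_mem _) a (by rwa [part3_eq])
    have h2 := hψ.2.2 0 (Submodule.zero_mem _) a (by rwa [part3_eq])
    rw [hI, map_zero, zero_add, h.tensor_eq ha] at h1 h2
    exact sub_eq_zero.2 (h2.trans h1.symm)

end R3

/-! ### The third Reidemeister move -/

/-- The arcs at the corners of a triangle, listed from the positions `κ n`: the sides `a n`, and the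
outer arcs `u n`, `w n`. -/
structure TriArcs (D : PD) (t : Fin 3 → D.X) (κ : Fin 3 → Fin 4) (a u w : Fin 3 → D.E) : Prop where
  inj : Function.Injective t
  arc₀ : ∀ n, D.arc (t n) (κ n) = a n
  arc₁ : ∀ n, D.arc (t n) (κ n + 1) = a (n + 2)
  arc₂ : ∀ n, D.arc (t n) (κ n + 2) = u n
  arc₃ : ∀ n, D.arc (t n) (κ n + 3) = w n
  off : ∀ c, (∀ n, c ≠ t n) → ∀ i, D.arc c i ∉ Set.range a
  u_not : ∀ n, u n ∉ Set.range a
  w_not : ∀ n, w n ∉ Set.range a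
  a_inj : Function.Injective a

section

variable {D : PD} {t : Fin 3 → D.X} {κ : Fin 3 → Fin 4} {a u w : Fin 3 → D.E}

theorem TriArcs.loc_cut (h : D.TriArcs t κ a u w) (n : Fin 3) (l : D.E → Gen) :
    D.Loc (cut (κ n)) l (t n) ↔ l (a n) = l (a (n + 2)) ∧ l (u n) = l (w n) := by
  rw [PD.loc_cut, h.arc₀, h.arc₁, h.arc₂, h.arc₃]

theorem TriArcs.loc_not_cut (h : D.TriArcs t κ a u w) (n : Fin 3) (l : D.E → Gen) :
    D.Loc (!cut (κ n)) l (t n) ↔ l (a n) = l (w n) ∧ l (a (n + 2)) = l (u n) := by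
  rw [PD.loc_not_cut, h.arc₀, h.arc₁, h.arc₂, h.arc₃]

theorem TriArcs.loc_even (h : D.TriArcs t κ a u w) {n : Fin 3} (hn : Even (κ n : ℕ)) :
    (∀ l, D.Loc false l (t n) ↔ l (a n) = l (a (n + 2)) ∧ l (u n) = l (w n)) ∧
      ∀ l, D.Loc true l (t n) ↔ l (a n) = l (w n) ∧ l (a (n + 2)) = l (u n) := by
  have h1 := h.loc_cut n
  have h2 := h.loc_not_cut n
  rw [cut_of_even hn] at h1 h2
  exact ⟨h1, h2⟩

theorem TriArcs.loc_odd (h : D.TriArcs t κ a u w) {n : Fin 3} (hn : Odd (κ n : ℕ)) :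
    (∀ l, D.Loc true l (t n) ↔ l (a n) = l (a (n + 2)) ∧ l (u n) = l (w n)) ∧
      ∀ l, D.Loc false l (t n) ↔ l (a n) = l (w n) ∧ l (a (n + 2)) = l (u n) := by
  have h1 := h.loc_cut n
  have h2 := h.loc_not_cut n
  rw [cut_of_odd hn] at h1 h2
  exact ⟨h1, h2⟩

theorem range_fin_three {α : Type*} (f : Fin 3 → α) : Set.range f = {f 0, f 1, f 2} := by
  ext x
  simp only [Set.mem_range, Set.mem_insert_iff, Set.mem_singleton_iff, Fin.exists_fin_succ]
  simp [eq_comm]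

/-- The naming of the arcs for the pivot `t 0`. For the pivot `t 1`, in `tri₁`, the corners `y`,
`z`, `p` follow each other in the opposite direction, so the two ends at each corner change roles.
-/
theorem TriArcs.tri₀ (h : D.TriArcs t κ a u w) (h0 : Even (κ 0 : ℕ)) (h1 : Even (κ 1 : ℕ))
    (h2 : Odd (κ 2 : ℕ)) : D.Tri (t 1) (t 2) (t 0) (a 1) (a 2) (a 0) (w 1) (u 1) (u 2) (w 2) (u 0)
      (w 0) := by
  have hI : Set.range a = {a 1, a 2, a 0} := by
    rw [range_fin_three]
    grind
  obtain ⟨l00, l01⟩ := h.loc_even h0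
  obtain ⟨l10, l11⟩ := h.loc_even h1
  obtain ⟨l20, l21⟩ := h.loc_odd h2
  have e0 : (0 + 2 : Fin 3) = 2 := rfl
  have e1 : (1 + 2 : Fin 3) = 0 := rfl
  have e2 : (2 + 2 : Fin 3) = 1 := rfl
  rw [e0] at l00 l01
  rw [e1] at l10 l11
  rw [e2] at l20 l21
  refine ⟨h.inj.ne (by decide), h.inj.ne (by decide), h.inj.ne (by decide), h.a_inj.ne (by decide),
    h.a_inj.ne (by decide), h.a_inj.ne (by decide), ?_, ?_, ?_, ?_, ?_, ?_, ?_, ?_⟩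
  · intro l
    rw [l10]
    grind
  · intro l
    rw [l11]
  · intro l
    rw [l20]
    grind
  · intro l
    rw [l21]
    grind
  · intro l
    rw [l00]
    grind
  · intro l
    rw [l01]
    grind
  · intro c hy hz hp i
    rw [← hI]
    refine h.off c (fun n => ?_) i
    fin_cases n
    exacts [hp, hy, hz]
  · rw [← hI]
    rintro e (rfl | rfl | rfl | rfl | rfl | rfl)
    exacts [h.w_not 1, h.u_not 1, h.u_not 2, h.w_not 2, h.u_not 0, h.w_not 0]

theorem TriArcs.tri₁ (h : D.TriArcs t κ a u w) (h0 : Even (κ 0 : ℕ)) (h1 : Even (κ 1 : ℕ))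
    (h2 : Odd (κ 2 : ℕ)) : D.Tri (t 0) (t 2) (t 1) (a 2) (a 1) (a 0) (u 0) (w 0) (w 2) (u 2) (w 1)
      (u 1) := by
  have hI : Set.range a = {a 2, a 1, a 0} := by
    rw [range_fin_three]
    grind
  obtain ⟨l00, l01⟩ := h.loc_even h0
  obtain ⟨l10, l11⟩ := h.loc_even h1
  obtain ⟨l20, l21⟩ := h.loc_odd h2
  have e0 : (0 + 2 : Fin 3) = 2 := rfl
  have e1 : (1 + 2 : Fin 3) = 0 := rfl
  have e2 : (2 + 2 : Fin 3) = 1 := rfl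
  rw [e0] at l00 l01
  rw [e1] at l10 l11
  rw [e2] at l20 l21
  refine ⟨h.inj.ne (by decide), h.inj.ne (by decide), h.inj.ne (by decide), h.a_inj.ne (by decide),
    h.a_inj.ne (by decide), h.a_inj.ne (by decide), ?_, ?_, ?_, ?_, ?_, ?_, ?_, ?_⟩
  · intro l
    rw [l00]
    grind
  · intro l
    rw [l01]
    grind
  · intro l
    rw [l20]
    grind
  · intro l
    rw [l21]
  · intro l
    rw [l10]
    grind
  · intro l
    rw [l11]
  · intro c hy hz hp i
    rw [← hI]
    refine h.off c (fun n => ?_) i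
    fin_cases n
    exacts [hy, hp, hz]
  · rw [← hI]
    rintro e (rfl | rfl | rfl | rfl | rfl | rfl)
    exacts [h.u_not 0, h.w_not 0, h.w_not 2, h.u_not 2, h.w_not 1, h.u_not 1]

end

section R3

variable {D : PD} {t : Fin 3 → D.X} {k : Fin 3 → Fin 4}

theorem IsTriangle.triArcs (hp : ∀ h, ∃! h', h' ≠ h ∧ D.lab h' = D.lab h) (h : D.IsTriangle t k) :
    D.TriArcs t k (fun n => D.arc (t n) (k n)) (fun n => D.arc (t n) (k n + 2))
      (fun n => D.arc (t n) (k n + 3)) := by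
  have hs : ∀ n j, j ≠ 0 → j ≠ 1 → D.arc (t n) (k n + j) ∉ D.sides t k := fun n j h0 h1 he => by
    obtain ⟨m, hm, hi⟩ := arc_mem_sides hp h he
    rw [← h.1 hm] at hi
    rcases hi with hi | hi
    · exact h0 (by simpa using hi)
    · exact h1 (by simpa using hi)
  refine ⟨h.1, fun _ => rfl, fun n => ?_, fun _ => rfl, fun _ => rfl, fun c hc i he => ?_,
    fun n => hs n 2 (by decide) (by decide), fun n => hs n 3 (by decide) (by decide),
    fun n m hnm => ?_⟩
  · have := h.2 (n + 2)
    rw [(by decide : ∀ m : Fin 3, m + 2 + 1 = m) n] at this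
    exact this.symm
  · obtain ⟨m, hm, -⟩ := arc_mem_sides hp h he
    exact hc m hm
  · by_contra hne
    have h1 := eq_other hp (h := (t n, k n)) (h' := (t m, k m))
      (fun he => hne (h.1 (congrArg Prod.fst he)).symm) hnm.symm
    have h2 := eq_other hp (h := (t n, k n)) (h' := (t (n + 1), k (n + 1) + 1)) (fun he =>
      (by decide : ∀ m : Fin 3, m + 1 ≠ m) n (h.1 (congrArg Prod.fst he))) (h.2 n).symm
    have h3 := h1.trans h2.symm
    obtain rfl := h.1 (congrArg Prod.fst h3)
    exact (by decide : ∀ j : Fin 4, j ≠ j + 1) _ (congrArg Prod.snd h3)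

/-- After the move the triangle lies in the opposite corner of each of its crossings. Adding 2 keeps
the parity, so the same smoothings cut it off. -/
theorem IsTriangle.triArcs_r3 (hp : ∀ h, ∃! h', h' ≠ h ∧ D.lab h' = D.lab h)
    (h : D.IsTriangle t k) :
    (D.rewire (D.r3 t k).arc).TriArcs t (fun n => k n + 2) (fun n => D.arc (t n) (k n))
      (fun n => D.arc (t (n + 1)) (k (n + 1) + 3))
      (fun n => D.arc (t (n + 2)) (k (n + 2) + 2)) := by
  have hT := h.triArcs hp
  have h22 : ∀ j : Fin 4, j + 2 + 2 = j + 0 := by decide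
  have h23 : ∀ j : Fin 4, j + 2 + 3 = j + 1 := by decide
  have h21 : ∀ j : Fin 4, j + 2 + 1 = j + 3 := by decide
  refine ⟨h.1, fun n => r3_arc h.1 n 2, fun n => ?_, fun n => ?_, fun n => ?_, fun c hc i => ?_,
    fun n => hT.w_not _, fun n => hT.u_not _, hT.a_inj⟩
  · rw [h21]
    exact (r3_arc h.1 n 3).trans (hT.arc₁ n)
  · rw [h22]
    exact r3_arc h.1 n 0
  · rw [h23]
    exact r3_arc h.1 n 1
  · have h1 : (D.r3 t k).arc c i = D.arc c i :=
      r3_arc_of_ne (D := D) c i hc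
    rintro ⟨n, hn⟩
    exact hT.off c hc i ⟨n, hn.trans h1⟩

theorem r3_tri (hp : ∀ h, ∃! h', h' ≠ h ∧ D.lab h' = D.lab h) (h : D.IsTriangle t k)
    (h0 : Even (k 0 : ℕ)) (h1 : Even (k 1 : ℕ)) (h2 : Odd (k 2 : ℕ)) {y q : D.X}
    (hy : (q = t 0 ∧ y = t 1) ∨ (q = t 1 ∧ y = t 0)) :
    ∃ A B C yA yC zA zB pB pC, D.Tri y (t 2) q A B C yA yC zA zB pB pC ∧
      (D.rewire (D.r3 t k).arc).Tri y (t 2) q A B C pB zB pC yC yA zA ∧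
      D.sides t k = {A, B, C} ∧ ∀ c, c ≠ y → c ≠ t 2 → c ≠ q → ∀ i,
        (D.r3 t k).arc c i = D.arc c i := by
  have hT := h.triArcs hp
  have hT' := h.triArcs_r3 hp
  have he : ∀ j : Fin 4, Even (j : ℕ) → Even ((j + 2 : Fin 4) : ℕ) := by decide
  have ho : ∀ j : Fin 4, Odd (j : ℕ) → Odd ((j + 2 : Fin 4) : ℕ) := by decide
  have hs : D.sides t k = {D.arc (t 0) (k 0), D.arc (t 1) (k 1), D.arc (t 2) (k 2)} :=
    range_fin_three _
  rcases hy with ⟨rfl, rfl⟩ | ⟨rfl, rfl⟩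
  · refine ⟨_, _, _, _, _, _, _, _, _, hT.tri₀ h0 h1 h2, hT'.tri₀ (he _ h0) (he _ h1) (ho _ h2),
      ?_, fun c hy hz hp i => r3_arc_of_ne c i fun n => ?_⟩
    · rw [hs]
      grind
    · fin_cases n
      exacts [hp, hy, hz]
  · refine ⟨_, _, _, _, _, _, _, _, _, hT.tri₁ h0 h1 h2, hT'.tri₁ (he _ h0) (he _ h1) (ho _ h2),
      ?_, fun c hy hz hp i => r3_arc_of_ne c i fun n => ?_⟩
    · rw [hs]
      grind
    · fin_cases n
      exacts [hy, hp, hz]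

theorem r3_betaEquiv (hG : D.Good) (h : D.IsTriangle t k)
    (h0 : Even (k 0 : ℕ)) (h1 : Even (k 1 : ℕ)) (h2 : Odd (k 2 : ℕ)) {y q : D.X}
    (hy : (q = t 0 ∧ y = t 1) ∨ (q = t 1 ∧ y = t 0)) :
    ∃ φ, D.IsR3Map t k y (t 2) q φ ∧ (∀ ψ, D.IsR3Map t k y (t 2) q ψ → ψ = φ) ∧
      BetaEquiv φ := by
  obtain ⟨A, B, C, yA, yC, zA, zB, pB, pC, hT, hT', hs, harc⟩ := r3_tri hG.pairing h h0 h1 h2 hy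
  have hD := hG.noSingle
  have hD' := (hG.r3 h).noSingle
  have hφ := isR3Map_slideMap hD hD' hT hT' hs
  refine ⟨_, hφ, fun ψ hψ => hφ.unique hD hT hs hψ, ?_⟩
  rw [hs]
  exact slideMap_betaEquiv hD hD' hT hT' harc

end R3

end PD
end KhBeta

namespace KhBeta

/-- Exchange `1` and `x`. -/
def Gen.swap : Gen → Gen
  | .one => .x
  | .x => .one

theorem Gen.swap_swap (g : Gen) : g.swap.swap = g := by cases g <;> rfl

theorem Gen.deg_swap (g : Gen) : g.swap.deg = -g.deg := by cases g <;> rfl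

namespace PD
open scoped Classical

/-! ### Mirror images -/

/-- `M` is the mirror image of `D`, up to renaming. -/
structure Mirror (D M : PD) where
  onX : D.X ≃ M.X
  onE : D.E ≃ M.E
  arc_eq : ∀ c i, M.arc (onX c) i = onE (D.arc c (i + 1))
  pos_eq : ∀ c, M.pos (onX c) = !D.pos c

namespace Mirror

variable {D M : PD} (μ : Mirror D M)

/-- The opposite smoothing. -/
def smoothing (s : D.X → Bool) (c : M.X) : Bool := !s (μ.onX.symm c)

theorem smoothing_onX (s : D.X → Bool) (c : D.X) : μ.smoothing s (μ.onX c) = !s c := by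
  simp [smoothing]

theorem smoothing_update (s : D.X → Bool) (c : D.X) (b : Bool) :
    μ.smoothing (Function.update s c b) = Function.update (μ.smoothing s) (μ.onX c) (!b) := by
  funext c'
  obtain ⟨c', rfl⟩ := μ.onX.surjective c'
  by_cases h : c' = c
  · subst h
    simp [smoothing]
  · simp [smoothing, h]

/-- Renumbering the ends by one step exchanges the two smoothings of a crossing. -/
theorem compat_iff (s : D.X → Bool) (l : M.E → Gen) :
    M.Compat (μ.smoothing s) l ↔ D.Compat s fun e => l (μ.onE e) := by
  rw [compat_iff_loc, compat_iff_loc, μ.onX.forall_congr_left]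
  refine forall_congr' fun c => ?_
  obtain ⟨c, rfl⟩ := μ.onX.surjective c
  rw [Equiv.symm_apply_apply, μ.smoothing_onX]
  have h1 : (0 + 1 : Fin 4) = 1 := rfl
  have h2 : (1 + 1 : Fin 4) = 2 := rfl
  have h3 : (2 + 1 : Fin 4) = 3 := rfl
  have h4 : (3 + 1 : Fin 4) = 0 := rfl
  simp only [Loc, μ.arc_eq, h1, h2, h3, h4]
  cases s c <;> simp only [Bool.not_true, Bool.not_false, true_implies, reduceCtorEq,
    false_implies, and_true, true_and] <;> grind

theorem circ_eq_iff (s : D.X → Bool) (e f : D.E) :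
    M.circ (μ.smoothing s) (μ.onE e) = M.circ (μ.smoothing s) (μ.onE f) ↔
      D.circ s e = D.circ s f := by
  rw [PD.circ_eq_iff, PD.circ_eq_iff]
  constructor
  · intro h l hl
    have := h (fun e => l (μ.onE.symm e)) ((μ.compat_iff s _).2 (by simpa using hl))
    simpa using this
  · exact fun h l hl => h _ ((μ.compat_iff s l).1 hl)

theorem smoothing_surjective (s' : M.X → Bool) : ∃ s, μ.smoothing s = s' :=
  ⟨fun c => !s' (μ.onX c), by funext c; simp [smoothing]⟩

theorem noSingle_iff (μ : Mirror D M) : M.NoSingle ↔ D.NoSingle := by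
  have h3 : ∀ s : D.X → Bool, ∀ c, (M.circ (μ.smoothing s) (M.arc (μ.onX c) 0) =
      M.circ (μ.smoothing s) (M.arc (μ.onX c) 2) ↔
      D.circ s (D.arc c 0) = D.circ s (D.arc c 2)) := fun s c => by
    rw [μ.arc_eq, μ.arc_eq, μ.circ_eq_iff, PD.circ_eq_iff, PD.circ_eq_iff]
    refine forall_congr' fun l => forall_congr' fun hl => ?_
    have h4 : D.Loc (s c) l c := hl c
    change l (D.arc c 1) = l (D.arc c 3) ↔ _
    cases h5 : s c <;> simp only [Loc, h5, true_implies, reduceCtorEq,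
      false_implies, and_true, true_and] at h4 <;> grind
  have key : ∀ s c b, (M.circ (μ.smoothing s) (M.arc (μ.onX c) 0) =
        M.circ (μ.smoothing s) (M.arc (μ.onX c) 2) ↔
      M.circ (Function.update (μ.smoothing s) (μ.onX c) (!b)) (M.arc (μ.onX c) 0) ≠
        M.circ (Function.update (μ.smoothing s) (μ.onX c) (!b)) (M.arc (μ.onX c) 2)) ↔
      (D.circ s (D.arc c 0) = D.circ s (D.arc c 2) ↔
      D.circ (Function.update s c b) (D.arc c 0) ≠ D.circ (Function.update s c b) (D.arc c 2)) := by
    intro s c b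
    rw [← μ.smoothing_update, h3, ne_eq, h3]
  constructor
  · intro hM s c b hb
    exact (key s c b).1 (hM _ _ _ (by rw [μ.smoothing_onX]; simpa using hb))
  · intro hD s c b hb
    obtain ⟨s, rfl⟩ := μ.smoothing_surjective s
    obtain ⟨c, rfl⟩ := μ.onX.surjective c
    rw [μ.smoothing_onX] at hb
    have := (key s c (!b)).2 (hD s c (!b) (by cases b <;> simp_all))
    rwa [Bool.not_not] at this

/-- The corresponding state of the mirror image. -/
def state (S : D.State) : M.State :=
  M.mkState (μ.smoothing S.smoothing) (fun e => (S.label (μ.onE.symm e)).swap)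
    ((μ.compat_iff _ _).2 fun c => by
      have := S.compat c
      simp only [Equiv.symm_apply_apply]
      exact ⟨fun h => ⟨congrArg _ (this.1 h).1, congrArg _ (this.1 h).2⟩,
        fun h => ⟨congrArg _ (this.2 h).1, congrArg _ (this.2 h).2⟩⟩)

theorem state_smoothing (S : D.State) : (μ.state S).smoothing = μ.smoothing S.smoothing := rfl

theorem state_label (S : D.State) (e : D.E) :
    (μ.state S).label (μ.onE e) = (S.label e).swap := by
  rw [state, mkState_label, Equiv.symm_apply_apply]

theorem state_circ (S : D.State) (e f : D.E) :
    (μ.state S).circ (μ.onE e) = (μ.state S).circ (μ.onE f) ↔ S.circ e = S.circ f :=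
  μ.circ_eq_iff _ e f

theorem state_bijective : Function.Bijective μ.state := by
  constructor
  · intro S T h
    refine State.ext' (funext fun c => ?_) fun e => ?_
    · have := congrFun (congrArg State.smoothing h) (μ.onX c)
      rw [state_smoothing, state_smoothing, smoothing_onX, smoothing_onX] at this
      simpa using this
    · have h1 := μ.state_label S e
      rw [h, state_label] at h1
      rw [← Gen.swap_swap (S.label e), ← h1, Gen.swap_swap]
  · intro T
    obtain ⟨s, hs⟩ := μ.smoothing_surjective T.smoothing
    refine ⟨D.mkState s (fun e => (T.label (μ.onE e)).swap) ?_, State.ext' hs fun e => ?_⟩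
    · have := T.compat
      rw [← hs, μ.compat_iff] at this
      have h1 : D.Compat s fun e => T.label (μ.onE e) := this
      intro c
      have := h1 c
      exact ⟨fun h => ⟨congrArg _ (this.1 h).1, congrArg _ (this.1 h).2⟩,
        fun h => ⟨congrArg _ (this.2 h).1, congrArg _ (this.2 h).2⟩⟩
    · obtain ⟨e, rfl⟩ := μ.onE.surjective e
      exact (μ.state_label _ e).trans (Gen.swap_swap _)

noncomputable def stateEquiv : D.State ≃ M.State := Equiv.ofBijective μ.state μ.state_bijective

theorem nNeg_eq (μ : Mirror D M) : M.nNeg = D.nPos := by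
  rw [nNeg, nPos, ← μ.onX.sum_comp]
  refine Finset.sum_congr rfl fun c _ => ?_
  rw [μ.pos_eq]
  cases D.pos c <;> rfl

theorem nPos_eq (μ : Mirror D M) : M.nPos = D.nNeg := by
  rw [nNeg, nPos, ← μ.onX.sum_comp]
  refine Finset.sum_congr rfl fun c _ => ?_
  rw [μ.pos_eq]
  cases D.pos c <;> rfl

theorem weight_eq (s : D.X → Bool) :
    M.weight (μ.smoothing s) = D.nPos + D.nNeg - D.weight s := by
  rw [weight, weight, nPos, nNeg, ← μ.onX.sum_comp, ← Finset.sum_add_distrib,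
    ← Finset.sum_sub_distrib]
  refine Finset.sum_congr rfl fun c _ => ?_
  rw [smoothing_onX]
  cases D.pos c <;> cases s c <;> rfl

theorem hdeg_eq (S : D.State) : (μ.state S).hdeg = -S.hdeg := by
  rw [State.hdeg, State.hdeg, state_smoothing, weight_eq, μ.nNeg_eq]
  ring

theorem degSum_eq (S : D.State) : (μ.state S).degSum = -S.degSum := by
  have key := sum_circ_eq (D := D) (D' := M) (s := S.smoothing) (s' := (μ.state S).smoothing)
    (fun _ => True) μ.onE (fun e _ f _ => (μ.circ_eq_iff _ e f).symm)
    (fun γ => -(S.val γ).deg) (fun γ => ((μ.state S).val γ).deg)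
    (fun e _ => (congrArg Gen.deg (μ.state_label S e)).trans (Gen.deg_swap _))
  have hA : ∀ γ, ∃ e, True ∧ D.circ S.smoothing e = γ := fun γ => by
    obtain ⟨e, rfl⟩ := D.circ_surj _ γ
    exact ⟨e, trivial, rfl⟩
  have hA' : ∀ γ, ∃ e, True ∧ M.circ (μ.state S).smoothing (μ.onE e) = γ := fun γ => by
    obtain ⟨e, rfl⟩ := M.circ_surj _ γ
    exact ⟨μ.onE.symm e, trivial, by simp⟩
  simp only [hA, hA', Finset.filter_true, Finset.sum_neg_distrib] at key
  exact key.symm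

theorem qdeg_eq (S : D.State) : (μ.state S).qdeg = -S.qdeg := by
  rw [State.qdeg_eq, State.qdeg_eq, degSum_eq, state_smoothing, weight_eq, μ.nNeg_eq, μ.nPos_eq]
  ring

/-- An edge of the cube read backwards is an edge for the mirror image, with merges and splits
exchanged. The hypotheses on `m` and `Δ` express that they are transposes of each other once 1 and
`x` are exchanged; this holds for the structure constants of ∂ and for those of β. -/
theorem edgeCoeff_eq (hD : D.NoSingle) {m Δ : Gen → Gen → Gen → ZMod 2}
    (h₁ : ∀ a b c, Δ c.swap a.swap b.swap = m a b c)
    (h₂ : ∀ a b c, m b.swap a.swap c.swap = Δ c a b) (c : D.X) (S T : D.State) :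
    M.edgeCoeff m Δ (μ.onX c) (μ.state T) (μ.state S) = D.edgeCoeff m Δ c S T := by
  have hcond : ((μ.state T).smoothing (μ.onX c) = false ∧ (μ.state S).smoothing =
        Function.update (μ.state T).smoothing (μ.onX c) true ∧
        ∀ e, (μ.state T).circ e ≠ (μ.state T).circ (M.arc (μ.onX c) 0) →
          (μ.state T).circ e ≠ (μ.state T).circ (M.arc (μ.onX c) 2) →
          (μ.state S).label e = (μ.state T).label e) ↔
      S.smoothing c = false ∧ T.smoothing = Function.update S.smoothing c true ∧
        ∀ e, S.circ e ≠ S.circ (D.arc c 0) → S.circ e ≠ S.circ (D.arc c 2) →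
          T.label e = S.label e := by
    have e1 : (μ.state T).smoothing (μ.onX c) = false ∧ (μ.state S).smoothing =
        Function.update (μ.state T).smoothing (μ.onX c) true ↔
      S.smoothing c = false ∧ T.smoothing = Function.update S.smoothing c true := by
      have h3 : Function.update (μ.state T).smoothing (μ.onX c) true =
          (μ.smoothing (Function.update T.smoothing c false)) := by
        rw [μ.smoothing_update]
        rfl
      have h4 : ∀ s t : D.X → Bool, μ.smoothing s = μ.smoothing t ↔ s = t := fun s t => by
        refine ⟨fun h => funext fun c => ?_, fun h => h ▸ rfl⟩
        have := congrFun h (μ.onX c)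
        simpa [smoothing_onX] using this
      rw [h3, state_smoothing, state_smoothing, smoothing_onX, h4]
      constructor
      · rintro ⟨h5, h6⟩
        refine ⟨by rw [h6, Function.update_self], ?_⟩
        rw [h6, Function.update_idem]
        exact (Function.update_eq_self_iff.2 (by simpa using h5.symm)).symm
      · rintro ⟨h5, h6⟩
        refine ⟨by rw [h6, Function.update_self]; rfl, ?_⟩
        rw [h6, Function.update_idem]
        exact (Function.update_eq_self_iff.2 h5.symm).symm
    rw [← and_assoc, e1, ← and_assoc]
    refine and_congr_right fun ⟨hs, ht⟩ => ?_
    -- The ends `0` and `2` of the mirror image are `1` and `3` here. They lie on the same circles,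
    -- and an arc avoids `c` before the change of smoothing exactly if it does so afterwards.
    have e2 : ∀ e, ((μ.state T).circ (μ.onE e) ≠ (μ.state T).circ (M.arc (μ.onX c) 0) ∧
        (μ.state T).circ (μ.onE e) ≠ (μ.state T).circ (M.arc (μ.onX c) 2)) ↔
        (S.circ e ≠ S.circ (D.arc c 0) ∧ S.circ e ≠ S.circ (D.arc c 2)) := fun e => by
      rw [μ.arc_eq, μ.arc_eq, Ne, Ne, state_circ, state_circ]
      have h3 := D.off_update_iff S.smoothing c e true
      rw [← ht] at h3
      refine Iff.trans ?_ h3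
      constructor
      · intro h4
        have h5 : T.circ (D.arc c 1) = T.circ (D.arc c 2) :=
          circ_eq_of_joined ⟨c, by simp [ht]⟩
        have h6 : T.circ (D.arc c 0) = T.circ (D.arc c 3) :=
          circ_eq_of_joined ⟨c, by simp [ht]⟩
        exact ⟨fun h7 => h4.2 (h7.trans h6), fun h7 => h4.1 (h7.trans h5.symm)⟩
      · exact fun h4 => ⟨h4.circ_ne _, h4.circ_ne _⟩
    rw [μ.onE.forall_congr_left]
    refine forall_congr' fun e => ?_
    obtain ⟨e, rfl⟩ := μ.onE.surjective e
    rw [← and_imp, ← and_imp, Equiv.symm_apply_apply, e2, state_label, state_label]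
    refine imp_congr_right fun _ => ⟨fun h => ?_, fun h => by rw [h]⟩
    rw [← Gen.swap_swap (T.label e), ← h, Gen.swap_swap]
  rw [edgeCoeff, edgeCoeff]
  refine if_ctx_congr hcond (fun h => ?_) fun _ => rfl
  obtain ⟨hs, ht, -⟩ := h
  have hN := hD S.smoothing c true (by simp [hs])
  rw [← ht] at hN
  have s01 : S.circ (D.arc c 0) = S.circ (D.arc c 1) := circ_eq_of_joined ⟨c, by simp [hs]⟩
  have s23 : S.circ (D.arc c 2) = S.circ (D.arc c 3) := circ_eq_of_joined ⟨c, by simp [hs]⟩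
  have t03 : T.circ (D.arc c 0) = T.circ (D.arc c 3) := circ_eq_of_joined ⟨c, by simp [ht]⟩
  have t12 : T.circ (D.arc c 1) = T.circ (D.arc c 2) := circ_eq_of_joined ⟨c, by simp [ht]⟩
  have hm0 : M.arc (μ.onX c) 0 = μ.onE (D.arc c 1) := μ.arc_eq c 0
  have hm2 : M.arc (μ.onX c) 2 = μ.onE (D.arc c 3) := μ.arc_eq c 2
  have ls0 : S.label (D.arc c 0) = S.label (D.arc c 1) := congrArg S.val s01
  have ls2 : S.label (D.arc c 2) = S.label (D.arc c 3) := congrArg S.val s23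
  have lt0 : T.label (D.arc c 0) = T.label (D.arc c 3) := congrArg T.val t03
  have lt1 : T.label (D.arc c 1) = T.label (D.arc c 2) := congrArg T.val t12
  change S.circ (D.arc c 0) = S.circ (D.arc c 2) ↔ T.circ (D.arc c 0) ≠ T.circ (D.arc c 2) at hN
  simp only [ne_eq]
  rw [hm0, hm2, state_circ, state_circ, state_label, state_label, state_label, state_label,
    ← s01, ← s23, ← t03, t12, ← ls0, ← ls2, ← lt0, lt1, h₁, h₂]
  by_cases h : S.circ (D.arc c 0) = S.circ (D.arc c 2)
  · have h' := hN.1 h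
    rw [if_pos (fun h3 => h' h3.symm), if_neg (not_not.2 h), if_pos h']
  · have h' : T.circ (D.arc c 0) = T.circ (D.arc c 2) := not_not.1 (mt hN.2 h)
    rw [if_neg (not_not.2 h'.symm), if_pos h, if_pos h]
    congr 1
    exact (congrArg T.val h').symm

end Mirror

/-! ### Transposed maps -/

section Dual

variable {D₁ M₁ D₂ M₂ D₃ M₃ : PD} (μ₁ : Mirror D₁ M₁) (μ₂ : Mirror D₂ M₂) (μ₃ : Mirror D₃ M₃)

/-- The transpose of a linear map, on the chains of the mirror images. -/
noncomputable def dual (A : M₁.Chain →ₗ[ZMod 2] M₂.Chain) : D₂.Chain →ₗ[ZMod 2] D₁.Chain :=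
  ((LinearMap.toMatrix' A).transpose.submatrix μ₁.stateEquiv μ₂.stateEquiv).mulVecLin

theorem dual_apply (A : M₁.Chain →ₗ[ZMod 2] M₂.Chain) (f : D₂.Chain) (S : D₁.State) :
    dual μ₁ μ₂ A f S = ∑ T, A (Pi.single (μ₁.state S) 1) (μ₂.state T) * f T := rfl

theorem dual_comp (A : M₂.Chain →ₗ[ZMod 2] M₃.Chain) (B : M₁.Chain →ₗ[ZMod 2] M₂.Chain) :
    dual μ₁ μ₃ (A ∘ₗ B) = dual μ₁ μ₂ B ∘ₗ dual μ₂ μ₃ A := by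
  rw [dual, LinearMap.toMatrix'_comp, Matrix.transpose_mul, ← Matrix.submatrix_mul_equiv _ _ _
    μ₂.stateEquiv, Matrix.mulVecLin_mul]
  rfl

theorem dual_add (A B : M₁.Chain →ₗ[ZMod 2] M₂.Chain) :
    dual μ₁ μ₂ (A + B) = dual μ₁ μ₂ A + dual μ₁ μ₂ B := by
  rw [dual, map_add, Matrix.transpose_add, Matrix.submatrix_add, Pi.add_apply, Pi.add_apply,
    Matrix.mulVecLin_add]
  rfl

theorem dual_id : dual μ₁ μ₁ LinearMap.id = LinearMap.id := by
  rw [dual, LinearMap.toMatrix'_id, Matrix.transpose_one, Matrix.submatrix_one_equiv,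
    Matrix.mulVecLin_one]

theorem biHom_dual {a b : ℤ} {A : M₁.Chain →ₗ[ZMod 2] M₂.Chain} (h : BiHom a b A) :
    BiHom a b (dual μ₁ μ₂ A) := by
  intro i j f hf S hS
  rw [dual_apply] at hS
  obtain ⟨T, -, hT⟩ := Finset.exists_ne_zero_of_sum_ne_zero hS
  have h1 := hf T (right_ne_zero_of_mul hT)
  have h2 := h _ _ _ (single_mem_bideg (μ₁.state S)) _ (left_ne_zero_of_mul hT)
  rw [μ₁.hdeg_eq, μ₁.qdeg_eq, μ₂.hdeg_eq, μ₂.qdeg_eq] at h2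
  constructor <;> omega

theorem dual_cubeMap (hD : D₁.NoSingle) {m Δ : Gen → Gen → Gen → ZMod 2}
    (h₁ : ∀ a b c, Δ c.swap a.swap b.swap = m a b c)
    (h₂ : ∀ a b c, m b.swap a.swap c.swap = Δ c a b) :
    dual μ₁ μ₁ (M₁.cubeMap m Δ) = D₁.cubeMap m Δ := by
  refine LinearMap.ext fun f => funext fun T => ?_
  rw [dual_apply, cubeMap_apply]
  refine Finset.sum_congr rfl fun S _ => ?_
  congr 1
  rw [cubeMap_apply, Finset.sum_eq_single (μ₁.state T)]
  · rw [Pi.single_eq_same, mul_one, ← μ₁.onX.sum_comp]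
    exact Finset.sum_congr rfl fun c _ => μ₁.edgeCoeff_eq hD h₁ h₂ c S T
  · intro S' _ hS'
    rw [Pi.single_eq_of_ne hS', mul_zero]
  · simp

theorem dual_d (hD : D₁.NoSingle) : dual μ₁ μ₁ M₁.d = D₁.d :=
  dual_cubeMap μ₁ hD (by rintro (_ | _) (_ | _) (_ | _) <;> rfl)
    (by rintro (_ | _) (_ | _) (_ | _) <;> rfl)

theorem dual_beta (hD : D₁.NoSingle) : dual μ₁ μ₁ M₁.beta = D₁.beta :=
  dual_cubeMap μ₁ hD (by rintro (_ | _) (_ | _) (_ | _) <;> rfl)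
    (by rintro (_ | _) (_ | _) (_ | _) <;> rfl)

/-- Transposition reverses all maps and preserves bidegrees, as the mirror image negates both
degrees. The homotopies `H` and `H'` change places. -/
theorem BetaEquiv.dual {φ : M₁.Chain →ₗ[ZMod 2] M₂.Chain} (h : BetaEquiv φ) (hD₁ : D₁.NoSingle)
    (hD₂ : D₂.NoSingle) : BetaEquiv (dual μ₁ μ₂ φ) := by
  obtain ⟨ψ, H, H', φ₂, ⟨h1, h2, h3, h4, h5⟩, e1, e2, e3, e4, e5⟩ := h
  have d1 := dual_d μ₁ hD₁
  have d2 := dual_d μ₂ hD₂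
  have b1 := dual_beta μ₁ hD₁
  have b2 := dual_beta μ₂ hD₂
  refine ⟨PD.dual μ₂ μ₁ ψ, PD.dual μ₂ μ₂ H', PD.dual μ₁ μ₁ H, PD.dual μ₁ μ₂ φ₂,
    ⟨biHom_dual _ _ h1, biHom_dual _ _ h2, biHom_dual _ _ h4, biHom_dual _ _ h3,
      biHom_dual _ _ h5⟩, ?_, ?_, ?_, ?_, ?_⟩
  · have := congrArg (PD.dual μ₁ μ₂) e1
    rw [dual_comp μ₁ μ₁ μ₂, dual_comp μ₁ μ₂ μ₂, d1, d2] at this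
    exact this.symm
  · have := congrArg (PD.dual μ₂ μ₁) e2
    rw [dual_comp μ₂ μ₂ μ₁, dual_comp μ₂ μ₁ μ₁, d1, d2] at this
    exact this.symm
  · have := congrArg (PD.dual μ₂ μ₂) e4
    rw [dual_add, dual_add, dual_comp μ₂ μ₁ μ₂, dual_id, dual_comp μ₂ μ₂ μ₂, dual_comp μ₂ μ₂ μ₂,
      d2] at this
    rw [this, add_comm]
  · have := congrArg (PD.dual μ₁ μ₁) e3
    rw [dual_add, dual_add, dual_comp μ₁ μ₂ μ₁, dual_id, dual_comp μ₁ μ₁ μ₁, dual_comp μ₁ μ₁ μ₁,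
      d1] at this
    rw [this, add_comm]
  · have := congrArg (PD.dual μ₁ μ₂) e5
    rw [dual_add, dual_add, dual_comp μ₁ μ₂ μ₂, dual_comp μ₁ μ₁ μ₂, dual_comp μ₁ μ₂ μ₂,
      dual_comp μ₁ μ₁ μ₂, d1, d2, b1, b2] at this
    rw [add_comm, this, add_comm]

theorem BetaEquiv.khIso_of_mirror (μ₁ : Mirror D₁ M₁) (μ₂ : Mirror D₂ M₂)
    {φ : M₁.Chain →ₗ[ZMod 2] M₂.Chain} (h : BetaEquiv φ)
    (hD₁ : D₁.NoSingle) (hD₂ : D₂.NoSingle) : KhIso D₁ D₂ :=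
  ((h.dual μ₁ μ₂ hD₁ hD₂).khIso hD₂ hD₁).symm

end Dual

/-! ### The mirror image -/

/-- The mirror image. -/
abbrev flip (D : PD) : PD := { D with arc := fun c i => D.arc c (i + 1), pos := fun c => !D.pos c }

def flipMirror (D : PD) : Mirror D D.flip :=
  ⟨Equiv.refl _, Equiv.refl _, fun _ _ => rfl, fun _ => rfl⟩

theorem Good.flip {D : PD} (hD : D.Good) : D.flip.Good := by
  have h10 : ∀ i : Fin 4, i + 1 - 1 = i := by decide
  have h01 : ∀ i : Fin 4, i - 1 + 1 = i := by decide
  let f : D.X × Fin 4 → D.X × Fin 4 := fun h => (h.1, h.2 + 1)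
  have hf : Function.Bijective f := by
    constructor
    · rintro ⟨c, i⟩ ⟨c', i'⟩ h
      obtain rfl : c = c' := congrArg Prod.fst h
      have : i + 1 = i' + 1 := congrArg Prod.snd h
      rw [← h10 i, this, h10]
    · rintro ⟨c, i⟩
      exact ⟨(c, i - 1), by simp only [f, h01]⟩
  obtain ⟨o, ho, ho'⟩ := hD.source
  refine ⟨fun h => ?_, fun h => o (f h), fun c i => ho c (i + 1), fun h h' hne hl =>
    ho' _ _ (fun he => hne (hf.1 he)) hl⟩
  obtain ⟨h', hh, hu⟩ := hD.pairing (f h)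
  obtain ⟨h', rfl⟩ := hf.2 h'
  exact ⟨h', ⟨fun he => hh.1 (congrArg f he), hh.2⟩, fun h'' hh'' =>
    hf.1 (hu (f h'') ⟨fun he => hh''.1 (hf.1 he), hh''.2⟩)⟩

theorem BetaEquiv.id (D : PD) : BetaEquiv (LinearMap.id : D.Chain →ₗ[ZMod 2] D.Chain) :=
  ⟨LinearMap.id, 0, 0, 0, ⟨BiHom.id, BiHom.id, BiHom.zero, BiHom.zero, BiHom.zero⟩, rfl, rfl,
    LinearMap.ext fun x => by simp [ZModModule.add_self],
    LinearMap.ext fun x => by simp [ZModModule.add_self],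
    LinearMap.ext fun x => by simp [ZModModule.add_self]⟩

def Iso.mirror {D D' : PD} (e : D.Iso D') : Mirror D' D.flip where
  onX := e.onX.symm
  onE := e.onE.symm
  arc_eq c i := by
    obtain ⟨c, rfl⟩ := e.onX.surjective c
    rw [e.arc_eq]
    simp
  pos_eq c := by
    obtain ⟨c, rfl⟩ := e.onX.surjective c
    rw [e.pos_eq]
    simp

/-- Both diagrams have `D.flip` as a mirror image up to renaming, so the transpose of its identity
map compares them. -/
theorem Iso.khIso {D D' : PD} (e : D.Iso D') (hD : D.NoSingle) (hD' : D'.NoSingle) :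
    KhIso D D' :=
  (BetaEquiv.id D.flip).khIso_of_mirror D.flipMirror e.mirror hD hD'

/-! ### Invariance under the first Reidemeister move -/

theorem straight_flip (D : PD) (R : Set D.X) (e e' : D.E) :
    Straight D.flip R e e' ↔ D.Straight R e e' := by
  constructor
  · rintro ⟨c, hc, i, rfl, rfl⟩
    exact ⟨c, hc, i + 1, rfl, by rw [add_right_comm]⟩
  · rintro ⟨c, hc, i, rfl, rfl⟩
    have h1 : ∀ i : Fin 4, i - 1 + 1 = i := by decide
    have h2 : ∀ i : Fin 4, i - 1 + 2 + 1 = i + 2 := by decide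
    exact ⟨c, hc, i - 1, (congrArg (D.arc c) (h1 i)).symm, (congrArg (D.arc c) (h2 i)).symm⟩

def eraseMirror (D : PD) (R : Set D.X) : Mirror (D.erase R) (erase D.flip R) where
  onX := Equiv.refl {c : D.X // c ∉ R}
  onE := Quot.congr (ra := D.Straight R) (rb := Straight D.flip R) (Equiv.refl D.E)
    fun e e' => (straight_flip D R e e').symm
  arc_eq _ _ := rfl
  pos_eq _ := rfl

/-- A kink with negative twist becomes one with positive twist in the mirror image, where `k` is
lowered by one and the sign changes. -/
theorem kink_khIso {D : PD} {c : D.X} {k : Fin 4} (hG : D.Good) (h : D.IsKink c k)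
    (hpos : D.pos c = true ↔ Even (k : ℕ)) : (D.erase {c}).NoSingle ∧ KhIso D (D.erase {c}) := by
  have hD := hG.noSingle
  by_cases hk : Even (k : ℕ)
  · have hD' := hD.erase_kink h hk
    exact ⟨hD', (r1_betaEquiv hG h hk (hpos.2 hk)).khIso hD hD'⟩
  · have h1 : ∀ k : Fin 4, k - 1 + 1 = k := by decide
    have h2 : ∀ k : Fin 4, k - 1 + 1 + 1 = k + 1 := by decide
    have hM : IsKink D.flip c (k - 1) := by
      change D.arc c (k - 1 + 1) = D.arc c (k - 1 + 1 + 1)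
      rw [h1]
      exact h
    have hk' : Even ((k - 1 : Fin 4) : ℕ) := by
      revert hk
      clear h hpos hM
      revert k
      decide
    have hp : D.flip.pos c = true := by
      have := mt hpos.1 hk
      change (!D.pos c) = true
      simpa using this
    have hE := hG.flip.noSingle.erase_kink hM hk'
    have hD' := (D.eraseMirror {c}).noSingle_iff.1 hE
    exact ⟨hD', (r1_betaEquiv hG.flip hM hk' hp).khIso_of_mirror D.flipMirror
      (D.eraseMirror {c}) hD hD'⟩

/-! ### Invariance under the third Reidemeister move -/

section R3

variable {D : PD} {t : Fin 3 → D.X} {k : Fin 3 → Fin 4}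

/-- Transport along an equality of arc functions, on which the type of chains depends. -/
theorem exists_betaEquiv_rewire {A A' : D.X → Fin 4 → D.E} (h : A = A')
    (hA : ∃ φ : D.Chain →ₗ[ZMod 2] (D.rewire A).Chain, BetaEquiv φ) :
    ∃ φ : D.Chain →ₗ[ZMod 2] (D.rewire A').Chain, BetaEquiv φ :=
  h ▸ hA

theorem IsTriangle.rotate (h : D.IsTriangle t k) (r : Fin 3) :
    D.IsTriangle (fun n => t (n + r)) fun n => k (n + r) := by
  refine ⟨fun n m hnm => by simpa using h.1 hnm, fun n => ?_⟩
  change D.arc (t (n + r)) (k (n + r)) = D.arc (t (n + 1 + r)) (k (n + 1 + r) + 1)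
  rw [add_right_comm n]
  exact h.2 (n + r)

theorem r3_rotate (ht : Function.Injective t) (r : Fin 3) :
    (D.r3 (fun n => t (n + r)) fun n => k (n + r)).arc = (D.r3 t k).arc := by
  funext c i
  by_cases hc : ∃ n, c = t n
  · obtain ⟨n, rfl⟩ := hc
    obtain ⟨j, rfl⟩ : ∃ j, i = k n + j := ⟨i - k n, by abel⟩
    have h0 : n - r + r = n := sub_add_cancel n r
    have h1 : n - r + 1 + r = n + 1 := by rw [add_right_comm, h0]
    have h2 : n - r + 2 + r = n + 2 := by rw [add_right_comm, h0]
    have ht' : Function.Injective fun n => t (n + r) := fun n m hnm => by simpa using ht hnm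
    have h3 := r3_arc (D := D) (k := fun n => k (n + r)) ht' (n - r) j
    have h4 : D.r3Ends (fun n => t (n + r)) (fun n => k (n + r)) (n - r) = D.r3Ends t k n := by
      simp only [r3Ends, h0, h1, h2]
    rw [h4] at h3
    simp only [h0] at h3
    exact h3.trans (r3_arc ht n j).symm
  · push Not at hc
    exact (r3_arc_of_ne (D := D) (t := fun n => t (n + r)) (k := fun n => k (n + r)) c i
      fun n => hc _).trans (r3_arc_of_ne (D := D) (t := t) (k := k) c i hc).symm

/-- A rotation of the numbering gives the odd corner the index 2, as `r3_betaEquiv` requires. -/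
theorem exists_r3_betaEquiv (hG : D.Good) (h : D.IsTriangle t k) {n : Fin 3}
    (hn : Odd (k n : ℕ)) (hn' : ∀ m, m ≠ n → Even (k m : ℕ)) :
    ∃ φ : D.Chain →ₗ[ZMod 2] (D.r3 t k).Chain, BetaEquiv φ := by
  have h2 : ∀ n : Fin 3, 2 + (n + 1) = n := by decide
  have h1 : ∀ n : Fin 3, 1 + (n + 1) ≠ n := by decide
  have h0 : ∀ n : Fin 3, 0 + (n + 1) ≠ n := by decide
  obtain ⟨φ, -, -, hφ⟩ := r3_betaEquiv hG (h.rotate (n + 1)) (hn' _ (h0 n)) (hn' _ (h1 n))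
    (by rwa [h2]) (Or.inl ⟨rfl, rfl⟩)
  exact exists_betaEquiv_rewire (D := D) (r3_rotate h.1 (n + 1)) ⟨φ, hφ⟩

theorem IsTriangle.flip (h : D.IsTriangle t k) : IsTriangle D.flip t fun n => k n - 1 := by
  refine ⟨h.1, fun n => ?_⟩
  have h1 : ∀ j : Fin 4, j - 1 + 1 = j := by decide
  change D.arc (t n) (k n - 1 + 1) = D.arc (t (n + 1)) (k (n + 1) - 1 + 1 + 1)
  rw [h1, h1]
  exact h.2 n

theorem r3_flip_arc (ht : Function.Injective t) (c : D.X) (i : Fin 4) :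
    (r3 D.flip t fun n => k n - 1).arc c i = (D.r3 t k).arc c (i + 1) := by
  by_cases hc : ∃ n, c = t n
  · obtain ⟨n, rfl⟩ := hc
    obtain ⟨j, rfl⟩ : ∃ j, i = (k n - 1) + j := ⟨i - (k n - 1), by abel⟩
    have h0 : k n - 1 + j + 1 = k n + j := by abel
    rw [h0]
    refine (r3_arc (D := D.flip) ht n j).trans (Eq.trans ?_ (r3_arc ht n j).symm)
    have h1 : ∀ j : Fin 4, j - 1 + 1 = j := by decide
    have h3 : ∀ j : Fin 4, j - 1 + 2 + 1 = j + 2 := by decide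
    have h4 : ∀ j : Fin 4, j - 1 + 3 + 1 = j + 3 := by decide
    simp only [r3Ends, h1, h3, h4]
    rfl
  · push Not at hc
    exact (r3_arc_of_ne (D := D.flip) c i hc).trans (r3_arc_of_ne c (i + 1) hc).symm

def r3Mirror (ht : Function.Injective t) : Mirror (D.r3 t k) (r3 D.flip t fun n => k n - 1) where
  onX := Equiv.refl D.X
  onE := Equiv.refl D.E
  arc_eq := r3_flip_arc ht
  pos_eq _ := rfl

/-- A non-alternating triangle has two even corners and an odd one, or conversely. The mirror image
exchanges these cases. -/
theorem r3_khIso (hG : D.Good) (h : D.IsTriangle t k) (hk : NonAlternating k) :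
    KhIso D (D.r3 t k) := by
  have h3 : ∀ a b n : Fin 3, a ≠ b → n ≠ a → n ≠ b → ∀ m, m ≠ n → m = a ∨ m = b := by decide
  have h4 : ∀ a b : Fin 3, a ≠ b → ∃ n, n ≠ a ∧ n ≠ b := by decide
  obtain ⟨⟨a, ha⟩, b, hb⟩ := hk
  have hab : a ≠ b := by
    rintro rfl
    exact (Nat.not_even_iff_odd.2 hb) ha
  obtain ⟨n, hna, hnb⟩ := h4 a b hab
  by_cases hn : Even (k n : ℕ)
  · obtain ⟨φ, hφ⟩ := exists_r3_betaEquiv hG h hb fun m hm => by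
      rcases h3 a n b hna.symm hab.symm hnb.symm m hm with rfl | rfl
      exacts [ha, hn]
    exact hφ.khIso hG.noSingle (hG.r3 h).noSingle
  · have he : ∀ j : Fin 4, Odd (j : ℕ) → Even ((j - 1 : Fin 4) : ℕ) := by decide
    have ho : ∀ j : Fin 4, Even (j : ℕ) → Odd ((j - 1 : Fin 4) : ℕ) := by decide
    obtain ⟨φ, hφ⟩ := exists_r3_betaEquiv hG.flip h.flip (n := a) (ho _ ha) fun m hm => by
      rcases h3 n b a hnb hna.symm hab m hm with rfl | rfl
      exacts [he _ (Nat.not_even_iff_odd.1 hn), he _ hb]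
    exact hφ.khIso_of_mirror D.flipMirror (r3Mirror h.1) hG.noSingle (hG.r3 h).noSingle

end R3

/-! ### Signs of the crossings of kinks and bigons -/

/-- The arc of the kink leaves the crossing at one of two neighbouring ends and enters it at the
other; which neighbours have different directions depends on the sign. -/
theorem IsOriented.pos_kink {D : PD} (hD : D.IsOriented) {c : D.X} {k : Fin 4}
    (h : D.IsKink c k) : D.pos c = true ↔ Even (k : ℕ) := by
  have hne : ∀ k : Fin 4, k + 1 ≠ k := by decide
  have ho := hD.2 (c, k) (c, k + 1) (fun he => hne k (congrArg Prod.snd he)) h.symm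
  clear h
  simp only [IsOut] at ho
  revert ho
  cases D.pos c <;> revert k <;> decide

theorem IsOriented.pos_bigon {D : PD} (hD : D.IsOriented) {c₁ c₂ : D.X} {k₁ k₂ : Fin 4}
    (h : D.IsBigon c₁ k₁ c₂ k₂) : D.pos c₁ = !D.pos c₂ := by
  obtain ⟨hne, h1, h2, hk₁, hk₂⟩ := h
  have ho₁ := hD.2 (c₁, k₁) (c₂, k₂ + 1) (fun he => hne (congrArg Prod.fst he).symm) h1.symm
  have ho₂ := hD.2 (c₂, k₂) (c₁, k₁ + 1) (fun he => hne (congrArg Prod.fst he)) h2.symm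
  clear h1 h2
  simp only [IsOut] at ho₁ ho₂
  revert ho₁ ho₂ hk₁ hk₂
  cases D.pos c₁ <;> cases D.pos c₂ <;> revert k₁ k₂ <;> decide

/-! ### Invariance -/

theorem _root_.KhBeta.Move.khIso {D D' : LinkDiagram} (h : Move D D') :
    KhIso D.toPD D'.toPD := by
  have hG := D.good
  have hD' := D'.good.noSingle
  cases h with
  | rename e => exact e.khIso hG.noSingle hD'
  | r1 c k h e =>
    have := kink_khIso hG h (D.oriented.pos_kink h)
    exact this.2.trans (e.khIso this.1 hD')
  | r2 c₁ c₂ k₁ k₂ h e =>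
    have hE := hG.noSingle.erase_bigon hG.pairing h
    exact ((r2_betaEquiv hG h (D.oriented.pos_bigon h)).khIso hE hG.noSingle).symm.trans
      (e.khIso hE hD')
  | r3 t k h hk e => exact (r3_khIso hG h hk).trans (e.khIso (hG.r3 h).noSingle hD')

theorem _root_.KhBeta.SameLink.khIso {D D' : LinkDiagram} (h : SameLink D D') :
    KhIso D.toPD D'.toPD := by
  induction h with
  | rel _ _ h => exact h.khIso
  | refl _ => exact KhIso.refl _
  | symm _ _ _ ih => exact ih.symm
  | trans _ _ _ _ _ ih ih' => exact ih.trans ih'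

theorem BetaEquiv.facts {D D' : PD} {φ : D.Chain →ₗ[ZMod 2] D'.Chain} (h : BetaEquiv φ)
    (hD : D.NoSingle) (hD' : D'.NoSingle) :
    IsQuasiIso φ ∧ CommutesUpToBoundaries φ ∧ CommutesWithBetaStar φ :=
  ⟨h.isQuasiIso, h.commutesUpToBoundaries, h.commutesWithBetaStar hD hD'⟩

end PD
end KhBeta

/-! ### The main theorem -/

open KhBeta PD in
theorem proposition2p2 :
    -- `∂` is a differential, `β` is a map of complexes with `β² = 0` and bidegree `(1, 2)`, and
    -- `β_*` is the map `[z] ↦ [β z]`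
    (∀ D : LinkDiagram,
      D.d ∘ₗ D.d = 0 ∧ D.beta ∘ₗ D.d = D.d ∘ₗ D.beta ∧ D.beta ∘ₗ D.beta = 0 ∧
      (∀ i j, ∀ f ∈ D.bideg i j, D.d f ∈ D.bideg (i + 1) j ∧ D.beta f ∈ D.bideg (i + 1) (j + 2)) ∧
      ∀ (i j i' j' : ℤ), i' = i + 1 → j' = j + 2 → ∀ z : D.cycles i j,
        ∃ h : D.beta z ∈ D.cycles i' j',
          D.betaStar i j i' j' (D.cls z) = D.cls ⟨D.beta z, h⟩) ∧
    -- Reidemeister I, positive twist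
    (∀ (D : LinkDiagram) (c : D.X) (k : Fin 4), D.IsKink c k → Even (k : ℕ) →
      ∃ φ, D.IsR1Map c k φ ∧ (∀ ψ, D.IsR1Map c k ψ → ψ = φ) ∧
        IsQuasiIso φ ∧ CommutesUpToBoundaries φ ∧ CommutesWithBetaStar φ) ∧
    -- Reidemeister II
    (∀ (D : LinkDiagram) (c₁ c₂ : D.X) (k₁ k₂ : Fin 4), D.IsBigon c₁ k₁ c₂ k₂ →
      IsQuasiIso (D.r2Map c₁ k₁ c₂ k₂) ∧ CommutesUpToBoundaries (D.r2Map c₁ k₁ c₂ k₂) ∧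
        CommutesWithBetaStar (D.r2Map c₁ k₁ c₂ k₂)) ∧
    -- Reidemeister III, for either of the two possible pivots `p`
    (∀ (D : LinkDiagram) (t : Fin 3 → D.X) (k : Fin 3 → Fin 4) (y p : D.X),
      D.IsTriangle t k → Even (k 0 : ℕ) → Even (k 1 : ℕ) → Odd (k 2 : ℕ) →
      ((p = t 0 ∧ y = t 1) ∨ (p = t 1 ∧ y = t 0)) →
      ∃ φ, D.IsR3Map t k y (t 2) p φ ∧ (∀ ψ, D.IsR3Map t k y (t 2) p ψ → ψ = φ) ∧
        IsQuasiIso φ ∧ CommutesUpToBoundaries φ ∧ CommutesWithBetaStar φ) ∧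
    -- `(Kh, β_*)` and `KK` are invariants of oriented links
    (∀ D D' : LinkDiagram, SameLink D D' →
      ∃ Φ : ∀ i j : ℤ, D.Kh i j ≃ₗ[ZMod 2] D'.Kh i j,
        (∀ i j x, Φ (i + 1) (j + 2) (D.betaStar i j (i + 1) (j + 2) x) =
          D'.betaStar i j (i + 1) (j + 2) (Φ i j x)) ∧
        ∃ Ψ : ∀ i j : ℤ, D.KK i j ≃ₗ[ZMod 2] D'.KK i j,
          ∀ i j (x : D.kerBeta i j), ∃ h : Φ i j x ∈ D'.kerBeta i j,
            Ψ i j (D.clsKK x) = D'.clsKK ⟨Φ i j x, h⟩) := by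
  refine ⟨fun D => ?_, fun D c k h hk => ?_, fun D c₁ c₂ k₁ k₂ h => ?_,
    fun D t k y p h h0 h1 h2 hy => ?_, fun D D' h => h.khIso.exists_kk⟩
  · have hD := D.good.noSingle
    obtain ⟨h1, h2, h3⟩ := D.differential_facts hD
    refine ⟨h1, h2, h3, fun i j f hf => ⟨(D.biHom_d hD).mem hf rfl (add_zero j).symm,
      (D.biHom_beta hD).mem hf rfl rfl⟩, fun i j i' j' hi hj z => ?_⟩
    exact ⟨(beta_cond hD hi hj).1 z z.2, induced_cls (beta_cond hD hi hj) z⟩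
  · have hG := D.good
    exact ⟨D.r1Map c k, isR1Map_r1Map hG h hk, fun ψ hψ => hψ.unique hG h hk,
      (r1_betaEquiv hG h hk ((D.oriented.pos_kink h).2 hk)).facts hG.noSingle
        (hG.noSingle.erase_kink h hk)⟩
  · have hG := D.good
    exact (r2_betaEquiv hG h (D.oriented.pos_bigon h)).facts
      (hG.noSingle.erase_bigon hG.pairing h) hG.noSingle
  · have hG := D.good
    obtain ⟨φ, hφ, hu, hβ⟩ := r3_betaEquiv hG h h0 h1 h2 hy
    exact ⟨φ, hφ, hu, hβ.facts hG.noSingle (hG.r3 h).noSingle⟩
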